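/- Let $n\ge 1$, $s\in(0,1)$, $a=1-2s$, $\delta_0>0$, $\Lambda,K\ge 0$. Write $X=(x,y)\in\mathbb R^n\times\mathbb R$, $\nabla=\nabla_{x,y}$, $B_r=\{x\in\mathbb R^n:|x|<r\}$, $\mathbb B_r^+=\{X: |x|^2+y^2<r^2,\ y>0\}$, and let $L^2_{loc}(\mathbb B_1^+\times(-1,0],\,y^a\,dX\,dt)$ denote the functions that are square integrable for $y^a\,dX\,dt$ on $\{y>0\}\cap K'$ for every compact $K'\subset(\mathbb B_1^+\cup (B_1\times\{0\}))\times(-1,0]$. Let $\mu,\lambda$ be constants with $\mu\ge\delta_0$, $2\mu+\lambda\ge\delta_0$, $\mu\le\Lambda$, $|\lambda|\le\Lambda$, and let $V\in C^3(\mathbb R^n\times\mathbb R)$ be real valued, with all its derivatives of order $0,\dots,3$ bounded by $K$. Let $\tilde{\mathbf u}$, with values in $\mathbb R^n$, be a weak solution in $\mathbb B_1^+\times(-1,0]$ of $$\partial_t\tilde{\mathbf u}=\Big(\partial_y^2+\frac ay\partial_y\Big)\tilde{\mathbf u}+\mu\Delta_x\tilde{\mathbf u}+(\mu+\lambda)\nabla_x\operatorname{div}_x\tilde{\mathbf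 u}\quad (y>0),\qquad \tilde{\mathbf u}|_{y=0}=\mathbf u,\qquad \lim_{y\to0}y^a\partial_y\tilde{\mathbf u}=V\mathbf u\ \text{ on } B_1\times(-1,0].$$ That is: $\tilde{\mathbf u}$ and its weak gradient $\nabla\tilde{\mathbf u}$ belong to $L^2_{loc}(\mathbb B_1^+\times(-1,0],y^a\,dX\,dt)$; $\mathbf u$ is the trace of $\tilde{\mathbf u}$, in the sense that $\frac1h\int_0^h\int_{K''}|\tilde{\mathbf u}(x,y,t)-\mathbf u(x,t)|^2\,dx\,dt\,dy\to0$ as $h\to0^+$ for every compact $K''\subset B_1\times(-1,0]$; and for every smooth $\mathbb R^n$-valued $\varphi$ with compact support in $\{|X|<1\}\times(-1,0)$ $$-\int_{\mathbb B_1^+\times(-1,0]} y^a\,\tilde{\mathbf u}\cdot\partial_t\varphi+\int_{\mathbb B_1^+\times(-1,0]} y^a\big(\partial_y\tilde{\mathbf u}\cdot\partial_y\varphi+\mu\,\nabla_x\tilde{\mathbf u}:\nabla_x\varphi+(\mu+\lambda)\operatorname{div}_x\tilde{\mathbf u}\,\operatorname{div}_x\varphi\big)+\int_{B_1\times(-1,0]}V\,\mathbf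 u\cdot\varphi(x,0,t)\,dx\,dt=0 .$$ Then the weak derivatives $\nabla\nabla_x\tilde{\mathbf u}$ exist in $\mathbb B_1^+\times(-1,0)$ and $$\nabla\nabla_x\tilde{\mathbf u}\in L^2_{loc}(\mathbb B_1^+\times(-1,0],\,y^a\,dX\,dt).$$ Moreover $$\int_{\mathbb B_{1/2}^+\times(-1/4,0]}\big(|\nabla\tilde{\mathbf u}|^2+|\nabla\nabla_x\tilde{\mathbf u}|^2\big)y^a\,dX\,dt\le C\int_{\mathbb B_1^+\times(-1,0]}|\tilde{\mathbf u}|^2\,y^a\,dX\,dt$$ (the right side may be infinite), where $C$ depends only on $n$, $s$, $\delta_0$, $\Lambda$ and $K$. -/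

import Mathlib

open MeasureTheory Filter Topology
open scoped ContDiff

namespace LameExt

/-- The space `ℝⁿ` with its Euclidean norm. -/
abbrev E (n : ℕ) : Type := EuclideanSpace ℝ (Fin n)

/-- Points `(x, y, t) ∈ ℝⁿ × ℝ × ℝ`, where `X = (x, y)` is the thick space variable. -/
abbrev Pt (n : ℕ) : Type := E n × ℝ × ℝ

/-- Coordinate directions of `X = (x, y)`: `some i` is `x_i`, `none` is `y`. -/
noncomputable def dir {n : ℕ} : Option (Fin n) → Pt n
  | some i => (EuclideanSpace.single i 1, 0, 0)
  | none => (0, 1, 0)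

/-- The time direction. -/
def dirT {n : ℕ} : Pt n := (0, 0, 1)

/-- `𝔹_r⁺ × (-r², 0]`, with `𝔹_r⁺ = {|x|² + y² < r², y > 0}`. -/
def halfCyl (n : ℕ) (r : ℝ) : Set (Pt n) :=
  {p | ‖p.1‖ ^ 2 + p.2.1 ^ 2 < r ^ 2 ∧ 0 < p.2.1 ∧ -r ^ 2 < p.2.2 ∧ p.2.2 ≤ 0}

/-- The open set `𝔹₁⁺ × (-1, 0)`. -/
def openHalfCyl (n : ℕ) : Set (Pt n) :=
  {p | ‖p.1‖ ^ 2 + p.2.1 ^ 2 < 1 ∧ 0 < p.2.1 ∧ -1 < p.2.2 ∧ p.2.2 < 0}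

/-- `(𝔹₁⁺ ∪ B₁) × (-1, 0]`: the half-cylinder together with its thin part on `{y = 0}`. -/
def halfCylWithThin (n : ℕ) : Set (Pt n) :=
  {p | ‖p.1‖ ^ 2 + p.2.1 ^ 2 < 1 ∧ 0 ≤ p.2.1 ∧ -1 < p.2.2 ∧ p.2.2 ≤ 0}

/-- The open full cylinder `𝔹₁ × (-1, 0)`. Restricting to `{y ≥ 0}` the smooth functions with
compact support in it gives the test functions on `(𝔹₁⁺ ∪ B₁) × (-1, 0)`, which need not vanish
on `{y = 0}`. -/
def fullCyl (n : ℕ) : Set (Pt n) :=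
  {p | ‖p.1‖ ^ 2 + p.2.1 ^ 2 < 1 ∧ -1 < p.2.2 ∧ p.2.2 < 0}

/-- The thin cylinder `B₁ × (-1, 0]` in `ℝⁿ × ℝ`. -/
def thinCyl (n : ℕ) : Set (E n × ℝ) :=
  {q | ‖q.1‖ < 1 ∧ -1 < q.2 ∧ q.2 ≤ 0}

/-- The measure `y^a dX dt` on `{y > 0}`. -/
noncomputable def wMeasure (n : ℕ) (a : ℝ) : Measure (Pt n) :=
  (volume.restrict {p : Pt n | 0 < p.2.1}).withDensity (fun p => ENNReal.ofReal (p.2.1 ^ a))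

/-- `f ∈ L²_loc(𝔹₁⁺ × (-1, 0], y^a dX dt)`, local integrability being understood up to the thin
set `{y = 0}` and up to the final time `t = 0`. -/
def LocL2 {n : ℕ} (a : ℝ) (f : Pt n → E n) : Prop :=
  ∀ K : Set (Pt n), IsCompact K → K ⊆ halfCylWithThin n →
    MemLp f 2 ((wMeasure n a).restrict K)

/-- `g` is the weak derivative of `f` in the direction `v` in the open set `Ω`. -/
def HasWeakDeriv {n : ℕ} (Ω : Set (Pt n)) (v : Pt n) (f g : Pt n → E n) : Prop :=
  LocallyIntegrableOn f Ω ∧ LocallyIntegrableOn g Ω ∧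
    ∀ φ : Pt n → ℝ, ContDiff ℝ ∞ φ → HasCompactSupport φ → tsupport φ ⊆ Ω →
      ∫ p in Ω, fderiv ℝ φ p v • f p = -∫ p in Ω, φ p • g p

/-- `u` is the trace of `U` on `{y = 0}`, that is `U(·, y, ·) → u` in `L²_loc(B₁ × (-1, 0])` as
`y → 0+`; as `U` is only defined almost everywhere, one averages over `0 < y < h`. -/
def IsTrace {n : ℕ} (U : Pt n → E n) (u : E n × ℝ → E n) : Prop :=
  AEStronglyMeasurable u (volume.restrict (thinCyl n)) ∧
    ∀ K : Set (E n × ℝ), IsCompact K → K ⊆ thinCyl n →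
      Tendsto (fun h : ℝ => (ENNReal.ofReal h)⁻¹ *
          ∫⁻ p in {p : Pt n | (p.1, p.2.2) ∈ K ∧ 0 < p.2.1 ∧ p.2.1 < h},
            ‖U p - u (p.1, p.2.2)‖ₑ ^ 2)
        (𝓝[>] 0) (𝓝 0)

/-- `U`, with weak gradient `G = ∇_{x,y} U` and trace `u`, is a weak solution in
`𝔹₁⁺ × (-1, 0]` of
`∂_t U = (∂_y² + (a/y) ∂_y) U + μ Δ_x U + (μ + lam) ∇_x div_x U` in `{y > 0}`,
`U = u` and `lim_{y → 0} y^a ∂_y U = V u` on `{y = 0}`. The last field is the equation multiplied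
by `y^a φ` and integrated by parts. The test functions vanish near `t = -1` and near `t = 0`. -/
structure IsWeakSolution {n : ℕ} (a μ lam : ℝ) (V : E n × ℝ → ℝ)
    (U : Pt n → E n) (G : Option (Fin n) → Pt n → E n) (u : E n × ℝ → E n) : Prop where
  locL2 : LocL2 a U
  grad_locL2 : ∀ k, LocL2 a (G k)
  weakGrad : ∀ k, HasWeakDeriv (openHalfCyl n) (dir k) U (G k)
  trace : IsTrace U u
  weakEq : ∀ φ : Pt n → E n, ContDiff ℝ ∞ φ → HasCompactSupport φ → tsupport φ ⊆ fullCyl n →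
    -(∫ p in halfCyl n 1, p.2.1 ^ a * inner ℝ (U p) (fderiv ℝ φ p dirT))
    + (∫ p in halfCyl n 1, p.2.1 ^ a *
        (inner ℝ (G none p) (fderiv ℝ φ p (dir none))
          + μ * ∑ i : Fin n, inner ℝ (G (some i) p) (fderiv ℝ φ p (dir (some i)))
          + (μ + lam) * (∑ i : Fin n, G (some i) p i)
              * ∑ i : Fin n, fderiv ℝ φ p (dir (some i)) i))
    + (∫ q in thinCyl n, V q * inner ℝ (u q) (φ (q.1, 0, q.2))) = 0

/-- `V ∈ C³(ℝⁿ × ℝ)` with all derivatives of order at most `3` bounded by `K`. -/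
def C3Bound {n : ℕ} (V : E n × ℝ → ℝ) (K : ℝ) : Prop :=
  ContDiff ℝ 3 V ∧ ∀ k : ℕ, k ≤ 3 → ∀ q, ‖iteratedFDeriv ℝ k V q‖ ≤ K

end LameExt

namespace LameExt

set_option linter.unusedSectionVars false

open scoped ENNReal

/-! ### Averages of translates as approximate identities in `L²(μ)` -/

section Averaging

/-! The system is invariant under translations in `x`, so the proof is Nirenberg's method of
tangential difference quotients, run in the energy space with weight `y^a`. Everything rests on a
Caccioppoli inequality for solutions whose conormal derivative is `V u + b` (`exists_energy_le`,
`exists_caccioppoli`): the weighted energy on a smaller cylinder is controlled by the `L²` norms of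
`U` and `b` on a larger one, with a constant that depends only on the structural data and the two
cylinders.

The inequality comes from testing with `η² U`, and four points need care. (1) `U` has no time
derivative. The test function is therefore averaged over a short forward time interval; Young's
inequality and invariance under time translation then bound the time term, using only a one-sided
bound on the increments of `η²` (`Sol.energy_le`). Test functions vanish near `t = 0`, so `η`
carries a nonincreasing factor in time, whose increments have the good sign; it is removed by
monotone convergence, and the estimate reaches `t = 0`. (2) `η² U` must be a limit of smooth
functions in the weighted space. Mollification with a kernel that sees only points above the current
one never crosses `{y = 0}`, is bounded on `L²(y^a)` uniformly in the scale, and recovers the trace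
in the limit (`h1Approx_of_weak`). (3) As `μ + lam` may be negative, the quadratic form is not
coercive pointwise. It is after integration: since the weight depends on `y` alone, two integrations
by parts give `∫ (div w)² ≤ ∫ |∇ₓ w|²` for compactly supported `w`, and `2μ + lam ≥ δ₀` closes the
estimate (`H1Approx.coercive`). (4) `V` has no sign, so the boundary term is absorbed with a trace
inequality whose gradient coefficient is arbitrarily small; this holds because `y^(-a)` is
integrable at `0` (`H1Approx.exists_trace_le`).

A difference quotient `D U` of a solution solves the same system with conormal derivative `V (D u) +
(D V) u(· + h)`, where `D V` is bounded by `K` (`dq_mul_smul`, `Sol.diffQuot`). The Caccioppoli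
inequality bounds `D ∇U` uniformly. Applied to the difference of two quotients it does more: `D U`
and the boundary inhomogeneities converge strongly in `L²`, so the quotients `D ∇U` are Cauchy
(`RobinSol.exists_limit`). No weak compactness is used. The limits are the weak derivatives of `∇ₓ
U` (`RobinSol.hasWeakDeriv`), and two applications of the inequality on nested cylinders give the
quantitative bound (`exists_energy_bound`). -/

theorem eLpNorm_sq {α F : Type*} [MeasurableSpace α] [NormedAddCommGroup F] (f : α → F)
    (μ : Measure α) : eLpNorm f 2 μ ^ 2 = ∫⁻ x, ‖f x‖ₑ ^ 2 ∂μ := by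
  have h := eLpNorm_nnreal_pow_eq_lintegral (f := f) (μ := μ) (p := 2) two_ne_zero
  norm_num at h
  exact_mod_cast h

theorem eLpNorm_le_of_sq {α β F F' : Type*} [MeasurableSpace α] [MeasurableSpace β]
    [NormedAddCommGroup F] [NormedAddCommGroup F'] {f : α → F} {g : β → F'}
    {μ : Measure α} {ν : Measure β} {C : ℝ≥0∞}
    (h : ∫⁻ x, ‖f x‖ₑ ^ 2 ∂μ ≤ C * ∫⁻ x, ‖g x‖ₑ ^ 2 ∂ν) :
    eLpNorm f 2 μ ≤ C ^ (1 / 2 : ℝ) * eLpNorm g 2 ν := by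
  rw [← eLpNorm_sq, ← eLpNorm_sq] at h
  have h2 := ENNReal.rpow_le_rpow h (z := 1 / 2) (by norm_num)
  rw [ENNReal.mul_rpow_of_nonneg _ _ (by norm_num : (0 : ℝ) ≤ 1 / 2)] at h2
  have key : ∀ x : ℝ≥0∞, (x ^ 2) ^ (1 / 2 : ℝ) = x := fun x => by
    rw [← ENNReal.rpow_natCast, ← ENNReal.rpow_mul]; norm_num
  rwa [key, key] at h2

/-- Jensen's inequality, obtained from monotonicity of `Lᵖ` norms on a probability space. -/
theorem enorm_integral_sq_le {α F : Type*} [MeasurableSpace α] [NormedAddCommGroup F]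
    [NormedSpace ℝ F] (ν : Measure α) [IsProbabilityMeasure ν] {f : α → F}
    (hf : AEStronglyMeasurable f ν) :
    ‖∫ x, f x ∂ν‖ₑ ^ 2 ≤ ∫⁻ x, ‖f x‖ₑ ^ 2 ∂ν := by
  rw [← eLpNorm_sq]
  gcongr
  calc ‖∫ x, f x ∂ν‖ₑ ≤ ∫⁻ x, ‖f x‖ₑ ∂ν := enorm_integral_le_lintegral_enorm _
    _ = eLpNorm f 1 ν := (eLpNorm_one_eq_lintegral_enorm).symm
    _ ≤ eLpNorm f 2 ν := eLpNorm_le_eLpNorm_of_exponent_le (by norm_num) hf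

variable {G : Type*} [NormedAddCommGroup G] [MeasurableSpace G] [BorelSpace G]
  [SecondCountableTopology G]
variable {F : Type*} [NormedAddCommGroup F] [NormedSpace ℝ F] [MeasurableSpace F] [BorelSpace F]
  [SecondCountableTopology F] [CompleteSpace F]

/-- The average of the translates `f (· - q)` with respect to `ν`. -/
noncomputable def avg (ν : Measure G) (f : G → F) (p : G) : F := ∫ q, f (p - q) ∂ν

/-- Averaging with respect to `ν` is bounded on `L¹(μ)`, for nonnegative functions. -/
def AvgBdd (ν μ : Measure G) (C : ℝ≥0∞) : Prop :=
  ∀ f : G → ℝ≥0∞, Measurable f → ∫⁻ p, ∫⁻ q, f (p - q) ∂ν ∂μ ≤ C * ∫⁻ p, f p ∂μ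

theorem AvgBdd.mono {ν ν' μ : Measure G} {C : ℝ≥0∞} (h : AvgBdd ν' μ C) (hν : ν ≤ ν') :
    AvgBdd ν μ C := fun f hf =>
  (lintegral_mono fun _ => lintegral_mono' hν le_rfl).trans (h f hf)

theorem AvgBdd.smul {ν μ : Measure G} {C : ℝ≥0∞} (h : AvgBdd ν μ C) [SFinite ν] (c : ℝ≥0∞) :
    AvgBdd (c • ν) μ (c * C) := fun f hf => by
  simp only [lintegral_smul_measure, smul_eq_mul]
  rw [lintegral_const_mul, mul_assoc]
  · gcongr
    exact h f hf
  · exact Measurable.lintegral_prod_right' (f := fun x : G × G => f (x.1 - x.2)) (by fun_prop)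

/-- By Tonelli, each translate contributes exactly the integral of `f`. -/
theorem avgBdd_of_measurePreserving {ν μ : Measure G} [SFinite ν] [SFinite μ]
    (h : ∀ᵐ q ∂ν, MeasurePreserving (fun p => p - q) μ μ) : AvgBdd ν μ (ν Set.univ) :=
    fun f hf => by
  rw [lintegral_lintegral_swap (by fun_prop)]
  apply le_of_eq
  calc ∫⁻ q, ∫⁻ p, f (p - q) ∂μ ∂ν = ∫⁻ _, ∫⁻ p, f p ∂μ ∂ν :=
        lintegral_congr_ae (h.mono fun q hq => hq.lintegral_comp hf)
    _ = _ := by rw [lintegral_const, mul_comm]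

/-- Averaging bounds tensorize, which reduces the mollifier on `(x, y, t)` to one-dimensional
estimates; only the factor in `y` is not translation invariant. -/
theorem avgBdd_prod {G' : Type*} [NormedAddCommGroup G'] [MeasurableSpace G'] [BorelSpace G']
    [SecondCountableTopology G'] {ν μ : Measure G} {ν' μ' : Measure G'}
    [SFinite ν] [SFinite μ] [SFinite ν'] [SFinite μ'] {C C' : ℝ≥0∞}
    (h : AvgBdd ν μ C) (h' : AvgBdd ν' μ' C') :
    AvgBdd (ν.prod ν') (μ.prod μ') (C * C') := fun f hf => by
  have m1 : Measurable fun x : (G × G') × (G × G') => f (x.1 - x.2) := by fun_prop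
  calc ∫⁻ p, ∫⁻ q, f (p - q) ∂(ν.prod ν') ∂(μ.prod μ')
      = ∫⁻ p, ∫⁻ p', ∫⁻ q, ∫⁻ q', f (p - q, p' - q') ∂ν' ∂ν ∂μ' ∂μ := by
        rw [lintegral_prod _ (by fun_prop)]
        refine lintegral_congr fun p => lintegral_congr fun p' => ?_
        rw [lintegral_prod _ (by fun_prop)]
        rfl
    _ = ∫⁻ p, ∫⁻ q, ∫⁻ p', ∫⁻ q', f (p - q, p' - q') ∂ν' ∂μ' ∂ν ∂μ := by
        refine lintegral_congr fun p => ?_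
        rw [lintegral_lintegral_swap]
        fun_prop
    _ ≤ ∫⁻ p, ∫⁻ q, C' * ∫⁻ p', f (p - q, p') ∂μ' ∂ν ∂μ := by
        refine lintegral_mono fun p => lintegral_mono fun q => ?_
        exact h' (fun r => f (p - q, r)) (by fun_prop)
    _ ≤ C * ∫⁻ p, C' * ∫⁻ p', f (p, p') ∂μ' ∂μ :=
        h (fun r => C' * ∫⁻ p', f (r, p') ∂μ') (by fun_prop)
    _ = C * C' * ∫⁻ p, f p ∂(μ.prod μ') := by
        rw [lintegral_prod _ (by fun_prop), lintegral_const_mul _ (by fun_prop), mul_assoc]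

/-- Jensen pointwise, then the `L¹` bound applied to the square of the norm. -/
theorem lintegral_avg_sq_le {ν μ : Measure G} [IsProbabilityMeasure ν] {C : ℝ≥0∞}
    (h : AvgBdd ν μ C) {f : G → F} (hf : StronglyMeasurable f) :
    ∫⁻ p, ‖avg ν f p‖ₑ ^ 2 ∂μ ≤ C * ∫⁻ p, ‖f p‖ₑ ^ 2 ∂μ := by
  refine le_trans (lintegral_mono fun p => ?_) (h (fun p => ‖f p‖ₑ ^ 2) (by
    have := hf.measurable; fun_prop))
  exact enorm_integral_sq_le ν (hf.comp_measurable (by fun_prop)).aestronglyMeasurable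

theorem stronglyMeasurable_avg {ν : Measure G} [SFinite ν] {f : G → F} (hf : Measurable f) :
    StronglyMeasurable (avg ν f) :=
  StronglyMeasurable.integral_prod_right' (f := fun x : G × G => f (x.1 - x.2))
    (Measurable.stronglyMeasurable (by fun_prop))

theorem eLpNorm_avg_le {ν μ : Measure G} [IsProbabilityMeasure ν] {C : ℝ≥0∞}
    (h : AvgBdd ν μ C) {f : G → F} (hf : Measurable f) :
    eLpNorm (avg ν f) 2 μ ≤ C ^ (1 / 2 : ℝ) * eLpNorm f 2 μ :=
  eLpNorm_le_of_sq (lintegral_avg_sq_le h hf.stronglyMeasurable)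

theorem memLp_avg {ν μ : Measure G} [IsProbabilityMeasure ν] {C : ℝ≥0∞} (hC : C ≠ ⊤)
    (h : AvgBdd ν μ C) {f : G → F} (hf : Measurable f) (hf2 : MemLp f 2 μ) :
    MemLp (avg ν f) 2 μ :=
  ⟨(stronglyMeasurable_avg hf).aestronglyMeasurable, (eLpNorm_avg_le h hf).trans_lt
    (ENNReal.mul_lt_top (ENNReal.rpow_lt_top_of_nonneg (by norm_num) hC) hf2.2)⟩

/-- The Bochner integral defining `avg` is additive only where the translates are integrable; the
averaging bound makes this true almost everywhere. -/
theorem ae_integrable_sub {ν μ : Measure G} [IsProbabilityMeasure ν] {C : ℝ≥0∞} (hC : C ≠ ⊤)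
    (h : AvgBdd ν μ C) {f : G → F} (hf : Measurable f) (hf2 : MemLp f 2 μ) :
    ∀ᵐ p ∂μ, Integrable (fun q => f (p - q)) ν := by
  have h1 : ∫⁻ p, ∫⁻ q, ‖f (p - q)‖ₑ ^ 2 ∂ν ∂μ ≠ ⊤ := by
    refine ((h (fun p => ‖f p‖ₑ ^ 2) (by fun_prop)).trans_lt ?_).ne
    rw [← eLpNorm_sq]
    exact ENNReal.mul_lt_top hC.lt_top (ENNReal.pow_lt_top hf2.2)
  have h2 := ae_lt_top (Measurable.lintegral_prod_right'
    (f := fun x : G × G => ‖f (x.1 - x.2)‖ₑ ^ 2) (by fun_prop)) h1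
  filter_upwards [h2] with p hp
  rw [← eLpNorm_sq] at hp
  have : MemLp (fun q => f (p - q)) 2 ν :=
    ⟨Measurable.aestronglyMeasurable (by fun_prop), by
      by_contra hh
      rw [not_lt, top_le_iff] at hh
      simp [hh] at hp⟩
  exact this.integrable (by norm_num)

theorem avg_sub_ae {ν μ : Measure G} [IsProbabilityMeasure ν] {C : ℝ≥0∞} (hC : C ≠ ⊤)
    (h : AvgBdd ν μ C) {f g : G → F} (hf : Measurable f) (hf2 : MemLp f 2 μ)
    (hg : Measurable g) (hg2 : MemLp g 2 μ) :
    avg ν (f - g) =ᵐ[μ] avg ν f - avg ν g := by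
  filter_upwards [ae_integrable_sub hC h hf hf2, ae_integrable_sub hC h hg hg2] with p h1 h2
  simp only [avg, Pi.sub_apply]
  exact integral_sub h1 h2

theorem tendsto_avg_of_continuous {ι : Type*} {l : Filter ι} {ν : ι → Measure G} {μ : Measure G}
    [∀ j, IsProbabilityMeasure (ν j)] [IsFiniteMeasureOnCompacts μ] [ProperSpace G]
    (hsupp : ∀ ε > 0, ∀ᶠ j in l, ν j (Metric.closedBall 0 ε)ᶜ = 0)
    {g : G → F} (hg : Continuous g) (hgc : HasCompactSupport g) :
    Tendsto (fun j => eLpNorm (avg (ν j) g - g) 2 μ) l (𝓝 0) := by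
  rw [ENNReal.tendsto_nhds_zero]
  intro ε hε
  set S := Metric.cthickening 1 (tsupport g) with hS
  have hSc : IsCompact S := hgc.isCompact.cthickening
  have hSm : MeasurableSet S := hSc.isClosed.measurableSet
  obtain ⟨c, hc0, hc⟩ : ∃ c : NNReal, 0 < c ∧ c * (μ S) ^ (1 / 2 : ℝ) ≤ ε := by
    have hfin : (μ S) ^ (1 / 2 : ℝ) ≠ ⊤ :=
      (ENNReal.rpow_lt_top_of_nonneg (by norm_num) hSc.measure_lt_top.ne).ne
    have hpos : 0 < ε / ((μ S) ^ (1 / 2 : ℝ)) := ENNReal.div_pos hε.ne' hfin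
    obtain ⟨c, hc0, hc1⟩ := ENNReal.lt_iff_exists_nnreal_btwn.1 hpos
    refine ⟨c, by exact_mod_cast hc0, ?_⟩
    exact (mul_le_mul_left hc1.le _).trans (ENNReal.mul_le_of_le_div le_rfl)
  have huc := hgc.uniformContinuous_of_continuous hg
  obtain ⟨δ, hδ, hδg⟩ := Metric.uniformContinuous_iff.1 huc c (by exact_mod_cast hc0)
  -- The bound `δ / 2` makes the oscillation of `g` less than `c`; the bound `1` keeps the averages
  -- supported in `S`.
  filter_upwards [hsupp (min (δ / 2) 1) (by positivity)] with j hj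
  have hae : ∀ᵐ q ∂(ν j), q ∈ Metric.closedBall (0 : G) (min (δ / 2) 1) := hj
  have hgint : ∀ p, Integrable (fun q => g (p - q)) (ν j) := fun p => by
    obtain ⟨M, hM⟩ := hgc.exists_bound_of_continuous hg
    exact Integrable.of_bound (Continuous.aestronglyMeasurable (by fun_prop)) M
      (Eventually.of_forall fun q => hM _)
  have hdiff : ∀ p, (avg (ν j) g - g) p = ∫ q, (g (p - q) - g p) ∂(ν j) := fun p => by
    rw [integral_sub (hgint p) (integrable_const _)]
    simp [avg]
  have hbound : ∀ p, ‖(avg (ν j) g - g) p‖ ≤ ‖S.indicator (fun _ => (c : ℝ)) p‖ := fun p => by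
    rw [hdiff]
    by_cases hp : p ∈ S
    · rw [Set.indicator_of_mem hp, Real.norm_of_nonneg c.coe_nonneg]
      refine (norm_integral_le_of_norm_le_const (C := c) ?_).trans (by simp)
      filter_upwards [hae] with q hq
      rw [← dist_eq_norm]
      refine (hδg ?_).le
      rw [dist_eq_norm]
      simp only [sub_sub_cancel_left, norm_neg]
      rw [mem_closedBall_zero_iff] at hq
      linarith [min_le_left (δ / 2) 1]
    · have : ∀ᵐ q ∂(ν j), g (p - q) - g p = 0 := by
        filter_upwards [hae] with q hq
        have h1 : p ∉ tsupport g := fun h => hp (Metric.self_subset_cthickening _ h)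
        have h2 : p - q ∉ tsupport g := fun h => hp (by
          refine Metric.mem_cthickening_of_dist_le p (p - q) 1 _ h ?_
          rw [mem_closedBall_zero_iff] at hq
          rw [dist_eq_norm]
          simpa using hq.trans (min_le_right _ _))
        rw [image_eq_zero_of_notMem_tsupport h1, image_eq_zero_of_notMem_tsupport h2, sub_zero]
      rw [integral_congr_ae this]
      simp
  refine (eLpNorm_mono hbound).trans ?_
  rw [eLpNorm_indicator_const hSm (by norm_num) (by norm_num)]
  refine le_trans (le_of_eq ?_) hc
  simp

/-- Density of continuous compactly supported functions, together with the uniform `L²` bound.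
Invariance of `μ` is not needed, so the statement applies to the weighted measure. -/
theorem tendsto_avg {ι : Type*} {l : Filter ι} {ν : ι → Measure G} {μ : Measure G}
    [∀ j, IsProbabilityMeasure (ν j)] [μ.Regular] [ProperSpace G]
    {C : ℝ≥0∞} (hC : C ≠ ⊤) (h : ∀ j, AvgBdd (ν j) μ C)
    (hsupp : ∀ ε > 0, ∀ᶠ j in l, ν j (Metric.closedBall 0 ε)ᶜ = 0)
    {f : G → F} (hf : Measurable f) (hf2 : MemLp f 2 μ) :
    Tendsto (fun j => eLpNorm (avg (ν j) f - f) 2 μ) l (𝓝 0) := by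
  rw [ENNReal.tendsto_nhds_zero]
  intro ε hε
  -- The approximation error `f - g` is paid twice: once averaged, at the cost of the operator norm,
  -- and once as it stands.
  set D : ℝ≥0∞ := C ^ (1 / 2 : ℝ) + 1 with hD
  have hDt : D ≠ ⊤ :=
    ENNReal.add_ne_top.2 ⟨(ENNReal.rpow_lt_top_of_nonneg (by norm_num) hC).ne, by simp⟩
  obtain ⟨g, hgc, hfg, hg, hg2⟩ := hf2.exists_hasCompactSupport_eLpNorm_sub_le (by norm_num)
    (ε := ε / 2 / D) (ENNReal.div_pos (ENNReal.half_pos hε.ne').ne' hDt).ne'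
  have h1 := (ENNReal.tendsto_nhds_zero.1 (tendsto_avg_of_continuous (μ := μ) hsupp hg hgc))
    (ε / 2) (ENNReal.half_pos hε.ne')
  filter_upwards [h1] with j hj
  have e : avg (ν j) f - f =ᵐ[μ] (avg (ν j) (f - g) - (f - g)) + (avg (ν j) g - g) := by
    filter_upwards [avg_sub_ae hC (h j) hf hf2 hg.measurable hg2] with p hp
    simp only [Pi.sub_apply, Pi.add_apply, hp]
    abel
  have m1 := (stronglyMeasurable_avg (ν := ν j) (hf.sub hg.measurable)).aestronglyMeasurable
    (μ := μ)
  have m2 := (stronglyMeasurable_avg (ν := ν j) hg.measurable).aestronglyMeasurable (μ := μ)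
  have m3 : AEStronglyMeasurable (f - g) μ := (hf.sub hg.measurable).aestronglyMeasurable
  calc eLpNorm (avg (ν j) f - f) 2 μ
      = eLpNorm ((avg (ν j) (f - g) - (f - g)) + (avg (ν j) g - g)) 2 μ := eLpNorm_congr_ae e
    _ ≤ eLpNorm (avg (ν j) (f - g)) 2 μ + eLpNorm (f - g) 2 μ
          + eLpNorm (avg (ν j) g - g) 2 μ := by
        refine (eLpNorm_add_le (m1.sub m3) (m2.sub hg.aestronglyMeasurable) (by norm_num)).trans ?_
        gcongr
        exact eLpNorm_sub_le m1 m3 (by norm_num)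
    _ ≤ C ^ (1 / 2 : ℝ) * (ε / 2 / D) + 1 * (ε / 2 / D) + ε / 2 := by
        rw [one_mul]
        gcongr
        refine (eLpNorm_avg_le (h j) (hf.sub hg.measurable)).trans ?_
        gcongr
    _ ≤ ε / 2 + ε / 2 := by
        rw [← add_mul]
        gcongr
        exact ENNReal.mul_div_le
    _ = ε := ENNReal.add_halves ε

end Averaging

end LameExt

namespace LameExt

open scoped ENNReal

/-! ### The weight `y^a` and one-sided averages in `y` -/

section Weight

/-- The measure `y^a dy` on `(0, ∞)`. -/
noncomputable def yMeas (a : ℝ) : Measure ℝ :=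
  (volume.restrict (Set.Ioi 0)).withDensity (fun y => ENNReal.ofReal (y ^ a))

instance (a : ℝ) : SFinite (yMeas a) := by unfold yMeas; infer_instance

/-- The weight sees `y` only. This is what makes translations in `x` and `t` measure preserving and
allows arguments one variable at a time. -/
theorem wMeasure_eq_prod (n : ℕ) (a : ℝ) :
    wMeasure n a = (volume : Measure (E n)).prod ((yMeas a).prod volume) := by
  unfold wMeasure yMeas
  rw [prod_withDensity_left (by fun_prop), prod_withDensity_right (by fun_prop)]
  congr 1
  have h1 : (volume.restrict (Set.Ioi 0)).prod (volume : Measure ℝ) =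
      ((volume : Measure ℝ).prod volume).restrict (Set.Ioi 0 ×ˢ Set.univ) := by
    rw [← Measure.prod_restrict, Measure.restrict_univ]
  have h2 (X : Measure (ℝ × ℝ)) [SFinite X] (S : Set (ℝ × ℝ)) :
      (volume : Measure (E n)).prod (X.restrict S) =
        ((volume : Measure (E n)).prod X).restrict (Set.univ ×ˢ S) := by
    rw [← Measure.prod_restrict, Measure.restrict_univ]
  rw [h1, h2, Measure.volume_eq_prod, Measure.volume_eq_prod]
  congr 1
  ext p
  simp

instance : (volume : Measure (ℝ × ℝ)).IsAddHaarMeasure := by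
  rw [Measure.volume_eq_prod]; infer_instance

instance (n : ℕ) : (volume : Measure (Pt n)).IsAddHaarMeasure := by
  rw [Measure.volume_eq_prod]; infer_instance

instance (n : ℕ) : (volume : Measure (E n × ℝ)).IsAddHaarMeasure := by
  rw [Measure.volume_eq_prod]; infer_instance

instance (n : ℕ) (a : ℝ) : SFinite (wMeasure n a) := by rw [wMeasure_eq_prod]; infer_instance

theorem yMeas_finite {a : ℝ} (ha : -1 < a) : IsFiniteMeasureOnCompacts (yMeas a) := by
  refine ⟨fun K hK => ?_⟩
  obtain ⟨R, hR0, hR⟩ := hK.isBounded.subset_closedBall_lt 0 0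
  have hsub : K ⊆ Set.Iic R := fun x hx => by
    have := hR hx
    rw [mem_closedBall_zero_iff] at this
    exact (le_abs_self x).trans this
  refine (measure_mono hsub).trans_lt ?_
  rw [yMeas, withDensity_apply _ measurableSet_Iic, Measure.restrict_restrict measurableSet_Iic,
    Set.inter_comm, Set.Ioi_inter_Iic]
  have h := (intervalIntegral.intervalIntegrable_rpow' ha (a := 0) (b := R))
  rw [intervalIntegrable_iff_integrableOn_Ioc_of_le hR0.le] at h
  refine lt_of_le_of_lt (lintegral_mono fun y => ?_) h.2
  exact Real.ofReal_le_enorm _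

theorem wMeasure_finite (n : ℕ) {a : ℝ} (ha : -1 < a) :
    IsFiniteMeasureOnCompacts (wMeasure n a) := by
  have := yMeas_finite ha
  rw [wMeasure_eq_prod]; infer_instance

theorem wMeasure_regular (n : ℕ) {a : ℝ} (ha : -1 < a) : (wMeasure n a).Regular := by
  have := wMeasure_finite n ha
  infer_instance

theorem measurePreserving_add_tangential {n : ℕ} (a : ℝ) {q : Pt n} (hq : q.2.1 = 0) :
    MeasurePreserving (fun p => p + q) (wMeasure n a) (wMeasure n a) := by
  rw [wMeasure_eq_prod]
  have := (measurePreserving_add_right (volume : Measure (E n)) q.1).prod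
    ((MeasurePreserving.id (yMeas a)).prod (measurePreserving_add_right (volume : Measure ℝ) q.2.2))
  convert this using 1
  ext p <;> simp [Prod.map, hq]

/-- The density of `yMeas`, extended by zero. -/
noncomputable def yWeight (a y : ℝ) : ℝ≥0∞ :=
  (Set.Ioi (0 : ℝ)).indicator (fun y => ENNReal.ofReal (y ^ a)) y

@[fun_prop]
theorem measurable_yWeight (a : ℝ) : Measurable (yWeight a) :=
  Measurable.indicator (by fun_prop) measurableSet_Ioi

theorem lintegral_yMeas (a : ℝ) {f : ℝ → ℝ≥0∞} (hf : Measurable f) :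
    ∫⁻ y, f y ∂(yMeas a) = ∫⁻ y, yWeight a y * f y := by
  rw [yMeas, lintegral_withDensity_eq_lintegral_mul _ (by fun_prop) hf,
    ← lintegral_indicator measurableSet_Ioi]
  refine lintegral_congr fun y => ?_
  by_cases hy : y ∈ Set.Ioi (0 : ℝ) <;> simp [yWeight, hy]

/-- The constant of `lintegral_yWeight_le`. -/
noncomputable def yConst (a : ℝ) : ℝ := 4 / (a + 1) + 2

/-- A one-sided Muckenhoupt condition: the mean of the weight over points lying between `δ` and `2δ`
below `Y` is at most a multiple of its value at `Y`, uniformly in `δ`. Looking only downwards, `-1 <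
a` suffices. -/
theorem lintegral_yWeight_le {a δ : ℝ} (ha : -1 < a) (hδ : 0 < δ) (Y : ℝ) :
    ∫⁻ q in Set.Ioo (-(2 * δ)) (-δ), yWeight a (Y + q)
      ≤ ENNReal.ofReal (δ * yConst a) * yWeight a Y := by
  have hc : 0 ≤ 4 / (a + 1) := div_nonneg (by norm_num) (by linarith)
  rcases le_or_gt Y 0 with hY | hY
  · have : ∀ q ∈ Set.Ioo (-(2 * δ)) (-δ), yWeight a (Y + q) = 0 := fun q hq =>
      Set.indicator_of_notMem (by simp only [Set.mem_Ioi, not_lt]; linarith [hq.2]) _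
    rw [setLIntegral_congr_fun measurableSet_Ioo this]
    simp
  have hYw : yWeight a Y = ENNReal.ofReal (Y ^ a) := Set.indicator_of_mem (by simpa using hY) _
  have hvol : volume (Set.Ioo (-(2 * δ)) (-δ)) = ENNReal.ofReal δ := by
    rw [Real.volume_Ioo]; congr 1; ring
  have hconst : ∀ M : ℝ, 0 ≤ M → M ≤ yConst a →
      (∀ q ∈ Set.Ioo (-(2 * δ)) (-δ), yWeight a (Y + q) ≤ ENNReal.ofReal (M * Y ^ a)) →
      ∫⁻ q in Set.Ioo (-(2 * δ)) (-δ), yWeight a (Y + q)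
      ≤ ENNReal.ofReal (δ * yConst a) * yWeight a Y := by
    intro M hM0 hM h
    refine (setLIntegral_mono' measurableSet_Ioo h).trans ?_
    rw [setLIntegral_const, hvol, hYw, ← ENNReal.ofReal_mul (by positivity),
      ← ENNReal.ofReal_mul (mul_nonneg hδ.le (hM0.trans hM))]
    apply ENNReal.ofReal_le_ofReal
    have : 0 ≤ Y ^ a := by positivity
    have := mul_le_mul_of_nonneg_right hM (mul_nonneg this hδ.le)
    linarith
  -- For `a ≥ 0` the weight is nondecreasing, so its values below `Y` do not exceed the value at
  -- `Y`.
  rcases le_or_gt 0 a with ha0 | ha0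
  · refine hconst 1 zero_le_one (by unfold yConst; linarith) fun q hq => ?_
    rw [one_mul]
    by_cases h : Y + q ∈ Set.Ioi (0 : ℝ)
    · rw [yWeight, Set.indicator_of_mem h]
      apply ENNReal.ofReal_le_ofReal
      exact Real.rpow_le_rpow (le_of_lt h) (by linarith [hq.2]) ha0
    · rw [yWeight, Set.indicator_of_notMem h]; exact zero_le
  -- For `a < 0` and `Y ≥ 4δ` the points `Y + q` stay above `Y / 2`, which costs `2^(-a) ≤ 2`. For
  -- `Y < 4δ` one integrates over all of `(0, Y)` and uses `Y^(a+1) / (a+1) ≤ 4δ Y^a / (a+1)`.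
  rcases le_or_gt (4 * δ) Y with h4 | h4
  · refine hconst 2 (by norm_num) (by unfold yConst; linarith) fun q hq => ?_
    have hp : Y / 2 ≤ Y + q := by linarith [hq.1]
    have hpos : 0 < Y + q := by linarith
    rw [yWeight, Set.indicator_of_mem (by simpa using hpos)]
    apply ENNReal.ofReal_le_ofReal
    calc (Y + q) ^ a ≤ (Y / 2) ^ a :=
          Real.rpow_le_rpow_of_nonpos (by linarith) hp ha0.le
      _ = 2 ^ (-a) * Y ^ a := by
          rw [Real.div_rpow hY.le (by norm_num), Real.rpow_neg (by norm_num)]; ring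
      _ ≤ 2 * Y ^ a := by
          gcongr
          calc (2 : ℝ) ^ (-a) ≤ 2 ^ (1 : ℝ) :=
                Real.rpow_le_rpow_of_exponent_le (by norm_num) (by linarith)
            _ = 2 := Real.rpow_one 2
  · calc ∫⁻ q in Set.Ioo (-(2 * δ)) (-δ), yWeight a (Y + q)
        ≤ ∫⁻ q in Set.Iio 0, yWeight a (Y + q) :=
          lintegral_mono_set fun q hq => by simp only [Set.mem_Iio]; linarith [hq.2]
      _ = ∫⁻ q, (Set.Iio Y).indicator (yWeight a) (q + Y) := by
          rw [← lintegral_indicator measurableSet_Iio]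
          refine lintegral_congr fun q => ?_
          by_cases hq : q < 0
          · rw [Set.indicator_of_mem (by simpa using hq), Set.indicator_of_mem (by simpa using hq),
              add_comm]
          · rw [Set.indicator_of_notMem (by simpa using hq),
              Set.indicator_of_notMem (by simpa using hq)]
      _ = ∫⁻ q, (Set.Iio Y).indicator (yWeight a) q :=
          lintegral_add_right_eq_self (fun q => (Set.Iio Y).indicator (yWeight a) q) Y
      _ = ∫⁻ q in Set.Ioo 0 Y, ENNReal.ofReal (q ^ a) := by
          rw [← lintegral_indicator measurableSet_Ioo]
          refine lintegral_congr fun q => ?_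
          by_cases h1 : q < Y <;> by_cases h2 : 0 < q <;> simp [yWeight, Set.indicator, h1, h2]
      _ ≤ ENNReal.ofReal (Y ^ (a + 1) / (a + 1)) := by
          rw [setLIntegral_congr (Ioo_ae_eq_Ioc), ← ofReal_integral_eq_lintegral_ofReal]
          · rw [← intervalIntegral.integral_of_le hY.le, integral_rpow (Or.inl ha),
              Real.zero_rpow (by linarith), sub_zero]
          · have h := (intervalIntegral.intervalIntegrable_rpow' ha (a := 0) (b := Y))
            rwa [intervalIntegrable_iff_integrableOn_Ioc_of_le hY.le] at h
          · exact (ae_restrict_mem measurableSet_Ioc).mono fun y hy => by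
              have : 0 < y := hy.1
              simp only [Pi.zero_apply]; positivity
      _ ≤ _ := by
          rw [hYw, ← ENNReal.ofReal_mul (mul_nonneg hδ.le (by unfold yConst; linarith))]
          apply ENNReal.ofReal_le_ofReal
          rw [Real.rpow_add hY, Real.rpow_one]
          have h0 : 0 ≤ Y ^ a := by positivity
          have h1 : 0 < a + 1 := by linarith
          unfold yConst
          have h2 : Y ^ a * Y / (a + 1) ≤ Y ^ a * (4 * δ) / (a + 1) := by gcongr
          have h3 : Y ^ a * (4 * δ) / (a + 1) = δ * (4 / (a + 1)) * Y ^ a := by ring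
          have h4 : 0 ≤ δ * 2 * Y ^ a := by positivity
          linarith

/-- Tonelli and a translation move the shift from `f` to the weight: averages of `f` over points
above correspond to averages of the weight over points below. -/
theorem avgBdd_yMeas {a δ : ℝ} (ha : -1 < a) (hδ : 0 < δ) :
    AvgBdd (volume.restrict (Set.Ioo (-(2 * δ)) (-δ))) (yMeas a)
      (ENNReal.ofReal (δ * yConst a)) := fun f hf => by
  rw [lintegral_yMeas _ (by fun_prop), lintegral_yMeas _ hf]
  calc ∫⁻ y, yWeight a y * ∫⁻ q in Set.Ioo (-(2 * δ)) (-δ), f (y - q)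
      = ∫⁻ y, ∫⁻ q in Set.Ioo (-(2 * δ)) (-δ), yWeight a y * f (y - q) := by
        refine lintegral_congr fun y => ?_
        rw [lintegral_const_mul _ (by fun_prop)]
    _ = ∫⁻ q in Set.Ioo (-(2 * δ)) (-δ), ∫⁻ y, yWeight a y * f (y - q) :=
        lintegral_lintegral_swap (by fun_prop)
    _ = ∫⁻ q in Set.Ioo (-(2 * δ)) (-δ), ∫⁻ y, yWeight a (y + q) * f y := by
        refine lintegral_congr fun q => ?_
        rw [← lintegral_add_right_eq_self (fun y => yWeight a y * f (y - q)) q]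
        simp
    _ = ∫⁻ y, ∫⁻ q in Set.Ioo (-(2 * δ)) (-δ), yWeight a (y + q) * f y :=
        lintegral_lintegral_swap (by fun_prop)
    _ ≤ ∫⁻ y, ENNReal.ofReal (δ * yConst a) * (yWeight a y * f y) := by
        refine lintegral_mono fun y => ?_
        rw [lintegral_mul_const _ (by fun_prop), ← mul_assoc]
        gcongr
        exact lintegral_yWeight_le ha hδ y
    _ = _ := lintegral_const_mul _ (by fun_prop)

end Weight

/-! ### A mollifier that sees only points above -/

section Mollifier

variable (n : ℕ)

/-- A bump function supported in `{-2δ < y < -δ}`: averages with respect to it only see points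
above. -/
noncomputable def bump {δ : ℝ} (hδ : 0 < δ) : ContDiffBump ((0, -(3 / 2 * δ), 0) : Pt n) where
  rIn := δ / 4
  rOut := δ / 2
  rIn_pos := by positivity
  rIn_lt_rOut := by linarith

/-- The mollification kernel at scale `δ`. -/
noncomputable def kern {δ : ℝ} (hδ : 0 < δ) : Pt n → ℝ := (bump n hδ).normed volume

/-- The probability measure with density `kern`. -/
noncomputable def moll {δ : ℝ} (hδ : 0 < δ) : Measure (Pt n) :=
  volume.withDensity (fun q => ENNReal.ofReal (kern n hδ q))

variable {n} {δ : ℝ} (hδ : 0 < δ)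

theorem contDiff_kern : ContDiff ℝ ∞ (kern n hδ) := (bump n hδ).contDiff_normed

theorem hasCompactSupport_kern : HasCompactSupport (kern n hδ) :=
  (bump n hδ).hasCompactSupport_normed

theorem kern_nonneg (q : Pt n) : 0 ≤ kern n hδ q := (bump n hδ).nonneg_normed q

theorem measurable_kern : Measurable (kern n hδ) := (contDiff_kern hδ).continuous.measurable

instance : IsProbabilityMeasure (moll n hδ) := by
  constructor
  rw [moll, withDensity_apply _ MeasurableSet.univ, Measure.restrict_univ,
    ← ofReal_integral_eq_lintegral_ofReal]
  · rw [kern, ContDiffBump.integral_normed]; simp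
  · exact (bump n hδ).integrable_normed
  · exact Eventually.of_forall (kern_nonneg hδ)

theorem tsupport_kern_subset {q : Pt n} (hq : q ∈ tsupport (kern n hδ)) :
    ‖q.1‖ ≤ δ / 2 ∧ -(2 * δ) ≤ q.2.1 ∧ q.2.1 ≤ -δ ∧ |q.2.2| ≤ δ / 2 := by
  rw [kern, ContDiffBump.tsupport_normed_eq] at hq
  change q ∈ Metric.closedBall _ (δ / 2) at hq
  rw [mem_closedBall_iff_norm, Prod.norm_def, Prod.norm_def] at hq
  simp only [Prod.fst_sub, Prod.snd_sub, sub_zero, sup_le_iff, Real.norm_eq_abs, abs_le] at hq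
  refine ⟨hq.1, by linarith [hq.2.1.1], by linarith [hq.2.1.2], abs_le.2 hq.2.2⟩

theorem kern_eq_zero {q : Pt n} (hq : q ∉ Metric.ball ((0, -(3 / 2 * δ), 0) : Pt n) (δ / 2)) :
    kern n hδ q = 0 := by
  by_contra h
  have : q ∈ Function.support (kern n hδ) := h
  rw [kern, ContDiffBump.support_normed_eq] at this
  exact hq this

/-- The box containing the support of `kern`. -/
noncomputable def boxMeas (n : ℕ) (δ : ℝ) : Measure (Pt n) :=
  (volume.restrict (Metric.ball (0 : E n) (δ / 2))).prod
    ((volume.restrict (Set.Ioo (-(2 * δ)) (-δ))).prod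
      (volume.restrict (Metric.ball (0 : ℝ) (δ / 2))))

/-- The constant by which `moll` is dominated. -/
noncomputable def boxConst (n : ℕ) (δ : ℝ) : ℝ≥0∞ :=
  2 ^ (n + 2) * (volume (Metric.ball (0 : E n) (δ / 2)) * (ENNReal.ofReal δ *
    volume (Metric.ball (0 : ℝ) (δ / 2))))⁻¹

theorem boxMeas_eq : boxMeas n δ =
    volume.restrict (Metric.ball ((0, -(3 / 2 * δ), 0) : Pt n) (δ / 2)) := by
  rw [boxMeas, Measure.prod_restrict, Measure.prod_restrict, ← ball_prod_same, ← ball_prod_same]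
  rw [Real.ball_eq_Ioo (-(3 / 2 * δ)), Measure.volume_eq_prod, Measure.volume_eq_prod]
  have e1 : -(3 / 2 * δ) - δ / 2 = -(2 * δ) := by ring
  have e2 : -(3 / 2 * δ) + δ / 2 = -δ := by ring
  rw [e1, e2]

/-- The outer radius is twice the inner one in dimension `n + 2`, so the normalized bump is at most
`2^(n+2)` divided by the volume of its ball. For the product norm this ball is a box, hence a
product measure. -/
theorem moll_le : moll n hδ ≤ boxConst n δ • boxMeas n δ := by
  have hV : volume (Metric.ball ((0, -(3 / 2 * δ), 0) : Pt n) (δ / 2)) =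
      volume (Metric.ball (0 : E n) (δ / 2)) * (ENNReal.ofReal δ *
        volume (Metric.ball (0 : ℝ) (δ / 2))) := by
    rw [← ball_prod_same, ← ball_prod_same, Measure.volume_eq_prod, Measure.prod_prod,
      Measure.volume_eq_prod, Measure.prod_prod, Real.volume_ball (-(3 / 2 * δ))]
    congr 3
    ring
  rw [boxMeas_eq, boxConst, ← hV, moll, ← withDensity_const,
    ← withDensity_indicator measurableSet_ball]
  refine withDensity_mono (Eventually.of_forall fun q => ?_)
  by_cases hq : q ∈ Metric.ball ((0, -(3 / 2 * δ), 0) : Pt n) (δ / 2)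
  swap
  · simp [kern_eq_zero hδ hq]
  rw [Set.indicator_of_mem hq]
  have h1 := (bump n hδ).normed_le_div_measure_closedBall_rOut (μ := volume) 2
    (by change δ / 2 ≤ 2 * (δ / 4); linarith) q
  have hfr : Module.finrank ℝ (Pt n) = n + 2 := by
    simp [Module.finrank_prod]
  rw [hfr] at h1
  refine (ENNReal.ofReal_le_ofReal h1).trans ?_
  have hpos : 0 < volume.real (Metric.closedBall ((0, -(3 / 2 * δ), 0) : Pt n) (δ / 2)) :=
    ENNReal.toReal_pos (Metric.measure_closedBall_pos _ _ (by positivity)).ne'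
      measure_closedBall_lt_top.ne
  change ENNReal.ofReal (2 ^ (n + 2) / volume.real (Metric.closedBall _ (δ / 2))) ≤ _
  rw [ENNReal.ofReal_div_of_pos hpos, div_eq_mul_inv, ofReal_measureReal
    measure_closedBall_lt_top.ne]
  gcongr
  · rw [ENNReal.ofReal_pow (by norm_num)]; simp
  · exact Metric.ball_subset_closedBall

theorem boxConst_mul : boxConst n δ * (volume (Metric.ball (0 : E n) (δ / 2)) *
    (ENNReal.ofReal δ * volume (Metric.ball (0 : ℝ) (δ / 2)))) ≤ 2 ^ (n + 2) := by
  rw [boxConst, mul_assoc]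
  exact mul_le_of_le_one_right' (ENNReal.inv_mul_le_one _)

theorem avgBdd_volume_restrict {G : Type*} [NormedAddCommGroup G] [MeasureSpace G] [BorelSpace G]
    [SecondCountableTopology G] [SFinite (volume : Measure G)]
    [(volume : Measure G).IsAddRightInvariant] (s : Set G) :
    AvgBdd (volume.restrict s) (volume : Measure G) (volume s) := by
  have := avgBdd_of_measurePreserving (ν := volume.restrict s) (μ := (volume : Measure G))
    (Eventually.of_forall fun q => measurePreserving_sub_right volume q)
  simpa using this

/-- The constant in the `L²` bound of mollification. -/
noncomputable def mollConst (n : ℕ) (a : ℝ) : ℝ≥0∞ := 2 ^ (n + 2) * ENNReal.ofReal (yConst a)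

theorem mollConst_ne_top {a : ℝ} : mollConst n a ≠ ⊤ :=
  ENNReal.mul_ne_top (by simp) (by simp)

/-- The volumes of the box cancel against `boxConst`, which leaves a constant independent of the
scale `δ`. -/
theorem avgBdd_moll {a : ℝ} (ha : -1 < a) : AvgBdd (moll n hδ) (wMeasure n a) (mollConst n a) := by
  have hb : AvgBdd (boxMeas n δ) (wMeasure n a)
      (volume (Metric.ball (0 : E n) (δ / 2)) * (ENNReal.ofReal (δ * yConst a) *
        volume (Metric.ball (0 : ℝ) (δ / 2)))) := by
    rw [wMeasure_eq_prod]
    exact avgBdd_prod (avgBdd_volume_restrict _) (avgBdd_prod (avgBdd_yMeas ha hδ)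
      (avgBdd_volume_restrict _))
  have : SFinite (boxMeas n δ) := by unfold boxMeas; infer_instance
  intro f hf
  refine ((hb.smul (boxConst n δ)).mono (moll_le hδ) f hf).trans ?_
  gcongr
  rw [ENNReal.ofReal_mul hδ.le, mollConst]
  calc _ = boxConst n δ * (volume (Metric.ball (0 : E n) (δ / 2)) * (ENNReal.ofReal δ *
    volume (Metric.ball (0 : ℝ) (δ / 2)))) * ENNReal.ofReal (yConst a) := by ring
    _ ≤ _ := by gcongr; exact boxConst_mul

theorem moll_compl_closedBall {ε : ℝ} (h : 2 * δ ≤ ε) :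
    moll n hδ (Metric.closedBall 0 ε)ᶜ = 0 := by
  rw [moll, withDensity_apply _ Metric.isClosed_closedBall.measurableSet.compl]
  rw [setLIntegral_congr_fun (g := 0) Metric.isClosed_closedBall.measurableSet.compl]
  · simp
  intro q hq
  have : q ∉ tsupport (kern n hδ) := fun h' => hq (by
    obtain ⟨h1, h2, h3, h4⟩ := tsupport_kern_subset hδ h'
    rw [mem_closedBall_zero_iff, Prod.norm_def, Prod.norm_def]
    simp only [sup_le_iff, Real.norm_eq_abs, abs_le]
    rw [abs_le] at h4
    refine ⟨by linarith, ⟨by linarith, by linarith⟩, by linarith, by linarith⟩)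
  simp [image_eq_zero_of_notMem_tsupport this]

end Mollifier

end LameExt

namespace LameExt

open scoped ENNReal

set_option linter.unusedSectionVars false

/-! ### Averages along segments and smoothness of averages -/

section LineAverage

variable {G : Type*} [NormedAddCommGroup G] [NormedSpace ℝ G] [MeasurableSpace G] [BorelSpace G]
  [SecondCountableTopology G]
variable {F : Type*} [NormedAddCommGroup F] [NormedSpace ℝ F] [MeasurableSpace F] [BorelSpace F]
  [SecondCountableTopology F] [CompleteSpace F]

/-- The law of `-σ v` for `σ` uniform in `[0, 1]`. -/
noncomputable def lineMeas (v : G) : Measure G :=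
  (volume.restrict (Set.Ioc (0 : ℝ) 1)).map (fun σ => -(σ • v))

instance (v : G) : IsProbabilityMeasure (lineMeas v) := by
  have : IsProbabilityMeasure (volume.restrict (Set.Ioc (0 : ℝ) 1)) := ⟨by simp⟩
  exact Measure.isProbabilityMeasure_map (by fun_prop)

theorem avg_lineMeas (v : G) {f : G → F} (hf : Measurable f) (p : G) :
    avg (lineMeas v) f p = ∫ σ in (0 : ℝ)..1, f (p + σ • v) := by
  rw [avg, lineMeas, integral_map (by fun_prop) (Measurable.aestronglyMeasurable (by fun_prop)),
    intervalIntegral.integral_of_le zero_le_one]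
  simp

theorem ae_lineMeas {v : G} {P : G → Prop} (hP : MeasurableSet {q | P q})
    (h : ∀ σ ∈ Set.Ioc (0 : ℝ) 1, P (-(σ • v))) : ∀ᵐ q ∂(lineMeas v), P q := by
  rw [lineMeas, ae_map_iff (by fun_prop) hP]
  exact (ae_restrict_mem measurableSet_Ioc).mono h

theorem lineMeas_compl_closedBall {v : G} {ε : ℝ} (h : ‖v‖ ≤ ε) :
    lineMeas v (Metric.closedBall 0 ε)ᶜ = 0 :=
  ae_lineMeas (P := fun q => q ∈ Metric.closedBall (0 : G) ε)
    Metric.isClosed_closedBall.measurableSet fun σ hσ => by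
    rw [mem_closedBall_zero_iff, norm_neg, norm_smul, Real.norm_of_nonneg hσ.1.le]
    exact (mul_le_of_le_one_left (norm_nonneg _) hσ.2).trans h

theorem avgBdd_lineMeas {G : Type*} [NormedAddCommGroup G] [NormedSpace ℝ G]
    {mG : MeasurableSpace G} [BorelSpace G] [SecondCountableTopology G]
    {v : G} {μ : Measure G} [SFinite μ]
    (h : ∀ σ : ℝ, MeasurePreserving (fun p => p + σ • v) μ μ) : AvgBdd (lineMeas v) μ 1 := by
  rw [← measure_univ (μ := lineMeas v)]
  intro f hf
  have key : ∫⁻ p, ∫⁻ q, f (p - q) ∂(lineMeas v) ∂μ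
      = ∫⁻ p, (∫⁻ σ in Set.Ioc (0 : ℝ) 1, f (p + σ • v)) ∂μ := by
    refine lintegral_congr fun p => ?_
    rw [lineMeas, lintegral_map (by fun_prop) (by fun_prop)]
    simp
  rw [key, lintegral_lintegral_swap (by fun_prop)]
  rw [lintegral_congr fun σ => (h σ).lintegral_comp hf, lintegral_const]
  simp

theorem avgBdd_lineMeas_tangential {n : ℕ} (a : ℝ) {v : Pt n} (hv : v.2.1 = 0) :
    AvgBdd (lineMeas v) (wMeasure n a) 1 :=
  avgBdd_lineMeas fun σ => measurePreserving_add_tangential a (by simp [hv])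

theorem avgBdd_lineMeas_volume {n : ℕ} (v : E n × ℝ) : AvgBdd (lineMeas v) volume 1 :=
  avgBdd_lineMeas fun _ => measurePreserving_add_right volume _

section Smooth

variable {ν : Measure G} [IsFiniteMeasure ν] {ψ : G → F}

theorem avg_eq_convolution (ψ : G → F) :
    avg ν ψ = convolution (fun _ => (1 : ℝ)) ψ (ContinuousLinearMap.lsmul ℝ ℝ) ν := by
  ext p
  simp [avg, convolution]

theorem contDiff_avg (hψ : ContDiff ℝ ∞ ψ) (hc : HasCompactSupport ψ) : ContDiff ℝ ∞ (avg ν ψ) := by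
  rw [avg_eq_convolution]
  exact hc.contDiff_convolution_right _ (locallyIntegrable_const _) hψ

theorem integrable_comp_sub (hψ : Continuous ψ) (hc : HasCompactSupport ψ) (p : G) :
    Integrable (fun q => ψ (p - q)) ν := by
  obtain ⟨M, hM⟩ := hc.exists_bound_of_continuous hψ
  exact Integrable.of_bound (Continuous.aestronglyMeasurable (by fun_prop)) M
    (Eventually.of_forall fun q => hM _)

theorem fderiv_avg (hψ : ContDiff ℝ ∞ ψ) (hc : HasCompactSupport ψ) (p v : G) :
    fderiv ℝ (avg ν ψ) p v = avg ν (fun q => fderiv ℝ ψ q v) p := by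
  have hcont := hψ.continuous_fderiv (by norm_num)
  obtain ⟨M, hM⟩ := (hc.fderiv ℝ).exists_bound_of_continuous hcont
  have hint : Integrable (fun q => fderiv ℝ ψ (p - q)) ν :=
    Integrable.of_bound (Continuous.aestronglyMeasurable (by fun_prop)) M
      (Eventually.of_forall fun q => hM _)
  have h : HasFDerivAt (avg ν ψ) (∫ q, fderiv ℝ ψ (p - q) ∂ν) p := by
    have hψc := hψ.continuous
    refine hasFDerivAt_integral_of_dominated_of_fderiv_le (s := Set.univ)
      (F' := fun p q => fderiv ℝ ψ (p - q)) (bound := fun _ => M) Filter.univ_mem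
      (Eventually.of_forall fun x => Continuous.aestronglyMeasurable (by fun_prop))
      (integrable_comp_sub hψ.continuous hc p) hint.1
      (Eventually.of_forall fun q x _ => hM _) (integrable_const _)
      (Eventually.of_forall fun q x _ => ?_)
    exact ((hψ.differentiable (by norm_num)).differentiableAt.hasFDerivAt).comp x
      ((hasFDerivAt_id x).sub_const q)
  rw [h.fderiv, ContinuousLinearMap.integral_apply hint]
  rfl

theorem tsupport_avg_subset [ProperSpace G] {r : ℝ}
    (hν : ν (Metric.closedBall 0 r)ᶜ = 0) (ψ : G → F) :
    tsupport (avg ν ψ) ⊆ Metric.cthickening r (tsupport ψ) := by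
  refine closure_minimal (fun p hp => ?_) Metric.isClosed_cthickening
  by_contra h
  refine hp ?_
  have : ∀ᵐ q ∂ν, ψ (p - q) = 0 := by
    have hae : ∀ᵐ q ∂ν, q ∈ Metric.closedBall (0 : G) r := hν
    filter_upwards [hae] with q hq
    refine image_eq_zero_of_notMem_tsupport fun h2 => h ?_
    refine Metric.mem_cthickening_of_dist_le p (p - q) r _ h2 ?_
    rw [mem_closedBall_zero_iff] at hq
    rw [dist_eq_norm]
    simpa using hq
  rw [avg, integral_congr_ae this, integral_zero]

end Smooth

/-- The fundamental theorem of calculus along a segment. In the time direction it turns the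
derivative of an averaged test function into a finite difference; in direction `x_i` it expresses
difference quotients through the gradient. -/
theorem sub_eq_avg_lineMeas {ψ : G → F} (hψ : ContDiff ℝ ∞ ψ) (p v : G) :
    ψ (p + v) - ψ p = avg (lineMeas v) (fun q => fderiv ℝ ψ q v) p := by
  have hcont : Continuous fun q => fderiv ℝ ψ q v :=
    (hψ.continuous_fderiv (by norm_num)).clm_apply continuous_const
  rw [avg_lineMeas v hcont.measurable]
  have hd : ∀ σ ∈ Set.uIcc (0 : ℝ) 1,
      HasDerivAt (fun σ : ℝ => ψ (p + σ • v)) (fderiv ℝ ψ (p + σ • v) v) σ := fun σ _ => by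
    have h1 : HasFDerivAt ψ (fderiv ℝ ψ (p + σ • v)) (p + σ • v) :=
      (hψ.differentiable (by norm_num)).differentiableAt.hasFDerivAt
    have h2 : HasDerivAt (fun σ : ℝ => p + σ • v) v σ := by
      simpa using ((hasDerivAt_id σ).smul_const v).const_add p
    exact h1.comp_hasDerivAt σ h2
  have := intervalIntegral.integral_eq_sub_of_hasDerivAt hd
    (Continuous.intervalIntegrable (by fun_prop) _ _)
  rw [this]
  simp

end LineAverage

/-! ### Mollification of cut-off solutions above `{y = 0}` -/

section Approx

instance (n : ℕ) : (volume : Measure (Pt n)).IsNegInvariant :=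
  Measure.IsAddHaarMeasure.isNegInvariant_of_regular _

variable {n : ℕ}

/-- The trace on `{y = 0}` of a function defined everywhere. -/
def atZero {F : Type*} (f : Pt n → F) (b : E n × ℝ) : F := f (b.1, 0, b.2)

/-- `w`, with weak gradient `W` on `{y > 0}` and trace `w0`, is a limit of smooth compactly
supported functions in the weighted energy space. -/
def H1Approx (a : ℝ) (w : Pt n → E n) (W : Option (Fin n) → Pt n → E n) (w0 : E n × ℝ → E n) :
    Prop :=
  ∃ f : ℕ → Pt n → E n, (∀ j, ContDiff ℝ ∞ (f j)) ∧ (∀ j, HasCompactSupport (f j)) ∧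
    Tendsto (fun j => eLpNorm (f j - w) 2 (wMeasure n a)) atTop (𝓝 0) ∧
    (∀ k, Tendsto (fun j => eLpNorm ((fun p => fderiv ℝ (f j) p (dir k)) - W k) 2 (wMeasure n a))
      atTop (𝓝 0)) ∧
    Tendsto (fun j => eLpNorm (atZero (f j) - w0) 2 volume) atTop (𝓝 0)

theorem integrableOn_smul_of_tsupport {F : Type*} [NormedAddCommGroup F] [NormedSpace ℝ F]
    {Ω : Set (Pt n)} {f : Pt n → F} (hf : LocallyIntegrableOn f Ω) {φ : Pt n → ℝ}
    (hφ : Continuous φ) (hφc : HasCompactSupport φ) (hφs : tsupport φ ⊆ Ω) :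
    Integrable (fun p => φ p • f p) := by
  have h1 : IntegrableOn f (tsupport φ) := hf.integrableOn_compact_subset hφs hφc.isCompact
  have h2 := h1.continuousOn_smul hφ.continuousOn hφc.isCompact
  refine (integrableOn_iff_integrable_of_support_subset ?_).1 h2
  intro p hp
  refine subset_tsupport _ fun h => hp ?_
  simp [h]

theorem avg_moll_eq {δ : ℝ} (hδ : 0 < δ) (f : Pt n → E n) (p : Pt n) :
    avg (moll n hδ) f p = ∫ q, kern n hδ (p - q) • f q := by
  rw [avg, moll, integral_withDensity_eq_integral_toReal_smul]
  · rw [← integral_sub_left_eq_self _ _ p]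
    refine integral_congr_ae (Eventually.of_forall fun q => ?_)
    simp only [sub_sub_cancel]
    rw [ENNReal.toReal_ofReal (kern_nonneg hδ _)]
  · exact (measurable_kern hδ).ennreal_ofReal
  · exact Eventually.of_forall fun _ => by simp

/-- The weak gradient of `η U`. -/
noncomputable def cutGrad (η : Pt n → ℝ) (U : Pt n → E n) (G : Option (Fin n) → Pt n → E n)
    (k : Option (Fin n)) (p : Pt n) : E n :=
  η p • G k p + fderiv ℝ η p (dir k) • U p

section Mollify

variable {U : Pt n → E n} {η : Pt n → ℝ} {δ : ℝ} (hδ : 0 < δ)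

/-- The mollification of `η U`, cut off below `{y = δ}`. -/
noncomputable def mollify (η : Pt n → ℝ) (U : Pt n → E n) : Pt n → E n :=
  convolution (kern n hδ) ({p | δ ≤ p.2.1}.indicator (fun p => η p • U p))
    (ContinuousLinearMap.lsmul ℝ ℝ) volume

/-- Local integrability for Lebesgue measure is known only inside the open half-cylinder; removing
`{y < δ}` leaves a compact part of it. -/
theorem integrable_cut (hU : LocallyIntegrableOn U (openHalfCyl n)) (hη : Continuous η)
    (hηc : HasCompactSupport η) (hηs : tsupport η ⊆ fullCyl n) (hδ : 0 < δ) :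
    Integrable ({p | δ ≤ p.2.1}.indicator (fun p : Pt n => η p • U p)) := by
  have hm : IsClosed {p : Pt n | δ ≤ p.2.1} := isClosed_le (by fun_prop) (by fun_prop)
  rw [integrable_indicator_iff hm.measurableSet]
  set K := tsupport η ∩ {p : Pt n | δ ≤ p.2.1}
  have hK : IsCompact K := hηc.isCompact.inter_right hm
  have hKs : K ⊆ openHalfCyl n := fun p hp => by
    obtain ⟨h1, h2, h3⟩ := hηs hp.1
    exact ⟨h1, hδ.trans_le hp.2, h2, h3⟩
  have h1 := (hU.integrableOn_compact_subset hKs hK).continuousOn_smul hη.continuousOn hK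
  refine h1.of_forall_sdiff_eq_zero hm.measurableSet fun p hp => ?_
  have : p ∉ tsupport η := fun h => hp.2 ⟨h, hp.1⟩
  simp [image_eq_zero_of_notMem_tsupport this]

theorem contDiff_mollify (hU : LocallyIntegrableOn U (openHalfCyl n)) (hη : Continuous η)
    (hηc : HasCompactSupport η) (hηs : tsupport η ⊆ fullCyl n) :
    ContDiff ℝ ∞ (mollify hδ η U) :=
  (hasCompactSupport_kern hδ).contDiff_convolution_left _ (contDiff_kern hδ)
    (integrable_cut hU hη hηc hηs hδ).locallyIntegrable

theorem hasCompactSupport_mollify (hηc : HasCompactSupport η) :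
    HasCompactSupport (mollify hδ η U) := by
  refine (hasCompactSupport_kern hδ).convolution _ ?_
  refine hηc.mono fun p hp h => hp ?_
  simp [Set.indicator, h]

/-- If `p` has `y ≥ 0` and `p - q` lies in the support of the kernel, then `q` has `y ≥ δ`. The
cut-off below `δ` is therefore invisible from the closed half-space. -/
theorem kern_mul_indicator {p : Pt n} (hp : 0 ≤ p.2.1) (c : Pt n → ℝ)
    (hc : ∀ q, q ∉ tsupport (kern n hδ) → c q = 0) (f : Pt n → E n) (q : Pt n) :
    c (p - q) • ({p | δ ≤ p.2.1}.indicator f) q = c (p - q) • f q := by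
  by_cases h : p - q ∈ tsupport (kern n hδ)
  · obtain ⟨-, -, h3, -⟩ := tsupport_kern_subset hδ h
    simp only [Prod.snd_sub, Prod.fst_sub] at h3
    rw [Set.indicator_of_mem]
    simp only [Set.mem_ofPred_eq]; linarith
  · simp [hc _ h]

theorem mollify_eq_avg {p : Pt n} (hp : 0 ≤ p.2.1) :
    mollify hδ η U p = avg (moll n hδ) (fun p => η p • U p) p := by
  rw [avg_moll_eq, mollify, convolution_eq_swap]
  refine integral_congr_ae (Eventually.of_forall fun q => ?_)
  exact kern_mul_indicator hδ hp (kern n hδ) (fun q => image_eq_zero_of_notMem_tsupport) _ q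

/-- The function `q ↦ kern (p - q) η(q)` is an admissible test function for the weak derivative of
`U`, because its support stays above `{y = 0}`. The product rule produces the two terms of
`cutGrad`. -/
theorem fderiv_mollify {G : Option (Fin n) → Pt n → E n} (k : Option (Fin n))
    (hw : HasWeakDeriv (openHalfCyl n) (dir k) U (G k)) (hη : ContDiff ℝ ∞ η)
    (hηc : HasCompactSupport η) (hηs : tsupport η ⊆ fullCyl n) {p : Pt n} (hp : 0 < p.2.1) :
    fderiv ℝ (mollify hδ η U) p (dir k) = avg (moll n hδ) (cutGrad η U G k) p := by
  obtain ⟨hU, hG, hweak⟩ := hw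
  have hint := integrable_cut hU hη.continuous hηc hηs hδ
  have hk := contDiff_kern (n := n) hδ
  have hdk : Continuous (fderiv ℝ (kern n hδ)) := hk.continuous_fderiv (by norm_num)
  have hdη : Continuous (fderiv ℝ η) := hη.continuous_fderiv (by norm_num)
  set v : Pt n := dir k
  have h1 : fderiv ℝ (mollify hδ η U) p v =
      ∫ q, fderiv ℝ (kern n hδ) (p - q) v • (η q • U q) := by
    have h := (hasCompactSupport_kern (n := n) hδ).hasFDerivAt_convolution_left
      (ContinuousLinearMap.lsmul ℝ ℝ) (hk.of_le (by norm_num)) hint.locallyIntegrable p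
    rw [mollify, h.fderiv, convolution_eq_swap, ContinuousLinearMap.integral_apply]
    · refine integral_congr_ae (Eventually.of_forall fun q => ?_)
      simp only [ContinuousLinearMap.precompL_apply, ContinuousLinearMap.lsmul_apply]
      exact kern_mul_indicator hδ hp.le (fun q => fderiv ℝ (kern n hδ) q v) (fun q hq => by
        rw [image_eq_zero_of_notMem_tsupport fun h' => hq (tsupport_fderiv_subset ℝ h')]
        rfl) (fun q => η q • U q) q
    · have := ((hasCompactSupport_kern (n := n) hδ).fderiv ℝ).convolutionExists_left
        ((ContinuousLinearMap.lsmul ℝ ℝ).precompL (Pt n)) hdk hint.locallyIntegrable p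
      exact this.integrable_swap
  rw [h1, avg_moll_eq]
  -- Every product that occurs is supported where `η` is and where `y ≥ p_y + δ`, hence in a compact
  -- subset of the open half-cylinder.
  have supp : ∀ c : Pt n → ℝ, (∀ q, q ∉ tsupport (kern n hδ) → c q = 0) → ∀ ζ : Pt n → ℝ,
      (∀ q, q ∉ tsupport η → ζ q = 0) → HasCompactSupport (fun q => c (p - q) * ζ q) ∧
      tsupport (fun q => c (p - q) * ζ q) ⊆ openHalfCyl n := by
    intro c hc ζ hζ
    have hcl : IsClosed {q : Pt n | p.2.1 + δ ≤ q.2.1} := isClosed_le (by fun_prop) (by fun_prop)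
    have h2 : tsupport (fun q => c (p - q) * ζ q) ⊆
        tsupport η ∩ {q : Pt n | p.2.1 + δ ≤ q.2.1} := by
      refine closure_minimal (fun q hq => ?_) ((isClosed_tsupport η).inter hcl)
      have h3 : q ∈ tsupport η := by
        by_contra h; exact hq (by simp [hζ q h])
      have h4 : p - q ∈ tsupport (kern n hδ) := by
        by_contra h; exact hq (by simp [hc _ h])
      obtain ⟨-, -, h5, -⟩ := tsupport_kern_subset hδ h4
      simp only [Prod.snd_sub, Prod.fst_sub] at h5
      exact ⟨h3, by simp only [Set.mem_ofPred_eq]; linarith⟩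
    refine ⟨hηc.isCompact.of_isClosed_subset (isClosed_tsupport _)
      (h2.trans Set.inter_subset_left), fun q hq => ?_⟩
    obtain ⟨h5, h6⟩ := h2 hq
    obtain ⟨h7, h8, h9⟩ := hηs h5
    simp only [Set.mem_ofPred_eq] at h6
    exact ⟨h7, by linarith, h8, h9⟩
  have hck : ∀ q, q ∉ tsupport (kern n hδ) → kern n hδ q = 0 := fun q =>
    image_eq_zero_of_notMem_tsupport
  have hcdk : ∀ q, q ∉ tsupport (kern n hδ) → fderiv ℝ (kern n hδ) q v = 0 := fun q hq => by
    rw [image_eq_zero_of_notMem_tsupport fun h' => hq (tsupport_fderiv_subset ℝ h')]; rfl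
  have hcη : ∀ q, q ∉ tsupport η → η q = 0 := fun q => image_eq_zero_of_notMem_tsupport
  have hcdη : ∀ q, q ∉ tsupport η → fderiv ℝ η q v = 0 := fun q hq => by
    rw [image_eq_zero_of_notMem_tsupport fun h' => hq (tsupport_fderiv_subset ℝ h')]; rfl
  obtain ⟨s1, s2⟩ := supp _ hcdk _ hcη
  obtain ⟨t1, t2⟩ := supp _ hck _ hcη
  obtain ⟨r1, r2⟩ := supp _ hck _ hcdη
  have iA := integrableOn_smul_of_tsupport hU
    (φ := fun q => fderiv ℝ (kern n hδ) (p - q) v * η q) (by have := hη.continuous; fun_prop) s1 s2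
  have iB := integrableOn_smul_of_tsupport hU
    (φ := fun q => kern n hδ (p - q) * fderiv ℝ η q v) (by have := hk.continuous; fun_prop) r1 r2
  have iD := integrableOn_smul_of_tsupport hG
    (φ := fun q => kern n hδ (p - q) * η q)
    (by have := hk.continuous; have := hη.continuous; fun_prop) t1 t2
  have hφ : ContDiff ℝ ∞ (fun q => kern n hδ (p - q) * η q) := by fun_prop
  have hweq := hweak _ hφ t1 t2
  have hfd : ∀ q, fderiv ℝ (fun q => kern n hδ (p - q) * η q) q v =
      -(fderiv ℝ (kern n hδ) (p - q) v * η q) + kern n hδ (p - q) * fderiv ℝ η q v := fun q => by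
    have e1 : HasFDerivAt (fun q => kern n hδ (p - q))
        ((fderiv ℝ (kern n hδ) (p - q)).comp (-ContinuousLinearMap.id ℝ (Pt n))) q :=
      ((hk.differentiable (by norm_num)).differentiableAt.hasFDerivAt).comp q
        ((hasFDerivAt_id q).const_sub p)
    have e2 : HasFDerivAt η (fderiv ℝ η q) q :=
      (hη.differentiable (by norm_num)).differentiableAt.hasFDerivAt
    have e3 := (e1.mul e2).fderiv
    change fderiv ℝ (fun q => kern n hδ (p - q) * η q) q = _ at e3
    rw [e3]
    simp
    ring
  have out : ∀ {c ζ : Pt n → ℝ} {f : Pt n → E n},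
      tsupport (fun q => c (p - q) * ζ q) ⊆ openHalfCyl n →
      ∫ q in openHalfCyl n, (c (p - q) * ζ q) • f q = ∫ q, (c (p - q) * ζ q) • f q :=
    fun hs => setIntegral_eq_integral_of_forall_compl_eq_zero fun q hq => by
      rw [image_eq_zero_of_notMem_tsupport fun h' => hq (hs h'), zero_smul]
  have hL : ∫ q in openHalfCyl n, fderiv ℝ (fun q => kern n hδ (p - q) * η q) q v • U q =
      -(∫ q, (fderiv ℝ (kern n hδ) (p - q) v * η q) • U q)
        + ∫ q, (kern n hδ (p - q) * fderiv ℝ η q v) • U q := by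
    have : ∀ q, fderiv ℝ (fun q => kern n hδ (p - q) * η q) q v • U q =
        -((fderiv ℝ (kern n hδ) (p - q) v * η q) • U q)
          + (kern n hδ (p - q) * fderiv ℝ η q v) • U q := fun q => by
      rw [hfd, add_smul, neg_smul]
    simp only [this]
    rw [integral_add (f := fun q => -((fderiv ℝ (kern n hδ) (p - q) v * η q) • U q))
      iA.neg.integrableOn iB.integrableOn, integral_neg,
      out (c := fun q => fderiv ℝ (kern n hδ) q v) s2, out (ζ := fun q => fderiv ℝ η q v) r2]
  rw [hL, out t2] at hweq
  simp only [cutGrad, smul_add, smul_smul]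
  rw [integral_add iD iB, ← sub_eq_zero]
  rw [← sub_eq_zero] at hweq
  rw [← neg_eq_zero, ← hweq]
  abel

end Mollify

end Approx

end LameExt

namespace LameExt

open scoped ENNReal

variable {n : ℕ}

/-! ### Limits of `L²` norms -/

section Lp

variable {α F : Type*} [MeasurableSpace α] [NormedAddCommGroup F] {μ : Measure α}

theorem tendsto_eLpNorm_of_sub {ι : Type*} {l : Filter ι} {f : ι → α → F} {g : α → F}
    (hf : ∀ j, AEStronglyMeasurable (f j) μ) (hg : MemLp g 2 μ)
    (h : Tendsto (fun j => eLpNorm (f j - g) 2 μ) l (𝓝 0)) :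
    Tendsto (fun j => eLpNorm (f j) 2 μ) l (𝓝 (eLpNorm g 2 μ)) := by
  have h1 : Tendsto (fun j => eLpNorm g 2 μ - eLpNorm (f j - g) 2 μ) l (𝓝 (eLpNorm g 2 μ)) := by
    simpa using ENNReal.Tendsto.sub tendsto_const_nhds h (Or.inl hg.2.ne)
  have h2 : Tendsto (fun j => eLpNorm g 2 μ + eLpNorm (f j - g) 2 μ) l (𝓝 (eLpNorm g 2 μ)) := by
    simpa using tendsto_const_nhds.add h
  refine tendsto_of_tendsto_of_tendsto_of_le_of_le h1 h2 (fun j => ?_) (fun j => ?_)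
  · rw [tsub_le_iff_right]
    calc eLpNorm g 2 μ = eLpNorm (f j - (f j - g)) 2 μ := by rw [sub_sub_cancel]
      _ ≤ _ := eLpNorm_sub_le (hf j) ((hf j).sub hg.1) (by norm_num)
  · calc eLpNorm (f j) 2 μ = eLpNorm (g + (f j - g)) 2 μ := by rw [add_sub_cancel]
      _ ≤ _ := eLpNorm_add_le hg.1 ((hf j).sub hg.1) (by norm_num)

theorem tendsto_eLpNorm_add {ι : Type*} {l : Filter ι} {f f' : ι → α → F} {g g' : α → F}
    (hf : ∀ j, AEStronglyMeasurable (f j - g) μ) (hf' : ∀ j, AEStronglyMeasurable (f' j - g') μ)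
    (h : Tendsto (fun j => eLpNorm (f j - g) 2 μ) l (𝓝 0))
    (h' : Tendsto (fun j => eLpNorm (f' j - g') 2 μ) l (𝓝 0)) :
    Tendsto (fun j => eLpNorm (f j + f' j - (g + g')) 2 μ) l (𝓝 0) := by
  have h2 := h.add h'
  rw [add_zero] at h2
  refine tendsto_of_tendsto_of_tendsto_of_le_of_le tendsto_const_nhds h2 (fun _ => zero_le)
    fun j => ?_
  simp only
  rw [add_sub_add_comm]
  exact eLpNorm_add_le (hf j) (hf' j) (by norm_num)

end Lp

/-! ### Density of smooth functions, including convergence of traces -/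

section Traces

variable {δ : ℝ} (hδ : 0 < δ)

/-- At `y = 0` the kernel samples heights in `(δ, 2δ)`. After domination by the box, translation
invariance in `(x, t)` removes the other variables and the mean over heights remains. -/
theorem lintegral_atZero_box_le {f : Pt n → ℝ≥0∞} (hf : Measurable f) :
    ∫⁻ b : E n × ℝ, ∫⁻ q, f ((b.1, 0, b.2) - q) ∂(moll n hδ)
      ≤ 2 ^ (n + 2) * ((ENNReal.ofReal δ)⁻¹ *
        ∫⁻ z in Set.Ioo δ (2 * δ), ∫⁻ b : E n × ℝ, f (b.1, z, b.2)) := by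
  have hSF : SFinite (boxMeas n δ) := by unfold boxMeas; infer_instance
  have hJ : Measurable fun z : ℝ => ∫⁻ b : E n × ℝ, f (b.1, z, b.2) :=
    Measurable.lintegral_prod_right' (f := fun x : ℝ × (E n × ℝ) => f (x.2.1, x.1, x.2.2))
      (by fun_prop)
  set J : ℝ → ℝ≥0∞ := fun z => ∫⁻ b : E n × ℝ, f (b.1, z, b.2) with hJdef
  calc ∫⁻ b : E n × ℝ, ∫⁻ q, f ((b.1, 0, b.2) - q) ∂(moll n hδ)
      ≤ ∫⁻ b : E n × ℝ, ∫⁻ q, f ((b.1, 0, b.2) - q) ∂(boxConst n δ • boxMeas n δ) :=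
        lintegral_mono fun b => lintegral_mono' (moll_le hδ) le_rfl
    _ = ∫⁻ b : E n × ℝ, boxConst n δ * ∫⁻ q, f ((b.1, 0, b.2) - q) ∂(boxMeas n δ) := by
        simp only [lintegral_smul_measure, smul_eq_mul]
    _ = boxConst n δ * ∫⁻ b : E n × ℝ, ∫⁻ q, f ((b.1, 0, b.2) - q) ∂(boxMeas n δ) :=
        lintegral_const_mul _ (Measurable.lintegral_prod_right'
          (f := fun x : (E n × ℝ) × Pt n => f ((x.1.1, 0, x.1.2) - x.2)) (by fun_prop))
    _ = boxConst n δ * ∫⁻ q, J (-q.2.1) ∂(boxMeas n δ) := by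
        rw [lintegral_lintegral_swap (by fun_prop)]
        congr 1
        refine lintegral_congr fun q => ?_
        have := lintegral_sub_right_eq_self (μ := (volume : Measure (E n × ℝ)))
          (fun b => f (b.1, -q.2.1, b.2)) (q.1, q.2.2)
        rw [hJdef]
        simp only
        rw [← this]
        refine lintegral_congr fun b => ?_
        congr 1
        ext <;> simp
    _ = boxConst n δ * (volume (Metric.ball (0 : E n) (δ / 2)) *
          ((∫⁻ z in Set.Ioo δ (2 * δ), J z) * volume (Metric.ball (0 : ℝ) (δ / 2)))) := by
        have e1 : ∫⁻ y in Set.Ioo (-(2 * δ)) (-δ), J (-y) = ∫⁻ z in Set.Ioo δ (2 * δ), J z := by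
          rw [← lintegral_indicator measurableSet_Ioo, ← lintegral_indicator measurableSet_Ioo,
            ← lintegral_neg_eq_self]
          refine lintegral_congr fun y => ?_
          by_cases h : y ∈ Set.Ioo δ (2 * δ)
          · rw [Set.indicator_of_mem h, Set.indicator_of_mem, neg_neg]
            exact ⟨by linarith [h.2], by linarith [h.1]⟩
          · rw [Set.indicator_of_notMem h, Set.indicator_of_notMem]
            exact fun h' => h ⟨by linarith [h'.2], by linarith [h'.1]⟩
        rw [boxMeas, lintegral_prod _ (by fun_prop)]
        simp only
        rw [lintegral_const, Measure.restrict_apply_univ, lintegral_prod _ (by fun_prop)]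
        simp only [lintegral_const, Measure.restrict_apply_univ]
        rw [lintegral_mul_const _ (by fun_prop), e1]
        ring
    _ = boxConst n δ * (volume (Metric.ball (0 : E n) (δ / 2)) * (ENNReal.ofReal δ *
          volume (Metric.ball (0 : ℝ) (δ / 2)))) *
          ((ENNReal.ofReal δ)⁻¹ * ∫⁻ z in Set.Ioo δ (2 * δ), J z) := by
        have : ENNReal.ofReal δ * (ENNReal.ofReal δ)⁻¹ = 1 :=
          ENNReal.mul_inv_cancel (by simpa using hδ) (by simp)
        calc _ = boxConst n δ * (volume (Metric.ball (0 : E n) (δ / 2)) *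
          ((∫⁻ z in Set.Ioo δ (2 * δ), J z) * volume (Metric.ball (0 : ℝ) (δ / 2)))) *
            (ENNReal.ofReal δ * (ENNReal.ofReal δ)⁻¹) := by rw [this, mul_one]
          _ = _ := by ring
    _ ≤ _ := by gcongr; exact boxConst_mul

theorem ae_wMeasure_pos (n : ℕ) (a : ℝ) : ∀ᵐ p ∂(wMeasure n a), 0 < p.2.1 := by
  refine (withDensity_absolutelyContinuous _ _).ae_le ?_
  exact ae_restrict_mem (measurableSet_lt (by fun_prop) (by fun_prop))

theorem integrable_moll_comp_sub {U : Pt n → E n} {η : Pt n → ℝ}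
    (hU : LocallyIntegrableOn U (openHalfCyl n)) (hη : Continuous η)
    (hηc : HasCompactSupport η) (hηs : tsupport η ⊆ fullCyl n) {p : Pt n} (hp : 0 ≤ p.2.1) :
    Integrable (fun q => η (p - q) • U (p - q)) (moll n hδ) := by
  have h := (hasCompactSupport_kern (n := n) hδ).convolutionExists_left
    (ContinuousLinearMap.lsmul ℝ ℝ) (contDiff_kern hδ).continuous
    (integrable_cut hU hη hηc hηs hδ).locallyIntegrable p
  rw [moll, integrable_withDensity_iff_integrable_smul' (measurable_kern hδ).ennreal_ofReal
    (Eventually.of_forall fun _ => by simp)]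
  refine h.integrable.congr (Eventually.of_forall fun q => ?_)
  have := kern_mul_indicator hδ hp (kern n hδ) (fun q => image_eq_zero_of_notMem_tsupport)
    (fun q => η q • U q) (p - q)
  simp only [sub_sub_cancel] at this
  simp only [ContinuousLinearMap.lsmul_apply]
  rw [this, ENNReal.toReal_ofReal (kern_nonneg hδ _)]

/-- The mollifications of `η U` are smooth. Their values and gradients converge by the approximate
identity theorem in `L²(y^a)`, and their traces because `U` approaches `u` in the mean over thin
strips. -/
theorem h1Approx_of_weak {a : ℝ} (ha : -1 < a) {U : Pt n → E n} {G : Option (Fin n) → Pt n → E n}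
    {u : E n × ℝ → E n} (hUm : Measurable U) (hGm : ∀ k, Measurable (G k)) (hum : Measurable u)
    {η : Pt n → ℝ} (hη : ContDiff ℝ ∞ η) (hηc : HasCompactSupport η)
    (hηs : tsupport η ⊆ fullCyl n)
    (hweak : ∀ k, HasWeakDeriv (openHalfCyl n) (dir k) U (G k))
    (hU : MemLp (fun p => η p • U p) 2 (wMeasure n a))
    (hW : ∀ k, MemLp (cutGrad η U G k) 2 (wMeasure n a))
    (hu : MemLp (fun b => atZero η b • u b) 2 volume)
    (htr : Tendsto (fun δ : ℝ => (ENNReal.ofReal δ)⁻¹ * ∫⁻ z in Set.Ioo δ (2 * δ),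
      ∫⁻ b : E n × ℝ, ‖η (b.1, z, b.2) • U (b.1, z, b.2) - atZero η b • u b‖ₑ ^ 2)
      (𝓝[>] 0) (𝓝 0)) :
    H1Approx a (fun p => η p • U p) (cutGrad η U G) (fun b => atZero η b • u b) := by
  have hreg := wMeasure_regular n ha
  have hpos : ∀ j : ℕ, 0 < 1 / ((j : ℝ) + 1) := fun j => Nat.one_div_pos_of_nat
  have hη1 := hη.continuous
  have hη2 := hη.continuous_fderiv (by norm_num)
  have hWm : ∀ k, Measurable (cutGrad η U G k) := fun k => by
    have := hGm k
    unfold cutGrad; fun_prop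
  have hsupp : ∀ ε > 0, ∀ᶠ j : ℕ in atTop,
      moll n (hpos j) (Metric.closedBall 0 ε)ᶜ = 0 := fun ε hε => by
    have h1 := tendsto_one_div_add_atTop_nhds_zero_nat (𝕜 := ℝ)
    filter_upwards [h1.eventually_lt_const (half_pos hε)] with j hj
    exact moll_compl_closedBall _ (by linarith)
  have hUl := (hweak none).1
  refine ⟨fun j => mollify (hpos j) η U, fun j => contDiff_mollify _ hUl hη1 hηc hηs,
    fun j => hasCompactSupport_mollify _ hηc, ?_, fun k => ?_, ?_⟩
  · refine (tendsto_avg mollConst_ne_top (fun j => avgBdd_moll (hpos j) ha) hsupp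
      (by fun_prop) hU).congr fun j => eLpNorm_congr_ae ?_
    filter_upwards [ae_wMeasure_pos n a] with p hp
    simp only [Pi.sub_apply]
    rw [mollify_eq_avg (hpos j) hp.le]
  · refine (tendsto_avg mollConst_ne_top (fun j => avgBdd_moll (hpos j) ha) hsupp
      (hWm k) (hW k)).congr fun j => eLpNorm_congr_ae ?_
    filter_upwards [ae_wMeasure_pos n a] with p hp
    simp only [Pi.sub_apply]
    rw [fderiv_mollify (hpos j) k (hweak k) hη hηc hηs hp]
  · set w0 : E n × ℝ → E n := fun b => atZero η b • u b with hw0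
    have hw0m : Measurable w0 := by unfold w0 atZero; fun_prop
    -- Split `η U` into `w0 ∘ π` and the remainder `D`. At `y = 0` the average of the first is an
    -- approximate identity on the thin space for the pushed-forward kernels; that of the second is
    -- controlled by the trace condition.
    set π : Pt n → E n × ℝ := fun p => (p.1, p.2.2) with hπ
    have hπm : Measurable π := by fun_prop
    set D : Pt n → E n := fun p => η p • U p - w0 (π p) with hD
    have hDm : Measurable D := by fun_prop
    have hprob : ∀ j : ℕ, IsProbabilityMeasure ((moll n (hpos j)).map π) := fun j =>
      Measure.isProbabilityMeasure_map (by fun_prop)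
    have hb : ∀ j : ℕ, AvgBdd ((moll n (hpos j)).map π) volume 1 := fun j => by
      rw [← measure_univ (μ := (moll n (hpos j)).map π)]
      exact avgBdd_of_measurePreserving
        (Eventually.of_forall fun q => measurePreserving_sub_right volume q)
    have hsupp2 : ∀ ε > 0, ∀ᶠ j : ℕ in atTop,
        ((moll n (hpos j)).map π) (Metric.closedBall 0 ε)ᶜ = 0 := fun ε hε => by
      filter_upwards [hsupp ε hε] with j hj
      rw [Measure.map_apply (by fun_prop) Metric.isClosed_closedBall.measurableSet.compl]
      refine measure_mono_null (t := (Metric.closedBall (0 : Pt n) ε)ᶜ) ?_ hj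
      intro p hp h
      refine hp ?_
      rw [mem_closedBall_zero_iff] at h ⊢
      refine le_trans ?_ h
      rw [Prod.norm_def, Prod.norm_def, Prod.norm_def]
      exact max_le (le_max_left _ _) ((le_max_right _ _).trans (le_max_right _ _))
    have t1 := tendsto_avg (by norm_num) hb hsupp2 hw0m hu
    have t2 : Tendsto (fun j : ℕ =>
        eLpNorm (fun b : E n × ℝ => avg (moll n (hpos j)) D (b.1, 0, b.2)) 2 volume)
        atTop (𝓝 0) := by
      have hδ0 : Tendsto (fun j : ℕ => 1 / ((j : ℝ) + 1)) atTop (𝓝[>] 0) :=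
        tendsto_nhdsWithin_iff.2 ⟨tendsto_one_div_add_atTop_nhds_zero_nat,
          Eventually.of_forall fun j => hpos j⟩
      have h1 := htr.comp hδ0
      have h2 : Tendsto (fun j : ℕ => (2 ^ (n + 2) * (fun δ : ℝ => (ENNReal.ofReal δ)⁻¹ *
          ∫⁻ z in Set.Ioo δ (2 * δ), ∫⁻ b : E n × ℝ,
          ‖η (b.1, z, b.2) • U (b.1, z, b.2) - atZero η b • u b‖ₑ ^ 2) (1 / ((j : ℝ) + 1))) ^
            (1 / 2 : ℝ)) atTop (𝓝 0) := by
        have := (ENNReal.Tendsto.const_mul h1 (a := 2 ^ (n + 2)) (Or.inr (by simp))).ennrpow_const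
          (1 / 2 : ℝ)
        simpa using this
      refine tendsto_of_tendsto_of_tendsto_of_le_of_le tendsto_const_nhds h2
        (fun _ => zero_le) fun j => ?_
      have h3 : ∫⁻ b : E n × ℝ, ‖avg (moll n (hpos j)) D (b.1, 0, b.2)‖ₑ ^ 2 ≤
          2 ^ (n + 2) * ((ENNReal.ofReal (1 / ((j : ℝ) + 1)))⁻¹ * ∫⁻ z in
            Set.Ioo (1 / ((j : ℝ) + 1)) (2 * (1 / ((j : ℝ) + 1))),
            ∫⁻ b : E n × ℝ, ‖D (b.1, z, b.2)‖ₑ ^ 2) := by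
        refine le_trans (lintegral_mono fun b => ?_)
          (lintegral_atZero_box_le (hpos j) (f := fun p => ‖D p‖ₑ ^ 2) (by fun_prop))
        exact enorm_integral_sq_le _
          (hDm.comp (by fun_prop : Measurable fun q : Pt n => ((b.1, 0, b.2) : Pt n) - q)
            ).aestronglyMeasurable
      rw [← eLpNorm_sq] at h3
      have h4 := ENNReal.rpow_le_rpow h3 (z := 1 / 2) (by norm_num)
      rw [← ENNReal.rpow_natCast, ← ENNReal.rpow_mul] at h4
      norm_num at h4 ⊢
      exact h4
    have t3 := t1.add t2
    rw [add_zero] at t3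
    refine tendsto_of_tendsto_of_tendsto_of_le_of_le tendsto_const_nhds t3
      (fun _ => zero_le) fun j => ?_
    have hae : atZero (mollify (hpos j) η U) - w0 =ᵐ[volume]
        (avg ((moll n (hpos j)).map π) w0 - w0) +
        (fun b : E n × ℝ => avg (moll n (hpos j)) D (b.1, 0, b.2)) := by
      filter_upwards [ae_integrable_sub (by norm_num) (hb j) hw0m hu] with b hb1
      have e0 : avg ((moll n (hpos j)).map π) w0 b =
          ∫ q, w0 (π ((b.1, 0, b.2) - q)) ∂(moll n (hpos j)) := by
        rw [avg, integral_map (by fun_prop) (Measurable.aestronglyMeasurable (by fun_prop))]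
        rfl
      have i2 : Integrable (fun q => w0 (π ((b.1, 0, b.2) - q))) (moll n (hpos j)) := by
        rw [integrable_map_measure (Measurable.aestronglyMeasurable (by fun_prop))
          (by fun_prop)] at hb1
        exact hb1
      have e1 : avg (moll n (hpos j)) D (b.1, 0, b.2) =
          avg (moll n (hpos j)) (fun p => η p • U p) (b.1, 0, b.2) -
            avg ((moll n (hpos j)).map π) w0 b := by
        rw [e0]
        exact integral_sub (integrable_moll_comp_sub (hpos j) hUl hη1 hηc hηs
          (p := (b.1, 0, b.2)) le_rfl) i2
      simp only [Pi.sub_apply, Pi.add_apply, e1, atZero]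
      rw [mollify_eq_avg (hpos j) (p := (b.1, 0, b.2)) le_rfl]
      abel
    rw [eLpNorm_congr_ae hae]
    refine eLpNorm_add_le ?_ ?_ (by norm_num)
    · exact ((stronglyMeasurable_avg hw0m).aestronglyMeasurable).sub hw0m.aestronglyMeasurable
    · exact ((stronglyMeasurable_avg (ν := moll n (hpos j)) hDm).measurable.comp
        (by fun_prop : Measurable fun b : E n × ℝ => ((b.1, 0, b.2) : Pt n))).aestronglyMeasurable

end Traces

end LameExt

namespace LameExt

open scoped ENNReal

variable {n : ℕ}

/-! ### A trace inequality with small gradient coefficient -/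

section TraceInequality

theorem ennreal_add_sq_le (x y : ℝ≥0∞) : (x + y) ^ 2 ≤ 2 * x ^ 2 + 2 * y ^ 2 := by
  have h := ENNReal.rpow_add_le_mul_rpow_add_rpow x y (p := 2) (by norm_num)
  norm_num at h
  rwa [← mul_add]

theorem lintegral_wMeasure (a : ℝ) {f : Pt n → ℝ≥0∞} (hf : Measurable f) :
    ∫⁻ p, f p ∂(wMeasure n a) = ∫⁻ b : E n × ℝ, ∫⁻ y, f (b.1, y, b.2) ∂(yMeas a) := by
  rw [wMeasure_eq_prod, lintegral_prod _ hf.aemeasurable, Measure.volume_eq_prod,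
    lintegral_prod _ (Measurable.aemeasurable (Measurable.lintegral_prod_right'
      (f := fun x : (E n × ℝ) × ℝ => f (x.1.1, x.2, x.1.2)) (by fun_prop)))]
  refine lintegral_congr fun x => ?_
  rw [lintegral_prod_symm _ (by fun_prop)]

/-- Cauchy–Schwarz after the splitting `1 = y^(-a/2) y^(a/2)`. -/
theorem sq_lintegral_Ioo_le (a ℓ : ℝ) {f : ℝ → ℝ≥0∞} (hf : Measurable f) :
    (∫⁻ y in Set.Ioo 0 ℓ, f y) ^ 2 ≤ yMeas (-a) (Set.Ioo 0 ℓ) * ∫⁻ y, f y ^ 2 ∂(yMeas a) := by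
  have hsub : Set.Ioo 0 ℓ ∩ Set.Ioi 0 = Set.Ioo (0 : ℝ) ℓ := by
    ext y; simp only [Set.mem_inter_iff, Set.mem_Ioo, Set.mem_Ioi]; tauto
  have h1 : yMeas (-a) (Set.Ioo 0 ℓ) = ∫⁻ y in Set.Ioo 0 ℓ, ENNReal.ofReal (y ^ (-a)) := by
    rw [yMeas, withDensity_apply _ measurableSet_Ioo,
      Measure.restrict_restrict measurableSet_Ioo, hsub]
  have h2 : ∫⁻ y in Set.Ioo 0 ℓ, ENNReal.ofReal (y ^ a) * f y ^ 2 ≤ ∫⁻ y, f y ^ 2 ∂(yMeas a) := by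
    rw [yMeas, lintegral_withDensity_eq_lintegral_mul _ (by fun_prop) (by fun_prop)]
    exact lintegral_mono_set fun y hy => hy.1
  have h3 : ∫⁻ y in Set.Ioo 0 ℓ, f y = ∫⁻ y in Set.Ioo 0 ℓ,
      ((fun y => ENNReal.ofReal (y ^ (-(a / 2)))) * fun y => ENNReal.ofReal (y ^ (a / 2)) * f y) y := by
    refine setLIntegral_congr_fun measurableSet_Ioo fun y hy => ?_
    have hy0 : 0 < y := hy.1
    simp only [Pi.mul_apply]
    rw [← mul_assoc, ← ENNReal.ofReal_mul (by positivity), ← Real.rpow_add hy0]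
    simp
  have h4 := ENNReal.lintegral_mul_le_Lp_mul_Lq (volume.restrict (Set.Ioo 0 ℓ))
    Real.HolderConjugate.two_two (f := fun y => ENNReal.ofReal (y ^ (-(a / 2))))
    (g := fun y => ENNReal.ofReal (y ^ (a / 2)) * f y) (by fun_prop) (by fun_prop)
  rw [← h3] at h4
  have key : ∀ x : ℝ≥0∞, (x ^ (1 / (2 : ℝ))) ^ 2 = x := fun x => by
    rw [← ENNReal.rpow_natCast, ← ENNReal.rpow_mul]; norm_num
  have h5 := pow_le_pow_left₀ zero_le h4 2
  rw [mul_pow, key, key] at h5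
  have e1 : ∫⁻ y in Set.Ioo 0 ℓ, ENNReal.ofReal (y ^ (-(a / 2))) ^ (2 : ℝ) =
      ∫⁻ y in Set.Ioo 0 ℓ, ENNReal.ofReal (y ^ (-a)) := by
    refine setLIntegral_congr_fun measurableSet_Ioo fun y hy => ?_
    have hy0 : 0 < y := hy.1
    rw [ENNReal.ofReal_rpow_of_nonneg (by positivity) (by norm_num), ← Real.rpow_mul hy0.le]
    congr 2; ring
  have e2 : ∫⁻ y in Set.Ioo 0 ℓ, (ENNReal.ofReal (y ^ (a / 2)) * f y) ^ (2 : ℝ) =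
      ∫⁻ y in Set.Ioo 0 ℓ, ENNReal.ofReal (y ^ a) * f y ^ 2 := by
    refine setLIntegral_congr_fun measurableSet_Ioo fun y hy => ?_
    have hy0 : 0 < y := hy.1
    rw [ENNReal.mul_rpow_of_nonneg _ _ (by norm_num),
      ENNReal.ofReal_rpow_of_nonneg (by positivity) (by norm_num), ← Real.rpow_mul hy0.le]
    norm_num
  rw [e1, e2, ← h1] at h5
  exact h5.trans (by gcongr)

theorem exists_yMeas_Ioo_le {a : ℝ} (ha : -1 < a) {ε : ℝ≥0∞} (hε : 0 < ε) :
    ∃ ℓ : ℝ, 0 < ℓ ∧ yMeas a (Set.Ioo 0 ℓ) ≤ ε := by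
  have hfin := yMeas_finite ha
  have h := tendsto_measure_iInter_atTop (μ := yMeas a)
    (s := fun j : ℕ => Set.Ioo (0 : ℝ) (1 / ((j : ℝ) + 1)))
    (fun j => measurableSet_Ioo.nullMeasurableSet)
    (fun i j hij => Set.Ioo_subset_Ioo_right (one_div_le_one_div_of_le (by positivity)
      (by gcongr)))
    ⟨0, (lt_of_le_of_lt (measure_mono Set.Ioo_subset_Icc_self) isCompact_Icc.measure_lt_top).ne⟩
  have hemp : ⋂ j : ℕ, Set.Ioo (0 : ℝ) (1 / ((j : ℝ) + 1)) = ∅ := by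
    ext y
    simp only [Set.mem_iInter, Set.mem_Ioo, Set.mem_empty_iff_false, iff_false, not_forall]
    by_cases hy : 0 < y
    · obtain ⟨j, hj⟩ := exists_nat_one_div_lt hy
      exact ⟨j, fun h => absurd h.2 (not_lt.2 hj.le)⟩
    · exact ⟨0, fun h => hy h.1⟩
  rw [hemp, measure_empty] at h
  obtain ⟨j, hj⟩ := (h.eventually_le_const hε).exists
  exact ⟨1 / ((j : ℝ) + 1), Nat.one_div_pos_of_nat, hj⟩

/-- Write `g 0 = g y - ∫₀ʸ g'` and average over `0 < y < ℓ` against `y^a`. The derivative enters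
with the factor `∫₀^ℓ y^(-a)`, which tends to `0` with `ℓ` because `a < 1`. -/
theorem exists_sq_enorm_zero_le {a : ℝ} (ha : -1 < a) (ha1 : a < 1) {ε : ℝ≥0∞} (hε : 0 < ε) :
    ∃ A : ℝ≥0∞, A ≠ ⊤ ∧ ∀ g : ℝ → E n, ContDiff ℝ 1 g →
      ‖g 0‖ₑ ^ 2 ≤ A * ∫⁻ y, ‖g y‖ₑ ^ 2 ∂(yMeas a) + ε * ∫⁻ y, ‖deriv g y‖ₑ ^ 2 ∂(yMeas a) := by
  obtain ⟨ℓ, hℓ, hd⟩ := exists_yMeas_Ioo_le (a := -a) (by linarith) (ε := ε / 2)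
    (ENNReal.half_pos hε.ne')
  have hfin := yMeas_finite ha
  set c := yMeas a (Set.Ioo 0 ℓ) with hc
  have hct : c ≠ ⊤ := (lt_of_le_of_lt (measure_mono Set.Ioo_subset_Icc_self)
      (isCompact_Icc (a := (0 : ℝ)) (b := ℓ)).measure_lt_top).ne
  have hc0 : c ≠ 0 := by
    intro h0
    rw [hc, yMeas, withDensity_apply_eq_zero (by fun_prop)] at h0
    have : Set.Ioo 0 ℓ ⊆ {x : ℝ | ENNReal.ofReal (x ^ a) ≠ 0} ∩ Set.Ioo 0 ℓ := fun y hy =>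
      ⟨by have := hy.1; simp only [Set.mem_ofPred_eq, ne_eq, ENNReal.ofReal_eq_zero, not_le]
          positivity, hy⟩
    have h1 := measure_mono_null this h0
    rw [Measure.restrict_apply measurableSet_Ioo] at h1
    have hsub : Set.Ioo 0 ℓ ∩ Set.Ioi 0 = Set.Ioo (0 : ℝ) ℓ := by
      ext y; simp only [Set.mem_inter_iff, Set.mem_Ioo, Set.mem_Ioi]; tauto
    rw [hsub, Real.volume_Ioo] at h1
    simp at h1
    linarith
  refine ⟨2 * c⁻¹, ENNReal.mul_ne_top (by simp) (ENNReal.inv_ne_top.2 hc0), fun g hg => ?_⟩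
  have hg' : Continuous (deriv g) := hg.continuous_deriv le_rfl
  set T := ∫⁻ y in Set.Ioo 0 ℓ, ‖deriv g y‖ₑ with hT
  have hT2 : T ^ 2 ≤ ε / 2 * ∫⁻ y, ‖deriv g y‖ₑ ^ 2 ∂(yMeas a) :=
    (sq_lintegral_Ioo_le a ℓ (by fun_prop)).trans (by gcongr)
  have hpt : ∀ y ∈ Set.Ioo 0 ℓ, ‖g 0‖ₑ ^ 2 ≤ 2 * ‖g y‖ₑ ^ 2 + 2 * T ^ 2 := fun y hy => by
    have h1 : g 0 = g y - ∫ z in (0 : ℝ)..y, deriv g z := by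
      rw [intervalIntegral.integral_deriv_eq_sub (fun z _ =>
        (hg.differentiable (by norm_num)).differentiableAt) (hg'.intervalIntegrable _ _)]
      abel
    have h2 : ‖g 0‖ₑ ≤ ‖g y‖ₑ + T := by
      rw [h1]
      refine (enorm_sub_le).trans ?_
      gcongr
      rw [intervalIntegral.integral_of_le hy.1.le]
      refine (enorm_integral_le_lintegral_enorm _).trans ?_
      exact lintegral_mono_set fun z hz => ⟨hz.1, hz.2.trans_lt hy.2⟩
    calc ‖g 0‖ₑ ^ 2 ≤ (‖g y‖ₑ + T) ^ 2 := by gcongr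
      _ ≤ 2 * ‖g y‖ₑ ^ 2 + 2 * T ^ 2 := ennreal_add_sq_le _ _
  have hint : c * ‖g 0‖ₑ ^ 2 ≤ 2 * ∫⁻ y, ‖g y‖ₑ ^ 2 ∂(yMeas a) + c * (2 * T ^ 2) := by
    have h1 := setLIntegral_mono' (μ := yMeas a) measurableSet_Ioo hpt
    rw [setLIntegral_const, mul_comm, lintegral_add_right _ (by fun_prop), setLIntegral_const,
      lintegral_const_mul _ (by have := hg.continuous; fun_prop)] at h1
    refine h1.trans ?_
    rw [mul_comm _ c]
    gcongr
    exact Measure.restrict_le_self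
  calc ‖g 0‖ₑ ^ 2 = c⁻¹ * (c * ‖g 0‖ₑ ^ 2) := by
        rw [← mul_assoc, ENNReal.inv_mul_cancel hc0 hct, one_mul]
    _ ≤ c⁻¹ * (2 * ∫⁻ y, ‖g y‖ₑ ^ 2 ∂(yMeas a) + c * (2 * T ^ 2)) := by gcongr
    _ = 2 * c⁻¹ * ∫⁻ y, ‖g y‖ₑ ^ 2 ∂(yMeas a) + 2 * T ^ 2 := by
        rw [mul_add, ← mul_assoc c⁻¹ c, ENNReal.inv_mul_cancel hc0 hct, one_mul]
        ring
    _ ≤ 2 * c⁻¹ * ∫⁻ y, ‖g y‖ₑ ^ 2 ∂(yMeas a)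
          + 2 * (ε / 2 * ∫⁻ y, ‖deriv g y‖ₑ ^ 2 ∂(yMeas a)) := by gcongr
    _ = _ := by
        rw [← mul_assoc, ENNReal.mul_div_cancel (by norm_num) (by norm_num)]

/-- The one-dimensional inequality on every line in direction `y`, integrated over the thin space.
-/
theorem exists_atZero_le {a : ℝ} (ha : -1 < a) (ha1 : a < 1) {ε : ℝ≥0∞} (hε : 0 < ε) :
    ∃ A : ℝ≥0∞, A ≠ ⊤ ∧ ∀ f : Pt n → E n, ContDiff ℝ ∞ f →
      eLpNorm (atZero f) 2 volume ^ 2 ≤ A * eLpNorm f 2 (wMeasure n a) ^ 2 +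
        ε * eLpNorm (fun p => fderiv ℝ f p (dir none)) 2 (wMeasure n a) ^ 2 := by
  obtain ⟨A, hA, h⟩ := exists_sq_enorm_zero_le (n := n) ha ha1 hε
  refine ⟨A, hA, fun f hf => ?_⟩
  have hf0 := hf.continuous.measurable
  have hf1 : Continuous fun p => fderiv ℝ f p (dir none) :=
    (hf.continuous_fderiv (by norm_num)).clm_apply continuous_const
  simp only [eLpNorm_sq]
  rw [lintegral_wMeasure a (by fun_prop), lintegral_wMeasure a (by fun_prop),
    ← lintegral_const_mul, ← lintegral_const_mul, ← lintegral_add_left]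
  rotate_left
  · exact (Measurable.lintegral_prod_right' (f := fun x : (E n × ℝ) × ℝ =>
      ‖f (x.1.1, x.2, x.1.2)‖ₑ ^ 2) (by fun_prop)).const_mul _
  · exact (Measurable.lintegral_prod_right' (f := fun x : (E n × ℝ) × ℝ =>
      ‖fderiv ℝ f (x.1.1, x.2, x.1.2) (dir none)‖ₑ ^ 2) (by fun_prop))
  · exact (Measurable.lintegral_prod_right' (f := fun x : (E n × ℝ) × ℝ =>
      ‖f (x.1.1, x.2, x.1.2)‖ₑ ^ 2) (by fun_prop))
  refine lintegral_mono fun b => ?_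
  have hg : ContDiff ℝ 1 (fun y : ℝ => f (b.1, y, b.2)) :=
    (hf.of_le (by norm_num)).comp (by fun_prop)
  refine (h _ hg).trans (le_of_eq ?_)
  have : ∀ y : ℝ, deriv (fun y : ℝ => f (b.1, y, b.2)) y = fderiv ℝ f (b.1, y, b.2) (dir none) := by
    intro y
    have h1 : HasFDerivAt f (fderiv ℝ f (b.1, y, b.2)) (b.1, y, b.2) :=
      (hf.differentiable (by norm_num)).differentiableAt.hasFDerivAt
    have h2 : HasDerivAt (fun y : ℝ => ((b.1, y, b.2) : Pt n)) (dir none) y :=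
      (hasDerivAt_const y b.1).prodMk ((hasDerivAt_id y).prodMk (hasDerivAt_const y b.2))
    exact (h1.comp_hasDerivAt y h2).deriv
  simp only [this]

/-- Every term of the smooth inequality is continuous for the convergence in `H1Approx`, so the
inequality survives the limit. -/
theorem H1Approx.exists_trace_le {a : ℝ} (ha : -1 < a) (ha1 : a < 1) {ε : ℝ≥0∞} (hε : 0 < ε) :
    ∃ A : ℝ≥0∞, A ≠ ⊤ ∧ ∀ (w : Pt n → E n) (W : Option (Fin n) → Pt n → E n) (w0 : E n × ℝ → E n),
      H1Approx a w W w0 → MemLp w 2 (wMeasure n a) → MemLp (W none) 2 (wMeasure n a) →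
      MemLp w0 2 volume →
      eLpNorm w0 2 volume ^ 2 ≤ A * eLpNorm w 2 (wMeasure n a) ^ 2 +
        ε * eLpNorm (W none) 2 (wMeasure n a) ^ 2 := by
  -- An infinite coefficient would break the passage to the limit; it is weaker than the case `ε =
  -- 1`.
  wlog hεt : ε ≠ ⊤ generalizing ε
  · obtain ⟨A, hA, h⟩ := this (ε := 1) (by norm_num) (by norm_num)
    refine ⟨A, hA, fun w W w0 h1 h2 h3 h4 => (h w W w0 h1 h2 h3 h4).trans ?_⟩
    gcongr
    rw [not_not.1 hεt]; exact le_top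
  obtain ⟨A, hA, h⟩ := exists_atZero_le (n := n) ha ha1 hε
  refine ⟨A, hA, fun w W w0 ⟨f, hf, hfc, h1, h2, h3⟩ hw hW hw0 => ?_⟩
  have t1 := tendsto_eLpNorm_of_sub (fun j => (hf j).continuous.aestronglyMeasurable) hw h1
  have t2 := tendsto_eLpNorm_of_sub (fun j => (((hf j).continuous_fderiv (by norm_num)).clm_apply
    continuous_const).aestronglyMeasurable) hW (h2 none)
  have t3 := tendsto_eLpNorm_of_sub (fun j => ((hf j).continuous.comp
    (by fun_prop : Continuous fun b : E n × ℝ => ((b.1, 0, b.2) : Pt n))).aestronglyMeasurable)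
    hw0 h3
  refine le_of_tendsto_of_tendsto' (ENNReal.Tendsto.pow t3 (n := 2))
    ((ENNReal.Tendsto.const_mul (ENNReal.Tendsto.pow t1 (n := 2)) (Or.inr hA)).add
      (ENNReal.Tendsto.const_mul (ENNReal.Tendsto.pow t2 (n := 2)) (Or.inr hεt))) fun j => h _ (hf j)

end TraceInequality

/-! ### The divergence is bounded by the tangential gradient -/

section Divergence

theorem integrable_of_continuous_compact {a : ℝ} (ha : -1 < a) {F : Type*} [NormedAddCommGroup F]
    {f : Pt n → F} (hf : Continuous f) (hfc : HasCompactSupport f) :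
    Integrable f (wMeasure n a) := by
  have := wMeasure_finite n ha
  exact hf.integrable_of_hasCompactSupport hfc

/-- The weight is constant along `x`, so Fubini reduces this to the vanishing integral of a
derivative on `ℝⁿ`. -/
theorem integral_fderiv_eq_zero {a : ℝ} (ha : -1 < a) {f : Pt n → ℝ} (hf : ContDiff ℝ 1 f)
    (hfc : HasCompactSupport f) (v : E n) :
    ∫ p, fderiv ℝ f p (v, 0, 0) ∂(wMeasure n a) = 0 := by
  have hd : Continuous fun p => fderiv ℝ f p (v, 0, 0) :=
    (hf.continuous_fderiv (by norm_num)).clm_apply continuous_const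
  have hi := integrable_of_continuous_compact ha hd (hfc.fderiv_apply ℝ (v, 0, 0))
  rw [wMeasure_eq_prod] at hi ⊢
  rw [integral_prod_symm _ hi]
  refine integral_eq_zero_of_ae (Eventually.of_forall fun r => ?_)
  have hg : ContDiff ℝ 1 fun x : E n => f (x, r) := hf.comp (by fun_prop)
  have hgc : HasCompactSupport fun x : E n => f (x, r) :=
    HasCompactSupport.intro (hfc.isCompact.image continuous_fst) fun x hx =>
      image_eq_zero_of_notMem_tsupport fun h => hx ⟨(x, r), h, rfl⟩
  have hgd : ∀ x : E n, fderiv ℝ (fun x : E n => f (x, r)) x v = fderiv ℝ f (x, r) (v, 0, 0) := by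
    intro x
    have h1 : HasFDerivAt f (fderiv ℝ f (x, r)) (x, r) :=
      (hf.differentiable (by norm_num)).differentiableAt.hasFDerivAt
    have h0 : HasFDerivAt (fun x : E n => ((x, r) : Pt n))
        ((ContinuousLinearMap.id ℝ (E n)).prod 0) x :=
      (hasFDerivAt_id x).prodMk (hasFDerivAt_const r x)
    have h3 := (h1.comp x h0).fderiv
    change fderiv ℝ (fun x : E n => f (x, r)) x = _ at h3
    rw [h3]
    rfl
  have hgdc : Continuous fun x : E n => fderiv ℝ (fun x : E n => f (x, r)) x v :=
    (hg.continuous_fderiv (by norm_num)).clm_apply continuous_const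
  have := integral_mul_fderiv_eq_neg_fderiv_mul_of_integrable (μ := (volume : Measure (E n)))
    (f := fun _ => (1 : ℝ)) (g := fun x : E n => f (x, r)) (v := v) (by simp)
    (by simpa using hgdc.integrable_of_hasCompactSupport (hgc.fderiv_apply ℝ v))
    (by simpa using hg.continuous.integrable_of_hasCompactSupport hgc)
    (by fun_prop) (fun x _ => (hg.differentiable (by norm_num)).differentiableAt)
  simpa [hgd] using this

/-- The difference of the two integrands is `∂_v (f ∂_w g) - ∂_w (f ∂_v g)` by symmetry of second
derivatives, and tangential derivatives integrate to zero. -/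
theorem integral_fderiv_mul_fderiv_comm {a : ℝ} (ha : -1 < a) {f g : Pt n → ℝ}
    (hf : ContDiff ℝ ∞ f) (hfc : HasCompactSupport f) (hg : ContDiff ℝ ∞ g) (v w : E n) :
    ∫ p, fderiv ℝ f p (v, 0, 0) * fderiv ℝ g p (w, 0, 0) ∂(wMeasure n a) =
      ∫ p, fderiv ℝ f p (w, 0, 0) * fderiv ℝ g p (v, 0, 0) ∂(wMeasure n a) := by
  have hD : ∀ {f : Pt n → ℝ}, ContDiff ℝ ∞ f → ∀ v : E n,
      ContDiff ℝ ∞ fun p => fderiv ℝ f p (v, 0, 0) := fun hf v =>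
    (hf.fderiv_right (m := ∞) (by norm_num)).clm_apply contDiff_const
  have hprod : ∀ v w : E n, ∀ p, fderiv ℝ (fun p => f p * fderiv ℝ g p (w, 0, 0)) p (v, 0, 0) =
      fderiv ℝ f p (v, 0, 0) * fderiv ℝ g p (w, 0, 0)
        + f p * fderiv ℝ (fderiv ℝ g) p (v, 0, 0) (w, 0, 0) := fun v w p => by
    have h1 : HasFDerivAt f (fderiv ℝ f p) p :=
      (hf.differentiable (by norm_num)).differentiableAt.hasFDerivAt
    have h2 : HasFDerivAt (fderiv ℝ g) (fderiv ℝ (fderiv ℝ g) p) p :=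
      ((hg.fderiv_right (m := ∞) (by norm_num)).differentiable
        (by norm_num)).differentiableAt.hasFDerivAt
    have h3 := (h1.mul (h2.clm_apply (hasFDerivAt_const ((w, 0, 0) : Pt n) p))).fderiv
    change fderiv ℝ (fun p => f p * fderiv ℝ g p (w, 0, 0)) p = _ at h3
    rw [h3]
    simp
    ring
  have key : ∀ p, fderiv ℝ f p (v, 0, 0) * fderiv ℝ g p (w, 0, 0) -
      fderiv ℝ f p (w, 0, 0) * fderiv ℝ g p (v, 0, 0) =
      fderiv ℝ (fun p => f p * fderiv ℝ g p (w, 0, 0)) p (v, 0, 0) -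
      fderiv ℝ (fun p => f p * fderiv ℝ g p (v, 0, 0)) p (w, 0, 0) := fun p => by
    have hsymm : fderiv ℝ (fderiv ℝ g) p (v, 0, 0) (w, 0, 0) =
        fderiv ℝ (fderiv ℝ g) p (w, 0, 0) (v, 0, 0) :=
      (hg.contDiffAt.isSymmSndFDerivAt (by
        simpa using (WithTop.coe_le_coe.2 (le_top : (2 : ℕ∞) ≤ ⊤) :(2 : WithTop ℕ∞) ≤ ((⊤ : ℕ∞) : WithTop ℕ∞)))).eq _ _
    rw [hprod, hprod, hsymm]
    ring
  have hi : ∀ v w : E n, Integrable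
      (fun p => fderiv ℝ f p (v, 0, 0) * fderiv ℝ g p (w, 0, 0)) (wMeasure n a) := fun v w =>
    integrable_of_continuous_compact ha ((hD hf v).continuous.mul (hD hg w).continuous)
      ((hfc.fderiv_apply ℝ _).mul_right)
  have hj : ∀ v w : E n, Integrable
      (fun p => fderiv ℝ (fun p => f p * fderiv ℝ g p (w, 0, 0)) p (v, 0, 0))
        (wMeasure n a) := fun v w =>
    integrable_of_continuous_compact ha (hD (hf.mul (hD hg w)) v).continuous
      ((hfc.mul_right).fderiv_apply ℝ _)
  rw [← sub_eq_zero, ← integral_sub (hi v w) (hi w v), integral_congr_ae (Eventually.of_forall key),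
    integral_sub (hj v w) (hj w v),
    integral_fderiv_eq_zero ha ((hf.mul (hD hg w)).of_le (by norm_num)) hfc.mul_right,
    integral_fderiv_eq_zero ha ((hf.mul (hD hg v)).of_le (by norm_num)) hfc.mul_right, sub_zero]

/-- The divergence in `x` attached to a gradient. -/
def divOf (W : Option (Fin n) → Pt n → E n) (p : Pt n) : ℝ := ∑ i, W (some i) p i

/-- Expanding the square, `∫ ∂_i f_i ∂_j f_j = ∫ ∂_j f_i ∂_i f_j`, and the right side is at most
half the sum of the two squared norms. The constant is exactly `1`, which the coercivity under `2μ +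
lam ≥ δ₀` requires. -/
theorem eLpNorm_div_le_of_contDiff {a : ℝ} (ha : -1 < a) {f : Pt n → E n}
    (hf : ContDiff ℝ ∞ f) (hfc : HasCompactSupport f) :
    eLpNorm (divOf fun k p => fderiv ℝ f p (dir k)) 2 (wMeasure n a) ^ 2 ≤
      ∑ i : Fin n, eLpNorm (fun p => fderiv ℝ f p (dir (some i))) 2 (wMeasure n a) ^ 2 := by
  set e : Fin n → E n := fun i => EuclideanSpace.single i 1
  set D : Fin n → Fin n → Pt n → ℝ := fun i j p => fderiv ℝ f p (e i, 0, 0) j with hD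
  have hfj : ∀ j, ContDiff ℝ ∞ fun p => f p j := fun j => by fun_prop
  have hfjc : ∀ j, HasCompactSupport fun p => f p j := fun j =>
    hfc.comp_left (g := fun x : E n => x j) rfl
  have hDeq : ∀ i j p, D i j p = fderiv ℝ (fun p => f p j) p (e i, 0, 0) := fun i j p => by
    have h1 : HasFDerivAt f (fderiv ℝ f p) p :=
      (hf.differentiable (by norm_num)).differentiableAt.hasFDerivAt
    have h2 := ((EuclideanSpace.proj (𝕜 := ℝ) j).hasFDerivAt.comp p h1).fderiv
    change fderiv ℝ (fun p => f p j) p = _ at h2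
    rw [h2]; rfl
  have hDc : ∀ i j, Continuous (D i j) := fun i j => by
    have := (hf.continuous_fderiv (by norm_num))
    simp only [hD]; fun_prop
  have hDs : ∀ i j, HasCompactSupport (D i j) := fun i j =>
    (hfc.fderiv_apply ℝ (e i, 0, 0)).comp_left (g := fun x : E n => x j) rfl
  have hDD : ∀ i j i' j', Integrable (fun p => D i j p * D i' j' p) (wMeasure n a) :=
    fun i j i' j' => integrable_of_continuous_compact ha ((hDc _ _).mul (hDc _ _))
      ((hDs _ _).mul_right)
  have hcomm : ∀ i j, ∫ p, D i i p * D j j p ∂(wMeasure n a) =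
      ∫ p, D j i p * D i j p ∂(wMeasure n a) := fun i j => by
    simp only [hDeq]
    exact integral_fderiv_mul_fderiv_comm ha (hfj i) (hfjc i) (hfj j) (e i) (e j)
  have hreal : ∫ p, (∑ i, D i i p) ^ 2 ∂(wMeasure n a) ≤
      ∫ p, ∑ i, ∑ j, D i j p ^ 2 ∂(wMeasure n a) := by
    have e1 : ∫ p, (∑ i, D i i p) ^ 2 ∂(wMeasure n a) =
        ∑ i, ∑ j, ∫ p, D i i p * D j j p ∂(wMeasure n a) := by
      simp only [sq, Finset.sum_mul_sum]
      rw [integral_finsetSum _ fun i _ => integrable_finsetSum _ fun j _ => hDD _ _ _ _]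
      exact Finset.sum_congr rfl fun i _ => integral_finsetSum _ fun j _ => hDD _ _ _ _
    have e2 : ∫ p, ∑ i, ∑ j, D i j p ^ 2 ∂(wMeasure n a) =
        ∑ i, ∑ j, ∫ p, D i j p * D i j p ∂(wMeasure n a) := by
      simp only [sq]
      rw [integral_finsetSum _ fun i _ => integrable_finsetSum _ fun j _ => hDD _ _ _ _]
      exact Finset.sum_congr rfl fun i _ => integral_finsetSum _ fun j _ => hDD _ _ _ _
    rw [e1, e2]
    have e3 : ∀ i j, ∫ p, D i i p * D j j p ∂(wMeasure n a) ≤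
        (∫ p, D i j p * D i j p ∂(wMeasure n a) + ∫ p, D j i p * D j i p ∂(wMeasure n a)) / 2 := by
      intro i j
      rw [hcomm, ← integral_add (hDD _ _ _ _) (hDD _ _ _ _), ← integral_div]
      refine integral_mono (hDD _ _ _ _) (((hDD _ _ _ _).add (hDD _ _ _ _)).div_const 2) fun p => ?_
      simp only
      nlinarith [sq_nonneg (D i j p - D j i p)]
    calc _ ≤ ∑ i, ∑ j, (∫ p, D i j p * D i j p ∂(wMeasure n a)
          + ∫ p, D j i p * D j i p ∂(wMeasure n a)) / 2 :=
        Finset.sum_le_sum fun i _ => Finset.sum_le_sum fun j _ => e3 i j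
      _ = _ := by
        simp only [add_div, Finset.sum_add_distrib]
        rw [Finset.sum_comm (f := fun i j => (∫ p, D j i p * D j i p ∂(wMeasure n a)) / 2),
          ← Finset.sum_add_distrib]
        refine Finset.sum_congr rfl fun i _ => ?_
        rw [← Finset.sum_add_distrib]
        exact Finset.sum_congr rfl fun j _ => by ring
  have h0 : ∀ r : ℝ, ‖r‖ₑ ^ 2 = ENNReal.ofReal (r ^ 2) := fun r => by
    rw [← ofReal_norm, ← ENNReal.ofReal_pow (norm_nonneg _), Real.norm_eq_abs, sq_abs]
  have h1 : ∀ i p, ‖fderiv ℝ f p (dir (some i))‖ₑ ^ 2 = ENNReal.ofReal (∑ j, D i j p ^ 2) :=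
    fun i p => by
    rw [← ofReal_norm, ← ENNReal.ofReal_pow (norm_nonneg _), EuclideanSpace.norm_sq_eq]
    simp only [Real.norm_eq_abs, sq_abs]
    rfl
  simp only [eLpNorm_sq]
  rw [← lintegral_finsetSum]
  rotate_left
  · intro i _
    have := (hf.continuous_fderiv (by norm_num))
    fun_prop
  simp only [h0, h1]
  have i1 : Integrable (fun p => (∑ i, D i i p) ^ 2) (wMeasure n a) := by
    simp only [sq, Finset.sum_mul_sum]
    exact integrable_finsetSum _ fun i _ => integrable_finsetSum _ fun j _ => hDD _ _ _ _
  have i2 : Integrable (fun p => ∑ i, ∑ j, D i j p ^ 2) (wMeasure n a) := by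
    simp only [sq]
    exact integrable_finsetSum _ fun i _ => integrable_finsetSum _ fun j _ => hDD _ _ _ _
  have h2 : ∀ p, ∑ i, ENNReal.ofReal (∑ j, D i j p ^ 2) =
      ENNReal.ofReal (∑ i, ∑ j, D i j p ^ 2) := fun p =>
    (ENNReal.ofReal_sum_of_nonneg fun i _ => Finset.sum_nonneg fun j _ => sq_nonneg _).symm
  simp only [h2]
  rw [← ofReal_integral_eq_lintegral_ofReal i2 (Eventually.of_forall fun p =>
    Finset.sum_nonneg fun i _ => Finset.sum_nonneg fun j _ => sq_nonneg _)]
  change ∫⁻ p, ENNReal.ofReal ((∑ i, D i i p) ^ 2) ∂(wMeasure n a) ≤ _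
  rw [← ofReal_integral_eq_lintegral_ofReal i1 (Eventually.of_forall fun p => sq_nonneg _)]
  exact ENNReal.ofReal_le_ofReal hreal

theorem H1Approx.eLpNorm_div_le {a : ℝ} (ha : -1 < a) {w : Pt n → E n}
    {W : Option (Fin n) → Pt n → E n} {w0 : E n × ℝ → E n} (h : H1Approx a w W w0)
    (hW : ∀ k, MemLp (W k) 2 (wMeasure n a)) :
    eLpNorm (divOf W) 2 (wMeasure n a) ^ 2 ≤
      ∑ i : Fin n, eLpNorm (W (some i)) 2 (wMeasure n a) ^ 2 := by
  obtain ⟨f, hf, hfc, -, h2, -⟩ := h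
  have hm : ∀ j k, AEStronglyMeasurable (fun p => fderiv ℝ (f j) p (dir k)) (wMeasure n a) :=
    fun j k => (((hf j).continuous_fderiv (by norm_num)).clm_apply
      continuous_const).aestronglyMeasurable
  have hcoord : ∀ i : Fin n, ∀ X : Pt n → E n, AEStronglyMeasurable X (wMeasure n a) →
      AEStronglyMeasurable (fun p => X p i) (wMeasure n a) := fun i X hX =>
    (EuclideanSpace.proj (𝕜 := ℝ) i).continuous.comp_aestronglyMeasurable hX
  have hsum : ∀ X : Option (Fin n) → Pt n → E n, (∀ k, AEStronglyMeasurable (X k) (wMeasure n a)) →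
      AEStronglyMeasurable (divOf X) (wMeasure n a) := fun X hX => by
    unfold divOf
    exact Finset.aestronglyMeasurable_fun_sum _ fun i _ => hcoord i _ (hX (some i))
  have hle : ∀ i : Fin n, ∀ X : Pt n → E n,
      eLpNorm (fun p => X p i) 2 (wMeasure n a) ≤ eLpNorm X 2 (wMeasure n a) := fun i X =>
    eLpNorm_mono fun p => PiLp.norm_apply_le (X p) i
  have hdiv : MemLp (divOf W) 2 (wMeasure n a) := by
    unfold divOf
    exact memLp_finsetSum _ fun i _ =>
      ⟨hcoord i _ (hW (some i)).1, (hle i _).trans_lt (hW (some i)).2⟩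
  have t1 : Tendsto (fun j => eLpNorm
      ((divOf fun k p => fderiv ℝ (f j) p (dir k)) - divOf W) 2 (wMeasure n a)) atTop (𝓝 0) := by
    have h3 : Tendsto (fun j => ∑ i : Fin n, eLpNorm ((fun p => fderiv ℝ (f j) p (dir (some i)))
        - W (some i)) 2 (wMeasure n a)) atTop (𝓝 0) := by
      simpa using tendsto_finsetSum Finset.univ fun i (_ : i ∈ Finset.univ) => h2 (some i)
    refine tendsto_of_tendsto_of_tendsto_of_le_of_le tendsto_const_nhds h3 (fun _ => zero_le)
      fun j => ?_
    have e : (divOf fun k p => fderiv ℝ (f j) p (dir k)) - divOf W =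
        ∑ i : Fin n, fun p => ((fun p => fderiv ℝ (f j) p (dir (some i))) - W (some i)) p i := by
      ext p
      simp [divOf, Finset.sum_apply]
    rw [e]
    refine (eLpNorm_sum_le (fun i _ => ?_) (by norm_num)).trans
      (Finset.sum_le_sum fun i _ => hle i _)
    exact hcoord i _ ((hm j _).sub (hW _).1)
  have t2 := tendsto_eLpNorm_of_sub (fun j => hsum _ fun k => hm j k) hdiv t1
  have t3 : Tendsto (fun j => ∑ i : Fin n,
      eLpNorm (fun p => fderiv ℝ (f j) p (dir (some i))) 2 (wMeasure n a) ^ 2) atTop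
      (𝓝 (∑ i : Fin n, eLpNorm (W (some i)) 2 (wMeasure n a) ^ 2)) :=
    tendsto_finsetSum _ fun i _ => ENNReal.Tendsto.pow
      (tendsto_eLpNorm_of_sub (fun j => hm j _) (hW _) (h2 (some i)))
  exact le_of_tendsto_of_tendsto' (ENNReal.Tendsto.pow t2 (n := 2)) t3 fun j =>
    eLpNorm_div_le_of_contDiff ha (hf j) (hfc j)

end Divergence

end LameExt

namespace LameExt

open scoped ENNReal

variable {n : ℕ}

/-! ### Continuity of `L²` pairings -/

section Pairing

variable {α F : Type*} [MeasurableSpace α] [NormedAddCommGroup F] [InnerProductSpace ℝ F]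
  {μ : Measure α}

theorem integrable_inner {f g : α → F} (hf : MemLp f 2 μ) (hg : MemLp g 2 μ) :
    Integrable (fun x => inner ℝ (f x) (g x)) μ := by
  refine ((hf.norm.integrable_mul hg.norm)).mono
    (hf.1.inner hg.1) (Eventually.of_forall fun x => ?_)
  simpa using norm_inner_le_norm (𝕜 := ℝ) (f x) (g x)

theorem tendsto_integral_inner {ι : Type*} {l : Filter ι} {f g : α → F} {gs : ι → α → F}
    (hf : MemLp f 2 μ) (hgs : ∀ j, MemLp (gs j) 2 μ) (hg : MemLp g 2 μ)
    (h : Tendsto (fun j => eLpNorm (gs j - g) 2 μ) l (𝓝 0)) :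
    Tendsto (fun j => ∫ x, inner ℝ (f x) (gs j x) ∂μ) l (𝓝 (∫ x, inner ℝ (f x) (g x) ∂μ)) := by
  have h1 := (Lp.tendsto_Lp_iff_tendsto_eLpNorm'' gs hgs g hg).2 h
  have h2 : Tendsto (fun j => inner ℝ (hf.toLp f) ((hgs j).toLp (gs j))) l
      (𝓝 (inner ℝ (hf.toLp f) (hg.toLp g))) := tendsto_const_nhds.inner h1
  have h3 : ∀ (g : α → F) (hg : MemLp g 2 μ), inner ℝ (hf.toLp f) (hg.toLp g) =
      ∫ x, inner ℝ (f x) (g x) ∂μ := fun g hg => by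
    rw [L2.inner_def]
    refine integral_congr_ae ?_
    filter_upwards [hf.coeFn_toLp, hg.coeFn_toLp] with x h1 h2
    rw [h1, h2]
  simpa only [h3] using h2

theorem eLpNorm_sq_eq_ofReal {F : Type*} [NormedAddCommGroup F] {f : α → F} (hf : MemLp f 2 μ) :
    eLpNorm f 2 μ ^ 2 = ENNReal.ofReal (∫ x, ‖f x‖ ^ 2 ∂μ) := by
  rw [eLpNorm_sq, ofReal_integral_eq_lintegral_ofReal]
  · refine lintegral_congr fun x => ?_
    rw [← ofReal_norm, ENNReal.ofReal_pow (norm_nonneg _)]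
  · exact (memLp_two_iff_integrable_sq_norm hf.1).1 hf
  · exact Eventually.of_forall fun x => sq_nonneg _

theorem MemLp.integrable_norm_sq {F : Type*} [NormedAddCommGroup F] {f : α → F}
    (hf : MemLp f 2 μ) : Integrable (fun x => ‖f x‖ ^ 2) μ :=
  (memLp_two_iff_integrable_sq_norm hf.1).1 hf

end Pairing

/-! ### Averages and `L²` limits -/

section AvgLimit

variable {G : Type*} [NormedAddCommGroup G] [MeasurableSpace G] [BorelSpace G]
  [SecondCountableTopology G]
variable {F : Type*} [NormedAddCommGroup F] [NormedSpace ℝ F] [MeasurableSpace F] [BorelSpace F]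
  [SecondCountableTopology F] [CompleteSpace F]

theorem tendsto_avg_of_tendsto {ι : Type*} {l : Filter ι} {ν μ : Measure G}
    [IsProbabilityMeasure ν] (hb : AvgBdd ν μ 1) {f : ι → G → F} {g : G → F}
    (hf : ∀ j, Measurable (f j)) (hf2 : ∀ j, MemLp (f j) 2 μ) (hg : Measurable g)
    (hg2 : MemLp g 2 μ) (h : Tendsto (fun j => eLpNorm (f j - g) 2 μ) l (𝓝 0)) :
    Tendsto (fun j => eLpNorm (avg ν (f j) - avg ν g) 2 μ) l (𝓝 0) := by
  refine tendsto_of_tendsto_of_tendsto_of_le_of_le tendsto_const_nhds h (fun _ => zero_le)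
    fun j => ?_
  simp only
  rw [← eLpNorm_congr_ae (avg_sub_ae (by norm_num) hb (hf j) (hf2 j) hg hg2)]
  refine (eLpNorm_avg_le hb ((hf j).sub hg)).trans (by simp)

end AvgLimit

/-! ### Local weak solutions and time-averaged test functions -/

section Solutions

/-- The flux paired with `∂_k φ` in the weak formulation. -/
noncomputable def flux (μ lam : ℝ) (G : Option (Fin n) → Pt n → E n) :
    Option (Fin n) → Pt n → E n
  | none => G none
  | some i => fun p => μ • G (some i) p + EuclideanSpace.single i ((μ + lam) * divOf G p)

/-- Local weak solutions in `Ω ∩ {y > 0}` with conormal derivative `g` on `{y = 0}`. -/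
structure Sol (Ω : Set (Pt n)) (a μ lam : ℝ) (U : Pt n → E n)
    (G : Option (Fin n) → Pt n → E n) (u g : E n × ℝ → E n) : Prop where
  measU : Measurable U
  measG : ∀ k, Measurable (G k)
  measu : Measurable u
  measg : Measurable g
  memU : ∀ K, IsCompact K → K ⊆ Ω → MemLp U 2 ((wMeasure n a).restrict K)
  memG : ∀ k K, IsCompact K → K ⊆ Ω → MemLp (G k) 2 ((wMeasure n a).restrict K)
  memu : ∀ K : Set (Pt n), IsCompact K → K ⊆ Ω →
    MemLp u 2 (volume.restrict {b : E n × ℝ | ((b.1, 0, b.2) : Pt n) ∈ K})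
  memg : ∀ K : Set (Pt n), IsCompact K → K ⊆ Ω →
    MemLp g 2 (volume.restrict {b : E n × ℝ | ((b.1, 0, b.2) : Pt n) ∈ K})
  approx : ∀ η : Pt n → ℝ, ContDiff ℝ ∞ η → HasCompactSupport η → tsupport η ⊆ Ω →
    H1Approx a (fun p => η p • U p) (cutGrad η U G) (fun b => atZero η b • u b)
  eq : ∀ φ : Pt n → E n, ContDiff ℝ ∞ φ → HasCompactSupport φ → tsupport φ ⊆ Ω →
    ∫ p, inner ℝ (U p) (fderiv ℝ φ p dirT) ∂(wMeasure n a) =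
      ∑ k, ∫ p, inner ℝ (flux μ lam G k p) (fderiv ℝ φ p (dir k)) ∂(wMeasure n a) +
        ∫ b, inner ℝ (g b) (atZero φ b)

theorem measurable_coord (i : Fin n) : Measurable fun x : E n => x i := by fun_prop

theorem measurable_flux {μ lam : ℝ} {G : Option (Fin n) → Pt n → E n} (hG : ∀ k, Measurable (G k))
    (k : Option (Fin n)) : Measurable (flux μ lam G k) := by
  cases k with
  | none => exact hG none
  | some i =>
    have h1 : Measurable (divOf G) :=
      Finset.measurable_sum _ fun i _ => (measurable_coord i).comp (hG (some i))
    have h2 : Measurable fun c : ℝ => (EuclideanSpace.single i c : E n) := by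
      have : Continuous fun c : ℝ => (c • EuclideanSpace.single i (1 : ℝ) : E n) := by fun_prop
      refine (this.congr fun c => ?_).measurable
      ext j; simp
    have h3 := hG (some i)
    exact (h3.const_smul μ).add (h2.comp (h1.const_mul _))

theorem memLp_flux {μ lam : ℝ} {G : Option (Fin n) → Pt n → E n} {ν : Measure (Pt n)}
    (hGm : ∀ k, Measurable (G k)) (hG : ∀ k, MemLp (G k) 2 ν)
    (k : Option (Fin n)) : MemLp (flux μ lam G k) 2 ν := by
  cases k with
  | none => exact hG none
  | some i =>
    have h1 : MemLp (divOf G) 2 ν := by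
      unfold divOf
      refine memLp_finsetSum _ fun i _ => (hG (some i)).mono
        ((measurable_coord i).comp (hGm (some i))).aestronglyMeasurable
        (Eventually.of_forall fun p => PiLp.norm_apply_le _ i)
    have h2 : MemLp (fun p => EuclideanSpace.single i ((μ + lam) * divOf G p) : Pt n → E n) 2 ν := by
      refine (h1.const_mul (μ + lam)).mono ?_ (Eventually.of_forall fun p => by simp)
      have := (measurable_flux (μ := μ) (lam := lam) hGm (some i)).sub ((hGm (some i)).const_smul μ)
      refine this.aestronglyMeasurable.congr (Eventually.of_forall fun p => ?_)
      simp [flux]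
    exact ((hG (some i)).const_smul μ).add h2

theorem inner_indicator_left {α : Type*} {K : Set α} {X f : α → E n} (h : ∀ p, p ∉ K → X p = 0)
    (p : α) : inner ℝ (f p) (X p) = inner ℝ (K.indicator f p) (X p) := by
  by_cases hp : p ∈ K
  · rw [Set.indicator_of_mem hp]
  · simp [h p hp]

theorem norm_dirT : ‖(dirT : Pt n)‖ = 1 := by
  simp [dirT, Prod.norm_def]

theorem atZero_avg_lineMeas {ψ : Pt n → E n} (hψ : Continuous ψ) (h : ℝ) :
    atZero (avg (lineMeas (h • (dirT : Pt n))) ψ) =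
      avg (lineMeas (h • ((0, 1) : E n × ℝ))) (atZero ψ) := by
  ext1 b
  have h1 : Continuous (atZero ψ) := hψ.comp (by fun_prop)
  rw [avg_lineMeas _ h1.measurable, atZero, avg_lineMeas _ hψ.measurable]
  simp [atZero, dirT]

/-- The test function `(1/h) ∫₀ʰ ψ(· + σ) dσ`. -/
theorem Sol.eq_timeAverage {Ω : Set (Pt n)} {a μ lam : ℝ} {U : Pt n → E n}
    {G : Option (Fin n) → Pt n → E n} {u g : E n × ℝ → E n} (hS : Sol Ω a μ lam U G u g)
    {K₀ : Set (Pt n)} {ρ h : ℝ} (hh : 0 < h) (hhρ : h ≤ ρ) (hK : Metric.cthickening ρ K₀ ⊆ Ω)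
    {ψ : Pt n → E n} (hψ : ContDiff ℝ ∞ ψ) (hψc : HasCompactSupport ψ) (hψs : tsupport ψ ⊆ K₀) :
    h⁻¹ * ∫ p, inner ℝ ((Metric.cthickening ρ K₀).indicator U p) (ψ (p + h • dirT) - ψ p)
        ∂(wMeasure n a) =
      ∑ k, ∫ p, inner ℝ ((Metric.cthickening ρ K₀).indicator (flux μ lam G k) p)
        (avg (lineMeas (h • dirT)) (fun q => fderiv ℝ ψ q (dir k)) p) ∂(wMeasure n a) +
      ∫ b, inner ℝ ({b : E n × ℝ | ((b.1, 0, b.2) : Pt n) ∈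
        Metric.cthickening ρ K₀}.indicator g b)
        (avg (lineMeas (h • ((0, 1) : E n × ℝ))) (atZero ψ) b) := by
  set φ := avg (lineMeas (h • (dirT : Pt n))) ψ with hφ
  have hts : tsupport φ ⊆ Metric.cthickening ρ K₀ := by
    refine (tsupport_avg_subset (r := h) (lineMeas_compl_closedBall ?_) ψ).trans
      ((Metric.cthickening_mono hhρ _).trans (Metric.cthickening_subset_of_subset _ hψs))
    rw [norm_smul, norm_dirT, Real.norm_of_nonneg hh.le, mul_one]
  have hφ1 : ContDiff ℝ ∞ φ := contDiff_avg hψ hψc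
  have hφc : HasCompactSupport φ :=
    (hψc.isCompact.cthickening (r := h)).of_isClosed_subset (isClosed_tsupport _)
      (tsupport_avg_subset (lineMeas_compl_closedBall
        (by rw [norm_smul, norm_dirT, Real.norm_of_nonneg hh.le, mul_one])) ψ)
  have heq := hS.eq φ hφ1 hφc (hts.trans hK)
  have hd : ∀ k p, fderiv ℝ φ p (dir k) =
      avg (lineMeas (h • dirT)) (fun q => fderiv ℝ ψ q (dir k)) p := fun k p =>
    fderiv_avg hψ hψc p (dir k)
  -- The time derivative of the forward average is a forward difference of `ψ`, so no time
  -- derivative is left and `ψ` may later be replaced by a function that is rough in time.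
  have hdT : ∀ p, fderiv ℝ φ p dirT = h⁻¹ • (ψ (p + h • dirT) - ψ p) := fun p => by
    rw [sub_eq_avg_lineMeas hψ, ← fderiv_avg hψ hψc, map_smul, smul_smul,
      inv_mul_cancel₀ hh.ne', one_smul]
  have hz : ∀ v p, p ∉ Metric.cthickening ρ K₀ → fderiv ℝ φ p v = 0 := fun v p hp => by
    rw [image_eq_zero_of_notMem_tsupport fun h' => hp (hts (tsupport_fderiv_subset ℝ h'))]; rfl
  have hz0 : ∀ b : E n × ℝ, b ∉ {b : E n × ℝ | ((b.1, 0, b.2) : Pt n) ∈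
      Metric.cthickening ρ K₀} → atZero φ b = 0 := fun b hb =>
    image_eq_zero_of_notMem_tsupport (f := φ) fun h' => hb (hts h')
  -- Solutions are square integrable only on compact subsets of `Ω`. Restricting them to the
  -- thickened support makes all factors global `L²` functions without changing the integrals.
  rw [integral_congr_ae (Eventually.of_forall fun p => inner_indicator_left (f := U) (hz dirT) p),
    integral_congr_ae (Eventually.of_forall fun b => inner_indicator_left (f := g) hz0 b),
    Finset.sum_congr rfl fun k _ => integral_congr_ae (Eventually.of_forall fun p =>
      inner_indicator_left (f := flux μ lam G k) (hz (dir k)) p)] at heq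
  simp only [hd, hdT, inner_smul_right, integral_const_mul] at heq
  rw [hφ, atZero_avg_lineMeas hψ.continuous] at heq
  exact heq

end Solutions

end LameExt

namespace LameExt

open scoped ENNReal

variable {n : ℕ}

/-! ### Multiplication by cut-off functions -/

section Multipliers

variable {α F : Type*} [MeasurableSpace α] [NormedAddCommGroup F] [NormedSpace ℝ F]
  {μ : Measure α}

theorem tendsto_eLpNorm_smul {ι : Type*} {l : Filter ι} {c : α → ℝ} {M : ℝ}
    (hM : ∀ p, ‖c p‖ ≤ M) {f : ι → α → F} {g : α → F}
    (h : Tendsto (fun j => eLpNorm (f j - g) 2 μ) l (𝓝 0)) :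
    Tendsto (fun j => eLpNorm ((fun p => c p • f j p) - fun p => c p • g p) 2 μ) l (𝓝 0) := by
  have h2 := ENNReal.Tendsto.const_mul h (a := ENNReal.ofReal M) (Or.inr (by simp))
  rw [mul_zero] at h2
  refine tendsto_of_tendsto_of_tendsto_of_le_of_le tendsto_const_nhds h2 (fun _ => zero_le)
    fun j => ?_
  refine eLpNorm_le_mul_eLpNorm_of_ae_le_mul (Eventually.of_forall fun p => ?_) 2
  simp only [Pi.sub_apply, ← smul_sub, norm_smul]
  gcongr
  exact hM p

theorem memLp_smul_of_tsupport [TopologicalSpace α] [OpensMeasurableSpace α] {c : α → ℝ}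
    (hc : Continuous c)
    (hcc : HasCompactSupport c) {X : α → F} {K : Set α} (hcK : tsupport c ⊆ K)
    (hK : MeasurableSet K) (hX : MemLp X 2 (μ.restrict K)) : MemLp (fun p => c p • X p) 2 μ := by
  obtain ⟨M, hM⟩ := hcc.exists_bound_of_continuous hc
  have h1 : MemLp (fun p => c p • K.indicator X p) 2 μ := by
    have h2 := (memLp_indicator_iff_restrict hK).2 hX
    refine (h2.const_smul M).mono ?_ (Eventually.of_forall fun p => ?_)
    · exact hc.measurable.aestronglyMeasurable.smul h2.1
    · simp only [norm_smul, Pi.smul_apply]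
      gcongr
      exact (hM p).trans (le_abs_self M)
  refine h1.ae_eq (Eventually.of_forall fun p => ?_)
  by_cases hp : p ∈ K
  · simp [Set.indicator_of_mem hp]
  · simp [image_eq_zero_of_notMem_tsupport fun h => hp (hcK h)]

end Multipliers

/-! ### Testing with `η² U` -/

section Energy

variable {Ω : Set (Pt n)} {a μ lam : ℝ} {U : Pt n → E n}
    {G : Option (Fin n) → Pt n → E n} {u g : E n × ℝ → E n}

theorem isClosedEmbedding_atZero : Topology.IsClosedEmbedding
    (fun b : E n × ℝ => ((b.1, 0, b.2) : Pt n)) := by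
  refine Topology.IsClosedEmbedding.of_continuous_injective_isClosedMap (by fun_prop)
    (fun x y h => ?_) ?_
  · simp only [Prod.mk.injEq, true_and] at h
    exact Prod.ext h.1 h.2
  · intro S hS
    have : (fun b : E n × ℝ => ((b.1, 0, b.2) : Pt n)) '' S =
        {p : Pt n | p.2.1 = 0} ∩ (fun p : Pt n => (p.1, p.2.2)) ⁻¹' S := by
      ext p
      constructor
      · rintro ⟨b, hb, rfl⟩; exact ⟨rfl, hb⟩
      · rintro ⟨h1, h2⟩
        refine ⟨_, h2, ?_⟩
        have h1 : p.2.1 = 0 := h1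
        ext <;> simp [h1]
    rw [this]
    exact (isClosed_eq (by fun_prop) continuous_const).inter (hS.preimage (by fun_prop))

theorem hasCompactSupport_atZero {F : Type*} [Zero F] {f : Pt n → F} (hf : HasCompactSupport f) :
    HasCompactSupport (atZero f) :=
  hf.comp_isClosedEmbedding isClosedEmbedding_atZero

theorem tsupport_atZero_subset {F : Type*} [Zero F] (f : Pt n → F) :
    tsupport (atZero f) ⊆ {b : E n × ℝ | ((b.1, 0, b.2) : Pt n) ∈ tsupport f} :=
  closure_minimal (fun _ hb => subset_tsupport f hb)
    ((isClosed_tsupport f).preimage isClosedEmbedding_atZero.continuous)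

theorem Sol.memLp_cut (hS : Sol Ω a μ lam U G u g) {η : Pt n → ℝ} (hη : Continuous η)
    (hηc : HasCompactSupport η) (hηs : tsupport η ⊆ Ω) :
    MemLp (fun p => η p • U p) 2 (wMeasure n a) :=
  memLp_smul_of_tsupport hη hηc le_rfl (isClosed_tsupport η).measurableSet
    (hS.memU _ hηc.isCompact hηs)

theorem Sol.memLp_cutGrad (hS : Sol Ω a μ lam U G u g) {η : Pt n → ℝ} (hη : ContDiff ℝ ∞ η)
    (hηc : HasCompactSupport η) (hηs : tsupport η ⊆ Ω) (k : Option (Fin n)) :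
    MemLp (cutGrad η U G k) 2 (wMeasure n a) := by
  have h1 := memLp_smul_of_tsupport hη.continuous hηc le_rfl (isClosed_tsupport η).measurableSet
    (hS.memG k _ hηc.isCompact hηs)
  have h2 := memLp_smul_of_tsupport
    ((hη.continuous_fderiv (by norm_num)).clm_apply (continuous_const (y := dir k)))
    (hηc.fderiv_apply ℝ (dir k)) (tsupport_fderiv_apply_subset ℝ (dir k))
    (isClosed_tsupport η).measurableSet (hS.memU _ hηc.isCompact hηs)
  exact h1.add h2

theorem Sol.memLp_cut_atZero (hS : Sol Ω a μ lam U G u g) {η : Pt n → ℝ} (hη : Continuous η)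
    (hηc : HasCompactSupport η) (hηs : tsupport η ⊆ Ω) :
    MemLp (fun b => atZero η b • u b) 2 volume :=
  memLp_smul_of_tsupport (hη.comp isClosedEmbedding_atZero.continuous) (hasCompactSupport_atZero hηc)
    (tsupport_atZero_subset η) (((isClosed_tsupport η).preimage
      isClosedEmbedding_atZero.continuous).measurableSet) (hS.memu _ hηc.isCompact hηs)

theorem measurable_cutGrad {η : Pt n → ℝ} (hη : ContDiff ℝ ∞ η) (hU : Measurable U)
    (hG : ∀ k, Measurable (G k)) (k : Option (Fin n)) : Measurable (cutGrad η U G k) := by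
  have h1 := hη.continuous
  have h2 := hη.continuous_fderiv (by norm_num)
  have := hG k
  unfold cutGrad; fun_prop

/-- The gradient of `η² U`. -/
noncomputable def testGrad (η : Pt n → ℝ) (U : Pt n → E n) (G : Option (Fin n) → Pt n → E n)
    (k : Option (Fin n)) (p : Pt n) : E n :=
  η p • cutGrad η U G k p + fderiv ℝ η p (dir k) • (η p • U p)

theorem Sol.memLp_testGrad (hS : Sol Ω a μ lam U G u g) {η : Pt n → ℝ} (hη : ContDiff ℝ ∞ η)
    (hηc : HasCompactSupport η) (hηs : tsupport η ⊆ Ω) (k : Option (Fin n)) :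
    MemLp (testGrad η U G k) 2 (wMeasure n a) := by
  have h1 := memLp_smul_of_tsupport hη.continuous hηc le_rfl (isClosed_tsupport η).measurableSet
    ((hS.memLp_cutGrad hη hηc hηs k).restrict _)
  have h2 := memLp_smul_of_tsupport
    ((hη.continuous_fderiv (by norm_num)).clm_apply (continuous_const (y := dir k)))
    (hηc.fderiv_apply ℝ (dir k)) (tsupport_fderiv_apply_subset ℝ (dir k))
    (isClosed_tsupport η).measurableSet ((hS.memLp_cut hη.continuous hηc hηs).restrict _)
  exact h1.add h2

theorem measurable_testGrad {η : Pt n → ℝ} (hη : ContDiff ℝ ∞ η) (hU : Measurable U)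
    (hG : ∀ k, Measurable (G k)) (k : Option (Fin n)) : Measurable (testGrad η U G k) := by
  have h1 := hη.continuous
  have h2 := hη.continuous_fderiv (by norm_num)
  have := measurable_cutGrad hη hU hG k
  unfold testGrad; fun_prop

theorem fderiv_smul_apply {η : Pt n → ℝ} (hη : ContDiff ℝ ∞ η) {f : Pt n → E n}
    (hf : ContDiff ℝ ∞ f) (p v : Pt n) : fderiv ℝ (fun p => η p • f p) p v =
      η p • fderiv ℝ f p v + fderiv ℝ η p v • f p := by
  have h := ((hη.differentiable (by norm_num)).differentiableAt.hasFDerivAt (x := p)).smul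
    ((hf.differentiable (by norm_num)).differentiableAt.hasFDerivAt)
  have h := h.fderiv
  change fderiv ℝ (fun p => η p • f p) p = _ at h
  rw [h]
  simp

/-- The time-averaged weak formulation holds with `η² U` as test function. -/
theorem Sol.eq_timeAverage_cut (hS : Sol Ω a μ lam U G u g) (ha : -1 < a)
    {η : Pt n → ℝ} (hη : ContDiff ℝ ∞ η) (hηc : HasCompactSupport η) {ρ h : ℝ}
    (hΩ : Metric.cthickening ρ (tsupport η) ⊆ Ω) (hh : 0 < h) (hhρ : h ≤ ρ) :
    h⁻¹ * ∫ p, inner ℝ ((Metric.cthickening ρ (tsupport η)).indicator U p)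
        (η (p + h • dirT) • η (p + h • dirT) • U (p + h • dirT) - η p • η p • U p)
        ∂(wMeasure n a) =
      ∑ k, ∫ p, inner ℝ ((Metric.cthickening ρ (tsupport η)).indicator (flux μ lam G k) p)
        (avg (lineMeas (h • dirT)) (testGrad η U G k) p) ∂(wMeasure n a) +
      ∫ b, inner ℝ ({b : E n × ℝ | ((b.1, 0, b.2) : Pt n) ∈
        Metric.cthickening ρ (tsupport η)}.indicator g b)
        (avg (lineMeas (h • ((0, 1) : E n × ℝ))) (fun b => atZero η b • atZero η b • u b) b) := by
  set K := Metric.cthickening ρ (tsupport η) with hKdef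
  have hηs : tsupport η ⊆ Ω := (Metric.self_subset_cthickening _).trans hΩ
  have hKc : IsCompact K := hηc.isCompact.cthickening
  have hKm : MeasurableSet K := hKc.isClosed.measurableSet
  have hK0m : MeasurableSet {b : E n × ℝ | ((b.1, 0, b.2) : Pt n) ∈ K} :=
    hKm.preimage (by fun_prop)
  have mU := hS.measU
  have mu := hS.measu
  have hη0 := hη.continuous
  have hη1 := hη.continuous_fderiv (by norm_num)
  have mη := hη0.measurable
  have hz0 : Continuous (atZero η) := hη0.comp isClosedEmbedding_atZero.continuous
  have hUK : MemLp (K.indicator U) 2 (wMeasure n a) :=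
    (memLp_indicator_iff_restrict hKm).2 (hS.memU K hKc hΩ)
  have hFK : ∀ k, MemLp (K.indicator (flux μ lam G k)) 2 (wMeasure n a) := fun k =>
    (memLp_indicator_iff_restrict hKm).2 (memLp_flux hS.measG (fun k => hS.memG k K hKc hΩ) k)
  have hgK := (memLp_indicator_iff_restrict hK0m).2 (hS.memg K hKc hΩ)
  obtain ⟨f, hf, hfc, c1, c2, c3⟩ := hS.approx η hη hηc hηs
  set v : Pt n := h • dirT with hv
  have hv0 : v.2.1 = 0 := by simp [hv, dirT]
  obtain ⟨M, hM⟩ := hηc.exists_bound_of_continuous hη0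
  -- `f j` approximates `η U` but its support is not controlled. The second factor `η` keeps the
  -- test functions supported in `tsupport η`, and their limit is `η² U`.
  set ψ : ℕ → Pt n → E n := fun j p => η p • f j p with hψdef
  have hψ : ∀ j, ContDiff ℝ ∞ (ψ j) := fun j => hη.smul (hf j)
  have hψc : ∀ j, HasCompactSupport (ψ j) := fun j => hηc.smul_right
  have hψs : ∀ j, tsupport (ψ j) ⊆ tsupport η := fun j => tsupport_smul_subset_left η (f j)
  have hfin := wMeasure_finite n ha
  have memψ : ∀ j, MemLp (ψ j) 2 (wMeasure n a) := fun j =>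
    (hψ j).continuous.memLp_of_hasCompactSupport (hψc j)
  set Φ : Pt n → E n := fun p => η p • η p • U p with hΦ
  have memΦ : MemLp Φ 2 (wMeasure n a) :=
    memLp_smul_of_tsupport hη0 hηc le_rfl (isClosed_tsupport η).measurableSet
      ((hS.memLp_cut hη0 hηc hηs).restrict _)
  have mΦ : Measurable Φ := by fun_prop
  have tψ : Tendsto (fun j => eLpNorm (ψ j - Φ) 2 (wMeasure n a)) atTop (𝓝 0) :=
    tendsto_eLpNorm_smul hM c1
  have hmp : MeasurePreserving (fun p : Pt n => p + v) (wMeasure n a) (wMeasure n a) :=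
    measurePreserving_add_tangential a hv0
  -- left-hand side
  have L : Tendsto (fun j => h⁻¹ * ∫ p, inner ℝ (K.indicator U p) (ψ j (p + v) - ψ j p)
      ∂(wMeasure n a)) atTop
      (𝓝 (h⁻¹ * ∫ p, inner ℝ (K.indicator U p) (Φ (p + v) - Φ p) ∂(wMeasure n a))) := by
    refine (tendsto_integral_inner (gs := fun j p => ψ j (p + v) - ψ j p)
      (g := fun p => Φ (p + v) - Φ p) hUK
      (fun j => ((memψ j).comp_measurePreserving hmp).sub (memψ j))
      ((memΦ.comp_measurePreserving hmp).sub memΦ) ?_).const_mul _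
    have t2 : Tendsto (fun j => eLpNorm ((ψ j - Φ) ∘ fun p => p + v) 2 (wMeasure n a)) atTop
        (𝓝 0) := by
      refine tψ.congr fun j => (eLpNorm_comp_measurePreserving ?_ hmp).symm
      exact ((hψ j).continuous.measurable.sub mΦ).aestronglyMeasurable
    have t3 := t2.add tψ
    rw [add_zero] at t3
    refine tendsto_of_tendsto_of_tendsto_of_le_of_le tendsto_const_nhds t3 (fun _ => zero_le)
      fun j => ?_
    have e : ((fun p => ψ j (p + v) - ψ j p) - fun p => Φ (p + v) - Φ p) =
        ((ψ j - Φ) ∘ fun p => p + v) - (ψ j - Φ) := by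
      ext1 p
      simp only [Pi.sub_apply, Function.comp_apply]
      abel
    simp only
    rw [e]
    have m1 := ((hψ j).continuous.measurable.sub mΦ)
    exact eLpNorm_sub_le (m1.comp (by fun_prop)).aestronglyMeasurable m1.aestronglyMeasurable
      (by norm_num)
  -- gradient terms
  have R1 : ∀ k, Tendsto (fun j => ∫ p, inner ℝ (K.indicator (flux μ lam G k) p)
      (avg (lineMeas v) (fun q => fderiv ℝ (ψ j) q (dir k)) p) ∂(wMeasure n a)) atTop
      (𝓝 (∫ p, inner ℝ (K.indicator (flux μ lam G k) p)
        (avg (lineMeas v) (testGrad η U G k) p) ∂(wMeasure n a))) := by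
    intro k
    have hb := avgBdd_lineMeas_tangential a hv0
    have mT := measurable_testGrad hη mU hS.measG k
    have memT := hS.memLp_testGrad hη hηc hηs k
    have hcd : ∀ j, Continuous fun q => fderiv ℝ (ψ j) q (dir k) := fun j =>
      ((hψ j).continuous_fderiv (by norm_num)).clm_apply continuous_const
    have memd : ∀ j, MemLp (fun q => fderiv ℝ (ψ j) q (dir k)) 2 (wMeasure n a) := fun j =>
      (hcd j).memLp_of_hasCompactSupport ((hψc j).fderiv_apply ℝ (dir k))
    refine tendsto_integral_inner (hFK k)
      (fun j => memLp_avg (by norm_num) hb (hcd j).measurable (memd j))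
      (memLp_avg (by norm_num) hb mT memT)
      (tendsto_avg_of_tendsto hb (fun j => (hcd j).measurable) memd mT memT ?_)
    have hcη : Continuous fun p => fderiv ℝ η p (dir k) := by fun_prop
    obtain ⟨M', hM'⟩ := (hηc.fderiv_apply ℝ (dir k)).exists_bound_of_continuous hcη
    have hcf : ∀ j, Continuous fun q => fderiv ℝ (f j) q (dir k) := fun j =>
      ((hf j).continuous_fderiv (by norm_num)).clm_apply continuous_const
    have mC := measurable_cutGrad hη mU hS.measG k
    have t1 := tendsto_eLpNorm_smul hM (c2 k)
    have t2 := tendsto_eLpNorm_smul hM' c1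
    refine (tendsto_eLpNorm_add (fun j => ?_) (fun j => ?_) t1 t2).congr fun j => ?_
    · have := (hcf j).measurable
      exact Measurable.aestronglyMeasurable (by fun_prop)
    · have := (hf j).continuous.measurable
      exact Measurable.aestronglyMeasurable (by fun_prop)
    · congr 1
      ext1 p
      simp only [Pi.sub_apply, Pi.add_apply, testGrad]
      rw [fderiv_smul_apply hη (hf j)]
  -- trace term
  have R2 : Tendsto (fun j => ∫ b, inner ℝ ({b : E n × ℝ | ((b.1, 0, b.2) : Pt n) ∈ K}.indicator g b)
      (avg (lineMeas (h • ((0, 1) : E n × ℝ))) (atZero (ψ j)) b)) atTop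
      (𝓝 (∫ b, inner ℝ ({b : E n × ℝ | ((b.1, 0, b.2) : Pt n) ∈ K}.indicator g b)
      (avg (lineMeas (h • ((0, 1) : E n × ℝ)))
        (fun b => atZero η b • atZero η b • u b) b))) := by
    have hb := avgBdd_lineMeas_volume (h • ((0, 1) : E n × ℝ))
    have hc : ∀ j, Continuous (atZero (ψ j)) := fun j =>
      (hψ j).continuous.comp isClosedEmbedding_atZero.continuous
    have mem0 : ∀ j, MemLp (atZero (ψ j)) 2 volume := fun j =>
      (hc j).memLp_of_hasCompactSupport (hasCompactSupport_atZero (hψc j))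
    have m0 : Measurable fun b => atZero η b • atZero η b • u b := by
      have := hz0.measurable; fun_prop
    have memu : MemLp (fun b => atZero η b • atZero η b • u b) 2 volume :=
      memLp_smul_of_tsupport hz0 (hasCompactSupport_atZero hηc) le_rfl (isClosed_tsupport _).measurableSet
        ((hS.memLp_cut_atZero hη0 hηc hηs).restrict _)
    refine tendsto_integral_inner hgK
      (fun j => memLp_avg (by norm_num) hb (hc j).measurable (mem0 j))
      (memLp_avg (by norm_num) hb m0 memu)
      (tendsto_avg_of_tendsto hb (fun j => (hc j).measurable) mem0 m0 memu ?_)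
    exact tendsto_eLpNorm_smul (fun b => hM _) c3
  refine tendsto_nhds_unique L (((tendsto_finsetSum _ fun k _ => R1 k).add R2).congr fun j => ?_)
  exact (hS.eq_timeAverage hh hhρ hΩ (hψ j) (hψc j) (hψs j)).symm

/-- Young's inequality for the mixed term. With `x`, `y` the values of `U` at times `t`, `t + h` and
`c`, `d` those of `η`, it replaces the identity `2 U · ∂ₜU = ∂ₜ|U|²`. -/
theorem inner_smul_smul_sub_le (c d : ℝ) (x y : E n) :
    inner ℝ x (d • d • y - c • c • x) ≤
      1 / 2 * ‖d • x‖ ^ 2 + 1 / 2 * ‖d • y‖ ^ 2 - ‖c • x‖ ^ 2 := by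
  have h1 : inner ℝ x (d • d • y) = inner ℝ (d • x) (d • y) := by
    rw [inner_smul_right, real_inner_smul_left]
  have h2 : inner ℝ x (c • c • x) = ‖c • x‖ ^ 2 := by
    rw [inner_smul_right, ← real_inner_smul_left, real_inner_self_eq_norm_sq]
  rw [inner_sub_right, h1, h2]
  have h3 := real_inner_le_norm (d • x) (d • y)
  nlinarith [sq_nonneg (‖d • x‖ - ‖d • y‖)]

theorem integral_inner_smul_sub_le {α : Type*} [MeasurableSpace α] {ν : Measure α} {K : Set α}
    {c d : α → ℝ} {x y : α → E n} (hc : ∀ p, p ∉ K → c p = 0) (hd : ∀ p, p ∉ K → d p = 0)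
    (hx : MemLp (K.indicator x) 2 ν) (i1 : Integrable (fun p => ‖c p • x p‖ ^ 2) ν)
    (i2 : Integrable (fun p => ‖d p • x p‖ ^ 2) ν) (i3 : Integrable (fun p => ‖d p • y p‖ ^ 2) ν)
    (hX : MemLp (fun p => d p • d p • y p - c p • c p • x p) 2 ν) :
    ∫ p, inner ℝ (K.indicator x p) (d p • d p • y p - c p • c p • x p) ∂ν ≤
      1 / 2 * ∫ p, ‖d p • x p‖ ^ 2 ∂ν + 1 / 2 * ∫ p, ‖d p • y p‖ ^ 2 ∂ν -
        ∫ p, ‖c p • x p‖ ^ 2 ∂ν := by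
  have j2 := i2.const_mul (1 / 2)
  have j3 := i3.const_mul (1 / 2)
  have j4 := j2.add j3
  rw [← integral_const_mul, ← integral_const_mul, ← integral_add j2 j3,
    ← integral_sub (f := fun p => 1 / 2 * ‖d p • x p‖ ^ 2 + 1 / 2 * ‖d p • y p‖ ^ 2) j4 i1]
  refine integral_mono (integrable_inner hx hX) (j4.sub i1) fun p => ?_
  rw [← inner_indicator_left (K := K) (f := x)
    (X := fun p => d p • d p • y p - c p • c p • x p) (fun p hp => by simp [hc p hp, hd p hp]) p]
  exact inner_smul_smul_sub_le _ _ _ _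

/-- The time term of the averaged equation is at most half the increment of `η²` integrated against
`|U|²`: the term with `U` at the later time becomes one at the current time by translation. Letting
`h → 0` removes the averages from the other terms. -/
theorem Sol.energy_le (hS : Sol Ω a μ lam U G u g) (ha : -1 < a)
    {η : Pt n → ℝ} (hη : ContDiff ℝ ∞ η) (hηc : HasCompactSupport η) {ρ : ℝ} (hρ : 0 < ρ)
    (hΩ : Metric.cthickening ρ (tsupport η) ⊆ Ω) {B : ℝ}
    (hB : ∀ h, 0 < h → h ≤ ρ →
      ∫ p, (η (p + h • dirT) ^ 2 - η p ^ 2) * ‖U p‖ ^ 2 ∂(wMeasure n a) ≤ h * B) :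
    ∑ k, ∫ p, inner ℝ (flux μ lam G k p) (testGrad η U G k p) ∂(wMeasure n a) +
      ∫ b, inner ℝ (g b) (atZero η b • atZero η b • u b) ≤ B / 2 := by
  set K := Metric.cthickening ρ (tsupport η) with hKdef
  have hηs : tsupport η ⊆ Ω := (Metric.self_subset_cthickening _).trans hΩ
  have hKc : IsCompact K := hηc.isCompact.cthickening
  have hKm : MeasurableSet K := hKc.isClosed.measurableSet
  have hK0m : MeasurableSet {b : E n × ℝ | ((b.1, 0, b.2) : Pt n) ∈ K} :=
    hKm.preimage (by fun_prop)
  have mU := hS.measU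
  have mu := hS.measu
  have hη0 := hη.continuous
  have mη := hη0.measurable
  have hz0 : Continuous (atZero η) := hη0.comp isClosedEmbedding_atZero.continuous
  have hUK : MemLp (K.indicator U) 2 (wMeasure n a) :=
    (memLp_indicator_iff_restrict hKm).2 (hS.memU K hKc hΩ)
  have hFK : ∀ k, MemLp (K.indicator (flux μ lam G k)) 2 (wMeasure n a) := fun k =>
    (memLp_indicator_iff_restrict hKm).2 (memLp_flux hS.measG (fun k => hS.memG k K hKc hΩ) k)
  have hgK := (memLp_indicator_iff_restrict hK0m).2 (hS.memg K hKc hΩ)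
  have hreg := wMeasure_regular n ha
  have hsK : tsupport η ⊆ K := Metric.self_subset_cthickening _
  have hηK : ∀ p, p ∉ K → η p = 0 := fun p hp =>
    image_eq_zero_of_notMem_tsupport fun h => hp (hsK h)
  have hdηK : ∀ k p, p ∉ K → fderiv ℝ η p (dir k) = 0 := fun k p hp => by
    rw [image_eq_zero_of_notMem_tsupport fun h' => hp (hsK (tsupport_fderiv_subset ℝ h'))]; rfl
  have hmp : ∀ h : ℝ, MeasurePreserving (fun p : Pt n => p + h • dirT)
      (wMeasure n a) (wMeasure n a) := fun h =>
    measurePreserving_add_tangential a (by simp [dirT])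
  have hcut := hS.memLp_cut hη0 hηc hηs
  have memΦ : MemLp (fun p => η p • η p • U p) 2 (wMeasure n a) :=
    memLp_smul_of_tsupport hη0 hηc le_rfl (isClosed_tsupport η).measurableSet (hcut.restrict _)
  have left : ∀ h, 0 < h → h ≤ ρ → h⁻¹ * ∫ p, inner ℝ (K.indicator U p)
        (η (p + h • dirT) • η (p + h • dirT) • U (p + h • dirT) - η p • η p • U p)
        ∂(wMeasure n a) ≤ B / 2 := by
    intro h h0 h1
    have hnear : ∀ p, p ∉ K → η (p + h • dirT) = 0 := fun p hp =>
      image_eq_zero_of_notMem_tsupport fun h' => hp (by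
        refine Metric.mem_cthickening_of_dist_le p (p + h • dirT) ρ _ h' ?_
        rw [dist_eq_norm]
        simp only [sub_add_cancel_left, norm_neg, norm_smul, norm_dirT, mul_one,
          Real.norm_of_nonneg h0.le]
        exact h1)
    have i1 : Integrable (fun p => ‖η p • U p‖ ^ 2) (wMeasure n a) := MemLp.integrable_norm_sq hcut
    have i1' : Integrable (fun p => ‖η (p + h • dirT) • U (p + h • dirT)‖ ^ 2) (wMeasure n a) :=
      (hmp h).integrable_comp_of_integrable (g := fun p => ‖η p • U p‖ ^ 2) i1
    have i2 : Integrable (fun p => ‖η (p + h • dirT) • U p‖ ^ 2) (wMeasure n a) := by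
      have hcc : HasCompactSupport fun p => η (p + h • dirT) :=
        hηc.comp_homeomorph (Homeomorph.addRight (h • (dirT : Pt n)))
      refine MemLp.integrable_norm_sq (memLp_smul_of_tsupport (by fun_prop) hcc (K := K) ?_ hKm
        (hS.memU K hKc hΩ))
      refine closure_minimal (fun p hp => ?_) hKc.isClosed
      by_contra hpK
      exact hp (hnear p hpK)
    -- The shifted square has the same integral, so half of it cancels against half of the negative
    -- term from Young's inequality.
    have e1 : ∫ p, ‖η (p + h • dirT) • U (p + h • dirT)‖ ^ 2 ∂(wMeasure n a) =
        ∫ p, ‖η p • U p‖ ^ 2 ∂(wMeasure n a) :=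
      (hmp h).integral_comp (MeasurableEquiv.addRight (h • (dirT : Pt n))).measurableEmbedding
        (fun p => ‖η p • U p‖ ^ 2)
    have e2 : ∫ p, (η (p + h • dirT) ^ 2 - η p ^ 2) * ‖U p‖ ^ 2 ∂(wMeasure n a) =
        ∫ p, ‖η (p + h • dirT) • U p‖ ^ 2 ∂(wMeasure n a) -
          ∫ p, ‖η p • U p‖ ^ 2 ∂(wMeasure n a) := by
      rw [← integral_sub i2 i1]
      refine integral_congr_ae (Eventually.of_forall fun p => ?_)
      simp only [norm_smul, mul_pow, Real.norm_eq_abs, sq_abs]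
      ring
    have hBh := hB h h0 h1
    rw [e2] at hBh
    have hle := integral_inner_smul_sub_le hηK hnear hUK i1 i2 i1'
      ((memΦ.comp_measurePreserving (hmp h)).sub memΦ)
    rw [e1] at hle
    rw [inv_mul_le_iff₀ h0]
    linarith
  have hsupp : ∀ ε > 0, ∀ᶠ h : ℝ in 𝓝[>] 0,
      lineMeas (h • (dirT : Pt n)) (Metric.closedBall 0 ε)ᶜ = 0 := fun ε hε => by
    filter_upwards [Ioc_mem_nhdsGT hε] with h hh
    refine lineMeas_compl_closedBall ?_
    rw [norm_smul, norm_dirT, mul_one, Real.norm_of_nonneg hh.1.le]; exact hh.2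
  have hsupp0 : ∀ ε > 0, ∀ᶠ h : ℝ in 𝓝[>] 0,
      lineMeas (h • ((0, 1) : E n × ℝ)) (Metric.closedBall 0 ε)ᶜ = 0 := fun ε hε => by
    filter_upwards [Ioc_mem_nhdsGT hε] with h hh
    refine lineMeas_compl_closedBall ?_
    have : ‖((0, 1) : E n × ℝ)‖ = 1 := by simp [Prod.norm_def]
    rw [norm_smul, this, mul_one, Real.norm_of_nonneg hh.1.le]; exact hh.2
  have m0 : Measurable fun b => atZero η b • atZero η b • u b := by
    have := hz0.measurable; fun_prop
  have memu : MemLp (fun b => atZero η b • atZero η b • u b) 2 volume :=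
    memLp_smul_of_tsupport hz0 (hasCompactSupport_atZero hηc) le_rfl (isClosed_tsupport _).measurableSet
      ((hS.memLp_cut_atZero hη0 hηc hηs).restrict _)
  have R1 : ∀ k, Tendsto (fun h : ℝ => ∫ p, inner ℝ (K.indicator (flux μ lam G k) p)
        (avg (lineMeas (h • dirT)) (testGrad η U G k) p) ∂(wMeasure n a)) (𝓝[>] 0)
        (𝓝 (∫ p, inner ℝ (K.indicator (flux μ lam G k) p) (testGrad η U G k p)
          ∂(wMeasure n a))) := fun k => by
    have hb : ∀ h : ℝ, AvgBdd (lineMeas (h • (dirT : Pt n))) (wMeasure n a) 1 := fun h =>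
      avgBdd_lineMeas_tangential a (by simp [dirT])
    have mT := measurable_testGrad hη mU hS.measG k
    have memT := hS.memLp_testGrad hη hηc hηs k
    exact tendsto_integral_inner (hFK k) (fun h => memLp_avg (by norm_num) (hb h) mT memT) memT
      (tendsto_avg (by norm_num) hb hsupp mT memT)
  have R2 : Tendsto (fun h : ℝ =>
      ∫ b, inner ℝ ({b : E n × ℝ | ((b.1, 0, b.2) : Pt n) ∈ K}.indicator g b)
        (avg (lineMeas (h • ((0, 1) : E n × ℝ))) (fun b => atZero η b • atZero η b • u b) b))
      (𝓝[>] 0) (𝓝 (∫ b, inner ℝ ({b : E n × ℝ | ((b.1, 0, b.2) : Pt n) ∈ K}.indicator g b)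
        (atZero η b • atZero η b • u b))) := by
    have hb : ∀ h : ℝ, AvgBdd (lineMeas (h • ((0, 1) : E n × ℝ))) volume 1 := fun h =>
      avgBdd_lineMeas_volume _
    exact tendsto_integral_inner hgK (fun h => memLp_avg (by norm_num) (hb h) m0 memu) memu
      (tendsto_avg (by norm_num) hb hsupp0 m0 memu)
  have hfinal := le_of_tendsto ((tendsto_finsetSum _ fun k _ => R1 k).add R2)
    (by
      filter_upwards [Ioc_mem_nhdsGT hρ] with h hh
      rw [← hS.eq_timeAverage_cut ha hη hηc hΩ hh.1 hh.2]
      exact left h hh.1 hh.2)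
  have e1 : ∀ k p, inner ℝ (flux μ lam G k p) (testGrad η U G k p) =
      inner ℝ (K.indicator (flux μ lam G k) p) (testGrad η U G k p) := fun k =>
    inner_indicator_left fun p hp => by simp [testGrad, hηK p hp]
  have e2 : ∀ b, inner ℝ (g b) (atZero η b • atZero η b • u b) =
      inner ℝ ({b : E n × ℝ | ((b.1, 0, b.2) : Pt n) ∈ K}.indicator g b)
        (atZero η b • atZero η b • u b) :=
    inner_indicator_left fun b hb => by simp [atZero, hηK _ hb]
  simp only [e1, e2]
  exact hfinal

end Energy

end LameExt

namespace LameExt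

open scoped ENNReal

variable {n : ℕ}

/-! ### The quadratic form and its coercivity -/

section QuadraticForm

/-- The quadratic form of the equation. -/
noncomputable def quad (μ lam : ℝ) (X : Option (Fin n) → Pt n → E n) (p : Pt n) : ℝ :=
  ‖X none p‖ ^ 2 + μ * ∑ i, ‖X (some i) p‖ ^ 2 + (μ + lam) * divOf X p ^ 2

theorem sum_inner_flux (μ lam : ℝ) (X Z : Option (Fin n) → Pt n → E n) (p : Pt n) :
    ∑ k, inner ℝ (flux μ lam X k p) (Z k p) =
      inner ℝ (X none p) (Z none p) + μ * ∑ i, inner ℝ (X (some i) p) (Z (some i) p) +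
        (μ + lam) * divOf X p * divOf Z p := by
  rw [Fintype.sum_option]
  simp only [flux, inner_add_left, real_inner_smul_left, EuclideanSpace.inner_single_left,
    Finset.sum_add_distrib, ← Finset.mul_sum, divOf]
  simp [add_assoc]

/-- Completing the square: for a symmetric form, pairing `∇U` with `∇(η² U)` gives the form at `∇(η
U)` minus the form at `∇η ⊗ U`. The first is coercive after integration since `η U` has compact
support; the second is of order zero in `U`. -/
theorem sum_inner_flux_testGrad (μ lam : ℝ) (η : Pt n → ℝ) (U : Pt n → E n)
    (G : Option (Fin n) → Pt n → E n) (p : Pt n) :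
    ∑ k, inner ℝ (flux μ lam G k p) (testGrad η U G k p) =
      quad μ lam (cutGrad η U G) p - quad μ lam (fun k p => fderiv ℝ η p (dir k) • U p) p := by
  have h : ∀ k, inner ℝ (G k p) (testGrad η U G k p) =
      ‖cutGrad η U G k p‖ ^ 2 - ‖fderiv ℝ η p (dir k) • U p‖ ^ 2 := fun k => by
    simp only [testGrad, cutGrad]
    rw [norm_add_sq_real, inner_add_right, inner_smul_right, inner_add_right, inner_smul_right,
      inner_smul_right, inner_smul_right, inner_smul_right, real_inner_smul_left, inner_smul_right,
      real_inner_self_eq_norm_sq, norm_smul (η p), mul_pow, Real.norm_eq_abs, sq_abs]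
    ring
  have hd1 : divOf (testGrad η U G) p = η p * (divOf (cutGrad η U G) p +
      divOf (fun k p => fderiv ℝ η p (dir k) • U p) p) := by
    simp only [divOf, ← Finset.sum_add_distrib, Finset.mul_sum]
    refine Finset.sum_congr rfl fun i _ => ?_
    simp [testGrad, cutGrad]; ring
  have hd2 : divOf (cutGrad η U G) p = η p * divOf G p +
      divOf (fun k p => fderiv ℝ η p (dir k) • U p) p := by
    simp only [divOf, ← Finset.sum_add_distrib, Finset.mul_sum]
    refine Finset.sum_congr rfl fun i _ => ?_
    simp [cutGrad]
  rw [sum_inner_flux, h]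
  simp only [h, quad, Finset.sum_sub_distrib]
  rw [hd1, hd2]
  ring

theorem divOf_sq_le (X : Option (Fin n) → Pt n → E n) (p : Pt n) :
    divOf X p ^ 2 ≤ n * ∑ i, ‖X (some i) p‖ ^ 2 := by
  have h := sq_sum_le_card_mul_sum_sq (s := (Finset.univ : Finset (Fin n)))
    (f := fun i => X (some i) p i)
  simp only [Finset.card_univ, Fintype.card_fin] at h
  refine h.trans ?_
  refine mul_le_mul_of_nonneg_left (Finset.sum_le_sum fun i _ => ?_) (Nat.cast_nonneg n)
  exact sq_le_sq.2 ((PiLp.norm_apply_le (X (some i) p) i).trans (le_abs_self _))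

theorem quad_le {μ lam Λ : ℝ} (hμ0 : 0 ≤ μ) (hμ : μ ≤ Λ) (hlam : |lam| ≤ Λ)
    (X : Option (Fin n) → Pt n → E n) (p : Pt n) :
    quad μ lam X p ≤ (1 + Λ + 2 * Λ * n) * ∑ k, ‖X k p‖ ^ 2 := by
  have h1 := divOf_sq_le X p
  have h0 : 0 ≤ ∑ i, ‖X (some i) p‖ ^ 2 := Finset.sum_nonneg fun i _ => sq_nonneg _
  have hl := abs_le.1 hlam
  have hn : (0 : ℝ) ≤ n := Nat.cast_nonneg n
  rw [Fintype.sum_option, quad]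
  have e1 : μ * ∑ i, ‖X (some i) p‖ ^ 2 ≤ Λ * ∑ i, ‖X (some i) p‖ ^ 2 := by gcongr
  have e2 : (μ + lam) * divOf X p ^ 2 ≤ 2 * Λ * (n * ∑ i, ‖X (some i) p‖ ^ 2) :=
    (mul_le_mul_of_nonneg_right (by linarith) (sq_nonneg _)).trans
      (mul_le_mul_of_nonneg_left h1 (by linarith))
  have e3 : 0 ≤ (Λ + 2 * Λ * n) * ‖X none p‖ ^ 2 := by
    have : 0 ≤ Λ := hμ0.trans hμ
    positivity
  linarith

variable {a μ lam : ℝ}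

theorem memLp_divOf {X : Option (Fin n) → Pt n → E n} {ν : Measure (Pt n)}
    (hX : ∀ k, MemLp (X k) 2 ν) : MemLp (divOf X) 2 ν := by
  unfold divOf
  exact memLp_finsetSum _ fun i _ => (hX (some i)).mono
    ((EuclideanSpace.proj (𝕜 := ℝ) i).continuous.comp_aestronglyMeasurable (hX (some i)).1)
    (Eventually.of_forall fun p => PiLp.norm_apply_le _ i)

theorem integrable_quad {X : Option (Fin n) → Pt n → E n} {ν : Measure (Pt n)}
    (hX : ∀ k, MemLp (X k) 2 ν) : Integrable (quad μ lam X) ν := by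
  have hd := MemLp.integrable_norm_sq (memLp_divOf hX)
  simp only [Real.norm_eq_abs, sq_abs] at hd
  have h1 := fun k => MemLp.integrable_norm_sq (hX k)
  exact ((h1 none).add ((integrable_finsetSum _ fun i _ => h1 (some i)).const_mul μ)).add
    (hd.const_mul (μ + lam))

theorem integral_quad {X : Option (Fin n) → Pt n → E n} {ν : Measure (Pt n)}
    (hX : ∀ k, MemLp (X k) 2 ν) : ∫ p, quad μ lam X p ∂ν =
      ∫ p, ‖X none p‖ ^ 2 ∂ν + μ * ∑ i, ∫ p, ‖X (some i) p‖ ^ 2 ∂ν +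
        (μ + lam) * ∫ p, divOf X p ^ 2 ∂ν := by
  have hd := MemLp.integrable_norm_sq (memLp_divOf hX)
  simp only [Real.norm_eq_abs, sq_abs] at hd
  have h1 := fun k => MemLp.integrable_norm_sq (hX k)
  have h2 := (integrable_finsetSum Finset.univ fun i _ => h1 (some i)).const_mul μ
  have h3 := (h1 none).add h2
  unfold quad
  rw [integral_add (f := fun p => ‖X none p‖ ^ 2 + μ * ∑ i, ‖X (some i) p‖ ^ 2) h3
    (hd.const_mul _), integral_add (h1 none) h2, integral_const_mul, integral_const_mul,
    integral_finsetSum _ fun i _ => h1 (some i)]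

/-- If `μ + lam ≥ 0`, the divergence term is dropped. Otherwise the divergence inequality replaces
it by `(μ + lam) ∫ |∇ₓ w|²`, and the total coefficient is `2μ + lam ≥ δ₀`. -/
theorem H1Approx.coercive (ha : -1 < a) {w : Pt n → E n} {W : Option (Fin n) → Pt n → E n}
    {w0 : E n × ℝ → E n} (h : H1Approx a w W w0) (hW : ∀ k, MemLp (W k) 2 (wMeasure n a))
    {δ₀ : ℝ} (h1 : δ₀ ≤ μ) (h2 : δ₀ ≤ 2 * μ + lam) :
    min 1 δ₀ * ∑ k, ∫ p, ‖W k p‖ ^ 2 ∂(wMeasure n a) ≤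
      ∫ p, quad μ lam W p ∂(wMeasure n a) := by
  have hdiv := h.eLpNorm_div_le ha hW
  have hd := memLp_divOf hW
  have hnn : ∀ k, 0 ≤ ∫ p, ‖W k p‖ ^ 2 ∂(wMeasure n a) := fun k =>
    integral_nonneg fun p => sq_nonneg _
  rw [eLpNorm_sq_eq_ofReal hd, Finset.sum_congr rfl fun i _ => eLpNorm_sq_eq_ofReal (hW (some i)),
    ← ENNReal.ofReal_sum_of_nonneg fun i _ => hnn (some i),
    ENNReal.ofReal_le_ofReal_iff (Finset.sum_nonneg fun i _ => hnn (some i))] at hdiv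
  simp only [Real.norm_eq_abs, sq_abs] at hdiv
  have hd0 : 0 ≤ ∫ p, divOf W p ^ 2 ∂(wMeasure n a) := integral_nonneg fun p => sq_nonneg _
  rw [integral_quad hW, Fintype.sum_option]
  set S := ∑ i, ∫ p, ‖W (some i) p‖ ^ 2 ∂(wMeasure n a)
  have hS : 0 ≤ S := Finset.sum_nonneg fun i _ => hnn (some i)
  have m1 : min 1 δ₀ * ∫ p, ‖W none p‖ ^ 2 ∂(wMeasure n a) ≤
      1 * ∫ p, ‖W none p‖ ^ 2 ∂(wMeasure n a) :=
    mul_le_mul_of_nonneg_right (min_le_left _ _) (hnn none)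
  have m2 : min 1 δ₀ * S ≤ δ₀ * S := mul_le_mul_of_nonneg_right (min_le_right _ _) hS
  have m3 : δ₀ * S ≤ μ * S + (μ + lam) * ∫ p, divOf W p ^ 2 ∂(wMeasure n a) := by
    rcases le_total 0 (μ + lam) with h' | h'
    · have := mul_nonneg h' hd0
      have := mul_le_mul_of_nonneg_right h1 hS
      linarith
    · have := mul_le_mul_of_nonpos_left hdiv h'
      have := mul_le_mul_of_nonneg_right h2 hS
      linarith
  linarith

end QuadraticForm

/-! ### Energy inequality with the boundary term absorbed -/

section Caccioppoli

variable {Ω : Set (Pt n)} {a μ lam : ℝ} {U : Pt n → E n}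
    {G : Option (Fin n) → Pt n → E n} {u g : E n × ℝ → E n}

theorem Sol.coercive_energy_le (hS : Sol Ω a μ lam U G u g) (ha : -1 < a)
    {δ₀ Λ : ℝ} (hδ₀ : 0 < δ₀) (h1 : δ₀ ≤ μ) (h2 : δ₀ ≤ 2 * μ + lam) (h3 : μ ≤ Λ) (h4 : |lam| ≤ Λ)
    {η : Pt n → ℝ} (hη : ContDiff ℝ ∞ η) (hηc : HasCompactSupport η) {ρ : ℝ} (hρ : 0 < ρ)
    (hΩ : Metric.cthickening ρ (tsupport η) ⊆ Ω) {B : ℝ}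
    (hB : ∀ h, 0 < h → h ≤ ρ →
      ∫ p, (η (p + h • dirT) ^ 2 - η p ^ 2) * ‖U p‖ ^ 2 ∂(wMeasure n a) ≤ h * B) :
    min 1 δ₀ * ∑ k, ∫ p, ‖cutGrad η U G k p‖ ^ 2 ∂(wMeasure n a) +
      ∫ b, inner ℝ (g b) (atZero η b • atZero η b • u b) ≤ B / 2 +
        (1 + Λ + 2 * Λ * n) * ∑ k, ∫ p, ‖fderiv ℝ η p (dir k) • U p‖ ^ 2 ∂(wMeasure n a) := by
  have hηs : tsupport η ⊆ Ω := (Metric.self_subset_cthickening _).trans hΩ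
  have hηK : ∀ p, p ∉ tsupport η → η p = 0 := fun p hp => image_eq_zero_of_notMem_tsupport hp
  have hW := fun k => hS.memLp_cutGrad hη hηc hηs k
  have hY : ∀ k, MemLp (fun p => fderiv ℝ η p (dir k) • U p) 2 (wMeasure n a) := fun k =>
    memLp_smul_of_tsupport
    ((hη.continuous_fderiv (by norm_num)).clm_apply (continuous_const (y := dir k)))
    (hηc.fderiv_apply ℝ (dir k)) (tsupport_fderiv_apply_subset ℝ (dir k))
    (isClosed_tsupport η).measurableSet (hS.memU _ hηc.isCompact hηs)
  have hen := hS.energy_le ha hη hηc hρ hΩ hB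
  have hKm := (isClosed_tsupport η).measurableSet
  have hint : ∀ k, Integrable (fun p => inner ℝ (flux μ lam G k p) (testGrad η U G k p))
      (wMeasure n a) := fun k => by
    have hF := (memLp_indicator_iff_restrict hKm).2 (memLp_flux (μ := μ) (lam := lam) hS.measG
      (fun k => hS.memG k _ hηc.isCompact hηs) k)
    refine (integrable_inner hF (hS.memLp_testGrad hη hηc hηs k)).congr
      (Eventually.of_forall fun p => (inner_indicator_left (fun p hp => ?_) p).symm)
    simp [testGrad, hηK p hp]
  rw [← integral_finsetSum _ fun k _ => hint k,
    integral_congr_ae (Eventually.of_forall fun p => sum_inner_flux_testGrad μ lam η U G p),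
    integral_sub (integrable_quad hW) (integrable_quad hY)] at hen
  have hco := (hS.approx η hη hηc hηs).coercive ha hW h1 h2
  have hup : ∫ p, quad μ lam (fun k p => fderiv ℝ η p (dir k) • U p) p ∂(wMeasure n a) ≤
      (1 + Λ + 2 * Λ * n) * ∑ k, ∫ p, ‖fderiv ℝ η p (dir k) • U p‖ ^ 2 ∂(wMeasure n a) := by
    have hi := fun k => MemLp.integrable_norm_sq (hY k)
    rw [← integral_finsetSum _ fun k _ => hi k, ← integral_const_mul]
    exact integral_mono (integrable_quad hY) ((integrable_finsetSum _ fun k _ => hi k).const_mul _)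
      fun p => quad_le (hδ₀.le.trans h1) h3 h4 _ p
  linarith

/-- `V` contributes at worst `-K |e u|²`, and Young's inequality on the cross term with `b` costs
one more `|e u|²`. -/
theorem neg_le_integral_inner_boundary {α : Type*} [MeasurableSpace α] {ν : Measure α}
    {e V : α → ℝ} {u g b : α → E n} {K : ℝ} (hV : ∀ x, |V x| ≤ K)
    (hg : ∀ x, g x = V x • u x + b x) (hu : MemLp (fun x => e x • u x) 2 ν)
    (hb : MemLp (fun x => e x • b x) 2 ν) (hge : MemLp (fun x => e x • g x) 2 ν) :
    -((K + 1) * ∫ x, ‖e x • u x‖ ^ 2 ∂ν + ∫ x, ‖e x • b x‖ ^ 2 ∂ν) ≤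
      ∫ x, inner ℝ (g x) (e x • e x • u x) ∂ν := by
  have h : ∀ x, inner ℝ (g x) (e x • e x • u x) = inner ℝ (e x • g x) (e x • u x) := fun x => by
    rw [inner_smul_right, real_inner_smul_left]
  have i1 := MemLp.integrable_norm_sq hu
  have i2 := MemLp.integrable_norm_sq hb
  rw [← integral_const_mul, ← integral_add (i1.const_mul _) i2, ← integral_neg]
  simp only [h]
  refine integral_mono ((i1.const_mul _).add i2).neg (integrable_inner hge hu) fun x => ?_
  simp only [hg x, smul_add, inner_add_left]
  rw [smul_comm, real_inner_smul_left, real_inner_self_eq_norm_sq]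
  have e1 := (abs_le.1 (hV x)).1
  have e2 := (abs_le.1 (abs_real_inner_le_norm (e x • b x) (e x • u x))).1
  generalize ‖e x • u x‖ = r at *
  generalize ‖e x • b x‖ = t at *
  have e3 : -K * r ^ 2 ≤ V x * r ^ 2 := mul_le_mul_of_nonneg_right e1 (sq_nonneg _)
  nlinarith [sq_nonneg (t - r), sq_nonneg t, sq_nonneg r]

/-- The arithmetic of the absorption: `X` is the energy of `η U`, `T` its squared trace, `Z` the
norm of `η U`, `Y` that of `∇η ⊗ U`. With this `ε` one has `(K + 1) ε = c0 / 2`, so half of the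
coercive term remains. -/
theorem absorb_le {c0 C0 K ε A X Y Z T B b I : ℝ} (hc0 : 0 < c0) (hK : 0 ≤ K)
    (hε : ε = c0 / (2 * (K + 1))) (hA : 0 ≤ A) (hY : 0 ≤ Y) (hZ : 0 ≤ Z)
    (hB : 0 ≤ B) (hb : 0 ≤ b) (hT : T ≤ A * Z + ε * X)
    (hI : -((K + 1) * T + b) ≤ I) (h : c0 * X + I ≤ B / 2 + C0 * Y) :
    X + T ≤ ((1 + ε) * (2 / c0 * (1 + |C0| + (K + 1) * A)) + A) * (B + Y + Z + b) := by
  set M : ℝ := 1 + |C0| + (K + 1) * A with hM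
  have hε0 : 0 < ε := by rw [hε]; positivity
  have hC1 : C0 * Y ≤ |C0| * Y := mul_le_mul_of_nonneg_right (le_abs_self _) hY
  have hkey : c0 / 2 * X ≤ M * (B + Y + Z + b) := by
    have hKT : (K + 1) * T ≤ (K + 1) * A * Z + c0 / 2 * X := by
      have := mul_le_mul_of_nonneg_left hT (by positivity : 0 ≤ K + 1)
      have e : (K + 1) * (ε * X) = c0 / 2 * X := by rw [hε]; field_simp
      rw [mul_add, e] at this
      linarith
    have p1 : 0 ≤ (|C0| + (K + 1) * A) * (B + b) := by positivity
    have p2 : 0 ≤ (1 + (K + 1) * A) * Y := by positivity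
    have p3 : 0 ≤ (1 + |C0|) * Z := by positivity
    rw [hM]
    linarith
  have hX : X ≤ 2 / c0 * M * (B + Y + Z + b) := by
    have := mul_le_mul_of_nonneg_left hkey (by positivity : 0 ≤ 2 / c0)
    have e : 2 / c0 * (c0 / 2 * X) = X := by field_simp
    rw [e] at this
    linarith
  have hAZ : A * Z ≤ A * (B + Y + Z + b) := mul_le_mul_of_nonneg_left (by linarith) hA
  have := mul_le_mul_of_nonneg_left hX (by positivity : 0 ≤ 1 + ε)
  linarith

/-- A Caccioppoli inequality with the boundary term absorbed. -/
theorem exists_energy_le (n : ℕ) {a : ℝ} (ha : -1 < a) (ha1 : a < 1) {δ₀ : ℝ} (hδ₀ : 0 < δ₀)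
    (Λ : ℝ) {K : ℝ} (hK : 0 ≤ K) :
    ∃ C : ℝ, 0 ≤ C ∧ ∀ (Ω : Set (Pt n)) (μ lam : ℝ) (U : Pt n → E n)
      (G : Option (Fin n) → Pt n → E n) (u g b : E n × ℝ → E n) (V : E n × ℝ → ℝ)
      (η : Pt n → ℝ) (ρ B : ℝ),
      δ₀ ≤ μ → δ₀ ≤ 2 * μ + lam → μ ≤ Λ → |lam| ≤ Λ → Sol Ω a μ lam U G u g →
      (∀ x, |V x| ≤ K) → (∀ x, g x = V x • u x + b x) →
      ContDiff ℝ ∞ η → HasCompactSupport η → 0 < ρ →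
      Metric.cthickening ρ (tsupport η) ⊆ Ω → 0 ≤ B →
      MemLp (fun x => atZero η x • b x) 2 volume →
      (∀ h, 0 < h → h ≤ ρ →
        ∫ p, (η (p + h • dirT) ^ 2 - η p ^ 2) * ‖U p‖ ^ 2 ∂(wMeasure n a) ≤ h * B) →
      ∑ k, ∫ p, ‖cutGrad η U G k p‖ ^ 2 ∂(wMeasure n a) + ∫ x, ‖atZero η x • u x‖ ^ 2 ≤
        C * (B + ∑ k, ∫ p, ‖fderiv ℝ η p (dir k) • U p‖ ^ 2 ∂(wMeasure n a) +
          ∫ p, ‖η p • U p‖ ^ 2 ∂(wMeasure n a) + ∫ x, ‖atZero η x • b x‖ ^ 2) := by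
  have hc0 : 0 < min 1 δ₀ := lt_min one_pos hδ₀
  set c0 := min 1 δ₀
  set ε : ℝ := c0 / (2 * (K + 1)) with hε
  have hε0 : 0 < ε := by positivity
  obtain ⟨A, hA, htr⟩ := H1Approx.exists_trace_le (n := n) ha ha1 (ENNReal.ofReal_pos.2 hε0)
  set A' := A.toReal
  have hA' : 0 ≤ A' := ENNReal.toReal_nonneg
  refine ⟨(1 + ε) * (2 / c0 * (1 + |1 + Λ + 2 * Λ * n| + (K + 1) * A')) + A', by positivity, ?_⟩
  intro Ω μ lam U G u g b V η ρ B h1 h2 h3 h4 hS hV hg hη hηc hρ hΩ hB0 hb hB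
  have hηs : tsupport η ⊆ Ω := (Metric.self_subset_cthickening _).trans hΩ
  have hW := fun k => hS.memLp_cutGrad hη hηc hηs k
  have hU := hS.memLp_cut hη.continuous hηc hηs
  have hu := hS.memLp_cut_atZero hη.continuous hηc hηs
  have hen := hS.coercive_energy_le ha hδ₀ h1 h2 h3 h4 hη hηc hρ hΩ hB
  have ht := htr _ _ _ (hS.approx η hη hηc hηs) hU (hW none) hu
  have hnn : ∀ k, 0 ≤ ∫ p, ‖cutGrad η U G k p‖ ^ 2 ∂(wMeasure n a) := fun k =>
    integral_nonneg fun p => sq_nonneg _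
  have hU0 : 0 ≤ ∫ p, ‖η p • U p‖ ^ 2 ∂(wMeasure n a) := integral_nonneg fun p => sq_nonneg _
  have hb0 : 0 ≤ ∫ x, ‖atZero η x • b x‖ ^ 2 := integral_nonneg fun p => sq_nonneg _
  have hY0 : 0 ≤ ∑ k, ∫ p, ‖fderiv ℝ η p (dir k) • U p‖ ^ 2 ∂(wMeasure n a) :=
    Finset.sum_nonneg fun k _ => integral_nonneg fun p => sq_nonneg _
  rw [eLpNorm_sq_eq_ofReal hU, eLpNorm_sq_eq_ofReal (hW none), eLpNorm_sq_eq_ofReal hu,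
    ← ENNReal.ofReal_toReal hA, ← ENNReal.ofReal_mul hA', ← ENNReal.ofReal_mul hε0.le,
    ← ENNReal.ofReal_add (mul_nonneg hA' hU0) (mul_nonneg hε0.le (hnn none)),
    ENNReal.ofReal_le_ofReal_iff (add_nonneg (mul_nonneg hA' hU0)
      (mul_nonneg hε0.le (hnn none)))] at ht
  have hge : MemLp (fun x => atZero η x • g x) 2 volume :=
    memLp_smul_of_tsupport (hη.continuous.comp isClosedEmbedding_atZero.continuous)
      (hasCompactSupport_atZero hηc)
      (tsupport_atZero_subset η) (((isClosed_tsupport η).preimage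
      isClosedEmbedding_atZero.continuous).measurableSet) (hS.memg _ hηc.isCompact hηs)
  have hsum : ∫ p, ‖cutGrad η U G none p‖ ^ 2 ∂(wMeasure n a) ≤
      ∑ k, ∫ p, ‖cutGrad η U G k p‖ ^ 2 ∂(wMeasure n a) :=
    Finset.single_le_sum (f := fun k => ∫ p, ‖cutGrad η U G k p‖ ^ 2 ∂(wMeasure n a))
      (fun k _ => hnn k) (Finset.mem_univ none)
  exact absorb_le hc0 hK hε hA' hY0 hU0 hB0 hb0
    (ht.trans (add_le_add le_rfl (mul_le_mul_of_nonneg_left hsum hε0.le)))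
    (neg_le_integral_inner_boundary hV hg hu hb hge) hen

end Caccioppoli

end LameExt

namespace LameExt

open scoped ENNReal

variable {n : ℕ}

/-! ### Cut-off functions in space and time -/

section Cutoff

theorem lintegral_enorm_sq_eq_ofReal {α F : Type*} [MeasurableSpace α] {μ : Measure α}
    [NormedAddCommGroup F] {f : α → F} (hf : MemLp f 2 μ) :
    ∫⁻ x, ‖f x‖ₑ ^ 2 ∂μ = ENNReal.ofReal (∫ x, ‖f x‖ ^ 2 ∂μ) := by
  rw [← eLpNorm_sq, eLpNorm_sq_eq_ofReal hf]

open scoped Manifold in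
-- `η` equals `1` near every point of `S`, not just on it, so that its gradient vanishes there too.
-- The radius `ρ` leaves room for forward shifts in time.
theorem exists_cutoff {S N : Set (Pt n)} (hS : IsCompact S) (hN : IsOpen N) (hSN : S ⊆ N) :
    ∃ (η : Pt n → ℝ) (ρ : ℝ), ContDiff ℝ ∞ η ∧ HasCompactSupport η ∧ 0 < ρ ∧
      Metric.cthickening ρ (tsupport η) ⊆ N ∧ (∀ p, 0 ≤ η p ∧ η p ≤ 1) ∧
      ∀ p ∈ S, η =ᶠ[𝓝 p] fun _ => 1 := by
  obtain ⟨δ, hδ, hδN⟩ := hS.exists_cthickening_subset_open hN hSN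
  obtain ⟨f, h1, h0, hf⟩ := exists_contMDiffMap_one_nhds_of_subset_interior (n := (⊤ : ℕ∞)) 𝓘(ℝ, Pt n)
    (s := S) (t := Metric.cthickening δ S) hS.isClosed
    ((Metric.self_subset_thickening hδ S).trans
      (interior_maximal (Metric.thickening_subset_cthickening _ _) Metric.isOpen_thickening))
  have hsub : tsupport (f : Pt n → ℝ) ⊆ Metric.cthickening δ S :=
    closure_minimal (fun p hp => by
      by_contra hp'
      exact hp (h0 p hp')) Metric.isClosed_cthickening
  have hc : HasCompactSupport (f : Pt n → ℝ) :=
    hS.cthickening.of_isClosed_subset (isClosed_tsupport _) hsub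
  obtain ⟨ρ, hρ, hρN⟩ := hc.isCompact.exists_cthickening_subset_open hN (hsub.trans hδN)
  exact ⟨f, ρ, contMDiff_iff_contDiff.1 f.contMDiff, hc, hρ, hρN, fun p => hf p, fun p hp =>
    h1.filter_mono (nhds_le_nhdsSet hp)⟩

/-- A smooth nonincreasing function of time, equal to `1` for `t ≤ -2τ` and to `0` for
`t ≥ -τ`. -/
noncomputable def timeCut (τ : ℝ) (p : Pt n) : ℝ := Real.smoothTransition (-p.2.2 / τ - 1)

variable {τ : ℝ}

theorem contDiff_timeCut : ContDiff ℝ ∞ (timeCut τ : Pt n → ℝ) := by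
  have : ContDiff ℝ ∞ Real.smoothTransition := Real.smoothTransition.contDiff
  unfold timeCut
  fun_prop

theorem timeCut_nonneg (p : Pt n) : 0 ≤ timeCut τ p := Real.smoothTransition.nonneg _

theorem timeCut_le_one (p : Pt n) : timeCut τ p ≤ 1 := Real.smoothTransition.le_one _

theorem timeCut_eq_one (hτ : 0 < τ) {p : Pt n} (hp : p.2.2 ≤ -(2 * τ)) : timeCut τ p = 1 := by
  refine Real.smoothTransition.one_of_one_le ?_
  rw [le_sub_iff_add_le, le_div_iff₀ hτ]
  linarith

theorem timeCut_eq_zero (hτ : 0 < τ) {p : Pt n} (hp : -τ ≤ p.2.2) : timeCut τ p = 0 := by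
  refine Real.smoothTransition.zero_of_nonpos ?_
  rw [sub_nonpos, div_le_one hτ]
  linarith

theorem timeCut_add_le (hτ : 0 < τ) {h : ℝ} (hh : 0 ≤ h) (p : Pt n) :
    timeCut τ (p + h • dirT) ≤ timeCut τ p := by
  refine Real.smoothTransition.monotone ?_
  have : (p + h • dirT).2.2 = p.2.2 + h := by simp [dirT]
  rw [this]
  gcongr
  linarith

theorem fderiv_timeCut (p : Pt n) (k : Option (Fin n)) :
    fderiv ℝ (timeCut τ : Pt n → ℝ) p (dir k) = 0 := by
  rw [← ((contDiff_timeCut (n := n) (τ := τ)).differentiable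
    (by norm_num)).differentiableAt.lineDeriv_eq_fderiv, lineDeriv]
  have : (fun t : ℝ => (timeCut τ (p + t • dir k) : ℝ)) = fun _ => timeCut τ p := by
    ext1 t
    have : (dir k : Pt n).2.2 = 0 := by cases k <;> rfl
    simp [timeCut, this]
  rw [this]
  simp

variable {η₀ : Pt n → ℝ}

theorem fderiv_mul_timeCut (hη : ContDiff ℝ ∞ η₀) (p : Pt n) (k : Option (Fin n)) :
    fderiv ℝ (fun p => η₀ p * timeCut τ p) p (dir k) = timeCut τ p * fderiv ℝ η₀ p (dir k) := by
  have h := ((hη.differentiable (by norm_num)).differentiableAt.hasFDerivAt (x := p)).mul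
    (((contDiff_timeCut (n := n) (τ := τ)).differentiable (by norm_num)).differentiableAt.hasFDerivAt)
  have h := h.fderiv
  change fderiv ℝ (fun p => η₀ p * timeCut τ p) p = _ at h
  rw [h]
  simp [fderiv_timeCut]

theorem cutGrad_mul_timeCut (hη : ContDiff ℝ ∞ η₀) (hτ : 0 < τ) {p : Pt n}
    (h1 : η₀ =ᶠ[𝓝 p] fun _ => 1) (hp : p.2.2 ≤ -(2 * τ)) (U : Pt n → E n)
    (G : Option (Fin n) → Pt n → E n) (k : Option (Fin n)) :
    cutGrad (fun p => η₀ p * timeCut τ p) U G k p = G k p := by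
  rw [cutGrad, fderiv_mul_timeCut hη, h1.fderiv_eq, h1.self_of_nhds, timeCut_eq_one hτ hp]
  simp

/-- The product vanishes for `t > -τ`; thickening by at most `τ / 2` still leaves a strip before the
final time, where the weak formulation applies. -/
theorem cthickening_tsupport_mul_timeCut (hτ : 0 < τ) {ρ : ℝ} :
    Metric.cthickening (min ρ (τ / 2)) (tsupport fun p => η₀ p * timeCut τ p) ⊆
      Metric.cthickening ρ (tsupport η₀) ∩ {p | p.2.2 ≤ -(τ / 2)} := by
  have hs1 : tsupport (fun p => η₀ p * timeCut τ p) ⊆ tsupport η₀ :=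
    tsupport_mul_subset_left
  have hs2 : tsupport (fun p => η₀ p * timeCut τ p) ⊆ {p : Pt n | p.2.2 ≤ -τ} := by
    refine closure_minimal (fun p hp => ?_) (isClosed_le (by fun_prop) continuous_const)
    by_contra h
    exact hp (by simp [timeCut_eq_zero hτ (not_le.1 h).le])
  intro p hp
  refine ⟨Metric.cthickening_mono (min_le_left _ _) _
    (Metric.cthickening_subset_of_subset _ hs1 hp), ?_⟩
  have hp' := Metric.cthickening_mono (min_le_right ρ (τ / 2)) _
    (Metric.cthickening_subset_of_subset _ hs2 hp)
  rw [(isClosed_le (by fun_prop) continuous_const).cthickening_eq_biUnion_closedBall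
    (by positivity)] at hp'
  obtain ⟨q, hq, hpq⟩ := Set.mem_iUnion₂.1 hp'
  have h1 : |p.2.2 - q.2.2| ≤ τ / 2 := by
    rw [Metric.mem_closedBall, dist_eq_norm] at hpq
    exact ((norm_snd_le (p - q).2).trans (norm_snd_le (p - q))).trans hpq
  have h2 : q.2.2 ≤ -τ := hq
  have h3 := (abs_le.1 h1).2
  change p.2.2 ≤ -(τ / 2)
  linarith

theorem setIntegral_increment_le {m : Measure (Pt n)} {K : Set (Pt n)} (hK : MeasurableSet K)
    {U : Pt n → E n} (hU : MemLp U 2 (m.restrict K)) {η : Pt n → ℝ} {h L : ℝ} (hL : 0 ≤ L)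
    (hh : 0 ≤ h) (h0 : ∀ p, p ∉ K → η (p + h • dirT) = 0)
    (h1 : ∀ p, η (p + h • dirT) ^ 2 - η p ^ 2 ≤ L * h) :
    ∫ p, (η (p + h • dirT) ^ 2 - η p ^ 2) * ‖U p‖ ^ 2 ∂m ≤
      h * (L * ∫ p in K, ‖U p‖ ^ 2 ∂m) := by
  have hR : 0 ≤ h * (L * ∫ p in K, ‖U p‖ ^ 2 ∂m) := by
    have : 0 ≤ ∫ p in K, ‖U p‖ ^ 2 ∂m := integral_nonneg fun p => sq_nonneg _
    positivity
  by_cases hi : Integrable (fun p => (η (p + h • dirT) ^ 2 - η p ^ 2) * ‖U p‖ ^ 2) m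
  · have e : h * (L * ∫ p in K, ‖U p‖ ^ 2 ∂m) =
        ∫ p, K.indicator (fun p => L * h * ‖U p‖ ^ 2) p ∂m := by
      rw [integral_indicator hK, integral_const_mul]
      ring
    rw [e]
    refine integral_mono hi ((integrable_indicator_iff hK).2
      ((MemLp.integrable_norm_sq hU).const_mul _)) fun p => ?_
    by_cases hp : p ∈ K
    · simp only [Set.indicator_of_mem hp]
      exact mul_le_mul_of_nonneg_right (h1 p) (sq_nonneg _)
    · simp only [Set.indicator_of_notMem hp, h0 p hp]
      nlinarith [mul_nonneg (sq_nonneg (η p)) (sq_nonneg ‖U p‖)]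
  · rw [integral_undef hi]
    exact hR

/-- As the time factor is nonincreasing, its own increment only helps, and the Lipschitz constant of
`η₀²` suffices. The bound does not deteriorate as `τ → 0`. -/
theorem mul_timeCut_sq_sub_le (hτ : 0 < τ) {L : NNReal}
    (hL : LipschitzWith L fun p => η₀ p ^ 2) {h : ℝ} (hh : 0 ≤ h) (p : Pt n) :
    (η₀ (p + h • dirT) * timeCut τ (p + h • dirT)) ^ 2 - (η₀ p * timeCut τ p) ^ 2 ≤ L * h := by
  have h1 := hL.dist_le_mul (p + h • dirT) p
  rw [dist_eq_norm, dist_eq_norm, add_sub_cancel_left, norm_smul, norm_dirT, mul_one,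
    Real.norm_of_nonneg hh] at h1
  have h2 := (le_abs_self _).trans h1
  have h3 := timeCut_add_le hτ hh p
  have h4 := timeCut_nonneg (τ := τ) (p + h • dirT)
  have h5 := timeCut_nonneg (τ := τ) p
  have h6 := timeCut_le_one (τ := τ) p
  have h7 : timeCut τ (p + h • dirT) ^ 2 ≤ timeCut τ p ^ 2 := by gcongr
  have h8 : timeCut τ p ^ 2 ≤ 1 := pow_le_one₀ h5 h6
  have h9 : 0 ≤ (L : ℝ) * h := by positivity
  rw [mul_pow, mul_pow]
  have h10 := mul_le_mul_of_nonneg_left h7 (sq_nonneg (η₀ (p + h • dirT)))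
  have h11 := mul_le_mul_of_nonneg_right h2 (sq_nonneg (timeCut τ p))
  have h12 := mul_le_mul_of_nonneg_left h8 h9
  linarith

end Cutoff

/-! ### The Caccioppoli inequality up to the final time -/

section Caccioppoli

/-- In extended nonnegative form the estimate can be compared with integrals up to `t = 0` before
those are known to be finite. -/
theorem exists_lintegral_energy_le (n : ℕ) {a : ℝ} (ha : -1 < a) (ha1 : a < 1) {δ₀ : ℝ}
    (hδ₀ : 0 < δ₀) (Λ : ℝ) {K : ℝ} (hK : 0 ≤ K) :
    ∃ C : ℝ≥0∞, C ≠ ⊤ ∧ ∀ (Ω : Set (Pt n)) (μ lam : ℝ) (U : Pt n → E n)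
      (G : Option (Fin n) → Pt n → E n) (u g b : E n × ℝ → E n) (V : E n × ℝ → ℝ)
      (η : Pt n → ℝ) (ρ L : ℝ),
      δ₀ ≤ μ → δ₀ ≤ 2 * μ + lam → μ ≤ Λ → |lam| ≤ Λ → Sol Ω a μ lam U G u g →
      (∀ x, |V x| ≤ K) → (∀ x, g x = V x • u x + b x) →
      ContDiff ℝ ∞ η → HasCompactSupport η → 0 < ρ →
      Metric.cthickening ρ (tsupport η) ⊆ Ω → 0 ≤ L →
      MemLp (fun x => atZero η x • b x) 2 volume →
      (∀ h p, 0 ≤ h → η (p + h • dirT) ^ 2 - η p ^ 2 ≤ L * h) →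
      ∑ k, ∫⁻ p, ‖cutGrad η U G k p‖ₑ ^ 2 ∂(wMeasure n a) + ∫⁻ x, ‖atZero η x • u x‖ₑ ^ 2 ≤
        C * (ENNReal.ofReal L * ∫⁻ p in Metric.cthickening ρ (tsupport η), ‖U p‖ₑ ^ 2
            ∂(wMeasure n a) + ∑ k, ∫⁻ p, ‖fderiv ℝ η p (dir k) • U p‖ₑ ^ 2 ∂(wMeasure n a) +
          ∫⁻ p, ‖η p • U p‖ₑ ^ 2 ∂(wMeasure n a) + ∫⁻ x, ‖atZero η x • b x‖ₑ ^ 2) := by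
  obtain ⟨C, hC, h⟩ := exists_energy_le n ha ha1 hδ₀ Λ hK
  refine ⟨ENNReal.ofReal C, by simp, ?_⟩
  intro Ω μ lam U G u g b V η ρ L h1 h2 h3 h4 hS hV hg hη hηc hρ hΩ hL hb hB
  have hηs : tsupport η ⊆ Ω := (Metric.self_subset_cthickening _).trans hΩ
  have hKc : IsCompact (Metric.cthickening ρ (tsupport η)) := hηc.isCompact.cthickening
  have hUK := hS.memU _ hKc hΩ
  have hW := fun k => hS.memLp_cutGrad hη hηc hηs k
  have hU := hS.memLp_cut hη.continuous hηc hηs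
  have hu := hS.memLp_cut_atZero hη.continuous hηc hηs
  have hY : ∀ k, MemLp (fun p => fderiv ℝ η p (dir k) • U p) 2 (wMeasure n a) := fun k =>
    memLp_smul_of_tsupport
    ((hη.continuous_fderiv (by norm_num)).clm_apply (continuous_const (y := dir k)))
    (hηc.fderiv_apply ℝ (dir k)) (tsupport_fderiv_apply_subset ℝ (dir k))
    (isClosed_tsupport η).measurableSet (hS.memU _ hηc.isCompact hηs)
  have nn : ∀ {α : Type _} [MeasurableSpace α] (ν : Measure α) (f : α → E n),
      0 ≤ ∫ x, ‖f x‖ ^ 2 ∂ν := fun ν f => integral_nonneg fun x => sq_nonneg _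
  have := h Ω μ lam U G u g b V η ρ (L * ∫ p in Metric.cthickening ρ (tsupport η), ‖U p‖ ^ 2
    ∂(wMeasure n a)) h1 h2 h3 h4 hS hV hg hη hηc hρ hΩ (mul_nonneg hL (nn _ _)) hb
    fun h h0 hhρ => setIntegral_increment_le hKc.isClosed.measurableSet hUK hL h0.le
      (fun p hp => image_eq_zero_of_notMem_tsupport fun h' => hp (by
        refine Metric.mem_cthickening_of_dist_le p (p + h • dirT) ρ _ h' ?_
        rw [dist_eq_norm]
        simp only [sub_add_cancel_left, norm_neg, norm_smul, norm_dirT, mul_one,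
          Real.norm_of_nonneg h0.le]
        exact hhρ)) (fun p => hB h p h0.le)
  have hfin := ENNReal.ofReal_le_ofReal this
  have nW := fun k => nn (wMeasure n a) (cutGrad η U G k)
  have nY := fun k => nn (wMeasure n a) (fun p => fderiv ℝ η p (dir k) • U p)
  have nY' := Finset.sum_nonneg fun k (_ : k ∈ Finset.univ) => nY k
  have nU := nn (wMeasure n a) (fun p => η p • U p)
  have nK := mul_nonneg hL (nn ((wMeasure n a).restrict (Metric.cthickening ρ (tsupport η))) U)
  have nb := nn volume (fun x => atZero η x • b x)
  rw [ENNReal.ofReal_add (Finset.sum_nonneg fun k _ => nW k) (nn _ _),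
    ENNReal.ofReal_sum_of_nonneg fun k _ => nW k, ENNReal.ofReal_mul hC,
    ENNReal.ofReal_add (add_nonneg (add_nonneg nK nY') nU) nb,
    ENNReal.ofReal_add (add_nonneg nK nY') nU, ENNReal.ofReal_add nK nY',
    ENNReal.ofReal_mul hL, ENNReal.ofReal_sum_of_nonneg fun k _ => nY k] at hfin
  simp only [← lintegral_enorm_sq_eq_ofReal hUK, ← lintegral_enorm_sq_eq_ofReal (hW _),
    ← lintegral_enorm_sq_eq_ofReal (hY _), ← lintegral_enorm_sq_eq_ofReal hU,
    ← lintegral_enorm_sq_eq_ofReal hu, ← lintegral_enorm_sq_eq_ofReal hb] at hfin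
  exact hfin

/-- Monotone convergence along the sets `{t ≤ -2τ}`, which exhaust `{t < 0}` as `τ → 0`. -/
theorem setLIntegral_inter_neg_le {α : Type*} [MeasurableSpace α] {ν : Measure α} {f : α → ℝ≥0∞}
    {S : Set α} {t : α → ℝ} {c : ℝ≥0∞}
    (h : ∀ τ, 0 < τ → ∫⁻ x in S ∩ {x | t x ≤ -(2 * τ)}, f x ∂ν ≤ c) :
    ∫⁻ x in S ∩ {x | t x < 0}, f x ∂ν ≤ c := by
  have e : S ∩ {x | t x < 0} = ⋃ j : ℕ, S ∩ {x | t x ≤ -(2 * (1 / ((j : ℝ) + 1)))} := by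
    rw [← Set.inter_iUnion]
    congr 1
    ext x
    simp only [Set.mem_iUnion, Set.mem_ofPred_eq]
    constructor
    · intro hx
      obtain ⟨j, hj⟩ := exists_nat_one_div_lt (show 0 < -t x / 2 by linarith)
      exact ⟨j, by linarith⟩
    · rintro ⟨j, hj⟩
      have : 0 < 1 / ((j : ℝ) + 1) := by positivity
      linarith
  rw [e, setLIntegral_iUnion_of_directed]
  · exact iSup_le fun j => h _ (by positivity)
  · refine Monotone.directed_le fun i j hij => ?_
    refine Set.inter_subset_inter_right _ fun x hx => ?_
    have hx : t x ≤ -(2 * (1 / ((i : ℝ) + 1))) := hx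
    have : 1 / ((j : ℝ) + 1) ≤ 1 / ((i : ℝ) + 1) := by gcongr
    change t x ≤ -(2 * (1 / ((j : ℝ) + 1)))
    linarith

end Caccioppoli

end LameExt

namespace LameExt

open scoped ENNReal

variable {n : ℕ}

theorem enorm_smul_sq_le {c M : ℝ} (h : |c| ≤ M) (x : E n) :
    ‖c • x‖ₑ ^ 2 ≤ ENNReal.ofReal M ^ 2 * ‖x‖ₑ ^ 2 := by
  rw [enorm_smul, mul_pow]
  gcongr
  rw [← ofReal_norm]
  exact ENNReal.ofReal_le_ofReal h

theorem lintegral_smul_sq_le {α : Type*} [MeasurableSpace α] {ν : Measure α} {c : α → ℝ}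
    {x : α → E n} {K : Set α} (hK : MeasurableSet K) {M : ℝ} (hM : ∀ p, |c p| ≤ M)
    (hc : ∀ p, p ∉ K → c p = 0) :
    ∫⁻ p, ‖c p • x p‖ₑ ^ 2 ∂ν ≤ ENNReal.ofReal M ^ 2 * ∫⁻ p in K, ‖x p‖ₑ ^ 2 ∂ν := by
  rw [← lintegral_const_mul' _ _ (by simp), ← lintegral_indicator hK]
  refine lintegral_mono fun p => ?_
  by_cases hp : p ∈ K
  · rw [Set.indicator_of_mem hp]
    exact enorm_smul_sq_le (hM p) _
  · simp [hc p hp]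

/-- The Caccioppoli inequality, uniform up to the final time `t = 0`. -/
theorem exists_caccioppoli (n : ℕ) {a : ℝ} (ha : -1 < a) (ha1 : a < 1) {δ₀ : ℝ}
    (hδ₀ : 0 < δ₀) (Λ : ℝ) {K : ℝ} (hK : 0 ≤ K) {S N : Set (Pt n)} (hSc : IsCompact S)
    (hN : IsOpen N) (hSN : S ⊆ N) :
    ∃ C : ℝ≥0∞, C ≠ ⊤ ∧ ∀ (Ω : Set (Pt n)) (μ lam : ℝ) (U : Pt n → E n)
      (G : Option (Fin n) → Pt n → E n) (u g b : E n × ℝ → E n) (V : E n × ℝ → ℝ),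
      δ₀ ≤ μ → δ₀ ≤ 2 * μ + lam → μ ≤ Λ → |lam| ≤ Λ → Sol Ω a μ lam U G u g →
      (∀ x, |V x| ≤ K) → (∀ x, g x = V x • u x + b x) → N ∩ {p | p.2.2 < 0} ⊆ Ω →
      Measurable b →
      ∫⁻ x in {x : E n × ℝ | (x.1, 0, x.2) ∈ N} ∩ {x | x.2 < 0}, ‖b x‖ₑ ^ 2 ≠ ⊤ →
      (∀ k, ∫⁻ p in S ∩ {p | p.2.2 < 0}, ‖G k p‖ₑ ^ 2 ∂(wMeasure n a) ≤
        C * (∫⁻ p in N ∩ {p | p.2.2 < 0}, ‖U p‖ₑ ^ 2 ∂(wMeasure n a) +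
          ∫⁻ x in {x : E n × ℝ | (x.1, 0, x.2) ∈ N} ∩ {x | x.2 < 0}, ‖b x‖ₑ ^ 2)) ∧
      ∫⁻ x in {x : E n × ℝ | (x.1, 0, x.2) ∈ S} ∩ {x | x.2 < 0}, ‖u x‖ₑ ^ 2 ≤
        C * (∫⁻ p in N ∩ {p | p.2.2 < 0}, ‖U p‖ₑ ^ 2 ∂(wMeasure n a) +
          ∫⁻ x in {x : E n × ℝ | (x.1, 0, x.2) ∈ N} ∩ {x | x.2 < 0}, ‖b x‖ₑ ^ 2) := by
  obtain ⟨C, hC, h⟩ := exists_lintegral_energy_le n ha ha1 hδ₀ Λ hK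
  obtain ⟨η₀, ρ, hη, hηc, hρ, hηN, hη01, hη1⟩ := exists_cutoff hSc hN hSN
  have hsq : ContDiff ℝ ∞ fun p => η₀ p ^ 2 := hη.pow 2
  have hsqc : HasCompactSupport fun p => η₀ p ^ 2 := hηc.comp_left (g := fun x : ℝ => x ^ 2)
    (by simp)
  obtain ⟨L, hL⟩ := hsq.lipschitzWith_of_hasCompactSupport hsqc (by norm_num)
  have hdM : ∃ M, ∀ k p, |fderiv ℝ η₀ p (dir k)| ≤ M := by
    have : ∀ k, ∃ M, ∀ p, ‖fderiv ℝ η₀ p (dir k)‖ ≤ M := fun k =>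
      (hηc.fderiv_apply ℝ (dir k)).exists_bound_of_continuous
        ((hη.continuous_fderiv (by norm_num)).clm_apply (continuous_const (y := dir k)))
    choose M hM using this
    obtain ⟨M', hM'⟩ := (Set.finite_range M).bddAbove
    exact ⟨M', fun k p => (hM k p).trans (hM' ⟨k, rfl⟩)⟩
  obtain ⟨M, hM⟩ := hdM
  -- One summand for each error: the time increment, the gradient of the cut-off, `η U`, and the
  -- boundary inhomogeneity. All depend on `η₀` alone, that is on `S` and `N`, and not on `τ`.
  set D : ℝ≥0∞ := ENNReal.ofReal L + ∑ _k : Option (Fin n), ENNReal.ofReal M ^ 2 + 1 + 1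
  have hD : D ≠ ⊤ := by simp [D, ENNReal.mul_eq_top]
  refine ⟨C * D, ENNReal.mul_ne_top hC hD, ?_⟩
  intro Ω μ lam U G u g b V h1 h2 h3 h4 hS hV hg hNΩ mb hb
  set m := wMeasure n a with hm
  set IU := ∫⁻ p in N ∩ {p | p.2.2 < 0}, ‖U p‖ₑ ^ 2 ∂m
  set N0 : Set (E n × ℝ) := {x | (x.1, 0, x.2) ∈ N} ∩ {x | x.2 < 0}
  set Ib := ∫⁻ x in N0, ‖b x‖ₑ ^ 2
  have hN0 : MeasurableSet N0 :=
    (hN.preimage isClosedEmbedding_atZero.continuous).measurableSet.inter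
      (measurableSet_lt (by fun_prop) (by fun_prop))
  have key : ∀ τ, 0 < τ →
      ∑ k, ∫⁻ p, ‖cutGrad (fun p => η₀ p * timeCut τ p) U G k p‖ₑ ^ 2 ∂m +
        ∫⁻ x, ‖atZero (fun p => η₀ p * timeCut τ p) x • u x‖ₑ ^ 2 ≤ C * D * (IU + Ib) := by
    intro τ hτ
    set η : Pt n → ℝ := fun p => η₀ p * timeCut τ p with hηdef
    have hηs : ContDiff ℝ ∞ η := hη.mul contDiff_timeCut
    have hηcs : HasCompactSupport η := hηc.mul_right
    have hθ1 : ∀ p : Pt n, |timeCut τ p| ≤ 1 := fun p => by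
      rw [abs_of_nonneg (timeCut_nonneg p)]; exact timeCut_le_one p
    have hη1 : ∀ p, |η p| ≤ 1 := fun p => by
      rw [hηdef, abs_mul]
      refine mul_le_one₀ ?_ (abs_nonneg _) (hθ1 p)
      rw [abs_of_nonneg (hη01 p).1]; exact (hη01 p).2
    have hthick := (cthickening_tsupport_mul_timeCut (η₀ := η₀) (ρ := ρ) hτ)
    set ρ' := min ρ (τ / 2)
    have hρ' : 0 < ρ' := lt_min hρ (by positivity)
    have hsub : Metric.cthickening ρ' (tsupport η) ⊆ N ∩ {p | p.2.2 < 0} := fun p hp => by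
      refine ⟨hηN (hthick hp).1, ?_⟩
      have : p.2.2 ≤ -(τ / 2) := (hthick hp).2
      change p.2.2 < 0
      linarith
    have hts : tsupport η ⊆ Metric.cthickening ρ' (tsupport η) :=
      Metric.self_subset_cthickening _
    have hNm : MeasurableSet (N ∩ {p : Pt n | p.2.2 < 0}) :=
      hN.measurableSet.inter (measurableSet_lt (by fun_prop) (by fun_prop))
    have hz : ∀ p, p ∉ N ∩ {p | p.2.2 < 0} → η p = 0 := fun p hp =>
      image_eq_zero_of_notMem_tsupport fun h' => hp (hsub (hts h'))
    have hz0 : ∀ x, x ∉ N0 → atZero η x = 0 := fun x hx => hz _ fun h' => hx h'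
    have hbm : MemLp (fun x => atZero η x • b x) 2 volume := by
      refine ⟨?_, ?_⟩
      · have := (hηs.continuous.comp (isClosedEmbedding_atZero (n := n)).continuous).measurable
        exact (Measurable.smul this mb).aestronglyMeasurable
      · suffices hh : eLpNorm (fun x => atZero η x • b x) 2 volume ^ 2 < ⊤ by
          exact (ENNReal.pow_lt_top_iff.1 hh).resolve_right two_ne_zero
        rw [eLpNorm_sq]
        refine (lintegral_smul_sq_le hN0 (fun x => hη1 _) hz0).trans_lt ?_
        exact ENNReal.mul_lt_top (by simp) (lt_top_iff_ne_top.2 hb)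
    refine (h Ω μ lam U G u g b V η ρ' L h1 h2 h3 h4 hS hV hg hηs hηcs hρ' (hsub.trans hNΩ)
      L.2 hbm fun h p h0 => mul_timeCut_sq_sub_le hτ hL h0 p).trans ?_
    rw [mul_assoc]
    gcongr
    have b1 : ENNReal.ofReal L * ∫⁻ p in Metric.cthickening ρ' (tsupport η), ‖U p‖ₑ ^ 2 ∂m ≤
        ENNReal.ofReal L * IU := by
      exact mul_le_mul_right (lintegral_mono_set hsub) _
    have b2 : ∑ k, ∫⁻ p, ‖fderiv ℝ η p (dir k) • U p‖ₑ ^ 2 ∂m ≤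
        (∑ _k : Option (Fin n), ENNReal.ofReal M ^ 2) * IU := by
      rw [Finset.sum_mul]
      refine Finset.sum_le_sum fun k _ => lintegral_smul_sq_le hNm (fun p => ?_) fun p hp => ?_
      · rw [hηdef, fderiv_mul_timeCut hη, abs_mul]
        exact (mul_le_of_le_one_left (abs_nonneg _) (hθ1 p)).trans (hM k p)
      · rw [image_eq_zero_of_notMem_tsupport fun h' =>
          hp (hsub (hts (tsupport_fderiv_subset ℝ h')))]; rfl
    have b3 : ∫⁻ p, ‖η p • U p‖ₑ ^ 2 ∂m ≤ IU := by
      simpa using lintegral_smul_sq_le hNm hη1 hz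
    have b4 : ∫⁻ x, ‖atZero η x • b x‖ₑ ^ 2 ≤ Ib := by
      refine (lintegral_smul_sq_le hN0 (fun x => hη1 _) hz0).trans ?_
      simp [Ib]
    calc _ ≤ ENNReal.ofReal L * IU + (∑ _k : Option (Fin n), ENNReal.ofReal M ^ 2) * IU +
          IU + Ib := by gcongr
      _ ≤ D * IU + D * Ib := by
        have e1 : ENNReal.ofReal L * IU + (∑ _k : Option (Fin n), ENNReal.ofReal M ^ 2) * IU +
          IU = (ENNReal.ofReal L + ∑ _k : Option (Fin n), ENNReal.ofReal M ^ 2 + 1) * IU := by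
            ring
        have e2 : 1 ≤ D := le_add_self
        rw [e1]
        gcongr
        · exact le_self_add
        · exact le_mul_of_one_le_left zero_le e2
      _ = D * (IU + Ib) := by ring
  have hlt : ∀ {S : Set (Pt n)}, MeasurableSet S → ∀ τ : ℝ,
      MeasurableSet (S ∩ {p : Pt n | p.2.2 ≤ -(2 * τ)}) := fun hS τ =>
    hS.inter (measurableSet_le (by fun_prop) (by fun_prop))
  refine ⟨fun k => setLIntegral_inter_neg_le (t := fun p : Pt n => p.2.2) fun τ hτ => ?_,
    setLIntegral_inter_neg_le (t := fun x : E n × ℝ => x.2) fun τ hτ => ?_⟩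
  · refine le_trans ?_ ((le_self_add).trans (key τ hτ))
    refine le_trans ?_ (Finset.single_le_sum (f := fun k =>
      ∫⁻ p, ‖cutGrad (fun p => η₀ p * timeCut τ p) U G k p‖ₑ ^ 2 ∂m)
      (fun _ _ => zero_le) (Finset.mem_univ k))
    refine le_trans (le_of_eq ?_) (setLIntegral_le_lintegral (S ∩ {p | p.2.2 ≤ -(2 * τ)}) _)
    -- On `S ∩ {t ≤ -2τ}` the cut-off is locally `1` in space and its time factor is `1`, so
    -- `cutGrad` is the gradient itself.
    refine setLIntegral_congr_fun (hlt hSc.measurableSet τ) fun p hp => ?_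
    rw [cutGrad_mul_timeCut hη hτ (hη1 p hp.1) hp.2]
  · refine le_trans ?_ ((le_add_self).trans (key τ hτ))
    refine le_trans (le_of_eq ?_) (setLIntegral_le_lintegral
      ({x : E n × ℝ | (x.1, 0, x.2) ∈ S} ∩ {x | x.2 ≤ -(2 * τ)}) _)
    refine setLIntegral_congr_fun ?_ fun x hx => ?_
    · exact (hSc.measurableSet.preimage isClosedEmbedding_atZero.continuous.measurable).inter
        (measurableSet_le (by fun_prop) (by fun_prop))
    · simp only [atZero]
      rw [(hη1 _ hx.1).self_of_nhds, timeCut_eq_one (p := ((x.1, 0, x.2) : Pt n)) hτ hx.2]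
      simp

end LameExt

namespace LameExt

open scoped ENNReal

variable {n : ℕ} {Ω : Set (Pt n)} {a μ lam : ℝ}

/-! ### Linear combinations of solutions -/

section Combination

theorem tendsto_eLpNorm_lincomb {α : Type*} [MeasurableSpace α] {ν : Measure α}
    {F H : ℕ → α → E n} {F' H' : α → E n} (mF : ∀ j, Measurable (F j)) (mH : ∀ j, Measurable (H j))
    (mF' : Measurable F') (mH' : Measurable H')
    (t1 : Tendsto (fun j => eLpNorm (F j - F') 2 ν) atTop (𝓝 0))
    (t2 : Tendsto (fun j => eLpNorm (H j - H') 2 ν) atTop (𝓝 0)) (c d : ℝ) :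
    Tendsto (fun j => eLpNorm ((fun p => c • F j p + d • H j p) -
      fun p => c • F' p + d • H' p) 2 ν) atTop (𝓝 0) := by
  have t1 := tendsto_eLpNorm_smul (c := fun _ => c) (M := ‖c‖) (fun _ => le_rfl) t1
  have t2 := tendsto_eLpNorm_smul (c := fun _ => d) (M := ‖d‖) (fun _ => le_rfl) t2
  exact tendsto_eLpNorm_add
    (fun j => (((mF j).const_smul c).sub (mF'.const_smul c)).aestronglyMeasurable)
    (fun j => (((mH j).const_smul d).sub (mH'.const_smul d)).aestronglyMeasurable) t1 t2

theorem H1Approx.lincomb {w₁ w₂ : Pt n → E n} {W₁ W₂ : Option (Fin n) → Pt n → E n}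
    {z₁ z₂ : E n × ℝ → E n} (h₁ : H1Approx a w₁ W₁ z₁) (h₂ : H1Approx a w₂ W₂ z₂)
    (m₁ : Measurable w₁) (m₂ : Measurable w₂) (M₁ : ∀ k, Measurable (W₁ k))
    (M₂ : ∀ k, Measurable (W₂ k)) (n₁ : Measurable z₁) (n₂ : Measurable z₂) (c d : ℝ) :
    H1Approx a (fun p => c • w₁ p + d • w₂ p) (fun k p => c • W₁ k p + d • W₂ k p)
      (fun x => c • z₁ x + d • z₂ x) := by
  obtain ⟨f, hf, hfc, f1, f2, f3⟩ := h₁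
  obtain ⟨g, hg, hgc, g1, g2, g3⟩ := h₂
  have hmd : ∀ {f : Pt n → E n}, ContDiff ℝ ∞ f → ∀ k, Measurable fun p => fderiv ℝ f p (dir k) :=
    fun hf k => ((hf.continuous_fderiv (by norm_num)).clm_apply continuous_const).measurable
  have hz : ∀ {f : Pt n → E n}, ContDiff ℝ ∞ f → Measurable (atZero f) := fun hf =>
    (hf.continuous.comp isClosedEmbedding_atZero.continuous).measurable
  refine ⟨fun j p => c • f j p + d • g j p, fun j => ?_, fun j => ?_, ?_, fun k => ?_, ?_⟩
  · have := hf j; have := hg j; fun_prop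
  · have h1 := (hfc j).comp_left (g := fun x : E n => c • x) (smul_zero c)
    have h2 := (hgc j).comp_left (g := fun x : E n => d • x) (smul_zero d)
    exact h1.add h2
  · exact tendsto_eLpNorm_lincomb (fun j => (hf j).continuous.measurable) (fun j => (hg j).continuous.measurable)
      m₁ m₂ f1 g1 c d
  · refine (tendsto_eLpNorm_lincomb (fun j => hmd (hf j) k) (fun j => hmd (hg j) k) (M₁ k) (M₂ k)
      (f2 k) (g2 k) c d).congr fun j => ?_
    congr 1
    ext1 p
    have e1 := (((hf j).differentiable (by norm_num)).differentiableAt.hasFDerivAt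
      (x := p)).const_smul c
    have e2 := (((hg j).differentiable (by norm_num)).differentiableAt.hasFDerivAt
      (x := p)).const_smul d
    have e := (e1.add e2).fderiv
    change fderiv ℝ (fun p => c • f j p + d • g j p) p = _ at e
    simp [e]
  · exact tendsto_eLpNorm_lincomb (fun j => hz (hf j)) (fun j => hz (hg j)) n₁ n₂ f3 g3 c d

theorem flux_lincomb (G₁ G₂ : Option (Fin n) → Pt n → E n) (c d : ℝ) (k : Option (Fin n))
    (p : Pt n) : flux μ lam (fun k p => c • G₁ k p + d • G₂ k p) k p =
      c • flux μ lam G₁ k p + d • flux μ lam G₂ k p := by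
  cases k with
  | none => rfl
  | some i =>
    have h : divOf (fun k p => c • G₁ k p + d • G₂ k p) p =
        c * divOf G₁ p + d * divOf G₂ p := by
      simp [divOf, Finset.sum_add_distrib, Finset.mul_sum]
    ext j
    simp only [flux, h, PiLp.add_apply, PiLp.smul_apply, smul_eq_mul, PiLp.single_apply]
    split_ifs <;> ring

theorem integrable_inner_of_tsupport {α : Type*} [TopologicalSpace α] [MeasurableSpace α]
    [BorelSpace α] {ν : Measure α} {K : Set α} (hK : MeasurableSet K) {f ψ : α → E n}
    (hf : MemLp f 2 (ν.restrict K)) (hψ : MemLp ψ 2 ν) (hψK : tsupport ψ ⊆ K) :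
    Integrable (fun x => inner ℝ (f x) (ψ x)) ν := by
  have h1 := inner_indicator_left (K := K) (f := f) (X := ψ) fun p hp =>
    image_eq_zero_of_notMem_tsupport fun h => hp (hψK h)
  simp only [h1]
  exact integrable_inner ((memLp_indicator_iff_restrict hK).2 hf) hψ

theorem Sol.mono {U : Pt n → E n} {G : Option (Fin n) → Pt n → E n} {u g : E n × ℝ → E n}
    (hS : Sol Ω a μ lam U G u g) {Ω' : Set (Pt n)} (h : Ω' ⊆ Ω) : Sol Ω' a μ lam U G u g :=
  ⟨hS.measU, hS.measG, hS.measu, hS.measg, fun K hK hs => hS.memU K hK (hs.trans h),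
    fun k K hK hs => hS.memG k K hK (hs.trans h), fun K hK hs => hS.memu K hK (hs.trans h),
    fun K hK hs => hS.memg K hK (hs.trans h), fun η h1 h2 h3 => hS.approx η h1 h2 (h3.trans h),
    fun φ h1 h2 h3 => hS.eq φ h1 h2 (h3.trans h)⟩

/-- Linearity of the system. The conormal derivatives combine linearly too, which is why `Sol`
carries the boundary datum `g` as separate data instead of `V u`. -/
theorem Sol.lincomb (ha : -1 < a) {U₁ U₂ : Pt n → E n} {G₁ G₂ : Option (Fin n) → Pt n → E n}
    {u₁ u₂ g₁ g₂ : E n × ℝ → E n} (h₁ : Sol Ω a μ lam U₁ G₁ u₁ g₁)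
    (h₂ : Sol Ω a μ lam U₂ G₂ u₂ g₂) (c d : ℝ) :
    Sol Ω a μ lam (fun p => c • U₁ p + d • U₂ p) (fun k p => c • G₁ k p + d • G₂ k p)
      (fun x => c • u₁ x + d • u₂ x) (fun x => c • g₁ x + d • g₂ x) where
  measU := (h₁.measU.const_smul c).add (h₂.measU.const_smul d)
  measG k := ((h₁.measG k).const_smul c).add ((h₂.measG k).const_smul d)
  measu := (h₁.measu.const_smul c).add (h₂.measu.const_smul d)
  measg := (h₁.measg.const_smul c).add (h₂.measg.const_smul d)
  memU K hK hs := ((h₁.memU K hK hs).const_smul c).add ((h₂.memU K hK hs).const_smul d)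
  memG k K hK hs := ((h₁.memG k K hK hs).const_smul c).add ((h₂.memG k K hK hs).const_smul d)
  memu K hK hs := ((h₁.memu K hK hs).const_smul c).add ((h₂.memu K hK hs).const_smul d)
  memg K hK hs := ((h₁.memg K hK hs).const_smul c).add ((h₂.memg K hK hs).const_smul d)
  approx η hη hηc hηs := by
    have mη := hη.continuous.measurable
    have mz : Measurable (atZero η) :=
      (hη.continuous.comp isClosedEmbedding_atZero.continuous).measurable
    have := (h₁.approx η hη hηc hηs).lincomb (h₂.approx η hη hηc hηs)
      (mη.smul h₁.measU) (mη.smul h₂.measU)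
      (measurable_cutGrad hη h₁.measU h₁.measG) (measurable_cutGrad hη h₂.measU h₂.measG)
      (mz.smul h₁.measu) (mz.smul h₂.measu) c d
    convert this using 1
    · ext1 p
      module
    · ext1 k
      ext1 p
      simp only [cutGrad]
      module
    · ext1 x
      module
  eq φ hφ hφc hφs := by
    have hfin := wMeasure_finite n ha
    have hcd : ∀ v, Continuous fun p => fderiv ℝ φ p v := fun v =>
      (hφ.continuous_fderiv (by norm_num)).clm_apply continuous_const
    have hI : ∀ {X : Pt n → E n} (v : Pt n),
        MemLp X 2 ((wMeasure n a).restrict (tsupport φ)) →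
        Integrable (fun p => inner ℝ (X p) (fderiv ℝ φ p v)) (wMeasure n a) := fun v hX =>
      integrable_inner_of_tsupport (isClosed_tsupport φ).measurableSet hX
        ((hcd v).memLp_of_hasCompactSupport (hφc.fderiv_apply ℝ v)) (tsupport_fderiv_apply_subset ℝ v)
    have hI0 : ∀ {x : E n × ℝ → E n},
        MemLp x 2 (volume.restrict {b : E n × ℝ | ((b.1, 0, b.2) : Pt n) ∈ tsupport φ}) →
        Integrable (fun b => inner ℝ (x b) (atZero φ b)) volume := fun hx => by
      have hc := hφ.continuous.comp (isClosedEmbedding_atZero (n := n)).continuous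
      exact integrable_inner_of_tsupport ((isClosed_tsupport φ).preimage
        isClosedEmbedding_atZero.continuous).measurableSet hx
        (hc.memLp_of_hasCompactSupport (hasCompactSupport_atZero hφc)) (tsupport_atZero_subset φ)
    have hF₁ := memLp_flux (μ := μ) (lam := lam) h₁.measG fun k => h₁.memG k _ hφc.isCompact hφs
    have hF₂ := memLp_flux (μ := μ) (lam := lam) h₂.measG fun k => h₂.memG k _ hφc.isCompact hφs
    simp only [flux_lincomb, inner_add_left, real_inner_smul_left]
    rw [integral_add ((hI _ (h₁.memU _ hφc.isCompact hφs)).const_mul c)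
      ((hI _ (h₂.memU _ hφc.isCompact hφs)).const_mul d),
      integral_add ((hI0 (h₁.memg _ hφc.isCompact hφs)).const_mul c)
      ((hI0 (h₂.memg _ hφc.isCompact hφs)).const_mul d),
      Finset.sum_congr rfl fun k _ => integral_add ((hI _ (hF₁ k)).const_mul c)
      ((hI _ (hF₂ k)).const_mul d)]
    simp only [integral_const_mul, Finset.sum_add_distrib, ← Finset.mul_sum]
    rw [h₁.eq φ hφ hφc hφs, h₂.eq φ hφ hφc hφs]
    ring

end Combination

/-! ### Tangential translations of solutions -/

section Translation

theorem measurePreserving_add_restrict {α : Type*} [TopologicalSpace α] [AddGroup α]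
    [IsTopologicalAddGroup α] [MeasurableSpace α] [BorelSpace α] {ν : Measure α} {v : α}
    (hv : MeasurePreserving (fun p => p + v) ν ν) {f : α → E n} {K : Set α}
    (hK : MeasurableSet K) (hf : MemLp f 2 (ν.restrict ((fun p => p - v) ⁻¹' K))) :
    MemLp (fun p => f (p + v)) 2 (ν.restrict K) := by
  have h := hv.restrict_preimage
    (s := (fun p => p - v) ⁻¹' K) (hK.preimage (by fun_prop))
  rw [← Set.preimage_comp] at h
  have e : (fun p => p - v) ∘ (fun p => p + v) = id := by ext p; simp
  rw [e, Set.preimage_id] at h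
  exact hf.comp_measurePreserving h

theorem H1Approx.translate {U : Pt n → E n} {W : Option (Fin n) → Pt n → E n}
    {z : E n × ℝ → E n} (h : H1Approx a U W z) (mU : Measurable U) (mW : ∀ k, Measurable (W k))
    (mz : Measurable z) (e : E n) :
    H1Approx a (fun p => U (p + (e, 0, 0))) (fun k p => W k (p + (e, 0, 0)))
      (fun x => z (x + (e, 0))) := by
  obtain ⟨f, hf, hfc, f1, f2, f3⟩ := h
  set v : Pt n := (e, 0, 0)
  have hmp : MeasurePreserving (fun p : Pt n => p + v) (wMeasure n a) (wMeasure n a) :=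
    measurePreserving_add_tangential a rfl
  have hmp0 : MeasurePreserving (fun x : E n × ℝ => x + (e, 0)) volume volume :=
    measurePreserving_add_right volume _
  refine ⟨fun j p => f j (p + v), fun j => ?_, fun j => ?_, ?_, fun k => ?_, ?_⟩
  · have := hf j; fun_prop
  · exact (hfc j).comp_homeomorph (Homeomorph.addRight v)
  · refine f1.congr fun j => ?_
    exact (eLpNorm_comp_measurePreserving
      ((hf j).continuous.measurable.sub mU).aestronglyMeasurable hmp).symm
  · refine (f2 k).congr fun j => ?_
    have hc : Continuous fun p => fderiv ℝ (f j) p (dir k) :=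
      ((hf j).continuous_fderiv (by norm_num)).clm_apply continuous_const
    rw [← eLpNorm_comp_measurePreserving
      (hc.measurable.sub (mW k)).aestronglyMeasurable hmp]
    congr 1
    ext1 p
    simp [fderiv_comp_add_right]
  · have hc : ∀ j, Measurable (atZero (f j)) := fun j =>
      ((hf j).continuous.comp isClosedEmbedding_atZero.continuous).measurable
    refine f3.congr fun j => ?_
    rw [← eLpNorm_comp_measurePreserving ((hc j).sub mz).aestronglyMeasurable hmp0]
    congr 1
    ext1 x
    simp [atZero, v]

/-- Constant coefficients and a weight independent of `x`: a translation of the solution is passed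
on to the test function or the cut-off by a change of variables. -/
theorem Sol.translate {U : Pt n → E n} {G : Option (Fin n) → Pt n → E n}
    {u g : E n × ℝ → E n} (hS : Sol Ω a μ lam U G u g) (e : E n) :
    Sol ((fun p => p + (e, 0, 0)) ⁻¹' Ω) a μ lam (fun p => U (p + (e, 0, 0)))
      (fun k p => G k (p + (e, 0, 0))) (fun x => u (x + (e, 0))) (fun x => g (x + (e, 0))) := by
  set v : Pt n := (e, 0, 0) with hv
  have hmp : MeasurePreserving (fun p : Pt n => p + v) (wMeasure n a) (wMeasure n a) :=
    measurePreserving_add_tangential a rfl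
  have hmp0 : MeasurePreserving (fun x : E n × ℝ => x + (e, 0)) volume volume :=
    measurePreserving_add_right volume _
  have hKc : ∀ {K : Set (Pt n)}, IsCompact K → IsCompact ((fun p => p - v) ⁻¹' K) := fun hK =>
    (Homeomorph.subRight v).isCompact_preimage.2 hK
  have hKs : ∀ {K : Set (Pt n)}, K ⊆ (fun p => p + v) ⁻¹' Ω → (fun p => p - v) ⁻¹' K ⊆ Ω :=
    fun hs p hp => by simpa using hs hp
  have hpre : ∀ (K : Set (Pt n)), {b : E n × ℝ | ((b.1, 0, b.2) : Pt n) ∈ (fun p => p - v) ⁻¹' K} =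
      (fun b => b - (e, 0)) ⁻¹' {b : E n × ℝ | ((b.1, 0, b.2) : Pt n) ∈ K} := fun K => by
    ext b; simp [hv]
  have hK0 : ∀ {K : Set (Pt n)}, IsCompact K →
      MeasurableSet {b : E n × ℝ | ((b.1, 0, b.2) : Pt n) ∈ K} := fun hK =>
    (hK.isClosed.preimage isClosedEmbedding_atZero.continuous).measurableSet
  have ts : ∀ {F : Type _} [Zero F] (f : Pt n → F),
      tsupport (fun p => f (p - v)) = (fun p => p - v) ⁻¹' tsupport f := fun f =>
    tsupport_comp_eq_preimage f (Homeomorph.subRight v)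
  refine ⟨hS.measU.comp (by fun_prop), fun k => (hS.measG k).comp (by fun_prop),
    hS.measu.comp (by fun_prop), hS.measg.comp (by fun_prop), ?_, ?_, ?_, ?_, ?_, ?_⟩
  · exact fun K hK hs => measurePreserving_add_restrict hmp hK.measurableSet
      (hS.memU _ (hKc hK) (hKs hs))
  · exact fun k K hK hs => measurePreserving_add_restrict hmp hK.measurableSet
      (hS.memG k _ (hKc hK) (hKs hs))
  · intro K hK hs
    have := hS.memu _ (hKc hK) (hKs hs)
    rw [hpre] at this
    exact measurePreserving_add_restrict hmp0 (hK0 hK) this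
  · intro K hK hs
    have := hS.memg _ (hKc hK) (hKs hs)
    rw [hpre] at this
    exact measurePreserving_add_restrict hmp0 (hK0 hK) this
  · intro η hη hηc hηs
    have hη' : ContDiff ℝ ∞ fun p => η (p - v) := by fun_prop
    have h := (hS.approx (fun p => η (p - v)) hη' (hηc.comp_homeomorph (Homeomorph.subRight v))
      (by rw [ts]; exact hKs hηs)).translate (hη'.continuous.measurable.smul hS.measU)
      (measurable_cutGrad hη' hS.measU hS.measG)
      ((hη'.continuous.comp isClosedEmbedding_atZero.continuous).measurable.smul hS.measu) e
    convert h using 1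
    · ext1 p; simp [hv]
    · ext1 k; ext1 p
      simp [cutGrad, hv, fderiv_comp_sub]
    · ext1 x
      simp [atZero, hv]
  · intro φ hφ hφc hφs
    have h := hS.eq (fun p => φ (p - v)) (by fun_prop)
      (hφc.comp_homeomorph (Homeomorph.subRight v)) (by rw [ts]; exact hKs hφs)
    have hme := (MeasurableEquiv.addRight v).measurableEmbedding
    have hme0 := (MeasurableEquiv.addRight ((e, 0) : E n × ℝ)).measurableEmbedding
    rw [← hmp.integral_comp hme, ← hmp0.integral_comp hme0,
      Finset.sum_congr rfl fun k _ => (hmp.integral_comp hme _).symm] at h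
    simp only [fderiv_comp_sub, add_sub_cancel_right] at h
    rw [h]
    congr 1
    · refine Finset.sum_congr rfl fun k _ => integral_congr_ae (Eventually.of_forall fun p => ?_)
      cases k <;> rfl
    · refine integral_congr_ae (Eventually.of_forall fun x => ?_)
      simp [atZero, hv]

end Translation

end LameExt

namespace LameExt

open scoped ENNReal

variable {n : ℕ} {a μ lam : ℝ}

/-! ### Parabolic cylinders -/

section Cylinders

/-- The cylinder `{|X| < r} × (-r², 0)`, including both sides of `{y = 0}`. -/
def Q (n : ℕ) (r : ℝ) : Set (Pt n) :=
  {p | ‖p.1‖ ^ 2 + p.2.1 ^ 2 < r ^ 2 ∧ -r ^ 2 < p.2.2 ∧ p.2.2 < 0}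

/-- The thin part of `Q n r`. -/
def Q0 (n : ℕ) (r : ℝ) : Set (E n × ℝ) := {x | ((x.1, 0, x.2) : Pt n) ∈ Q n r}

/-- The closed cylinder `{|X| ≤ r} × [-r², 0]`. -/
def closedCyl (n : ℕ) (r : ℝ) : Set (Pt n) :=
  {p | ‖p.1‖ ^ 2 + p.2.1 ^ 2 ≤ r ^ 2 ∧ -r ^ 2 ≤ p.2.2 ∧ p.2.2 ≤ 0}

theorem Q_one : Q n 1 = fullCyl n := by
  ext p; simp [Q, fullCyl]

theorem isOpen_Q (r : ℝ) : IsOpen (Q n r) := by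
  refine IsOpen.and (isOpen_lt ?_ continuous_const) (IsOpen.and (isOpen_lt continuous_const ?_)
    (isOpen_lt ?_ continuous_const)) <;> fun_prop

theorem measurableSet_Q (r : ℝ) : MeasurableSet (Q n r) := (isOpen_Q r).measurableSet

theorem measurableSet_Q0 (r : ℝ) : MeasurableSet (Q0 n r) :=
  ((isOpen_Q r).preimage isClosedEmbedding_atZero.continuous).measurableSet

theorem isCompact_closedCyl (r : ℝ) : IsCompact (closedCyl n r) := by
  have h1 : IsCompact (Metric.closedBall (0 : E n) |r| ×ˢ (Metric.closedBall (0 : ℝ) |r| ×ˢ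
      Set.Icc (-r ^ 2) 0)) :=
    (isCompact_closedBall _ _).prod ((isCompact_closedBall _ _).prod isCompact_Icc)
  refine h1.of_isClosed_subset ?_ fun p hp => ?_
  · refine IsClosed.and (isClosed_le ?_ continuous_const) (IsClosed.and
      (isClosed_le continuous_const ?_) (isClosed_le ?_ continuous_const)) <;> fun_prop
  · obtain ⟨h1, h2⟩ := hp
    refine ⟨?_, ?_, h2⟩
    · rw [mem_closedBall_zero_iff, ← abs_norm, ← sq_le_sq]
      linarith [sq_nonneg p.2.1]
    · rw [mem_closedBall_zero_iff, Real.norm_eq_abs, ← sq_le_sq]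
      linarith [sq_nonneg ‖p.1‖]

theorem Q_subset_closedCyl (r : ℝ) : Q n r ⊆ closedCyl n r := fun _ hp =>
  ⟨hp.1.le, hp.2.1.le, hp.2.2.le⟩

theorem Q_mono {r r' : ℝ} (hr : 0 ≤ r) (h : r ≤ r') : Q n r ⊆ Q n r' := fun p hp => by
  have : r ^ 2 ≤ r' ^ 2 := by gcongr
  exact ⟨hp.1.trans_le this, by linarith [hp.2.1], hp.2.2⟩

theorem Q0_mono {r r' : ℝ} (hr : 0 ≤ r) (h : r ≤ r') : Q0 n r ⊆ Q0 n r' := fun _ hx =>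
  Q_mono hr h hx

theorem norm_add_sq_add_lt {r ρ y : ℝ} (hr : 0 ≤ r) {x e : E n} (he : ‖e‖ ≤ ρ)
    (h : ‖x‖ ^ 2 + y ^ 2 < r ^ 2) : ‖x + e‖ ^ 2 + y ^ 2 < (r + ρ) ^ 2 := by
  have h1 : ‖x + e‖ ≤ ‖x‖ + ρ := (norm_add_le _ _).trans (by gcongr)
  have h2 : ‖x‖ ≤ r := abs_le_of_sq_le_sq' (by linarith [sq_nonneg y]) hr |>.2
  have h3 : ‖x + e‖ ^ 2 ≤ (‖x‖ + ρ) ^ 2 := by gcongr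
  have h4 : 0 ≤ ρ := (norm_nonneg e).trans he
  nlinarith [mul_le_mul_of_nonneg_right h2 h4]

theorem add_mem_Q {r ρ : ℝ} (hr : 0 ≤ r) {e : E n} (he : ‖e‖ ≤ ρ) {p : Pt n} (hp : p ∈ Q n r) :
    p + (e, 0, 0) ∈ Q n (r + ρ) := by
  have h4 : 0 ≤ ρ := (norm_nonneg e).trans he
  refine ⟨?_, ?_, ?_⟩
  · simpa using norm_add_sq_add_lt hr he hp.1
  · have := hp.2.1
    simp only [Prod.snd_add, add_zero]
    nlinarith [mul_nonneg hr h4]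
  · simpa using hp.2.2

end Cylinders

/-! ### Difference quotients of solutions -/

section Quotient

/-- The difference quotient of step `h` in the direction `v`. -/
noncomputable def dq {X F : Type*} [AddCommGroup X] [Module ℝ X] [AddCommGroup F] [Module ℝ F]
    (h : ℝ) (v : X) (f : X → F) (p : X) : F := h⁻¹ • (f (p + h • v) - f p)

theorem dq_eq {X F : Type*} [AddCommGroup X] [Module ℝ X] [AddCommGroup F] [Module ℝ F]
    (h : ℝ) (v : X) (f : X → F) :
    dq h v f = fun p => h⁻¹ • f (p + h • v) + (-h⁻¹) • f p := by
  ext1 p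
  rw [dq]
  module

/-- The direction `x_i` on the thin space. -/
noncomputable def thinDir (i : Fin n) : E n × ℝ := (EuclideanSpace.single i 1, 0)

theorem smul_dir_some (h : ℝ) (i : Fin n) :
    h • (dir (some i) : Pt n) = (h • EuclideanSpace.single i 1, 0, 0) := by
  simp [dir]

theorem smul_thinDir (h : ℝ) (i : Fin n) :
    h • thinDir i = (h • EuclideanSpace.single i 1, (0 : ℝ)) := by
  simp [thinDir]

theorem norm_smul_single_le (h : ℝ) (i : Fin n) :
    ‖(h • EuclideanSpace.single i 1 : E n)‖ ≤ |h| := by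
  simp [norm_smul]

theorem norm_dir_some (i : Fin n) : ‖(dir (some i) : Pt n)‖ = 1 := by
  simp [dir, Prod.norm_def]

theorem norm_thinDir (i : Fin n) : ‖thinDir i‖ = 1 := by
  simp [thinDir, Prod.norm_def]

theorem add_smul_dir_mem_Q {r h : ℝ} (hr : 0 ≤ r) (i : Fin n) {p : Pt n} (hp : p ∈ Q n r) :
    p + h • dir (some i) ∈ Q n (r + |h|) := by
  rw [smul_dir_some]
  exact add_mem_Q hr (norm_smul_single_le h i) hp

theorem add_smul_thinDir_mem_Q0 {r h : ℝ} (hr : 0 ≤ r) (i : Fin n) {x : E n × ℝ}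
    (hx : x ∈ Q0 n r) : x + h • thinDir i ∈ Q0 n (r + |h|) := by
  have := add_smul_dir_mem_Q (h := h) hr i hx
  rw [smul_dir_some] at this
  rw [smul_thinDir]
  simpa [Q0] using this

/-- A difference quotient is a linear combination of a translate and the function itself; the
cylinder shrinks by the length of the step. -/
theorem Sol.diffQuot (ha : -1 < a) {U : Pt n → E n} {G : Option (Fin n) → Pt n → E n}
    {u g : E n × ℝ → E n} {R r h : ℝ} (hS : Sol (Q n R) a μ lam U G u g) (hr : 0 ≤ r)
    (hR : r + |h| ≤ R) (i : Fin n) :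
    Sol (Q n r) a μ lam (dq h (dir (some i)) U) (fun k => dq h (dir (some i)) (G k))
      (dq h (thinDir i) u) (dq h (thinDir i) g) := by
  have h0 := abs_nonneg h
  have hsub : Q n r ⊆ (fun p => p + (h • EuclideanSpace.single i 1, 0, 0)) ⁻¹' Q n R :=
    fun p hp => by
      exact Q_mono (by linarith) hR (add_mem_Q hr (norm_smul_single_le h i) hp)
  have hle : r ≤ R := by linarith
  have h1 := (hS.translate (h • EuclideanSpace.single i 1)).mono hsub
  have h2 := hS.mono (Q_mono hr hle)
  have h3 := Sol.lincomb ha h1 h2 h⁻¹ (-h⁻¹)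
  have e1 : ∀ f : Pt n → E n, dq h (dir (some i)) f =
      fun p => h⁻¹ • f (p + (h • EuclideanSpace.single i 1, 0, 0)) + (-h⁻¹) • f p := fun f => by
    rw [dq_eq, smul_dir_some]
  have e2 : ∀ f : E n × ℝ → E n, dq h (thinDir i) f =
      fun x => h⁻¹ • f (x + (h • EuclideanSpace.single i 1, 0)) + (-h⁻¹) • f x := fun f => by
    rw [dq_eq, smul_thinDir]
  rw [e1 U, e2 u, e2 g, funext fun k => e1 (G k)]
  exact h3

/-- The discrete product rule. It keeps the Robin form for the quotient, at the price of an
inhomogeneity in which `u` is not differenced. -/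
theorem dq_mul_smul {V : E n × ℝ → ℝ} {u : E n × ℝ → E n} (h : ℝ) (v : E n × ℝ) (x : E n × ℝ) :
    dq h v (fun x => V x • u x) x = V x • dq h v u x + dq h v V x • u (x + h • v) := by
  simp only [dq, smul_eq_mul]
  module

theorem ae_eq_of_tendsto_eLpNorm {α : Type*} [MeasurableSpace α] {ν : Measure α}
    {f : ℕ → α → E n} {g g' : α → E n} (hf : ∀ j, AEStronglyMeasurable (f j) ν)
    (hg : AEStronglyMeasurable g ν) (hg' : AEStronglyMeasurable g' ν)
    (h : Tendsto (fun j => eLpNorm (f j - g) 2 ν) atTop (𝓝 0))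
    (h' : Tendsto (fun j => eLpNorm (f j - g') 2 ν) atTop (𝓝 0)) : g =ᵐ[ν] g' := by
  have h0 : eLpNorm (g - g') 2 ν = 0 := by
    have := h'.add h
    rw [add_zero] at this
    refine le_antisymm (ge_of_tendsto this (Eventually.of_forall fun j => ?_)) zero_le
    have e : g - g' = (f j - g') - (f j - g) := by abel
    rw [e]
    exact eLpNorm_sub_le ((hf j).sub hg') ((hf j).sub hg) (by norm_num)
  rw [eLpNorm_eq_zero_iff (hg.sub hg') (by norm_num)] at h0
  filter_upwards [h0] with x hx
  exact sub_eq_zero.1 hx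

/-- The segment formula holds for the smooth approximations, and both sides are continuous in `L²`.
This replaces absolute continuity along lines. -/
theorem H1Approx.sub_ae_eq_avg {w : Pt n → E n} {W : Option (Fin n) → Pt n → E n}
    {z : E n × ℝ → E n} (hw : H1Approx a w W z) (ha : -1 < a) (mw : Measurable w)
    (i : Fin n) (mW : Measurable (W (some i))) (hW : MemLp (W (some i)) 2 (wMeasure n a)) (h : ℝ) :
    (fun p => w (p + h • dir (some i)) - w p) =ᵐ[wMeasure n a]
      avg (lineMeas (h • dir (some i))) fun q => h • W (some i) q := by
  obtain ⟨f, hf, hfc, f1, f2, -⟩ := hw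
  have hfin := wMeasure_finite n ha
  set v : Pt n := h • dir (some i) with hv
  have hv0 : v.2.1 = 0 := by simp [hv, dir]
  have hmp : MeasurePreserving (fun p : Pt n => p + v) (wMeasure n a) (wMeasure n a) :=
    measurePreserving_add_tangential a hv0
  have hcd : ∀ j, Continuous fun q => fderiv ℝ (f j) q v := fun j =>
    ((hf j).continuous_fderiv (by norm_num)).clm_apply continuous_const
  have m1 : ∀ j, Measurable (f j - w) := fun j => (hf j).continuous.measurable.sub mw
  refine ae_eq_of_tendsto_eLpNorm (f := fun j p => f j (p + v) - f j p) (fun j => ?_)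
    ((mw.comp (by fun_prop)).sub mw).aestronglyMeasurable
    (stronglyMeasurable_avg (mW.const_smul h)).aestronglyMeasurable ?_ ?_
  · have := (hf j).continuous
    exact Continuous.aestronglyMeasurable (by fun_prop)
  · have t2 : Tendsto (fun j => eLpNorm ((f j - w) ∘ fun p => p + v) 2 (wMeasure n a)) atTop
        (𝓝 0) := by
      refine f1.congr fun j => (eLpNorm_comp_measurePreserving ?_ hmp).symm
      exact (m1 j).aestronglyMeasurable
    have t3 := t2.add f1
    rw [add_zero] at t3
    refine tendsto_of_tendsto_of_tendsto_of_le_of_le tendsto_const_nhds t3 (fun _ => zero_le)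
      fun j => ?_
    have e : ((fun p => f j (p + v) - f j p) - fun p => w (p + v) - w p) =
        ((f j - w) ∘ fun p => p + v) - (f j - w) := by
      ext1 p
      simp only [Pi.sub_apply, Function.comp_apply]
      abel
    simp only
    rw [e]
    exact eLpNorm_sub_le ((m1 j).comp (by fun_prop)).aestronglyMeasurable
      (m1 j).aestronglyMeasurable (by norm_num)
  · have hb := avgBdd_lineMeas_tangential a hv0
    have t : Tendsto (fun j => eLpNorm ((fun q => fderiv ℝ (f j) q v) -
        fun q => h • W (some i) q) 2 (wMeasure n a)) atTop (𝓝 0) := by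
      refine (tendsto_eLpNorm_smul (c := fun _ => h) (M := ‖h‖) (fun _ => le_rfl)
        (f2 (some i))).congr fun j => ?_
      congr 1
      ext1 p
      simp [hv]
    refine (tendsto_avg_of_tendsto hb (fun j => (hcd j).measurable)
      (fun j => (hcd j).memLp_of_hasCompactSupport ((hfc j).fderiv_apply ℝ v))
      (mW.const_smul h) (hW.const_smul h) t).congr fun j => ?_
    congr 2
    ext1 p
    exact (sub_eq_avg_lineMeas (hf j) p v).symm

theorem avg_lineMeas_congr {v p : Pt n} {f g : Pt n → E n} (hf : Measurable f)
    (hg : Measurable g) (h : ∀ σ ∈ Set.Icc (0 : ℝ) 1, f (p + σ • v) = g (p + σ • v)) :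
    avg (lineMeas v) f p = avg (lineMeas v) g p := by
  rw [avg_lineMeas v hf, avg_lineMeas v hg]
  refine intervalIntegral.integral_congr fun σ hσ => ?_
  rw [Set.uIcc_of_le zero_le_one] at hσ
  exact h σ hσ

/-- The formula for `η U` gives the formula for `U` wherever `η = 1` near the whole segment. -/
theorem Sol.dq_ae_eq_avg (ha : -1 < a) {U : Pt n → E n} {G : Option (Fin n) → Pt n → E n}
    {u g : E n × ℝ → E n} {R r h : ℝ} (hS : Sol (Q n R) a μ lam U G u g) (hr : 0 ≤ r)
    (hR : r + |h| < R) (h0 : h ≠ 0) (i : Fin n) :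
    ∀ᵐ p ∂(wMeasure n a), p ∈ Q n r → dq h (dir (some i)) U p =
      avg (lineMeas (h • dir (some i))) (G (some i)) p := by
  have hh := abs_nonneg h
  -- A cut-off must be supported in the open cylinder, away from `t = 0`. The statement is proved
  -- for `t ≤ -1/(j+1)`, and countably many values of `j` cover `{t < 0}`.
  have key : ∀ j : ℕ, ∀ᵐ p ∂(wMeasure n a), p ∈ Q n r → p.2.2 ≤ -(1 / ((j : ℝ) + 1)) →
      dq h (dir (some i)) U p = avg (lineMeas (h • dir (some i))) (G (some i)) p := by
    intro j
    have hj : (0 : ℝ) < 1 / ((j : ℝ) + 1) := by positivity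
    set S := closedCyl n (r + |h|) ∩ {p | p.2.2 ≤ -(1 / ((j : ℝ) + 1))} with hSdef
    have hSc : IsCompact S := (isCompact_closedCyl _).inter_right
      (isClosed_le (by fun_prop) continuous_const)
    have hSQ : S ⊆ Q n R := fun p hp => by
      have h1 : (r + |h|) ^ 2 < R ^ 2 := by gcongr
      have h2 : p.2.2 ≤ -(1 / ((j : ℝ) + 1)) := hp.2
      exact ⟨hp.1.1.trans_lt h1, by linarith [hp.1.2.1], by linarith⟩
    obtain ⟨η, ρ, hη, hηc, hρ, hηQ, -, hη1⟩ := exists_cutoff hSc (isOpen_Q R) hSQ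
    have hηs : tsupport η ⊆ Q n R := (Metric.self_subset_cthickening _).trans hηQ
    have mC := measurable_cutGrad hη hS.measU hS.measG (some i)
    have hae := (hS.approx η hη hηc hηs).sub_ae_eq_avg ha
      (hη.continuous.measurable.smul hS.measU) i mC (hS.memLp_cutGrad hη hηc hηs (some i)) h
    filter_upwards [hae] with p hp hpQ hpt
    have hseg : ∀ σ ∈ Set.Icc (0 : ℝ) 1, p + σ • h • dir (some i) ∈ S := fun σ hσ => by
      have h1 : |σ * h| ≤ |h| := by
        rw [abs_mul, abs_of_nonneg hσ.1]
        exact mul_le_of_le_one_left hh hσ.2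
      rw [smul_smul]
      refine ⟨Q_subset_closedCyl _ (Q_mono (by positivity) (by gcongr)
        (add_smul_dir_mem_Q (h := σ * h) hr i hpQ)), ?_⟩
      simpa [dir] using hpt
    have e0 : η p = 1 := by
      have := (hη1 _ (hseg 0 (by simp))).self_of_nhds
      simpa using this
    have e1 : η (p + h • dir (some i)) = 1 := by
      have := (hη1 _ (hseg 1 (by simp))).self_of_nhds
      simpa using this
    simp only [e0, e1, one_smul] at hp
    rw [dq, hp, avg_lineMeas_congr (f := fun q => h • cutGrad η U G (some i) q)
      (g := fun q => h • G (some i) q) (mC.const_smul h) ((hS.measG (some i)).const_smul h)]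
    · simp only [avg, integral_smul, smul_smul]
      rw [inv_mul_cancel₀ h0, one_smul]
    · intro σ hσ
      have h1 := hη1 _ (hseg σ hσ)
      rw [cutGrad, h1.fderiv_eq, h1.self_of_nhds]
      simp
  filter_upwards [ae_all_iff.2 key] with p hp hpQ
  obtain ⟨j, hj⟩ := exists_nat_one_div_lt (show 0 < -p.2.2 by linarith [hpQ.2.2])
  exact hp j hpQ (by linarith)

end Quotient

end LameExt

namespace LameExt

open scoped ENNReal

variable {n : ℕ} {a μ lam : ℝ}

/-! ### Convergence of difference quotients in the interior -/

section InteriorConvergence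

theorem memLp_two_of_lintegral_ne_top {α F : Type*} [MeasurableSpace α] [NormedAddCommGroup F]
    {ν : Measure α} {f : α → F} (hf : AEStronglyMeasurable f ν) (h : ∫⁻ x, ‖f x‖ₑ ^ 2 ∂ν ≠ ⊤) :
    MemLp f 2 ν := by
  refine ⟨hf, ?_⟩
  have h2 : eLpNorm f 2 ν ^ 2 < ⊤ := by rw [eLpNorm_sq]; exact lt_top_iff_ne_top.2 h
  exact (ENNReal.pow_lt_top_iff.1 h2).resolve_right two_ne_zero

theorem lintegral_ne_top_of_memLp {α F : Type*} [MeasurableSpace α] [NormedAddCommGroup F]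
    {ν : Measure α} {f : α → F} (hf : MemLp f 2 ν) : ∫⁻ x, ‖f x‖ₑ ^ 2 ∂ν ≠ ⊤ := by
  rw [← eLpNorm_sq]
  exact (ENNReal.pow_lt_top hf.2).ne

theorem avg_eq_avg_indicator {r r' h : ℝ} (hr : 0 ≤ r) (hR : r + |h| ≤ r') (i : Fin n)
    {f : Pt n → E n} (hf : Measurable f) {p : Pt n} (hp : p ∈ Q n r) :
    avg (lineMeas (h • dir (some i))) f p =
      avg (lineMeas (h • dir (some i))) ((Q n r').indicator f) p := by
  refine avg_lineMeas_congr hf (hf.indicator (measurableSet_Q r')) fun σ hσ => ?_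
  rw [Set.indicator_of_mem]
  have h1 : |σ * h| ≤ |h| := by
    rw [abs_mul, abs_of_nonneg hσ.1]
    exact mul_le_of_le_one_left (abs_nonneg h) hσ.2
  rw [smul_smul]
  exact Q_mono (by positivity) (by linarith) (add_smul_dir_mem_Q (h := σ * h) hr i hp)

variable {U : Pt n → E n} {G : Option (Fin n) → Pt n → E n} {u g : E n × ℝ → E n} {R r r' : ℝ}

/-- The quotient is an average of the gradient along a segment inside the larger cylinder, and
tangential averages are contractions of `L²(y^a)`. -/
theorem Sol.eLpNorm_dq_le (ha : -1 < a) (hS : Sol (Q n R) a μ lam U G u g) (hr : 0 ≤ r) {h : ℝ}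
    (hr' : r + |h| ≤ r') (hR : r' < R) (h0 : h ≠ 0) (i : Fin n) :
    eLpNorm (dq h (dir (some i)) U) 2 ((wMeasure n a).restrict (Q n r)) ≤
      eLpNorm (G (some i)) 2 ((wMeasure n a).restrict (Q n r')) := by
  have hae := hS.dq_ae_eq_avg ha hr (hr'.trans_lt hR) h0 i
  have hb : AvgBdd (lineMeas (h • (dir (some i) : Pt n))) (wMeasure n a) 1 :=
    avgBdd_lineMeas_tangential a (by simp [dir])
  have mF := (hS.measG (some i)).indicator (measurableSet_Q (n := n) r')
  calc _ = eLpNorm (avg (lineMeas (h • dir (some i))) ((Q n r').indicator (G (some i)))) 2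
        ((wMeasure n a).restrict (Q n r)) := by
        refine eLpNorm_congr_ae ((ae_restrict_iff' (measurableSet_Q r)).2 ?_)
        filter_upwards [hae] with p hp hpQ
        rw [hp hpQ, avg_eq_avg_indicator hr hr' i (hS.measG _) hpQ]
    _ ≤ eLpNorm (avg (lineMeas (h • dir (some i))) ((Q n r').indicator (G (some i)))) 2
        (wMeasure n a) := eLpNorm_mono_measure _ Measure.restrict_le_self
    _ ≤ eLpNorm ((Q n r').indicator (G (some i))) 2 (wMeasure n a) := by
        simpa using eLpNorm_avg_le hb mF
    _ = _ := eLpNorm_indicator_eq_eLpNorm_restrict (measurableSet_Q r')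

/-- The same segment averages form an approximate identity as the step tends to zero, so the
convergence is strong. -/
theorem Sol.tendsto_dq (ha : -1 < a) (hS : Sol (Q n R) a μ lam U G u g) (hr : 0 ≤ r)
    (hr' : r < r') (hR : r' < R) (i : Fin n)
    (hG : MemLp (G (some i)) 2 ((wMeasure n a).restrict (Q n r'))) :
    Tendsto (fun h => eLpNorm (dq h (dir (some i)) U - G (some i)) 2
      ((wMeasure n a).restrict (Q n r))) (𝓝[≠] 0) (𝓝 0) := by
  have hreg := wMeasure_regular n ha
  have mF := (hS.measG (some i)).indicator (measurableSet_Q (n := n) r')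
  have hF := (memLp_indicator_iff_restrict (measurableSet_Q r')).2 hG
  have t := tendsto_avg (l := 𝓝[≠] (0 : ℝ)) (ν := fun h : ℝ => lineMeas (h • (dir (some i) : Pt n)))
    (by norm_num) (fun h => avgBdd_lineMeas_tangential a (by simp [dir])) (fun ε hε => by
      have h1 : Set.Icc (-ε) ε ∈ 𝓝[≠] (0 : ℝ) :=
        mem_nhdsWithin_of_mem_nhds (Icc_mem_nhds (by linarith) hε)
      filter_upwards [h1] with h hh
      refine lineMeas_compl_closedBall ?_
      rw [norm_smul, norm_dir_some, mul_one, Real.norm_eq_abs]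
      exact abs_le.2 hh) mF hF
  refine tendsto_of_tendsto_of_tendsto_of_le_of_le' tendsto_const_nhds t
    (Eventually.of_forall fun _ => zero_le) ?_
  have h1 : Set.Icc (-(r' - r)) (r' - r) ∈ 𝓝[≠] (0 : ℝ) :=
    mem_nhdsWithin_of_mem_nhds (Icc_mem_nhds (by linarith) (by linarith))
  filter_upwards [h1, self_mem_nhdsWithin] with h hh h0
  have hle : r + |h| ≤ r' := by linarith [abs_le.2 hh]
  have hae := hS.dq_ae_eq_avg ha hr (hle.trans_lt hR) h0 i
  refine le_trans (le_of_eq (eLpNorm_congr_ae ((ae_restrict_iff' (measurableSet_Q r)).2 ?_)))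
    (eLpNorm_mono_measure _ Measure.restrict_le_self)
  filter_upwards [hae] with p hp hpQ
  rw [Pi.sub_apply, Pi.sub_apply, hp hpQ, avg_eq_avg_indicator hr hle i (hS.measG _) hpQ,
    Set.indicator_of_mem (Q_mono hr hr'.le hpQ)]

end InteriorConvergence

/-! ### Convergence of the boundary inhomogeneity -/

section BoundaryConvergence

/-- Continuity of translations in `L²`, as the approximate identity theorem for Dirac masses. -/
theorem tendsto_translate {F : E n × ℝ → E n} (mF : Measurable F) (hF : MemLp F 2 volume)
    (v : E n × ℝ) :
    Tendsto (fun h : ℝ => eLpNorm ((fun x => F (x + h • v)) - F) 2 volume) (𝓝 0) (𝓝 0) := by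
  have t := tendsto_avg (l := 𝓝 (0 : ℝ)) (ν := fun h : ℝ => Measure.dirac (-(h • v)))
    (μ := (volume : Measure (E n × ℝ))) (C := 1)
    (by norm_num) (fun h => by
      have := avgBdd_of_measurePreserving (ν := Measure.dirac (-(h • v)))
        (μ := (volume : Measure (E n × ℝ)))
        (Eventually.of_forall fun q => measurePreserving_sub_right volume q)
      simpa using this) (fun ε hε => by
      have hc : Tendsto (fun h : ℝ => -(h • v)) (𝓝 0) (𝓝 0) := by
        have : Continuous fun h : ℝ => -(h • v) := by fun_prop
        simpa using this.tendsto 0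
      filter_upwards [hc (Metric.closedBall_mem_nhds 0 hε)] with h hh
      rw [Measure.dirac_apply' _ Metric.isClosed_closedBall.measurableSet.compl]
      simpa using hh) mF hF
  refine t.congr fun h => ?_
  congr 2
  ext1 x
  simp [avg]

variable {V : E n × ℝ → ℝ} {K : ℝ}

theorem abs_dq_le (hV : Differentiable ℝ V) (hK : ∀ x, ‖fderiv ℝ V x‖ ≤ K) (h : ℝ) (i : Fin n)
    (x : E n × ℝ) : |dq h (thinDir i) V x| ≤ K := by
  have h1 := Convex.norm_image_sub_le_of_norm_fderiv_le (𝕜 := ℝ) (f := V) (s := Set.univ) (C := K)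
    (fun x _ => hV x) (fun x _ => hK x) convex_univ (Set.mem_univ x)
    (Set.mem_univ (x + h • thinDir i))
  have hK0 : 0 ≤ K := (norm_nonneg _).trans (hK x)
  rw [add_sub_cancel_left, norm_smul, norm_thinDir, mul_one, Real.norm_eq_abs,
    Real.norm_eq_abs] at h1
  rw [dq, smul_eq_mul, abs_mul, abs_inv]
  -- For a zero step the quotient is `0`, since `0⁻¹ = 0`.
  rcases eq_or_ne h 0 with rfl | h0
  · simpa using hK0
  · rw [inv_mul_le_iff₀ (abs_pos.2 h0)]
    linarith

theorem tendsto_dq_fderiv (hV : Differentiable ℝ V) (i : Fin n) (x : E n × ℝ) :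
    Tendsto (fun h => dq h (thinDir i) V x) (𝓝[≠] 0) (𝓝 (fderiv ℝ V x (thinDir i))) := by
  have h1 := (hV x).hasFDerivAt.hasLineDerivAt (thinDir i)
  have h2 := hasDerivAt_iff_tendsto_slope_zero.1 h1
  simpa [dq] using h2

/-- The inhomogeneity in the boundary condition of a difference quotient. -/
noncomputable def bdry (V : E n × ℝ → ℝ) (u : E n × ℝ → E n) (i : Fin n) (h : ℝ)
    (x : E n × ℝ) : E n :=
  dq h (thinDir i) V x • u (x + h • thinDir i)

variable {u : E n × ℝ → E n} {r r' : ℝ}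

theorem eLpNorm_bdry_le (hV : Differentiable ℝ V) (hK : ∀ x, ‖fderiv ℝ V x‖ ≤ K)
    (mu : Measurable u) {h : ℝ} (hr : 0 ≤ r) (hr' : r + |h| ≤ r') (i : Fin n) :
    eLpNorm (bdry V u i h) 2 (volume.restrict (Q0 n r)) ≤
      ENNReal.ofReal K * eLpNorm u 2 (volume.restrict (Q0 n r')) := by
  have mF := mu.indicator (measurableSet_Q0 (n := n) r')
  calc _ ≤ ENNReal.ofReal K * eLpNorm (fun x => (Q0 n r').indicator u (x + h • thinDir i)) 2
        (volume.restrict (Q0 n r)) := by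
        refine eLpNorm_le_mul_eLpNorm_of_ae_le_mul
          ((ae_restrict_iff' (measurableSet_Q0 r)).2 (Eventually.of_forall fun x hx => ?_)) 2
        rw [bdry, norm_smul, Real.norm_eq_abs, Set.indicator_of_mem
          (Q0_mono (by positivity) hr' (add_smul_thinDir_mem_Q0 hr i hx))]
        gcongr
        exact abs_dq_le hV hK h i x
    _ ≤ ENNReal.ofReal K * eLpNorm (fun x => (Q0 n r').indicator u (x + h • thinDir i)) 2
        volume := by
        gcongr
        exact Measure.restrict_le_self
    _ = _ := by
        rw [← eLpNorm_indicator_eq_eLpNorm_restrict (measurableSet_Q0 r')]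
        have e := eLpNorm_comp_measurePreserving (p := 2) mF.aestronglyMeasurable
          (measurePreserving_add_right volume (h • thinDir i))
        rw [← e]
        rfl

/-- Two errors: the shift of `u`, small by continuity of translations since the quotients of `V` are
bounded, and `D V - ∂V`, which tends to zero pointwise and is handled by dominated convergence. -/
theorem tendsto_bdry (hV : ContDiff ℝ 1 V) (hK : ∀ x, ‖fderiv ℝ V x‖ ≤ K)
    (mu : Measurable u) (hr : 0 ≤ r) (hr' : r < r')
    (hu : MemLp u 2 (volume.restrict (Q0 n r'))) (i : Fin n) {s : ℕ → ℝ}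
    (hs : Tendsto s atTop (𝓝[≠] 0)) :
    Tendsto (fun j => eLpNorm (bdry V u i (s j) - fun x => fderiv ℝ V x (thinDir i) • u x) 2
      (volume.restrict (Q0 n r))) atTop (𝓝 0) := by
  have hVd : Differentiable ℝ V := hV.differentiable (by norm_num)
  have mV := hV.continuous.measurable
  have mdV : Measurable fun x => fderiv ℝ V x (thinDir i) :=
    ((hV.continuous_fderiv (by norm_num)).clm_apply continuous_const).measurable
  have mF := mu.indicator (measurableSet_Q0 (n := n) r')
  have hF := (memLp_indicator_iff_restrict (measurableSet_Q0 r')).2 hu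
  set F := (Q0 n r').indicator u
  have mdq : ∀ h, Measurable (dq h (thinDir i) V) := fun h => by
    unfold dq
    fun_prop
  have hs0 : Tendsto s atTop (𝓝 0) := hs.mono_right nhdsWithin_le_nhds
  have t1 : Tendsto (fun j => eLpNorm (fun x => dq (s j) (thinDir i) V x •
      (F (x + s j • thinDir i) - F x)) 2 volume) atTop (𝓝 0) := by
    have t := ENNReal.Tendsto.const_mul ((tendsto_translate mF hF (thinDir i)).comp hs0)
      (a := ENNReal.ofReal K) (Or.inr (by simp))
    rw [mul_zero] at t
    refine tendsto_of_tendsto_of_tendsto_of_le_of_le tendsto_const_nhds t (fun _ => zero_le)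
      fun j => ?_
    refine eLpNorm_le_mul_eLpNorm_of_ae_le_mul (Eventually.of_forall fun x => ?_) 2
    rw [norm_smul, Real.norm_eq_abs, Pi.sub_apply]
    gcongr
    exact abs_dq_le hVd hK _ i x
  have t2 : Tendsto (fun j => eLpNorm (fun x => (dq (s j) (thinDir i) V x -
      fderiv ℝ V x (thinDir i)) • F x) 2 volume) atTop (𝓝 0) := by
    have hsq : Tendsto (fun j => ∫⁻ x, ‖(dq (s j) (thinDir i) V x -
      fderiv ℝ V x (thinDir i)) • F x‖ₑ ^ 2) atTop (𝓝 (∫⁻ _ : E n × ℝ, 0)) := by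
      refine tendsto_lintegral_of_dominated_convergence
        (fun x => ENNReal.ofReal (2 * K) ^ 2 * ‖F x‖ₑ ^ 2) (fun j => ?_)
        (fun j => Eventually.of_forall fun x => ?_) ?_ (Eventually.of_forall fun x => ?_)
      · have := mdq (s j)
        fun_prop
      · refine enorm_smul_sq_le ?_ _
        have h1 := abs_dq_le hVd hK (s j) i x
        have h2 : |fderiv ℝ V x (thinDir i)| ≤ K := by
          have := (fderiv ℝ V x).le_opNorm (thinDir i)
          rw [norm_thinDir, mul_one] at this
          exact this.trans (hK x)
        have := abs_sub (dq (s j) (thinDir i) V x) (fderiv ℝ V x (thinDir i))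
        linarith
      · have hfin : ENNReal.ofReal (2 * K) ^ 2 ≠ ⊤ := (ENNReal.pow_lt_top ENNReal.ofReal_lt_top).ne
        rw [lintegral_const_mul' _ _ hfin]
        exact ENNReal.mul_ne_top hfin (lintegral_ne_top_of_memLp hF)
      · have h1 := ((tendsto_dq_fderiv hVd i x).comp hs).sub_const (fderiv ℝ V x (thinDir i))
        rw [sub_self] at h1
        have h2 := (h1.smul_const (F x)).enorm
        simp only [zero_smul, enorm_zero] at h2
        have h3 := ENNReal.Tendsto.pow (n := 2) h2
        simpa using h3
    simp only [lintegral_zero] at hsq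
    simp only [← eLpNorm_sq] at hsq
    have h4 := (ENNReal.continuous_rpow_const (y := (1 / 2 : ℝ))).tendsto 0 |>.comp hsq
    rw [ENNReal.zero_rpow_of_pos (by norm_num)] at h4
    refine h4.congr fun j => ?_
    simp only [Function.comp_apply]
    rw [← ENNReal.rpow_natCast, ← ENNReal.rpow_mul]
    norm_num
  have t3 := t1.add t2
  rw [add_zero] at t3
  refine tendsto_of_tendsto_of_tendsto_of_le_of_le' tendsto_const_nhds t3
    (Eventually.of_forall fun _ => zero_le) ?_
  have h1 : Set.Icc (-(r' - r)) (r' - r) ∈ 𝓝 (0 : ℝ) := Icc_mem_nhds (by linarith) (by linarith)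
  filter_upwards [hs0 h1] with j hj
  have hle : r + |s j| ≤ r' := by linarith [abs_le.2 hj]
  have m1 := mdq (s j)
  refine le_trans ?_ (eLpNorm_add_le
    (Measurable.aestronglyMeasurable (by fun_prop)) (Measurable.aestronglyMeasurable (by fun_prop))
    (by norm_num))
  refine le_trans (le_of_eq (eLpNorm_congr_ae ((ae_restrict_iff' (measurableSet_Q0 r)).2
    (Eventually.of_forall fun x hx => ?_)))) (eLpNorm_mono_measure _ Measure.restrict_le_self)
  have e1 : F x = u x := Set.indicator_of_mem (Q0_mono hr hr'.le hx) u
  have e2 : F (x + s j • thinDir i) = u (x + s j • thinDir i) := Set.indicator_of_mem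
    (Q0_mono (by positivity) hle (add_smul_thinDir_mem_Q0 hr i hx)) u
  simp only [Pi.sub_apply, Pi.add_apply, bdry, e1, e2]
  module

end BoundaryConvergence

end LameExt

namespace LameExt

open scoped ENNReal

variable {n : ℕ} {a μ lam : ℝ}

/-! ### The Caccioppoli inequality on cylinders -/

section Cylinders

theorem exists_caccioppoli_Q (n : ℕ) {a : ℝ} (ha : -1 < a) (ha1 : a < 1) {δ₀ : ℝ}
    (hδ₀ : 0 < δ₀) (Λ : ℝ) {K : ℝ} (hK : 0 ≤ K) {r r' : ℝ} (hr : 0 ≤ r) (hr' : r < r') :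
    ∃ C : ℝ≥0∞, C ≠ ⊤ ∧ ∀ (μ lam : ℝ) (U : Pt n → E n)
      (G : Option (Fin n) → Pt n → E n) (u g b : E n × ℝ → E n) (V : E n × ℝ → ℝ),
      δ₀ ≤ μ → δ₀ ≤ 2 * μ + lam → μ ≤ Λ → |lam| ≤ Λ → Sol (Q n r') a μ lam U G u g →
      (∀ x, |V x| ≤ K) → (∀ x, g x = V x • u x + b x) → Measurable b →
      ∫⁻ x in Q0 n r', ‖b x‖ₑ ^ 2 ≠ ⊤ →
      (∀ k, ∫⁻ p in Q n r, ‖G k p‖ₑ ^ 2 ∂(wMeasure n a) ≤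
        C * (∫⁻ p in Q n r', ‖U p‖ₑ ^ 2 ∂(wMeasure n a) + ∫⁻ x in Q0 n r', ‖b x‖ₑ ^ 2)) ∧
      ∫⁻ x in Q0 n r, ‖u x‖ₑ ^ 2 ≤
        C * (∫⁻ p in Q n r', ‖U p‖ₑ ^ 2 ∂(wMeasure n a) + ∫⁻ x in Q0 n r', ‖b x‖ₑ ^ 2) := by
  -- The outer neighbourhood is open across `t = 0`, so it contains the closed inner cylinder; its
  -- part in `{t < 0}` is exactly the outer cylinder.
  set N : Set (Pt n) := {p | ‖p.1‖ ^ 2 + p.2.1 ^ 2 < r' ^ 2 ∧ -r' ^ 2 < p.2.2} with hNdef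
  have hN : IsOpen N := by
    refine IsOpen.and (isOpen_lt ?_ continuous_const) (isOpen_lt continuous_const ?_) <;> fun_prop
  have hsq : r ^ 2 < r' ^ 2 := by gcongr
  have hSN : closedCyl n r ⊆ N := fun p hp => ⟨hp.1.trans_lt hsq, by linarith [hp.2.1]⟩
  have hNQ : N ∩ {p | p.2.2 < 0} = Q n r' := by
    ext p; simp [hNdef, Q, and_assoc]
  have hNQ0 : {x : E n × ℝ | (x.1, 0, x.2) ∈ N} ∩ {x | x.2 < 0} = Q0 n r' := by
    ext x; simp [hNdef, Q, Q0, and_assoc]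
  obtain ⟨C, hC, h⟩ := exists_caccioppoli n ha ha1 hδ₀ Λ hK (isCompact_closedCyl r) hN hSN
  refine ⟨C, hC, fun μ lam U G u g b V h1 h2 h3 h4 hS hV hg mb hb => ?_⟩
  have key := h (Q n r') μ lam U G u g b V h1 h2 h3 h4 hS hV hg hNQ.subset mb (by rwa [hNQ0])
  rw [hNQ, hNQ0] at key
  have hsub : Q n r ⊆ closedCyl n r ∩ {p | p.2.2 < 0} := fun p hp =>
    ⟨Q_subset_closedCyl r hp, hp.2.2⟩
  have hsub0 : Q0 n r ⊆ {x | (x.1, 0, x.2) ∈ closedCyl n r} ∩ {x | x.2 < 0} := fun x hx =>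
    ⟨Q_subset_closedCyl r hx, hx.2.2⟩
  exact ⟨fun k => (lintegral_mono_set hsub).trans (key.1 k),
    (lintegral_mono_set hsub0).trans key.2⟩

end Cylinders

/-! ### Second-order bounds and strong convergence for Robin solutions -/

section Robin

theorem Sol.sub (ha : -1 < a) {Ω : Set (Pt n)} {U₁ U₂ : Pt n → E n}
    {G₁ G₂ : Option (Fin n) → Pt n → E n}
    {u₁ u₂ g₁ g₂ : E n × ℝ → E n} (h₁ : Sol Ω a μ lam U₁ G₁ u₁ g₁)
    (h₂ : Sol Ω a μ lam U₂ G₂ u₂ g₂) :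
    Sol Ω a μ lam (U₁ - U₂) (fun k => G₁ k - G₂ k) (u₁ - u₂) (g₁ - g₂) := by
  have h := Sol.lincomb ha h₁ h₂ 1 (-1)
  have e : ∀ {X : Type _} (f f' : X → E n), f - f' = fun x => (1 : ℝ) • f x + (-1 : ℝ) • f' x :=
    fun f f' => by ext1 x; simp [sub_eq_add_neg]
  rw [e U₁, e u₁, e g₁, funext fun k => e (G₁ k) (G₂ k)]
  exact h

/-- Weak solutions in the unit cylinder with conormal derivative `V u`, square integrable up to
the final time. -/
structure RobinSol (a δ₀ Λ K μ lam : ℝ) (V : E n × ℝ → ℝ) (U : Pt n → E n)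
    (G : Option (Fin n) → Pt n → E n) (u : E n × ℝ → E n) : Prop where
  sol : Sol (Q n 1) a μ lam U G u fun x => V x • u x
  le_mu : δ₀ ≤ μ
  le_lam : δ₀ ≤ 2 * μ + lam
  mu_le : μ ≤ Λ
  lam_le : |lam| ≤ Λ
  contDiff : ContDiff ℝ 1 V
  abs_le : ∀ x, |V x| ≤ K
  fderiv_le : ∀ x, ‖fderiv ℝ V x‖ ≤ K
  finite : ∀ r, 0 ≤ r → r < 1 → ∫⁻ p in Q n r, ‖U p‖ₑ ^ 2 ∂(wMeasure n a) ≠ ⊤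

variable {δ₀ Λ K : ℝ} {V : E n × ℝ → ℝ} {U : Pt n → E n} {G : Option (Fin n) → Pt n → E n}
  {u : E n × ℝ → E n}

theorem RobinSol.K_nonneg (h : RobinSol a δ₀ Λ K μ lam V U G u) : 0 ≤ K :=
  (abs_nonneg _).trans (h.abs_le 0)

/-- `Sol` controls only compact sets before the final time. With `b = 0` and an intermediate radius,
square integrability of `U` up to `t = 0` passes to the gradient and the trace. -/
theorem RobinSol.memLp (ha : -1 < a) (ha1 : a < 1) (hδ₀ : 0 < δ₀)
    (h : RobinSol a δ₀ Λ K μ lam V U G u) {r : ℝ} (hr : 0 ≤ r) (hr1 : r < 1) :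
    MemLp U 2 ((wMeasure n a).restrict (Q n r)) ∧
    (∀ k, MemLp (G k) 2 ((wMeasure n a).restrict (Q n r))) ∧
    MemLp u 2 (volume.restrict (Q0 n r)) := by
  obtain ⟨C, hC, hcac⟩ := exists_caccioppoli_Q n ha ha1 hδ₀ Λ h.K_nonneg hr
    (by linarith : r < (r + 1) / 2)
  have hS := h.sol.mono (Q_mono (by linarith : 0 ≤ (r + 1) / 2) (by linarith : (r + 1) / 2 ≤ 1))
  have key := hcac μ lam U G u _ (fun _ => 0) V h.le_mu h.le_lam h.mu_le h.lam_le hS h.abs_le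
    (fun x => by simp) measurable_const (by simp)
  have hfin : C * (∫⁻ p in Q n ((r + 1) / 2), ‖U p‖ₑ ^ 2 ∂(wMeasure n a) +
      ∫⁻ x in Q0 n ((r + 1) / 2), ‖(0 : E n)‖ₑ ^ 2) ≠ ⊤ := by
    refine ENNReal.mul_ne_top hC (ENNReal.add_ne_top.2 ⟨?_, by simp⟩)
    exact h.finite _ (by linarith) (by linarith)
  exact ⟨memLp_two_of_lintegral_ne_top h.sol.measU.aestronglyMeasurable (h.finite r hr hr1),
    fun k => memLp_two_of_lintegral_ne_top (h.sol.measG k).aestronglyMeasurable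
      (ne_top_of_le_ne_top hfin (key.1 k)),
    memLp_two_of_lintegral_ne_top h.sol.measu.aestronglyMeasurable
      (ne_top_of_le_ne_top hfin key.2)⟩

theorem measurable_dq {X : Type*} [AddCommGroup X] [Module ℝ X] [MeasurableSpace X]
    [MeasurableAdd X] {f : X → E n} (hf : Measurable f) (h : ℝ) (v : X) :
    Measurable (dq h v f) := by
  unfold dq
  have : Measurable fun p => f (p + h • v) := hf.comp (measurable_add_const _)
  fun_prop

theorem RobinSol.measurable_bdry (h : RobinSol a δ₀ Λ K μ lam V U G u) (i : Fin n) (s : ℝ) :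
    Measurable (bdry V u i s) := by
  have h1 := h.contDiff.continuous.measurable
  have h2 := h.sol.measu
  unfold bdry dq
  fun_prop

/-- The Caccioppoli inequality for difference quotients. -/
theorem exists_dq_le (n : ℕ) {a : ℝ} (ha : -1 < a) (ha1 : a < 1) {δ₀ : ℝ}
    (hδ₀ : 0 < δ₀) (Λ : ℝ) {K : ℝ} (hK : 0 ≤ K) {r r₁ r₂ : ℝ} (hr : 0 ≤ r) (hr₁ : r < r₁)
    (hr₂ : r₁ < r₂) (hr₂1 : r₂ < 1) :
    ∃ C : ℝ≥0∞, C ≠ ⊤ ∧ ∀ (μ lam : ℝ) (V : E n × ℝ → ℝ) (U : Pt n → E n)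
      (G : Option (Fin n) → Pt n → E n) (u : E n × ℝ → E n),
      RobinSol a δ₀ Λ K μ lam V U G u → ∀ (i : Fin n) (s : ℝ), s ≠ 0 → r₁ + |s| ≤ r₂ →
      ∀ k, eLpNorm (dq s (dir (some i)) (G k)) 2 ((wMeasure n a).restrict (Q n r)) ^ 2 ≤
        C * (eLpNorm (G (some i)) 2 ((wMeasure n a).restrict (Q n r₂)) ^ 2 +
          eLpNorm u 2 (volume.restrict (Q0 n r₂)) ^ 2) := by
  obtain ⟨C, hC, hcac⟩ := exists_caccioppoli_Q n ha ha1 hδ₀ Λ hK hr hr₁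
  have hr₁0 : 0 ≤ r₁ := hr.trans hr₁.le
  set D : ℝ≥0∞ := 1 + ENNReal.ofReal K ^ 2
  have hDK : ENNReal.ofReal K ^ 2 ≠ ⊤ := (ENNReal.pow_lt_top ENNReal.ofReal_lt_top).ne
  have hD : D ≠ ⊤ := ENNReal.add_ne_top.2 ⟨by simp, hDK⟩
  refine ⟨C * D, ENNReal.mul_ne_top hC hD, fun μ lam V U G u h i s hs0 hs k => ?_⟩
  -- The quotient is a solution on the cylinder of radius `r₁`; reaching `r₂` pays for the step,
  -- both in bounding the quotient by `G (some i)` and in bounding the shifted trace.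
  have hS := h.sol.diffQuot ha hr₁0 (hs.trans hr₂1.le) i
  have hV := h.contDiff.differentiable (by norm_num)
  have hb := eLpNorm_bdry_le hV h.fderiv_le h.sol.measu hr₁0 hs i
  have hu := (h.memLp ha ha1 hδ₀ (hr₁0.trans hr₂.le) hr₂1).2.2
  have key := (hcac μ lam _ _ _ _ (bdry V u i s) V h.le_mu h.le_lam h.mu_le h.lam_le hS h.abs_le
    (fun x => dq_mul_smul s (thinDir i) x) (h.measurable_bdry i s) (by
      rw [← eLpNorm_sq]
      refine (ENNReal.pow_lt_top (hb.trans_lt ?_)).ne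
      exact ENNReal.mul_lt_top ENNReal.ofReal_lt_top hu.2)).1 k
  simp only [← eLpNorm_sq] at key
  refine key.trans ?_
  have hU := h.sol.eLpNorm_dq_le ha hr₁0 hs hr₂1 hs0 i
  rw [mul_assoc]
  gcongr
  calc _ ≤ eLpNorm (G (some i)) 2 ((wMeasure n a).restrict (Q n r₂)) ^ 2 +
        (ENNReal.ofReal K * eLpNorm u 2 (volume.restrict (Q0 n r₂))) ^ 2 := by gcongr
    _ ≤ D * eLpNorm (G (some i)) 2 ((wMeasure n a).restrict (Q n r₂)) ^ 2 +
        D * eLpNorm u 2 (volume.restrict (Q0 n r₂)) ^ 2 := by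
      rw [mul_pow]
      gcongr
      · exact le_mul_of_one_le_left zero_le le_self_add
      · exact le_add_self
    _ = _ := by ring

theorem tendsto_eLpNorm_pair {α : Type*} [MeasurableSpace α] {ν : Measure α} {f : ℕ → α → E n}
    {g : α → E n} (hf : ∀ j, AEStronglyMeasurable (f j) ν) (hg : AEStronglyMeasurable g ν)
    (h : Tendsto (fun j => eLpNorm (f j - g) 2 ν) atTop (𝓝 0)) :
    Tendsto (fun j : ℕ × ℕ => eLpNorm (f j.1 - f j.2) 2 ν) atTop (𝓝 0) := by
  have h1 : Tendsto (fun j : ℕ × ℕ => eLpNorm (f j.1 - g) 2 ν + eLpNorm (f j.2 - g) 2 ν)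
      atTop (𝓝 0) := by
    rw [← prod_atTop_atTop_eq]
    simpa using (h.comp tendsto_fst).add (h.comp tendsto_snd)
  refine tendsto_of_tendsto_of_tendsto_of_le_of_le tendsto_const_nhds h1 (fun _ => zero_le)
    fun j => ?_
  have e : f j.1 - f j.2 = (f j.1 - g) - (f j.2 - g) := by abel
  rw [e]
  exact eLpNorm_sub_le ((hf _).sub hg) ((hf _).sub hg) (by norm_num)

/-- Completeness of `L²`. Early terms need not be square integrable, since a large step leaves the
cylinder, so the sequence is shifted past them. -/
theorem exists_limit_of_cauchy {α : Type*} [MeasurableSpace α] {ν : Measure α} {f : ℕ → α → E n}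
    (hf : ∀ᶠ j in atTop, MemLp (f j) 2 ν)
    (h : Tendsto (fun j : ℕ × ℕ => eLpNorm (f j.1 - f j.2) 2 ν) atTop (𝓝 0)) :
    ∃ g, MemLp g 2 ν ∧ Tendsto (fun j => eLpNorm (f j - g) 2 ν) atTop (𝓝 0) := by
  obtain ⟨J, hJ⟩ := eventually_atTop.1 hf
  have hf' : ∀ j, MemLp (f (j + J)) 2 ν := fun j => hJ _ (by omega)
  have : Fact ((1 : ℝ≥0∞) ≤ 2) := ⟨by norm_num⟩
  have hc : CauchySeq fun j => (hf' j).toLp (f (j + J)) := by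
    rw [Lp.cauchySeq_Lp_iff_cauchySeq_eLpNorm]
    have hs : Tendsto (fun j : ℕ × ℕ => (j.1 + J, j.2 + J)) atTop atTop := by
      rw [← prod_atTop_atTop_eq]
      exact (tendsto_add_atTop_nat J).prodMap (tendsto_add_atTop_nat J)
    refine (h.comp hs).congr fun j => eLpNorm_congr_ae ?_
    exact ((hf' j.1).coeFn_toLp.sub (hf' j.2).coeFn_toLp).symm
  obtain ⟨g, hg⟩ := cauchySeq_tendsto_of_complete hc
  have h1 := (Lp.tendsto_Lp_iff_tendsto_eLpNorm' (fun j => (hf' j).toLp (f (j + J))) g).1 hg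
  refine ⟨g, Lp.memLp g, (tendsto_add_atTop_iff_nat
    (f := fun j => eLpNorm (f j - (g : α → E n)) 2 ν) J).1 (h1.congr fun j => ?_)⟩
  exact eLpNorm_congr_ae ((hf' j).coeFn_toLp.sub EventuallyEq.rfl)

/-- A sequence of steps. -/
noncomputable def stepSeq (j : ℕ) : ℝ := 1 / ((j : ℝ) + 1)

theorem stepSeq_pos (j : ℕ) : 0 < stepSeq j := by unfold stepSeq; positivity

theorem tendsto_stepSeq : Tendsto stepSeq atTop (𝓝[≠] 0) :=
  tendsto_nhdsWithin_iff.2 ⟨tendsto_one_div_add_atTop_nhds_zero_nat,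
    Eventually.of_forall fun j => (stepSeq_pos j).ne'⟩

theorem eventually_stepSeq_le {ε : ℝ} (hε : 0 < ε) : ∀ᶠ j in atTop, |stepSeq j| ≤ ε := by
  filter_upwards [(tendsto_stepSeq.mono_right nhdsWithin_le_nhds).eventually
    (Metric.closedBall_mem_nhds 0 hε)] with j hj
  simpa using hj

/-- The difference of two quotients solves the system with conormal derivative `V` times the
difference of their traces plus the difference of their inhomogeneities. The interior and boundary
data are Cauchy, so the Caccioppoli inequality makes the quotients of the gradient Cauchy. -/
theorem RobinSol.exists_limit (ha : -1 < a) (ha1 : a < 1) (hδ₀ : 0 < δ₀)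
    (h : RobinSol a δ₀ Λ K μ lam V U G u) {r : ℝ} (hr : 0 ≤ r) (hr1 : r < 1)
    (k : Option (Fin n)) (i : Fin n) :
    ∃ H, MemLp H 2 ((wMeasure n a).restrict (Q n r)) ∧
      Tendsto (fun j => eLpNorm (dq (stepSeq j) (dir (some i)) (G k) - H) 2
        ((wMeasure n a).restrict (Q n r))) atTop (𝓝 0) := by
  obtain ⟨r₁, hr₁, hr₁1⟩ := exists_between hr1
  obtain ⟨r₂, hr₂, hr₂1⟩ := exists_between hr₁1
  have hr₁0 : 0 ≤ r₁ := hr.trans hr₁.le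
  have hr₂0 : 0 ≤ r₂ := hr₁0.trans hr₂.le
  obtain ⟨-, hG₂, hu₂⟩ := h.memLp ha ha1 hδ₀ hr₂0 hr₂1
  obtain ⟨C, hC, hcac⟩ := exists_caccioppoli_Q n ha ha1 hδ₀ Λ h.K_nonneg hr hr₁
  obtain ⟨C', hC', hdq⟩ := exists_dq_le n ha ha1 hδ₀ Λ h.K_nonneg hr hr₁ hr₂ hr₂1
  have hstep := eventually_stepSeq_le (sub_pos.2 hr₂)
  have hV := h.contDiff.differentiable (by norm_num)
  refine exists_limit_of_cauchy ?_ ?_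
  · filter_upwards [hstep] with j hj
    refine memLp_two_of_lintegral_ne_top
      (measurable_dq (h.sol.measG k) _ _).aestronglyMeasurable ?_
    rw [← eLpNorm_sq]
    refine ne_top_of_le_ne_top ?_ (hdq μ lam V U G u h i _ (stepSeq_pos j).ne' (by linarith) k)
    exact ENNReal.mul_ne_top hC' (ENNReal.add_ne_top.2
      ⟨(ENNReal.pow_lt_top (hG₂ _).2).ne, (ENNReal.pow_lt_top hu₂.2).ne⟩)
  · have t1 := tendsto_eLpNorm_pair (fun j =>
      (measurable_dq h.sol.measU (stepSeq j) (dir (some i))).aestronglyMeasurable)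
      (h.sol.measG (some i)).aestronglyMeasurable
      ((h.sol.tendsto_dq ha hr₁0 hr₂ hr₂1 i (hG₂ _)).comp tendsto_stepSeq)
    have mdV : Measurable fun x => fderiv ℝ V x (thinDir i) :=
      ((h.contDiff.continuous_fderiv (by norm_num)).clm_apply continuous_const).measurable
    have t2 := tendsto_eLpNorm_pair (fun j =>
      (h.measurable_bdry i (stepSeq j)).aestronglyMeasurable)
      (mdV.smul h.sol.measu).aestronglyMeasurable
      (tendsto_bdry h.contDiff h.fderiv_le h.sol.measu hr₁0 hr₂ hu₂ i tendsto_stepSeq)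
    have t3 := (ENNReal.Tendsto.pow (n := 2) t1).add (ENNReal.Tendsto.pow (n := 2) t2)
    have t4 := ENNReal.Tendsto.const_mul t3 (a := C) (Or.inr hC)
    have t5 := (ENNReal.continuous_rpow_const (y := (1 / 2 : ℝ))).tendsto _ |>.comp t4
    simp only [ne_eq, OfNat.ofNat_ne_zero, not_false_eq_true, zero_pow, add_zero, mul_zero] at t5
    rw [ENNReal.zero_rpow_of_pos (by norm_num)] at t5
    refine tendsto_of_tendsto_of_tendsto_of_le_of_le' tendsto_const_nhds t5
      (Eventually.of_forall fun _ => zero_le) ?_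
    have hstep2 : ∀ᶠ j : ℕ × ℕ in atTop, |stepSeq j.1| ≤ r₂ - r₁ ∧ |stepSeq j.2| ≤ r₂ - r₁ := by
      rw [← prod_atTop_atTop_eq]
      exact hstep.prod_mk hstep
    filter_upwards [hstep2] with j hj
    have hS := Sol.sub ha (h.sol.diffQuot ha hr₁0 (by linarith [hj.1] : r₁ + |stepSeq j.1| ≤ 1) i)
      (h.sol.diffQuot ha hr₁0 (by linarith [hj.2] : r₁ + |stepSeq j.2| ≤ 1) i)
    have hbf : ∀ s, |s| ≤ r₂ - r₁ → MemLp (bdry V u i s) 2 (volume.restrict (Q0 n r₁)) :=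
      fun s hs => ⟨(h.measurable_bdry i s).aestronglyMeasurable,
        (eLpNorm_bdry_le hV h.fderiv_le h.sol.measu hr₁0 (by linarith : r₁ + |s| ≤ r₂) i).trans_lt
          (ENNReal.mul_lt_top ENNReal.ofReal_lt_top hu₂.2)⟩
    have key := (hcac μ lam _ _ _ _ (bdry V u i (stepSeq j.1) - bdry V u i (stepSeq j.2)) V h.le_mu
      h.le_lam h.mu_le h.lam_le hS h.abs_le (fun x => by
        simp only [Pi.sub_apply]
        rw [dq_mul_smul, dq_mul_smul, bdry, bdry]
        module) ((h.measurable_bdry i _).sub (h.measurable_bdry i _))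
        (lintegral_ne_top_of_memLp ((hbf _ hj.1).sub (hbf _ hj.2)))).1 k
    simp only [← eLpNorm_sq] at key
    have h6 := ENNReal.rpow_le_rpow key (z := 1 / 2) (by norm_num)
    rw [← ENNReal.rpow_natCast (eLpNorm (dq (stepSeq j.1) (dir (some i)) (G k) -
      dq (stepSeq j.2) (dir (some i)) (G k)) 2 _), ← ENNReal.rpow_mul] at h6
    norm_num at h6
    simpa using h6

end Robin

end LameExt

namespace LameExt

open scoped ENNReal

variable {n : ℕ} {a μ lam : ℝ}

/-! ### Limits on an exhaustion by cylinders -/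

section Gluing

/-- Uniqueness of limits makes the local limits agree almost everywhere on smaller sets. -/
theorem exists_glued_limit {α : Type*} [MeasurableSpace α] {ν : Measure α} {S : ℕ → Set α}
    (hSm : ∀ l, MeasurableSet (S l)) (hS : Monotone S) {f : ℕ → α → E n}
    (hf : ∀ j, AEStronglyMeasurable (f j) ν)
    (h : ∀ l, ∃ g, MemLp g 2 (ν.restrict (S l)) ∧
      Tendsto (fun j => eLpNorm (f j - g) 2 (ν.restrict (S l))) atTop (𝓝 0)) :
    ∃ g, ∀ l, MemLp g 2 (ν.restrict (S l)) ∧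
      Tendsto (fun j => eLpNorm (f j - g) 2 (ν.restrict (S l))) atTop (𝓝 0) := by
  classical
  choose g hg hlim using h
  have hcomp : ∀ l l', l' ≤ l → ∀ᵐ p ∂ν, p ∈ S l' → g l p = g l' p := fun l l' hl => by
    rw [← ae_restrict_iff' (hSm l')]
    have hle : ν.restrict (S l') ≤ ν.restrict (S l) := Measure.restrict_mono (hS hl) le_rfl
    refine ae_eq_of_tendsto_eLpNorm (fun j => (hf j).restrict) ((hg l).mono_measure hle).1
      (hg l').1 ?_ (hlim l')
    exact tendsto_of_tendsto_of_tendsto_of_le_of_le tendsto_const_nhds (hlim l)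
      (fun _ => zero_le) fun j => eLpNorm_mono_measure _ hle
  -- At each point take the limit belonging to the first set that contains it; on `S l` only
  -- finitely or countably many earlier limits have to be compared.
  refine ⟨fun p => if hp : ∃ l, p ∈ S l then g (Nat.find hp) p else 0, fun l => ?_⟩
  have hae : g l =ᵐ[ν.restrict (S l)]
      fun p => if hp : ∃ l, p ∈ S l then g (Nat.find hp) p else 0 := by
    refine (ae_restrict_iff' (hSm l)).2 ?_
    filter_upwards [ae_all_iff.2 fun l' : {l' // l' ≤ l} => hcomp l l' l'.2] with p hp hpl
    have hex : ∃ l, p ∈ S l := ⟨l, hpl⟩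
    rw [dif_pos hex]
    exact hp ⟨Nat.find hex, Nat.find_min' hex hpl⟩ (Nat.find_spec hex)
  refine ⟨(hg l).ae_eq hae, (hlim l).congr fun j => eLpNorm_congr_ae ?_⟩
  exact EventuallyEq.rfl.sub hae

/-- Radii increasing to `1`. -/
noncomputable def radius (l : ℕ) : ℝ := 1 - stepSeq (l + 1)

theorem radius_lt_one (l : ℕ) : radius l < 1 := by
  have := stepSeq_pos (l + 1)
  unfold radius; linarith

theorem radius_nonneg (l : ℕ) : 0 ≤ radius l := by
  unfold radius stepSeq
  rw [sub_nonneg, div_le_one (by positivity)]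
  have : (0 : ℝ) ≤ ((l + 1 : ℕ) : ℝ) := by positivity
  linarith

theorem monotone_radius : Monotone radius := fun l l' h => by
  unfold radius stepSeq
  gcongr

theorem exists_le_radius {r : ℝ} (hr : r < 1) : ∃ l, r ≤ radius l := by
  obtain ⟨l, hl⟩ := exists_nat_one_div_lt (sub_pos.2 hr)
  refine ⟨l, ?_⟩
  have : stepSeq (l + 1) ≤ 1 / ((l : ℝ) + 1) := by
    unfold stepSeq
    push_cast
    gcongr
    linarith
  unfold radius
  linarith

variable {δ₀ Λ K : ℝ} {V : E n × ℝ → ℝ} {U : Pt n → E n} {G : Option (Fin n) → Pt n → E n}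
  {u : E n × ℝ → E n}

theorem RobinSol.exists_glued_limit (ha : -1 < a) (ha1 : a < 1) (hδ₀ : 0 < δ₀)
    (h : RobinSol a δ₀ Λ K μ lam V U G u) :
    ∃ H : Option (Fin n) → Fin n → Pt n → E n, ∀ k i r, 0 ≤ r → r < 1 →
      MemLp (H k i) 2 ((wMeasure n a).restrict (Q n r)) ∧
      Tendsto (fun j => eLpNorm (dq (stepSeq j) (dir (some i)) (G k) - H k i) 2
        ((wMeasure n a).restrict (Q n r))) atTop (𝓝 0) := by
  have key := fun k i => LameExt.exists_glued_limit (S := fun l => Q n (radius l))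
    (fun l => measurableSet_Q _) (fun l l' hl => Q_mono (radius_nonneg l) (monotone_radius hl))
    (fun j => (measurable_dq (h.sol.measG k) (stepSeq j) (dir (some i))).aestronglyMeasurable)
    fun l => h.exists_limit ha ha1 hδ₀ (radius_nonneg l) (radius_lt_one l) k i
  choose H hH using key
  refine ⟨H, fun k i r hr hr1 => ?_⟩
  obtain ⟨l, hl⟩ := exists_le_radius hr1
  have hle : (wMeasure n a).restrict (Q n r) ≤ (wMeasure n a).restrict (Q n (radius l)) :=
    Measure.restrict_mono (Q_mono hr hl) le_rfl
  exact ⟨(hH k i l).1.mono_measure hle, tendsto_of_tendsto_of_tendsto_of_le_of_le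
    tendsto_const_nhds (hH k i l).2 (fun _ => zero_le) fun j => eLpNorm_mono_measure _ hle⟩

end Gluing

/-! ### The limits are weak derivatives -/

section WeakDerivative

/-- On a compact set with `y > 0` the weight has a positive minimum, so weighted `L²` convergence
gives unweighted convergence. -/
theorem exists_volume_le (a : ℝ) {K : Set (Pt n)} (hK : IsCompact K)
    (hpos : ∀ p ∈ K, 0 < p.2.1) :
    ∃ C : ℝ≥0∞, C ≠ ⊤ ∧ volume.restrict K ≤ C • (wMeasure n a).restrict K := by
  rcases K.eq_empty_or_nonempty with rfl | hne
  · exact ⟨0, by simp, by simp⟩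
  have hc : ContinuousOn (fun p : Pt n => p.2.1 ^ a) K := fun p hp =>
    ((by fun_prop : ContinuousAt (fun p : Pt n => p.2.1) p).rpow_const
      (Or.inl (hpos p hp).ne')).continuousWithinAt
  obtain ⟨p₀, hp₀, hmin⟩ := hK.exists_isMinOn hne hc
  set c := p₀.2.1 ^ a
  have hc0 : 0 < c := Real.rpow_pos_of_pos (hpos p₀ hp₀) a
  have hc0' : ENNReal.ofReal c ≠ 0 := by simpa using hc0
  refine ⟨(ENNReal.ofReal c)⁻¹, by simpa using hc0, Measure.le_iff.2 fun A hA => ?_⟩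
  have hAK : MeasurableSet (A ∩ K) := hA.inter hK.measurableSet
  rw [Measure.smul_apply, Measure.restrict_apply hA, Measure.restrict_apply hA, wMeasure,
    withDensity_apply _ hAK, Measure.restrict_restrict hAK]
  have e : A ∩ K ∩ {p : Pt n | 0 < p.2.1} = A ∩ K :=
    Set.inter_eq_left.2 fun p hp => hpos p hp.2
  rw [e, smul_eq_mul, ← ENNReal.div_eq_inv_mul, ENNReal.le_div_iff_mul_le (Or.inl hc0') (by simp),
    mul_comm, ← setLIntegral_const]
  exact setLIntegral_mono' hAK fun p hp => ENNReal.ofReal_le_ofReal (hmin hp.2)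

theorem tendsto_setIntegral_smul {K : Set (Pt n)} (hK : IsCompact K) {ψ : Pt n → ℝ}
    (hψ : Continuous ψ) (hψc : HasCompactSupport ψ) {f : ℕ → Pt n → E n} {g : Pt n → E n}
    (hf : ∀ᶠ j in atTop, MemLp (f j) 2 (volume.restrict K)) (hg : MemLp g 2 (volume.restrict K))
    (h : Tendsto (fun j => eLpNorm (f j - g) 2 (volume.restrict K)) atTop (𝓝 0)) :
    Tendsto (fun j => ∫ p in K, ψ p • f j p) atTop (𝓝 (∫ p in K, ψ p • g p)) := by
  have hfin : IsFiniteMeasure (volume.restrict K) := ⟨by simpa using hK.measure_lt_top⟩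
  obtain ⟨M, hM⟩ := hψc.exists_bound_of_continuous hψ
  have hsm : ∀ {f : Pt n → E n}, MemLp f 2 (volume.restrict K) →
      MemLp (fun p => ψ p • f p) 2 (volume.restrict K) := fun {f} hf =>
    (hf.const_smul M).mono (hψ.aestronglyMeasurable.smul hf.1) (Eventually.of_forall fun p => by
      simp only [norm_smul, Pi.smul_apply]
      gcongr
      exact (hM p).trans (le_abs_self M))
  have t := tendsto_eLpNorm_smul hM h
  have t2 := ENNReal.Tendsto.mul_const t (b := volume.restrict K Set.univ ^
    (1 / (1 : ℝ≥0∞).toReal - 1 / (2 : ℝ≥0∞).toReal)) (Or.inr (by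
      refine ENNReal.rpow_ne_top_of_nonneg (by norm_num) (measure_ne_top _ _)))
  rw [zero_mul] at t2
  refine tendsto_integral_of_L1' _ (hsm hg).1
    (hf.mono fun j hj => (hsm hj).integrable (by norm_num))
    (tendsto_of_tendsto_of_tendsto_of_le_of_le' tendsto_const_nhds t2
      (Eventually.of_forall fun _ => zero_le) ?_)
  filter_upwards [hf] with j hj
  exact eLpNorm_le_eLpNorm_mul_rpow_measure_univ (by norm_num) ((hsm hj).sub (hsm hg)).1

theorem setIntegral_eq_of_tsupport {Ω K : Set (Pt n)} {ψ : Pt n → ℝ} (hψ : tsupport ψ ⊆ K)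
    (hK : K ⊆ Ω) (f : Pt n → E n) :
    ∫ p in Ω, ψ p • f p = ∫ p in K, ψ p • f p := by
  have h0 : ∀ p, p ∉ K → ψ p • f p = 0 := fun p hp => by
    rw [image_eq_zero_of_notMem_tsupport fun h => hp (hψ h), zero_smul]
  rw [setIntegral_eq_integral_of_forall_compl_eq_zero h0,
    setIntegral_eq_integral_of_forall_compl_eq_zero fun p hp => h0 p fun h => hp (hK h)]

/-- The weak identity is used for `φ` and for its translate, whose support is still in `Ω` when the
step is at most `ρ`. -/
theorem HasWeakDeriv.integral_dq {Ω : Set (Pt n)} {v e : Pt n} {f g : Pt n → E n}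
    (h : HasWeakDeriv Ω v f g) {φ : Pt n → ℝ} (hφ : ContDiff ℝ ∞ φ) (hφc : HasCompactSupport φ)
    {ρ s : ℝ} (hφs : Metric.cthickening ρ (tsupport φ) ⊆ Ω) (hs : ‖s • e‖ ≤ ρ) :
    ∫ p, fderiv ℝ φ p v • dq s e f p = -∫ p, φ p • dq s e g p := by
  obtain ⟨hf, hg, heq⟩ := h
  set w := s • e
  have hts : tsupport φ ⊆ Ω := (Metric.self_subset_cthickening _).trans hφs
  set φ' : Pt n → ℝ := fun p => φ (p - w) with hφ'
  have hφ1 : ContDiff ℝ ∞ φ' := by fun_prop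
  have hφ1c : HasCompactSupport φ' := hφc.comp_homeomorph (Homeomorph.subRight w)
  have hφ1s : tsupport φ' ⊆ Ω := by
    have e1 : tsupport φ' = (fun p => p - w) ⁻¹' tsupport φ :=
      tsupport_comp_eq_preimage φ (Homeomorph.subRight w)
    rw [e1]
    intro p hp
    refine hφs (Metric.mem_cthickening_of_dist_le p (p - w) ρ _ hp ?_)
    rw [dist_eq_norm]
    simpa using hs
  have hcd : ∀ {φ : Pt n → ℝ}, ContDiff ℝ ∞ φ → Continuous fun p => fderiv ℝ φ p v := fun hφ =>
    (hφ.continuous_fderiv (by norm_num)).clm_apply continuous_const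
  have whole : ∀ {φ : Pt n → ℝ}, ContDiff ℝ ∞ φ → HasCompactSupport φ → tsupport φ ⊆ Ω →
      ∫ p, fderiv ℝ φ p v • f p = -∫ p, φ p • g p := fun {φ} h1 h2 h3 => by
    have := heq φ h1 h2 h3
    rwa [setIntegral_eq_integral_of_forall_compl_eq_zero fun p hp => ?_,
      setIntegral_eq_integral_of_forall_compl_eq_zero fun p hp => ?_] at this
    · rw [image_eq_zero_of_notMem_tsupport fun h => hp (h3 h), zero_smul]
    · rw [image_eq_zero_of_notMem_tsupport fun h => hp (h3 (tsupport_fderiv_subset ℝ h))]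
      simp
  have i1 := integrableOn_smul_of_tsupport hf (hcd hφ) (hφc.fderiv_apply ℝ v)
    ((tsupport_fderiv_apply_subset ℝ v).trans hts)
  have i2 := integrableOn_smul_of_tsupport hg hφ.continuous hφc hts
  have i1' := integrableOn_smul_of_tsupport hf (hcd hφ1) (hφ1c.fderiv_apply ℝ v)
    ((tsupport_fderiv_apply_subset ℝ v).trans hφ1s)
  have i2' := integrableOn_smul_of_tsupport hg hφ1.continuous hφ1c hφ1s
  have e1 := integral_add_right_eq_self (μ := volume) (fun p => fderiv ℝ φ' p v • f p) w
  have e2 := integral_add_right_eq_self (μ := volume) (fun p => φ' p • g p) w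
  have j1 := i1'.comp_add_right w
  have j2 := i2'.comp_add_right w
  simp only [hφ', fderiv_comp_sub, add_sub_cancel_right] at e1 e2 j1 j2
  have key1 : ∫ p, fderiv ℝ φ p v • dq s e f p =
      s⁻¹ • ((∫ p, fderiv ℝ φ' p v • f p) - ∫ p, fderiv ℝ φ p v • f p) := by
    have e3 : ∀ p, fderiv ℝ φ p v • dq s e f p =
        s⁻¹ • (fderiv ℝ φ p v • f (p + w) - fderiv ℝ φ p v • f p) := fun p => by
      rw [dq, smul_comm, smul_sub]
    simp only [e3]
    rw [integral_smul, integral_sub j1 i1, e1]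
    simp only [hφ', fderiv_comp_sub]
  have key2 : ∫ p, φ p • dq s e g p = s⁻¹ • ((∫ p, φ' p • g p) - ∫ p, φ p • g p) := by
    have e3 : ∀ p, φ p • dq s e g p = s⁻¹ • (φ p • g (p + w) - φ p • g p) := fun p => by
      rw [dq, smul_comm, smul_sub]
    simp only [e3]
    rw [integral_smul, integral_sub j2 i2, e2]
  rw [key1, key2, whole hφ1 hφ1c hφ1s, whole hφ hφc hts]
  module

/-- The compact set may touch `t = 0`. It is covered by the increasing open sets obtained from the
cylinders by dropping the condition `t < 0`. -/
theorem exists_radius_of_isCompact {S : Set (Pt n)} (hS : IsCompact S)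
    (h : ∀ p ∈ S, ‖p.1‖ ^ 2 + p.2.1 ^ 2 < 1 ∧ -1 < p.2.2) :
    ∃ l, ∀ p ∈ S, p.2.2 < 0 → p ∈ Q n (radius l) := by
  set O : ℕ → Set (Pt n) := fun l =>
    {p | ‖p.1‖ ^ 2 + p.2.1 ^ 2 < radius l ^ 2 ∧ -radius l ^ 2 < p.2.2}
  have hO : ∀ l, IsOpen (O l) := fun l => by
    refine IsOpen.and (isOpen_lt ?_ continuous_const) (isOpen_lt continuous_const ?_) <;> fun_prop
  have hmono : Monotone O := fun l l' hl p hp => by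
    have h1 : radius l ^ 2 ≤ radius l' ^ 2 := by
      have := radius_nonneg l
      have := monotone_radius hl
      gcongr
    exact ⟨hp.1.trans_le h1, by linarith [hp.2]⟩
  have hcov : S ⊆ ⋃ l, O l := fun p hp => by
    obtain ⟨h1, h2⟩ := h p hp
    have h3 : max (‖p.1‖ ^ 2 + p.2.1 ^ 2) (-p.2.2) < 1 := max_lt h1 (by linarith)
    have h4 : 0 ≤ max (‖p.1‖ ^ 2 + p.2.1 ^ 2) (-p.2.2) := le_max_of_le_left (by positivity)
    obtain ⟨q, hq, hq1⟩ := exists_between h3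
    obtain ⟨l, hl⟩ := exists_le_radius (r := √q) (by
      rw [Real.sqrt_lt' one_pos]; simpa using hq1)
    have h5 : q ≤ radius l ^ 2 := by
      rw [← Real.sq_sqrt (h4.trans hq.le)]
      gcongr
    refine Set.mem_iUnion.2 ⟨l, (le_max_left _ _).trans_lt (hq.trans_le h5), ?_⟩
    have := (le_max_right (‖p.1‖ ^ 2 + p.2.1 ^ 2) (-p.2.2)).trans_lt (hq.trans_le h5)
    linarith
  obtain ⟨l, hl⟩ := hS.elim_directed_cover O hO hcov hmono.directed_le
  exact ⟨l, fun p hp ht => ⟨(hl hp).1, (hl hp).2, ht⟩⟩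

variable {δ₀ Λ K : ℝ} {V : E n × ℝ → ℝ} {U : Pt n → E n} {G : Option (Fin n) → Pt n → E n}
  {u : E n × ℝ → E n}

/-- Difference the identity `∂_k U = G k` in direction `x_i` and pass to the limit: on one side the
quotients of `U` tend to `G (some i)`, on the other those of `G k` tend to `H`. Hence `H` is the
derivative of `G (some i)` in direction `k`, including `k = y`. -/
theorem RobinSol.hasWeakDeriv (ha : -1 < a) (ha1 : a < 1) (hδ₀ : 0 < δ₀)
    (h : RobinSol a δ₀ Λ K μ lam V U G u)
    (hw : ∀ k, HasWeakDeriv (openHalfCyl n) (dir k) U (G k)) {k : Option (Fin n)} {i : Fin n}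
    {H : Pt n → E n}
    (hH : ∀ r, 0 ≤ r → r < 1 → MemLp H 2 ((wMeasure n a).restrict (Q n r)) ∧
      Tendsto (fun j => eLpNorm (dq (stepSeq j) (dir (some i)) (G k) - H) 2
        ((wMeasure n a).restrict (Q n r))) atTop (𝓝 0)) :
    HasWeakDeriv (openHalfCyl n) (dir k) (G (some i)) H := by
  have hopen : IsOpen (openHalfCyl n) := by
    refine IsOpen.and (isOpen_lt ?_ continuous_const) (IsOpen.and (isOpen_lt continuous_const ?_)
      (IsOpen.and (isOpen_lt continuous_const ?_) (isOpen_lt ?_ continuous_const))) <;> fun_prop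
  have hcpt : ∀ S : Set (Pt n), S ⊆ openHalfCyl n → IsCompact S →
      ∃ (l : ℕ) (C : ℝ≥0∞), C ≠ ⊤ ∧
        volume.restrict S ≤ C • (wMeasure n a).restrict (Q n (radius l)) := by
    intro S hS hSc
    obtain ⟨l, hl⟩ := exists_radius_of_isCompact hSc fun p hp => ⟨(hS hp).1, (hS hp).2.2.1⟩
    obtain ⟨C, hC, hle⟩ := exists_volume_le a hSc fun p hp => (hS hp).2.1
    refine ⟨l, C, hC, hle.trans ?_⟩
    have h1 : (wMeasure n a).restrict S ≤ (wMeasure n a).restrict (Q n (radius l)) :=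
      Measure.restrict_mono (fun p hp => hl p hp (hS hp).2.2.2) le_rfl
    exact Measure.le_iff.2 fun A _ => by
      simp only [Measure.smul_apply, smul_eq_mul]
      gcongr
  refine ⟨(hw (some i)).2.1, ?_, fun φ hφ hφc hφs => ?_⟩
  · rw [locallyIntegrableOn_iff hopen.isLocallyClosed]
    intro S hS hSc
    obtain ⟨l, C, hC, hle⟩ := hcpt S hS hSc
    have hfin : IsFiniteMeasure (volume.restrict S) := ⟨by simpa using hSc.measure_lt_top⟩
    exact ((hH _ (radius_nonneg l) (radius_lt_one l)).1.of_measure_le_smul hC hle).integrable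
      (by norm_num)
  · set S := tsupport φ
    have hSc : IsCompact S := hφc.isCompact
    obtain ⟨l, C, hC, hle⟩ := hcpt S hφs hSc
    obtain ⟨ρ, hρ, hρΩ⟩ := hSc.exists_cthickening_subset_open hopen hφs
    obtain ⟨r', hr', hr'1⟩ := exists_between (radius_lt_one l)
    have hr'0 := (radius_nonneg l).trans hr'.le
    have transfer : ∀ {f : ℕ → Pt n → E n} {g : Pt n → E n},
        Tendsto (fun j => eLpNorm (f j - g) 2 ((wMeasure n a).restrict (Q n (radius l))))
          atTop (𝓝 0) →
        Tendsto (fun j => eLpNorm (f j - g) 2 (volume.restrict S)) atTop (𝓝 0) := by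
      intro f g hfg
      have h1 := ENNReal.Tendsto.const_mul hfg (a := C ^ (1 / (2 : ℝ≥0∞)).toReal)
        (Or.inr (ENNReal.rpow_ne_top_of_nonneg ENNReal.toReal_nonneg hC))
      rw [mul_zero] at h1
      exact tendsto_of_tendsto_of_tendsto_of_le_of_le tendsto_const_nhds h1 (fun _ => zero_le)
        fun j => eLpNorm_le_of_measure_le_smul hle
    have hmem : ∀ {f : ℕ → Pt n → E n} {g : Pt n → E n}, (∀ j, Measurable (f j)) →
        MemLp g 2 (volume.restrict S) →
        Tendsto (fun j => eLpNorm (f j - g) 2 (volume.restrict S)) atTop (𝓝 0) →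
        ∀ᶠ j in atTop, MemLp (f j) 2 (volume.restrict S) := by
      intro f g mf hg hfg
      filter_upwards [hfg.eventually_lt_const ENNReal.zero_lt_top] with j hj
      have : MemLp (f j - g) 2 (volume.restrict S) :=
        ⟨(mf j).aestronglyMeasurable.sub hg.1, hj⟩
      simpa using this.add hg
    have hGr := (h.memLp ha ha1 hδ₀ hr'0 hr'1).2.1 (some i)
    have hGS := ((h.memLp ha ha1 hδ₀ (radius_nonneg l) (radius_lt_one l)).2.1
      (some i)).of_measure_le_smul hC hle
    obtain ⟨hHm, hHt⟩ := hH _ (radius_nonneg l) (radius_lt_one l)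
    have t1 := transfer ((h.sol.tendsto_dq ha (radius_nonneg l) hr' hr'1 i hGr).comp
      tendsto_stepSeq)
    have t2 := transfer hHt
    have m1 := fun j => measurable_dq h.sol.measU (stepSeq j) (dir (some i))
    have m2 := fun j => measurable_dq (h.sol.measG k) (stepSeq j) (dir (some i))
    have hcd : Continuous fun p => fderiv ℝ φ p (dir k) :=
      (hφ.continuous_fderiv (by norm_num)).clm_apply continuous_const
    have hHS := hHm.of_measure_le_smul hC hle
    have l1 := tendsto_setIntegral_smul hSc hcd (hφc.fderiv_apply ℝ (dir k)) (hmem m1 hGS t1)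
      hGS t1
    have l2 := (tendsto_setIntegral_smul hSc hφ.continuous hφc (hmem m2 hHS t2) hHS t2).neg
    rw [setIntegral_eq_of_tsupport (tsupport_fderiv_apply_subset ℝ (dir k)) hφs,
      setIntegral_eq_of_tsupport (K := S) le_rfl hφs]
    refine tendsto_nhds_unique l1 (l2.congr' ?_)
    filter_upwards [eventually_stepSeq_le hρ] with j hj
    have := (hw k).integral_dq (e := dir (some i)) hφ hφc hρΩ
      (s := stepSeq j) (by rwa [norm_smul, norm_dir_some, mul_one])
    have e1 := setIntegral_eq_of_tsupport (tsupport_fderiv_apply_subset ℝ (dir k) : _ ⊆ S)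
      (Set.subset_univ _) (dq (stepSeq j) (dir (some i)) U)
    have e2 := setIntegral_eq_of_tsupport (le_rfl : tsupport φ ⊆ S)
      (Set.subset_univ _) (dq (stepSeq j) (dir (some i)) (G k))
    rw [setIntegral_univ] at e1 e2
    rw [e1, e2] at this
    exact this.symm

end WeakDerivative

end LameExt

namespace LameExt

open scoped ENNReal

variable {n : ℕ} {a μ lam : ℝ}

/-! ### The quantitative estimate -/

section EnergyBound

theorem exists_energy_bound (n : ℕ) {a : ℝ} (ha : -1 < a) (ha1 : a < 1) {δ₀ : ℝ}
    (hδ₀ : 0 < δ₀) (Λ : ℝ) {K : ℝ} (hK : 0 ≤ K) :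
    ∃ C : ℝ≥0∞, C ≠ ⊤ ∧ ∀ (μ lam : ℝ) (V : E n × ℝ → ℝ) (U : Pt n → E n)
      (G : Option (Fin n) → Pt n → E n) (u : E n × ℝ → E n),
      RobinSol a δ₀ Λ K μ lam V U G u →
      (∀ k, ∫⁻ p in Q n (1 / 2), ‖G k p‖ₑ ^ 2 ∂(wMeasure n a) ≤
        C * ∫⁻ p in Q n 1, ‖U p‖ₑ ^ 2 ∂(wMeasure n a)) ∧
      ∀ k i (H : Pt n → E n), MemLp H 2 ((wMeasure n a).restrict (Q n (1 / 2))) →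
        Tendsto (fun j => eLpNorm (dq (stepSeq j) (dir (some i)) (G k) - H) 2
          ((wMeasure n a).restrict (Q n (1 / 2)))) atTop (𝓝 0) →
        ∫⁻ p in Q n (1 / 2), ‖H p‖ₑ ^ 2 ∂(wMeasure n a) ≤
          C * ∫⁻ p in Q n 1, ‖U p‖ₑ ^ 2 ∂(wMeasure n a) := by
  -- Radii `1/2 < 5/8 < 3/4 < 1`: the first inequality controls the gradient and the trace on `3/4`
  -- by `U` on `1`; the second controls quotients of the gradient on `1/2` by the gradient and the
  -- trace on `3/4`, for steps up to `1/8`.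
  obtain ⟨C₁, hC₁, hcac⟩ := exists_caccioppoli_Q n ha ha1 hδ₀ Λ hK
    (by norm_num : (0 : ℝ) ≤ 3 / 4) (by norm_num : (3 / 4 : ℝ) < 1)
  obtain ⟨C₂, hC₂, hdq⟩ := exists_dq_le n ha ha1 hδ₀ Λ hK
    (by norm_num : (0 : ℝ) ≤ 1 / 2) (by norm_num : (1 / 2 : ℝ) < 5 / 8)
    (by norm_num : (5 / 8 : ℝ) < 3 / 4) (by norm_num)
  refine ⟨C₁ + C₂ * (C₁ + C₁), by finiteness, fun μ lam V U G u h => ?_⟩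
  have key := hcac μ lam U G u _ (fun _ => 0) V h.le_mu h.le_lam h.mu_le h.lam_le h.sol h.abs_le
    (fun x => by simp) measurable_const (by simp)
  simp only [enorm_zero, ne_eq, OfNat.ofNat_ne_zero, not_false_eq_true, zero_pow,
    lintegral_zero, add_zero] at key
  refine ⟨fun k => ?_, fun k i H hH hlim => ?_⟩
  · refine (lintegral_mono_set (Q_mono (by norm_num) (by norm_num))).trans ((key.1 k).trans ?_)
    gcongr
    exact le_self_add
  · have h1 := ENNReal.Tendsto.pow (n := 2) (tendsto_eLpNorm_of_sub
      (fun j => (measurable_dq (h.sol.measG k) _ _).aestronglyMeasurable) hH hlim)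
    rw [← eLpNorm_sq]
    refine le_of_tendsto h1 ?_
    filter_upwards [eventually_stepSeq_le (by norm_num : (0 : ℝ) < 1 / 8)] with j hj
    refine (hdq μ lam V U G u h i (stepSeq j) (stepSeq_pos j).ne' (by linarith) k).trans ?_
    rw [eLpNorm_sq, eLpNorm_sq]
    calc _ ≤ C₂ * (C₁ * (∫⁻ p in Q n 1, ‖U p‖ₑ ^ 2 ∂(wMeasure n a)) +
          C₁ * ∫⁻ p in Q n 1, ‖U p‖ₑ ^ 2 ∂(wMeasure n a)) := by
            gcongr
            · exact key.1 (some i)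
            · exact key.2
      _ = C₂ * (C₁ + C₁) * ∫⁻ p in Q n 1, ‖U p‖ₑ ^ 2 ∂(wMeasure n a) := by ring
      _ ≤ _ := by
        gcongr
        exact le_add_self

end EnergyBound

end LameExt

namespace LameExt

open scoped ENNReal

variable {n : ℕ} {a μ lam : ℝ}

/-! ### Slicing in `y` and null sets -/

section Slicing

/-- `(x, y, t) ↦ (y, x, t)`. -/
def slice (n : ℕ) : Pt n ≃ᵐ ℝ × (E n × ℝ) where
  toFun p := (p.2.1, p.1, p.2.2)
  invFun q := (q.2.1, q.1, q.2.2)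
  left_inv _ := rfl
  right_inv _ := rfl
  measurable_toFun := by
    change Measurable fun p : Pt n => (p.2.1, p.1, p.2.2)
    fun_prop
  measurable_invFun := by
    change Measurable fun q : ℝ × (E n × ℝ) => (q.2.1, q.1, q.2.2)
    fun_prop

theorem measurePreserving_slice (n : ℕ) : MeasurePreserving (slice n) := by
  have h1 := (volume_preserving_prodAssoc (α₁ := E n) (β₁ := ℝ) (γ₁ := ℝ)).symm
  have h2 : MeasurePreserving (Prod.map Prod.swap id : (E n × ℝ) × ℝ → (ℝ × E n) × ℝ) :=
    MeasurePreserving.prod (Measure.measurePreserving_swap) (MeasurePreserving.id _)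
  exact (volume_preserving_prodAssoc (α₁ := ℝ) (β₁ := E n) (γ₁ := ℝ)).comp (h2.comp h1)

theorem measurableSet_strip {S : Set (E n × ℝ)} (hS : MeasurableSet S) {I : Set ℝ}
    (hI : MeasurableSet I) : MeasurableSet {p : Pt n | (p.1, p.2.2) ∈ S ∧ p.2.1 ∈ I} := by
  have h1 : Measurable fun p : Pt n => ((p.1, p.2.2) : E n × ℝ) := by fun_prop
  have h2 : Measurable fun p : Pt n => p.2.1 := by fun_prop
  exact (h1 hS).inter (h2 hI)

theorem lintegral_strip {S : Set (E n × ℝ)} (hS : MeasurableSet S) {I : Set ℝ}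
    (hI : MeasurableSet I) {f : Pt n → ℝ≥0∞} (hf : Measurable f) :
    ∫⁻ p in {p : Pt n | (p.1, p.2.2) ∈ S ∧ p.2.1 ∈ I}, f p =
      ∫⁻ z in I, ∫⁻ b in S, f (b.1, z, b.2) := by
  have hm : Measurable fun q : ℝ × (E n × ℝ) => f (q.2.1, q.1, q.2.2) := by fun_prop
  have h1 := (measurePreserving_slice n).setLIntegral_comp_preimage (hI.prod hS) hm
  have e : {p : Pt n | (p.1, p.2.2) ∈ S ∧ p.2.1 ∈ I} = slice n ⁻¹' (I ×ˢ S) := by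
    ext p; simp [slice, and_comm]
  rw [e]
  refine h1.trans ?_
  rw [Measure.volume_eq_prod, ← Measure.prod_restrict, lintegral_prod _ hm.aemeasurable]

theorem quasiMeasurePreserving_thin (n : ℕ) :
    Measure.QuasiMeasurePreserving (fun p : Pt n => ((p.1, p.2.2) : E n × ℝ)) :=
  (Measure.quasiMeasurePreserving_snd (μ := volume) (ν := volume)).comp
    (measurePreserving_slice n).quasiMeasurePreserving

theorem wMeasure_absolutelyContinuous (n : ℕ) (a : ℝ) : wMeasure n a ≪ volume :=
  (withDensity_absolutelyContinuous _ _).trans Measure.absolutelyContinuous_restrict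

theorem ae_time_ne_zero (n : ℕ) : ∀ᵐ p : Pt n, p.2.2 ≠ 0 := by
  have h1 : Measure.QuasiMeasurePreserving (fun p : Pt n => p.2.2) :=
    (Measure.quasiMeasurePreserving_snd (μ := volume) (ν := volume)).comp
      (Measure.quasiMeasurePreserving_snd (μ := volume) (ν := volume))
  exact h1.ae (Measure.ae_ne volume 0)

theorem ae_wMeasure_time_ne_zero (n : ℕ) (a : ℝ) : ∀ᵐ p ∂(wMeasure n a), p.2.2 ≠ 0 :=
  (wMeasure_absolutelyContinuous n a).ae_le (ae_time_ne_zero n)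

theorem measurableSet_halfCyl (r : ℝ) : MeasurableSet (halfCyl n r) := by
  have h1 : MeasurableSet {p : Pt n | ‖p.1‖ ^ 2 + p.2.1 ^ 2 < r ^ 2} :=
    measurableSet_lt (by fun_prop) (by fun_prop)
  have h2 : MeasurableSet {p : Pt n | 0 < p.2.1} := measurableSet_lt (by fun_prop) (by fun_prop)
  have h3 : MeasurableSet {p : Pt n | -r ^ 2 < p.2.2} :=
    measurableSet_lt (by fun_prop) (by fun_prop)
  have h4 : MeasurableSet {p : Pt n | p.2.2 ≤ 0} := measurableSet_le (by fun_prop) (by fun_prop)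
  exact h1.inter (h2.inter (h3.inter h4))

theorem isOpen_openHalfCyl (n : ℕ) : IsOpen (openHalfCyl n) := by
  refine IsOpen.and (isOpen_lt ?_ continuous_const) (IsOpen.and (isOpen_lt continuous_const ?_)
    (IsOpen.and (isOpen_lt continuous_const ?_) (isOpen_lt ?_ continuous_const))) <;> fun_prop

theorem measurableSet_thinCyl (n : ℕ) : MeasurableSet (thinCyl n) := by
  have h1 : MeasurableSet {q : E n × ℝ | ‖q.1‖ < 1} :=
    measurableSet_lt (by fun_prop) (by fun_prop)
  have h2 : MeasurableSet {q : E n × ℝ | -1 < q.2} :=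
    measurableSet_lt (by fun_prop) (by fun_prop)
  have h3 : MeasurableSet {q : E n × ℝ | q.2 ≤ 0} := measurableSet_le (by fun_prop) (by fun_prop)
  exact h1.inter (h2.inter h3)

theorem halfCyl_ae_eq (r : ℝ) : halfCyl n r =ᵐ[wMeasure n a] Q n r := by
  filter_upwards [ae_wMeasure_pos n a, ae_wMeasure_time_ne_zero n a] with p h1 h2
  refine propext (⟨fun h => ⟨h.1, h.2.2.1, lt_of_le_of_ne h.2.2.2 h2⟩,
    fun h => ⟨h.1, h1, h.2.1, h.2.2.le⟩⟩ : p ∈ halfCyl n r ↔ p ∈ Q n r)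

theorem setIntegral_halfCyl (a : ℝ) (f : Pt n → ℝ) :
    ∫ p in halfCyl n 1, p.2.1 ^ a * f p = ∫ p in Q n 1, f p ∂(wMeasure n a) := by
  rw [← setIntegral_congr_set (halfCyl_ae_eq 1), wMeasure,
    restrict_withDensity (measurableSet_halfCyl 1),
    Measure.restrict_restrict (measurableSet_halfCyl 1),
    integral_withDensity_eq_integral_toReal_smul (by fun_prop) (by simp)]
  have hsub : halfCyl n 1 ⊆ {p | 0 < p.2.1} := fun p hp => hp.2.1
  rw [Set.inter_eq_left.2 hsub]
  refine setIntegral_congr_fun (measurableSet_halfCyl 1) fun p hp => ?_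
  have := Real.rpow_nonneg hp.2.1.le a
  simp only [smul_eq_mul, ENNReal.toReal_ofReal this]

/-- The weight is positive for `y > 0`, so weighted null sets are Lebesgue null there. -/
theorem ae_restrict_openHalfCyl {P : Pt n → Prop} (h : ∀ᵐ p ∂(wMeasure n a).restrict (Q n 1), P p) :
    ∀ᵐ p ∂volume.restrict (openHalfCyl n), P p := by
  have hpos : MeasurableSet {p : Pt n | 0 < p.2.1} := measurableSet_lt (by fun_prop) (by fun_prop)
  rw [wMeasure, restrict_withDensity (measurableSet_Q 1), ae_withDensity_iff (by fun_prop),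
    Measure.restrict_restrict (measurableSet_Q 1)] at h
  have hsub : openHalfCyl n ⊆ Q n 1 ∩ {p | 0 < p.2.1} := fun p hp =>
    ⟨⟨by simpa using hp.1, by simpa using hp.2.2.1, hp.2.2.2⟩, hp.2.1⟩
  filter_upwards [ae_restrict_of_ae_restrict_of_subset hsub h,
    ae_restrict_mem (isOpen_openHalfCyl n).measurableSet] with p hp hmem
  exact hp (by simpa using Real.rpow_pos_of_pos hmem.2.1 a)

end Slicing

/-! ### Local square integrability and changes of representative -/

section Local

/-- The part of `K` with `y < 0` carries no mass, so the sign of `y` need not be assumed. -/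
theorem LocL2.memLp_restrict {f : Pt n → E n} (h : LocL2 a f) {K : Set (Pt n)} (hK : IsCompact K)
    (hK1 : ∀ p ∈ K, ‖p.1‖ ^ 2 + p.2.1 ^ 2 < 1 ∧ -1 < p.2.2 ∧ p.2.2 ≤ 0) :
    MemLp f 2 ((wMeasure n a).restrict K) := by
  have hc : IsClosed {p : Pt n | 0 ≤ p.2.1} := isClosed_le continuous_const (by fun_prop)
  have he : (K ∩ {p : Pt n | 0 ≤ p.2.1} : Set (Pt n)) =ᵐ[wMeasure n a] K := by
    filter_upwards [ae_wMeasure_pos n a] with p hp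
    exact propext (⟨fun h => h.1, fun h => ⟨h, hp.le⟩⟩ :
      p ∈ K ∩ {p : Pt n | 0 ≤ p.2.1} ↔ p ∈ K)
  rw [← Measure.restrict_congr_set he]
  exact h _ (hK.inter_right hc) fun p hp => ⟨(hK1 p hp.1).1, hp.2, (hK1 p hp.1).2⟩

theorem LocL2.memLp_closedCyl {f : Pt n → E n} (h : LocL2 a f) {r : ℝ} (hr : 0 ≤ r)
    (hr1 : r < 1) : MemLp f 2 ((wMeasure n a).restrict (closedCyl n r)) := by
  have : r ^ 2 < 1 := by nlinarith
  exact h.memLp_restrict (isCompact_closedCyl r) fun p hp =>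
    ⟨hp.1.trans_lt this, by linarith [hp.2.1], hp.2.2⟩

theorem Q_one_subset_iUnion (n : ℕ) : Q n 1 ⊆ ⋃ l, closedCyl n (radius l) := fun p hp => by
  obtain ⟨l, hl⟩ := exists_radius_of_isCompact (isCompact_singleton (x := p)) (by
    rintro _ rfl
    exact ⟨by simpa using hp.1, by simpa using hp.2.1⟩)
  exact Set.mem_iUnion.2 ⟨l, Q_subset_closedCyl _ (hl p rfl hp.2.2)⟩

theorem LocL2.exists_measurable {f : Pt n → E n} (h : LocL2 a f) :
    ∃ f', Measurable f' ∧ f =ᵐ[(wMeasure n a).restrict (Q n 1)] f' := by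
  have h1 : AEStronglyMeasurable f ((wMeasure n a).restrict (⋃ l, closedCyl n (radius l))) :=
    aestronglyMeasurable_iUnion_iff.2 fun l =>
      (h.memLp_closedCyl (radius_nonneg l) (radius_lt_one l)).1
  have h2 := h1.mono_set (Q_one_subset_iUnion n)
  exact ⟨h2.mk f, h2.stronglyMeasurable_mk.measurable, h2.ae_eq_mk⟩

theorem ae_restrict_halfCylWithThin {P : Pt n → Prop}
    (h : ∀ᵐ p ∂(wMeasure n a).restrict (Q n 1), P p) {K : Set (Pt n)} (hK : MeasurableSet K)
    (hK1 : K ⊆ halfCylWithThin n) : ∀ᵐ p ∂(wMeasure n a).restrict K, P p := by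
  rw [ae_restrict_iff' (measurableSet_Q 1)] at h
  rw [ae_restrict_iff' hK]
  filter_upwards [h, ae_wMeasure_time_ne_zero n a] with p hp ht hpK
  have := hK1 hpK
  exact hp ⟨by simpa using this.1, by simpa using this.2.2.1, lt_of_le_of_ne this.2.2.2 ht⟩

theorem LocL2.congr {f f' : Pt n → E n} (h : LocL2 a f)
    (hf : f =ᵐ[(wMeasure n a).restrict (Q n 1)] f') : LocL2 a f' := fun K hK hK1 =>
  (h K hK hK1).ae_eq (ae_restrict_halfCylWithThin hf hK.measurableSet hK1)

theorem HasWeakDeriv.congr {Ω : Set (Pt n)} {v : Pt n} {f g f' g' : Pt n → E n}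
    (h : HasWeakDeriv Ω v f g) (hf : f =ᵐ[volume.restrict Ω] f')
    (hg : g =ᵐ[volume.restrict Ω] g') : HasWeakDeriv Ω v f' g' := by
  refine ⟨h.1.congr hf, h.2.1.congr hg, fun φ h1 h2 h3 => ?_⟩
  have e1 : ∫ p in Ω, fderiv ℝ φ p v • f' p = ∫ p in Ω, fderiv ℝ φ p v • f p :=
    integral_congr_ae (hf.mono fun p hp => by simp only [hp])
  have e2 : ∫ p in Ω, φ p • g' p = ∫ p in Ω, φ p • g p :=
    integral_congr_ae (hg.mono fun p hp => by simp only [hp])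
  rw [e1, e2]
  exact h.2.2 φ h1 h2 h3

theorem exists_norm_le_of_isCompact {S : Set (E n × ℝ)} (hS : IsCompact S)
    (hS1 : S ⊆ thinCyl n) : ∃ ρ : ℝ, 0 ≤ ρ ∧ ρ < 1 ∧ ∀ q ∈ S, ‖q.1‖ ≤ ρ := by
  by_cases hne : S.Nonempty
  swap
  · exact ⟨0, le_rfl, one_pos, fun p hp => absurd ⟨_, hp⟩ hne⟩
  have hcont : ContinuousOn (fun q : E n × ℝ => ‖q.1‖) S := by fun_prop
  obtain ⟨q, hq, hmax⟩ := hS.exists_isMaxOn hne hcont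
  exact ⟨‖q.1‖, norm_nonneg _, (hS1 hq).1, fun b hb => hmax hb⟩

/-- A thin strip over a compact part of the thin cylinder lies in the half cylinder. -/
theorem exists_strip {S : Set (E n × ℝ)} (hS : IsCompact S) (hS1 : S ⊆ thinCyl n) :
    ∃ h : ℝ, 0 < h ∧
      ∀ p : Pt n, (p.1, p.2.2) ∈ S → 0 ≤ p.2.1 → p.2.1 ≤ h → p ∈ halfCylWithThin n := by
  obtain ⟨ρ, hρ0, hρ1, hρ⟩ := exists_norm_le_of_isCompact hS hS1
  have hpos : 0 < 1 - ρ ^ 2 := by nlinarith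
  obtain ⟨c, hc0, hc⟩ := exists_between (Real.sqrt_pos.2 hpos)
  refine ⟨c, hc0, fun p hp h0 h1 => ?_⟩
  have h3 : ‖p.1‖ ^ 2 ≤ ρ ^ 2 := pow_le_pow_left₀ (norm_nonneg _) (hρ _ hp) 2
  have h4 : p.2.1 ^ 2 ≤ c ^ 2 := pow_le_pow_left₀ h0 h1 2
  have h5 : c ^ 2 < 1 - ρ ^ 2 := (Real.lt_sqrt hc0.le).1 hc
  exact ⟨by linarith, h0, (hS1 hp).2⟩
theorem IsTrace.congr {U U' : Pt n → E n} {u u' : E n × ℝ → E n} (h : IsTrace U u)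
    (hU : U =ᵐ[(wMeasure n a).restrict (Q n 1)] U')
    (hu : u =ᵐ[volume.restrict (thinCyl n)] u') : IsTrace U' u' := by
  refine ⟨h.1.congr hu, fun S hS hS1 => (h.2 S hS hS1).congr' ?_⟩
  obtain ⟨c, hc, hstrip⟩ := exists_strip hS hS1
  have hU1 := ae_restrict_openHalfCyl hU
  rw [ae_restrict_iff' (isOpen_openHalfCyl n).measurableSet] at hU1
  filter_upwards [Ioo_mem_nhdsGT hc] with h hh
  congr 1
  have hm : MeasurableSet {p : Pt n | (p.1, p.2.2) ∈ S ∧ 0 < p.2.1 ∧ p.2.1 < h} :=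
    measurableSet_strip hS.measurableSet measurableSet_Ioo
  refine setLIntegral_congr_fun_ae hm ?_
  filter_upwards [hU1, ae_time_ne_zero n, (quasiMeasurePreserving_thin n).ae
    ((ae_restrict_iff' (measurableSet_thinCyl n)).1 hu)] with p h1 h2 h3 hp
  have h4 := hstrip p hp.1 hp.2.1.le (hp.2.2.trans hh.2).le
  rw [h1 ⟨h4.1, hp.2.1, h4.2.2.1, lt_of_le_of_ne h4.2.2.2 h2⟩, h3 (hS1 hp.1)]

end Local

end LameExt

namespace LameExt

open scoped ENNReal

variable {n : ℕ} {a μ lam : ℝ}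

/-! ### Measurable representatives -/

section Representatives

theorem halfCyl_one_ae_eq (n : ℕ) : halfCyl n 1 =ᵐ[volume] openHalfCyl n := by
  filter_upwards [ae_time_ne_zero n] with p ht
  refine propext (?_ : p ∈ halfCyl n 1 ↔ p ∈ openHalfCyl n)
  simp only [halfCyl, openHalfCyl, Set.mem_ofPred_eq, one_pow]
  refine and_congr_right fun _ => and_congr_right fun _ => and_congr_right fun _ =>
    ⟨fun h => lt_of_le_of_ne h ht, le_of_lt⟩

theorem IsWeakSolution.congr {V : E n × ℝ → ℝ} {U U' : Pt n → E n}
    {G G' : Option (Fin n) → Pt n → E n} {u u' : E n × ℝ → E n}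
    (h : IsWeakSolution a μ lam V U G u)
    (hU : U =ᵐ[(wMeasure n a).restrict (Q n 1)] U')
    (hG : ∀ k, G k =ᵐ[(wMeasure n a).restrict (Q n 1)] G' k)
    (hu : u =ᵐ[volume.restrict (thinCyl n)] u') : IsWeakSolution a μ lam V U' G' u' where
  locL2 := h.locL2.congr hU
  grad_locL2 k := (h.grad_locL2 k).congr (hG k)
  weakGrad k := (h.weakGrad k).congr (ae_restrict_openHalfCyl hU) (ae_restrict_openHalfCyl (hG k))
  trace := h.trace.congr hU hu
  weakEq φ h1 h2 h3 := by
    have key := h.weakEq φ h1 h2 h3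
    have hU1 : ∀ᵐ p ∂volume.restrict (halfCyl n 1), U p = U' p := by
      rw [Measure.restrict_congr_set (halfCyl_one_ae_eq n)]
      exact ae_restrict_openHalfCyl hU
    have hG1 : ∀ᵐ p ∂volume.restrict (halfCyl n 1), ∀ k, G k p = G' k p := by
      rw [Measure.restrict_congr_set (halfCyl_one_ae_eq n)]
      exact ae_restrict_openHalfCyl (ae_all_iff.2 hG)
    have e1 := integral_congr_ae (hU1.mono fun p hp =>
      (by rw [hp] : p.2.1 ^ a * inner ℝ (U p) (fderiv ℝ φ p dirT) =
        p.2.1 ^ a * inner ℝ (U' p) (fderiv ℝ φ p dirT)))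
    have e2 := integral_congr_ae (hG1.mono fun p hp =>
      (by simp only [hp] : p.2.1 ^ a * (inner ℝ (G none p) (fderiv ℝ φ p (dir none))
          + μ * ∑ i : Fin n, inner ℝ (G (some i) p) (fderiv ℝ φ p (dir (some i)))
          + (μ + lam) * (∑ i : Fin n, G (some i) p i)
              * ∑ i : Fin n, fderiv ℝ φ p (dir (some i)) i) =
        p.2.1 ^ a * (inner ℝ (G' none p) (fderiv ℝ φ p (dir none))
          + μ * ∑ i : Fin n, inner ℝ (G' (some i) p) (fderiv ℝ φ p (dir (some i)))
          + (μ + lam) * (∑ i : Fin n, G' (some i) p i)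
              * ∑ i : Fin n, fderiv ℝ φ p (dir (some i)) i)))
    have e3 := integral_congr_ae (hu.mono fun q hq =>
      (by rw [hq] : V q * inner ℝ (u q) (φ (q.1, 0, q.2)) =
        V q * inner ℝ (u' q) (φ (q.1, 0, q.2))))
    rw [e1, e2, e3] at key
    exact key

/-- Averages of translates are defined through pointwise values, so the solution, its gradient and
its trace are first replaced by Borel functions. -/
theorem IsWeakSolution.exists_measurable {V : E n × ℝ → ℝ} {U : Pt n → E n}
    {G : Option (Fin n) → Pt n → E n} {u : E n × ℝ → E n}
    (h : IsWeakSolution a μ lam V U G u) :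
    ∃ (U' : Pt n → E n) (G' : Option (Fin n) → Pt n → E n) (u' : E n × ℝ → E n),
      Measurable U' ∧ (∀ k, Measurable (G' k)) ∧ Measurable u' ∧
      U =ᵐ[(wMeasure n a).restrict (Q n 1)] U' ∧
      (∀ k, G k =ᵐ[(wMeasure n a).restrict (Q n 1)] G' k) ∧
      IsWeakSolution a μ lam V U' G' u' := by
  obtain ⟨U', mU, hU⟩ := h.locL2.exists_measurable
  choose G' mG hG using fun k => (h.grad_locL2 k).exists_measurable
  exact ⟨U', G', h.trace.1.mk u, mU, mG, h.trace.1.stronglyMeasurable_mk.measurable, hU, hG,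
    h.congr hU hG h.trace.1.ae_eq_mk⟩

end Representatives

/-! ### Square integrability of the trace -/

section Trace

variable {U : Pt n → E n} {u : E n × ℝ → E n}

theorem enorm_sq_le_add_sub (x y : E n) : ‖y‖ₑ ^ 2 ≤ 2 * ‖x‖ₑ ^ 2 + 2 * ‖x - y‖ₑ ^ 2 := by
  have h : ‖y‖ₑ ≤ ‖x‖ₑ + ‖x - y‖ₑ := by
    have h1 : y = x - (x - y) := by abel
    calc ‖y‖ₑ = ‖x - (x - y)‖ₑ := by rw [← h1]
      _ ≤ _ := enorm_sub_le
  exact (pow_le_pow_left₀ zero_le h 2).trans (ennreal_add_sq_le _ _)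

theorem isCompact_strip {S : Set (E n × ℝ)} (hS : IsCompact S) {I : Set ℝ} (hI : IsCompact I) :
    IsCompact {p : Pt n | (p.1, p.2.2) ∈ S ∧ p.2.1 ∈ I} := by
  have hc : Continuous fun q : ℝ × (E n × ℝ) => ((q.2.1, q.1, q.2.2) : Pt n) := by fun_prop
  have e : {p : Pt n | (p.1, p.2.2) ∈ S ∧ p.2.1 ∈ I} =
      (fun q : ℝ × (E n × ℝ) => ((q.2.1, q.1, q.2.2) : Pt n)) '' (I ×ˢ S) := by
    ext p
    constructor
    · intro hp
      exact ⟨(p.2.1, p.1, p.2.2), ⟨hp.2, hp.1⟩, rfl⟩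
    · rintro ⟨q, hq, rfl⟩
      exact ⟨hq.2, hq.1⟩
  rw [e]
  exact (hI.prod hS).image hc

/-- By `|u|² ≤ 2|U|² + 2|U - u|²` the trace is square integrable over a strip, and as it does not
depend on `y`, also on the thin set. -/
theorem IsTrace.memLp (h : IsTrace U u) (hU : LocL2 a U) (mU : Measurable U) (mu : Measurable u)
    {S : Set (E n × ℝ)} (hS : IsCompact S) (hS1 : S ⊆ thinCyl n) :
    MemLp u 2 (volume.restrict S) := by
  obtain ⟨c, hc, hstrip⟩ := exists_strip hS hS1
  have hev := (h.2 S hS hS1).eventually_lt_const (zero_lt_one (α := ℝ≥0∞))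
  obtain ⟨δ, hδ1, hδ0, hδc⟩ := (hev.and (Ioo_mem_nhdsGT hc)).exists
  have hJ : ∫⁻ p in {p : Pt n | (p.1, p.2.2) ∈ S ∧ 0 < p.2.1 ∧ p.2.1 < δ},
      ‖U p - u (p.1, p.2.2)‖ₑ ^ 2 ≠ ⊤ := by
    intro htop
    rw [htop, ENNReal.mul_top (by simp)] at hδ1
    exact absurd hδ1 (by simp)
  -- The strip starts at height `δ / 2`, where the weight is comparable to a constant and `U` is
  -- square integrable for Lebesgue measure.
  set A : Set (Pt n) := {p | (p.1, p.2.2) ∈ S ∧ p.2.1 ∈ Set.Icc (δ / 2) δ} with hA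
  have hAc : IsCompact A := isCompact_strip hS isCompact_Icc
  obtain ⟨C, hC, hle⟩ := exists_volume_le a hAc fun p hp => (half_pos hδ0).trans_le hp.2.1
  have hUA : MemLp U 2 (volume.restrict A) := by
    refine (hU.memLp_restrict hAc fun p hp => ?_).of_measure_le_smul hC hle
    have := hstrip p hp.1 ((half_pos hδ0).le.trans hp.2.1) (hp.2.2.trans hδc.le)
    exact ⟨this.1, this.2.2⟩
  set B : Set (Pt n) := {p | (p.1, p.2.2) ∈ S ∧ p.2.1 ∈ Set.Ioo (δ / 2) δ} with hB
  have hBA : B ⊆ A := fun p hp => ⟨hp.1, hp.2.1.le, hp.2.2.le⟩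
  have hBJ : B ⊆ {p : Pt n | (p.1, p.2.2) ∈ S ∧ 0 < p.2.1 ∧ p.2.1 < δ} := fun p hp =>
    ⟨hp.1, (half_pos hδ0).trans hp.2.1, hp.2.2⟩
  have hm : Measurable fun p : Pt n => ‖u (p.1, p.2.2)‖ₑ ^ 2 := by fun_prop
  have h1 : ∫⁻ p in B, ‖u (p.1, p.2.2)‖ₑ ^ 2 =
      ∫⁻ _ in Set.Ioo (δ / 2) δ, ∫⁻ b in S, ‖u b‖ₑ ^ 2 :=
    lintegral_strip hS.measurableSet measurableSet_Ioo hm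
  rw [lintegral_const, Measure.restrict_apply_univ, Real.volume_Ioo] at h1
  have h2 : ∫⁻ p in B, ‖u (p.1, p.2.2)‖ₑ ^ 2 ≠ ⊤ := by
    refine ne_top_of_le_ne_top (b := 2 * (∫⁻ p in A, ‖U p‖ₑ ^ 2) +
      2 * ∫⁻ p in {p : Pt n | (p.1, p.2.2) ∈ S ∧ 0 < p.2.1 ∧ p.2.1 < δ},
        ‖U p - u (p.1, p.2.2)‖ₑ ^ 2) ?_ ?_
    · have := lintegral_ne_top_of_memLp hUA
      exact ENNReal.add_ne_top.2 ⟨ENNReal.mul_ne_top (by simp) this,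
        ENNReal.mul_ne_top (by simp) hJ⟩
    · calc ∫⁻ p in B, ‖u (p.1, p.2.2)‖ₑ ^ 2
          ≤ ∫⁻ p in B, (2 * ‖U p‖ₑ ^ 2 + 2 * ‖U p - u (p.1, p.2.2)‖ₑ ^ 2) :=
            lintegral_mono fun p => enorm_sq_le_add_sub _ _
        _ = 2 * (∫⁻ p in B, ‖U p‖ₑ ^ 2) + 2 * ∫⁻ p in B, ‖U p - u (p.1, p.2.2)‖ₑ ^ 2 := by
            rw [lintegral_add_left (by fun_prop), lintegral_const_mul _ (by fun_prop),
              lintegral_const_mul _ (by fun_prop)]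
        _ ≤ _ := by
            gcongr
  refine memLp_two_of_lintegral_ne_top mu.aestronglyMeasurable fun htop => h2 ?_
  rw [h1, htop, ENNReal.top_mul (by simp; linarith)]

end Trace

end LameExt

namespace LameExt

open scoped ENNReal

variable {n : ℕ} {a μ lam : ℝ} {U : Pt n → E n} {u : E n × ℝ → E n}

/-! ### The trace of a cut-off solution -/

section CutoffTrace

theorem exists_lipschitz_normal {η : Pt n → ℝ} (hη : ContDiff ℝ ∞ η) (hηc : HasCompactSupport η) :
    ∃ L : ℝ, 0 ≤ L ∧ ∀ (b : E n × ℝ) (z : ℝ), |η (b.1, z, b.2) - η (b.1, 0, b.2)| ≤ L * |z| := by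
  obtain ⟨L, hL⟩ := hη.lipschitzWith_of_hasCompactSupport hηc (by norm_num)
  refine ⟨L, L.2, fun b z => ?_⟩
  have := hL.dist_le_mul (b.1, z, b.2) (b.1, 0, b.2)
  simpa [Prod.dist_eq, Real.dist_eq] using this

theorem lintegral_cutoff_sub_le {η : Pt n → ℝ} {M L : ℝ}
    (hM : ∀ p, |η p| ≤ M)
    (hL : ∀ (b : E n × ℝ) (z : ℝ), |η (b.1, z, b.2) - η (b.1, 0, b.2)| ≤ L * |z|)
    (mU : Measurable U) (mu : Measurable u) {S : Set (E n × ℝ)} (hS : MeasurableSet S)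
    (hηS : ∀ (b : E n × ℝ) (z : ℝ), b ∉ S → η (b.1, z, b.2) = 0) (z : ℝ) :
    ∫⁻ b : E n × ℝ, ‖η (b.1, z, b.2) • U (b.1, z, b.2) - atZero η b • u b‖ₑ ^ 2 ≤
      2 * ENNReal.ofReal M ^ 2 * (∫⁻ b in S, ‖U (b.1, z, b.2) - u b‖ₑ ^ 2) +
        2 * ENNReal.ofReal (L * |z|) ^ 2 * ∫⁻ b in S, ‖u b‖ₑ ^ 2 := by
  calc _ ≤ ∫⁻ b, S.indicator (fun b : E n × ℝ =>
        2 * ENNReal.ofReal M ^ 2 * ‖U (b.1, z, b.2) - u b‖ₑ ^ 2 +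
        2 * ENNReal.ofReal (L * |z|) ^ 2 * ‖u b‖ₑ ^ 2) b := by
        refine lintegral_mono fun b => ?_
        by_cases hb : b ∈ S
        · rw [Set.indicator_of_mem hb]
          have e : η (b.1, z, b.2) • U (b.1, z, b.2) - atZero η b • u b =
              η (b.1, z, b.2) • (U (b.1, z, b.2) - u b) +
                (η (b.1, z, b.2) - η (b.1, 0, b.2)) • u b := by
            unfold atZero; module
          rw [e]
          have h1 : ‖η (b.1, z, b.2) • (U (b.1, z, b.2) - u b) +
              (η (b.1, z, b.2) - η (b.1, 0, b.2)) • u b‖ₑ ^ 2 ≤ _ :=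
            (pow_le_pow_left₀ zero_le (enorm_add_le _ _) 2).trans (ennreal_add_sq_le _ _)
          refine h1.trans ?_
          rw [mul_assoc, mul_assoc]
          gcongr
          · exact enorm_smul_sq_le (hM _) _
          · exact enorm_smul_sq_le (hL b z) _
        · rw [Set.indicator_of_notMem hb, hηS b z hb, atZero, hηS b 0 hb]
          simp
    _ = _ := by
        rw [lintegral_indicator hS, lintegral_add_left (by fun_prop),
          lintegral_const_mul _ (by fun_prop), lintegral_const_mul _ (by fun_prop)]

/-- `η U - η(·, 0, ·) u` splits into `η (U - u)`, controlled by the trace condition on the strip of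
height `2δ`, and a term of size `δ |u|` by the Lipschitz bound on `η`. -/
theorem IsTrace.tendsto_cutoff (h : IsTrace U u) (hU : LocL2 a U) (mU : Measurable U)
    (mu : Measurable u) {η : Pt n → ℝ} (hη : ContDiff ℝ ∞ η) (hηc : HasCompactSupport η)
    (hηs : tsupport η ⊆ fullCyl n) :
    Tendsto (fun δ : ℝ => (ENNReal.ofReal δ)⁻¹ * ∫⁻ z in Set.Ioo δ (2 * δ),
      ∫⁻ b : E n × ℝ, ‖η (b.1, z, b.2) • U (b.1, z, b.2) - atZero η b • u b‖ₑ ^ 2)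
      (𝓝[>] 0) (𝓝 0) := by
  have hproj : Continuous fun p : Pt n => ((p.1, p.2.2) : E n × ℝ) := by fun_prop
  set S : Set (E n × ℝ) := (fun p : Pt n => ((p.1, p.2.2) : E n × ℝ)) '' tsupport η with hSdef
  have hS : IsCompact S := hηc.isCompact.image hproj
  have hS1 : S ⊆ thinCyl n := by
    rintro _ ⟨p, hp, rfl⟩
    have hp1 := hηs hp
    refine ⟨?_, hp1.2.1, hp1.2.2.le⟩
    have h1 : ‖p.1‖ ^ 2 < 1 := by nlinarith [hp1.1, sq_nonneg p.2.1]
    exact (sq_lt_one_iff₀ (norm_nonneg _)).1 h1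
  have hηS : ∀ (b : E n × ℝ) (z : ℝ), b ∉ S → η (b.1, z, b.2) = 0 := fun b z hb =>
    image_eq_zero_of_notMem_tsupport fun hmem => hb ⟨_, hmem, rfl⟩
  obtain ⟨L, hL0, hL⟩ := exists_lipschitz_normal hη hηc
  obtain ⟨M, hM⟩ := hη.continuous.bounded_above_of_compact_support hηc
  have hI := lintegral_ne_top_of_memLp (h.memLp hU mU mu hS hS1)
  set I := ∫⁻ b in S, ‖u b‖ₑ ^ 2 with hIdef
  set J : ℝ → ℝ≥0∞ := fun δ => ∫⁻ p in {p : Pt n | (p.1, p.2.2) ∈ S ∧ 0 < p.2.1 ∧ p.2.1 < δ},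
    ‖U p - u (p.1, p.2.2)‖ₑ ^ 2 with hJdef
  have hJeq : ∀ δ, J δ = ∫⁻ z in Set.Ioo 0 δ, ∫⁻ b in S, ‖U (b.1, z, b.2) - u b‖ₑ ^ 2 :=
    fun δ => lintegral_strip hS.measurableSet measurableSet_Ioo
      (f := fun p => ‖U p - u (p.1, p.2.2)‖ₑ ^ 2) (by fun_prop)
  have hbound : ∀ δ, 0 < δ → (ENNReal.ofReal δ)⁻¹ * ∫⁻ z in Set.Ioo δ (2 * δ),
      ∫⁻ b : E n × ℝ, ‖η (b.1, z, b.2) • U (b.1, z, b.2) - atZero η b • u b‖ₑ ^ 2 ≤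
      4 * ENNReal.ofReal M ^ 2 * ((ENNReal.ofReal (2 * δ))⁻¹ * J (2 * δ)) +
        2 * ENNReal.ofReal (L * (2 * δ)) ^ 2 * I := by
    intro δ hδ
    have hδ' : ENNReal.ofReal δ ≠ 0 := by simpa using hδ
    have h1 : ∫⁻ z in Set.Ioo δ (2 * δ),
        ∫⁻ b : E n × ℝ, ‖η (b.1, z, b.2) • U (b.1, z, b.2) - atZero η b • u b‖ₑ ^ 2 ≤
        2 * ENNReal.ofReal M ^ 2 * J (2 * δ) +
          2 * ENNReal.ofReal (L * (2 * δ)) ^ 2 * I * ENNReal.ofReal δ := by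
      calc _ ≤ ∫⁻ z in Set.Ioo δ (2 * δ), (2 * ENNReal.ofReal M ^ 2 *
            (∫⁻ b in S, ‖U (b.1, z, b.2) - u b‖ₑ ^ 2) +
            2 * ENNReal.ofReal (L * (2 * δ)) ^ 2 * I) := by
            refine setLIntegral_mono' measurableSet_Ioo fun z hz => ?_
            refine (lintegral_cutoff_sub_le hM hL mU mu hS.measurableSet hηS z).trans ?_
            have hz' : |z| ≤ 2 * δ := by
              rw [abs_of_pos (hδ.trans hz.1)]; exact hz.2.le
            gcongr
        _ = 2 * ENNReal.ofReal M ^ 2 *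
            (∫⁻ z in Set.Ioo δ (2 * δ), ∫⁻ b in S, ‖U (b.1, z, b.2) - u b‖ₑ ^ 2) +
            2 * ENNReal.ofReal (L * (2 * δ)) ^ 2 * I * ENNReal.ofReal δ := by
            have hmeas : Measurable fun z => ∫⁻ b in S, ‖U (b.1, z, b.2) - u b‖ₑ ^ 2 :=
              Measurable.lintegral_prod_right'
                (f := fun q : ℝ × (E n × ℝ) => ‖U (q.2.1, q.1, q.2.2) - u q.2‖ₑ ^ 2)
                (by fun_prop)
            rw [lintegral_add_left (hmeas.const_mul _), lintegral_const_mul _ hmeas,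
              lintegral_const, Measure.restrict_apply_univ, Real.volume_Ioo]
            congr 3; ring_nf
        _ ≤ _ := by
            rw [hJeq]
            gcongr
    have e2 : (ENNReal.ofReal δ)⁻¹ = 2 * (ENNReal.ofReal (2 * δ))⁻¹ := by
      rw [ENNReal.ofReal_mul (by norm_num), ENNReal.mul_inv (by simp) (by simp), ← mul_assoc]
      simp [ENNReal.mul_inv_cancel]
    have e3 : (ENNReal.ofReal δ)⁻¹ * ENNReal.ofReal δ = 1 :=
      ENNReal.inv_mul_cancel hδ' ENNReal.ofReal_ne_top
    calc _ ≤ (ENNReal.ofReal δ)⁻¹ * (2 * ENNReal.ofReal M ^ 2 * J (2 * δ) +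
          2 * ENNReal.ofReal (L * (2 * δ)) ^ 2 * I * ENNReal.ofReal δ) := by gcongr
      _ = 2 * ENNReal.ofReal M ^ 2 * ((ENNReal.ofReal δ)⁻¹ * J (2 * δ)) +
          2 * ENNReal.ofReal (L * (2 * δ)) ^ 2 * I *
            ((ENNReal.ofReal δ)⁻¹ * ENNReal.ofReal δ) := by ring
      _ = _ := by rw [e3, e2]; ring
  have ht2 : Tendsto (fun δ : ℝ => 2 * δ) (𝓝[>] 0) (𝓝[>] 0) := by
    refine tendsto_nhdsWithin_iff.2 ⟨?_, ?_⟩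
    · have : Tendsto (fun δ : ℝ => 2 * δ) (𝓝 0) (𝓝 (2 * 0)) := by
        exact (continuous_const_mul 2).tendsto 0
      rw [mul_zero] at this
      exact this.mono_left nhdsWithin_le_nhds
    · filter_upwards [self_mem_nhdsWithin] with δ hδ
      exact mul_pos two_pos (Set.mem_Ioi.1 hδ)
  have t1 := ENNReal.Tendsto.const_mul ((h.2 S hS hS1).comp ht2)
    (a := 4 * ENNReal.ofReal M ^ 2) (Or.inr (by finiteness))
  have t2 : Tendsto (fun δ : ℝ => 2 * ENNReal.ofReal (L * (2 * δ)) ^ 2 * I) (𝓝[>] 0)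
      (𝓝 (2 * ENNReal.ofReal (L * (2 * 0)) ^ 2 * I)) := by
    have hc : Continuous fun δ : ℝ => 2 * ENNReal.ofReal (L * (2 * δ)) ^ 2 * I :=
      (ENNReal.continuous_mul_const hI).comp ((ENNReal.continuous_const_mul (by simp)).comp
        ((ENNReal.continuous_pow 2).comp (ENNReal.continuous_ofReal.comp (by fun_prop))))
    exact (hc.tendsto 0).mono_left nhdsWithin_le_nhds
  have t3 := t1.add t2
  simp only [mul_zero, ENNReal.ofReal_zero, ne_eq, OfNat.ofNat_ne_zero, not_false_eq_true,
    zero_pow, zero_mul, add_zero] at t3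
  refine tendsto_of_tendsto_of_tendsto_of_le_of_le' tendsto_const_nhds t3
    (Eventually.of_forall fun _ => zero_le) ?_
  filter_upwards [self_mem_nhdsWithin] with δ hδ
  exact hbound δ hδ

end CutoffTrace

end LameExt

namespace LameExt

open scoped ENNReal

variable {n : ℕ} {a μ lam : ℝ}

/-! ### Weak solutions fit the local framework -/

section OfWeakSolution

variable {V : E n × ℝ → ℝ} {U : Pt n → E n} {G : Option (Fin n) → Pt n → E n} {u : E n × ℝ → E n}

theorem LocL2.memLp_of_subset_Q {f : Pt n → E n} (h : LocL2 a f) {K : Set (Pt n)}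
    (hK : IsCompact K) (hK1 : K ⊆ Q n 1) : MemLp f 2 ((wMeasure n a).restrict K) :=
  h.memLp_restrict hK fun p hp => by
    have := hK1 hp
    exact ⟨by simpa using this.1, by simpa using this.2.1, this.2.2.le⟩

theorem thin_subset_thinCyl {K : Set (Pt n)} (hK : K ⊆ Q n 1) :
    {b : E n × ℝ | ((b.1, 0, b.2) : Pt n) ∈ K} ⊆ thinCyl n := fun b hb => by
  have h1 := hK hb
  have h2 : ‖b.1‖ ^ 2 < 1 := by simpa using h1.1
  exact ⟨(sq_lt_one_iff₀ (norm_nonneg _)).1 h2, by simpa using h1.2.1, h1.2.2.le⟩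

theorem IsWeakSolution.memLp_thin (h : IsWeakSolution a μ lam V U G u) (mU : Measurable U)
    (mu : Measurable u) {K : Set (Pt n)} (hK : IsCompact K) (hK1 : K ⊆ Q n 1) :
    MemLp u 2 (volume.restrict {b : E n × ℝ | ((b.1, 0, b.2) : Pt n) ∈ K}) :=
  h.trace.memLp h.locL2 mU mu (isClosedEmbedding_atZero.isCompact_preimage hK)
    (thin_subset_thinCyl hK1)

theorem LocL2.memLp_cut {f : Pt n → E n} (hf : LocL2 a f) {η : Pt n → ℝ}
    (hη : Continuous η) (hηc : HasCompactSupport η) (hηs : tsupport η ⊆ Q n 1) : MemLp (fun p => η p • f p) 2 (wMeasure n a) :=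
  memLp_smul_of_tsupport hη hηc le_rfl (isClosed_tsupport η).measurableSet
    (hf.memLp_of_subset_Q hηc.isCompact hηs)

theorem IsWeakSolution.h1Approx (h : IsWeakSolution a μ lam V U G u) (ha : -1 < a)
    (mU : Measurable U) (mG : ∀ k, Measurable (G k)) (mu : Measurable u) {η : Pt n → ℝ}
    (hη : ContDiff ℝ ∞ η) (hηc : HasCompactSupport η) (hηs : tsupport η ⊆ Q n 1) :
    H1Approx a (fun p => η p • U p) (cutGrad η U G) (fun b => atZero η b • u b) := by
  have hηs' : tsupport η ⊆ fullCyl n := by rwa [← Q_one]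
  refine h1Approx_of_weak ha mU mG mu hη hηc hηs' h.weakGrad
    (h.locL2.memLp_cut hη.continuous hηc hηs) (fun k => ?_) ?_
    (h.trace.tendsto_cutoff h.locL2 mU mu hη hηc hηs')
  · exact ((h.grad_locL2 k).memLp_cut hη.continuous hηc hηs).add
      (h.locL2.memLp_cut
        ((hη.continuous_fderiv (by norm_num)).clm_apply (continuous_const (y := dir k)))
        (hηc.fderiv_apply ℝ (dir k)) ((tsupport_fderiv_apply_subset ℝ (dir k)).trans hηs))
  · exact memLp_smul_of_tsupport (hη.continuous.comp isClosedEmbedding_atZero.continuous)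
      (hasCompactSupport_atZero hηc) (tsupport_atZero_subset η)
      ((isClosed_tsupport η).preimage isClosedEmbedding_atZero.continuous).measurableSet
      (h.memLp_thin mU mu hηc.isCompact hηs)

theorem setIntegral_Q_one {f : Pt n → ℝ} {S : Set (Pt n)} (hS : S ⊆ Q n 1)
    (hf : ∀ p, p ∉ S → f p = 0) :
    ∫ p in Q n 1, f p ∂(wMeasure n a) = ∫ p, f p ∂(wMeasure n a) :=
  setIntegral_eq_integral_of_forall_compl_eq_zero fun p hp => hf p fun h => hp (hS h)

/-- The test function vanishes off a compact part of the cylinder, so the set integrals become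
integrals against the weighted measure, and the bilinear form is the sum of flux pairings. -/
theorem IsWeakSolution.weakEq_flux (h : IsWeakSolution a μ lam V U G u) (ha : -1 < a)
    (mG : ∀ k, Measurable (G k)) {φ : Pt n → E n} (hφ : ContDiff ℝ ∞ φ)
    (hφc : HasCompactSupport φ) (hφs : tsupport φ ⊆ Q n 1) :
    ∫ p, inner ℝ (U p) (fderiv ℝ φ p dirT) ∂(wMeasure n a) =
      ∑ k, ∫ p, inner ℝ (flux μ lam G k p) (fderiv ℝ φ p (dir k)) ∂(wMeasure n a) +
        ∫ b, inner ℝ (V b • u b) (atZero φ b) := by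
  have hfin := wMeasure_finite n ha
  have key := h.weakEq φ hφ hφc (by rwa [← Q_one])
  have hz : ∀ p, p ∉ tsupport φ → ∀ v, fderiv ℝ φ p v = 0 := fun p hp v =>
    image_eq_zero_of_notMem_tsupport (f := fun p => fderiv ℝ φ p v)
      fun h => hp (tsupport_fderiv_apply_subset ℝ v h)
  have e1 := setIntegral_halfCyl a fun p => inner ℝ (U p) (fderiv ℝ φ p dirT)
  rw [setIntegral_Q_one hφs fun p hp => by rw [hz p hp, inner_zero_right]] at e1
  have hflux : ∀ p, inner ℝ (G none p) (fderiv ℝ φ p (dir none))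
          + μ * ∑ i : Fin n, inner ℝ (G (some i) p) (fderiv ℝ φ p (dir (some i)))
          + (μ + lam) * (∑ i : Fin n, G (some i) p i)
              * ∑ i : Fin n, fderiv ℝ φ p (dir (some i)) i =
      ∑ k, inner ℝ (flux μ lam G k p) (fderiv ℝ φ p (dir k)) := fun p =>
    (sum_inner_flux μ lam G (fun k p => fderiv ℝ φ p (dir k)) p).symm
  have e2 := setIntegral_halfCyl a fun p =>
    ∑ k, inner ℝ (flux μ lam G k p) (fderiv ℝ φ p (dir k))
  rw [setIntegral_Q_one hφs fun p hp => by simp [hz p hp], integral_finsetSum] at e2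
  swap
  · intro k _
    have hcd : Continuous fun p => fderiv ℝ φ p (dir k) :=
      (hφ.continuous_fderiv (by norm_num)).clm_apply continuous_const
    exact integrable_inner_of_tsupport (isClosed_tsupport φ).measurableSet
      (memLp_flux mG (fun k => (h.grad_locL2 k).memLp_of_subset_Q hφc.isCompact hφs) k)
      (hcd.memLp_of_hasCompactSupport (hφc.fderiv_apply ℝ (dir k)))
      (tsupport_fderiv_apply_subset ℝ (dir k))
  have e3 : ∫ q in thinCyl n, V q * inner ℝ (u q) (φ (q.1, 0, q.2)) =
      ∫ b, inner ℝ (V b • u b) (atZero φ b) := by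
    rw [setIntegral_eq_integral_of_forall_compl_eq_zero]
    · simp only [real_inner_smul_left, atZero]
    · intro q hq
      have : (q.1, 0, q.2) ∉ tsupport φ := fun hmem => hq (thin_subset_thinCyl hφs hmem)
      rw [image_eq_zero_of_notMem_tsupport this, inner_zero_right, mul_zero]
  simp only [hflux] at key
  rw [e1, e2, e3] at key
  linarith

theorem C3Bound.abs_le {K : ℝ} (h : C3Bound V K) (x : E n × ℝ) : |V x| ≤ K := by
  simpa using h.2 0 (by norm_num) x

theorem C3Bound.fderiv_le {K : ℝ} (h : C3Bound V K) (x : E n × ℝ) : ‖fderiv ℝ V x‖ ≤ K := by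
  simpa using h.2 1 (by norm_num) x

theorem IsWeakSolution.robinSol {δ₀ Λ K : ℝ} (h : IsWeakSolution a μ lam V U G u) (ha : -1 < a)
    (mU : Measurable U) (mG : ∀ k, Measurable (G k)) (mu : Measurable u)
    (h1 : δ₀ ≤ μ) (h2 : δ₀ ≤ 2 * μ + lam) (h3 : μ ≤ Λ) (h4 : |lam| ≤ Λ) (hV : C3Bound V K) :
    RobinSol a δ₀ Λ K μ lam V U G u where
  sol :=
    { measU := mU
      measG := mG
      measu := mu
      measg := hV.1.continuous.measurable.smul mu
      memU := fun S hS hS1 => h.locL2.memLp_of_subset_Q hS hS1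
      memG := fun k S hS hS1 => (h.grad_locL2 k).memLp_of_subset_Q hS hS1
      memu := fun S hS hS1 => h.memLp_thin mU mu hS hS1
      memg := fun S hS hS1 => (h.memLp_thin mU mu hS hS1).of_le_mul (c := K)
        (hV.1.continuous.measurable.smul mu).aestronglyMeasurable
        (Eventually.of_forall fun x => by
          rw [norm_smul]
          exact mul_le_mul_of_nonneg_right (hV.abs_le x) (norm_nonneg _))
      approx := fun η hη hηc hηs => h.h1Approx ha mU mG mu hη hηc hηs
      eq := fun φ hφ hφc hφs => h.weakEq_flux ha mG hφ hφc hφs }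
  le_mu := h1
  le_lam := h2
  mu_le := h3
  lam_le := h4
  contDiff := hV.1.of_le (by norm_num)
  abs_le := hV.abs_le
  fderiv_le := hV.fderiv_le
  finite r hr hr1 := ne_top_of_le_ne_top
    (lintegral_ne_top_of_memLp (h.locL2.memLp_closedCyl hr hr1))
    (lintegral_mono_set (Q_subset_closedCyl r))

end OfWeakSolution

end LameExt

/-! ### Assembly of the regularity theorem -/

namespace LameExt

open scoped ENNReal

variable {n : ℕ} {a : ℝ}

/-- A compact set reaching `{y = 0}` and `t = 0` lies in one of the cylinders up to the null set `{t
= 0}`. -/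
theorem locL2_of_memLp_Q {f : Pt n → E n}
    (h : ∀ r, 0 ≤ r → r < 1 → MemLp f 2 ((wMeasure n a).restrict (Q n r))) : LocL2 a f := by
  intro S hS hS1
  obtain ⟨l, hl⟩ := exists_radius_of_isCompact hS fun p hp => ⟨(hS1 hp).1, (hS1 hp).2.2.1⟩
  refine (h _ (radius_nonneg l) (radius_lt_one l)).mono_measure ?_
  have hle : S ≤ᵐ[wMeasure n a] Q n (radius l) := by
    filter_upwards [ae_wMeasure_time_ne_zero n a] with p ht hp
    exact hl p hp (lt_of_le_of_ne (hS1 hp).2.2.2 ht)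
  exact Measure.restrict_mono' hle le_rfl

theorem setLIntegral_halfCyl (r : ℝ) (f : Pt n → ℝ≥0∞) :
    ∫⁻ p in halfCyl n r, f p ∂(wMeasure n a) = ∫⁻ p in Q n r, f p ∂(wMeasure n a) :=
  setLIntegral_congr (halfCyl_ae_eq r)

/-- The constant depends only on the structural constants. -/
theorem exists_regularity_bound (n : ℕ) {a : ℝ} (ha : -1 < a) (ha1 : a < 1) {δ₀ : ℝ}
    (hδ₀ : 0 < δ₀) (Λ : ℝ) {K : ℝ} (hK : 0 ≤ K) :
    ∃ C : ℝ≥0∞, C ≠ ⊤ ∧ ∀ (μ lam : ℝ), δ₀ ≤ μ → δ₀ ≤ 2 * μ + lam → μ ≤ Λ → |lam| ≤ Λ →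
      ∀ V : E n × ℝ → ℝ, C3Bound V K → ∀ (U : Pt n → E n) (G : Option (Fin n) → Pt n → E n)
        (u : E n × ℝ → E n), IsWeakSolution a μ lam V U G u →
        ∃ H : Option (Fin n) → Fin n → Pt n → E n,
          (∀ k i, HasWeakDeriv (openHalfCyl n) (dir k) (G (some i)) (H k i)) ∧
          (∀ k i, LocL2 a (H k i)) ∧
          ∫⁻ p in halfCyl n (1 / 2), ((∑ k, ‖G k p‖ₑ ^ 2) + ∑ k, ∑ i, ‖H k i p‖ₑ ^ 2)
              ∂(wMeasure n a)
            ≤ C * ∫⁻ p in halfCyl n 1, ‖U p‖ₑ ^ 2 ∂(wMeasure n a) := by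
  obtain ⟨C, hC, hbound⟩ := exists_energy_bound n ha ha1 hδ₀ Λ hK
  -- There are `n + 1` first derivatives and `(n + 1) n` second derivatives, each bounded with
  -- constant `C`.
  refine ⟨((n + 1 : ℕ) + (n + 1 : ℕ) * n) * C, by finiteness,
    fun μ lam h1 h2 h3 h4 V hV U G u h => ?_⟩
  obtain ⟨U', G', u', mU, mG, mu, hU, hG, h'⟩ := h.exists_measurable
  have hR := h'.robinSol ha mU mG mu h1 h2 h3 h4 hV
  obtain ⟨H, hH⟩ := hR.exists_glued_limit ha ha1 hδ₀
  have hwd : ∀ k i, HasWeakDeriv (openHalfCyl n) (dir k) (G' (some i)) (H k i) := fun k i =>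
    hR.hasWeakDeriv ha ha1 hδ₀ h'.weakGrad (hH k i)
  have mH : ∀ k i, AEMeasurable (fun p => ‖H k i p‖ₑ ^ 2)
      ((wMeasure n a).restrict (Q n (1 / 2))) := fun k i =>
    ((hH k i (1 / 2) (by norm_num) (by norm_num)).1.1.enorm).pow_const 2
  refine ⟨H, fun k i => (hwd k i).congr (ae_restrict_openHalfCyl (hG (some i)).symm) .rfl,
    fun k i => locL2_of_memLp_Q fun r hr hr1 => (hH k i r hr hr1).1, ?_⟩
  obtain ⟨b1, b2⟩ := hbound μ lam V U' G' u' hR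
  have hUU : ∫⁻ p in Q n 1, ‖U' p‖ₑ ^ 2 ∂(wMeasure n a) =
      ∫⁻ p in Q n 1, ‖U p‖ₑ ^ 2 ∂(wMeasure n a) :=
    lintegral_congr_ae (hU.mono fun p hp => by simp only [hp])
  have hGG : ∀ᵐ p ∂(wMeasure n a).restrict (Q n (1 / 2)), ∀ k, G k p = G' k p :=
    ae_restrict_of_ae_restrict_of_subset (Q_mono (by norm_num) (by norm_num)) (ae_all_iff.2 hG)
  rw [setLIntegral_halfCyl, setLIntegral_halfCyl, ← hUU]
  set X := ∫⁻ p in Q n 1, ‖U' p‖ₑ ^ 2 ∂(wMeasure n a)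
  calc _ = ∫⁻ p in Q n (1 / 2), ((∑ k, ‖G' k p‖ₑ ^ 2) + ∑ k, ∑ i, ‖H k i p‖ₑ ^ 2)
        ∂(wMeasure n a) := lintegral_congr_ae (hGG.mono fun p hp => by simp only [hp])
    _ = (∑ k, ∫⁻ p in Q n (1 / 2), ‖G' k p‖ₑ ^ 2 ∂(wMeasure n a)) +
        ∑ k, ∑ i, ∫⁻ p in Q n (1 / 2), ‖H k i p‖ₑ ^ 2 ∂(wMeasure n a) := by
      rw [lintegral_add_left (Finset.measurable_fun_sum _ fun k _ => by
          have := mG k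
          fun_prop), lintegral_finsetSum _ fun k _ => by
          have := mG k
          fun_prop, lintegral_finsetSum' _ fun k _ =>
          Finset.aemeasurable_fun_sum _ fun i _ => mH k i]
      congr 1
      exact Finset.sum_congr rfl fun k _ => lintegral_finsetSum' _ fun i _ => mH k i
    _ ≤ (∑ _k : Option (Fin n), C * X) + ∑ _k : Option (Fin n), ∑ _i : Fin n, C * X := by
      gcongr with k _ k _ i _
      · exact b1 k
      · obtain ⟨c1, c2⟩ := hH k i (1 / 2) (by norm_num) (by norm_num)
        exact b2 k i _ c1 c2
    _ = _ := by
      simp only [Finset.sum_const, Finset.card_univ, Fintype.card_option, Fintype.card_fin,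
        nsmul_eq_mul]
      ring

end LameExt

theorem theorem5p1 (n : ℕ) (hn : 1 ≤ n) (s : ℝ) (hs0 : 0 < s) (hs1 : s < 1)
    (δ₀ : ℝ) (hδ₀ : 0 < δ₀) (Λ K : ℝ) :
    ∃ C : NNReal, ∀ (μ lam : ℝ), δ₀ ≤ μ → δ₀ ≤ 2 * μ + lam → μ ≤ Λ → |lam| ≤ Λ →
      ∀ V : LameExt.E n × ℝ → ℝ, LameExt.C3Bound V K →
      ∀ (U : LameExt.Pt n → LameExt.E n)
        (G : Option (Fin n) → LameExt.Pt n → LameExt.E n)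
        (u : LameExt.E n × ℝ → LameExt.E n),
        LameExt.IsWeakSolution (1 - 2 * s) μ lam V U G u →
        ∃ H : Option (Fin n) → Fin n → LameExt.Pt n → LameExt.E n,
          (∀ k i, LameExt.HasWeakDeriv (LameExt.openHalfCyl n) (LameExt.dir k)
            (G (some i)) (H k i)) ∧
          (∀ k i, LameExt.LocL2 (1 - 2 * s) (H k i)) ∧
          ∫⁻ p in LameExt.halfCyl n (1 / 2),
              ((∑ k, ‖G k p‖ₑ ^ 2) + ∑ k, ∑ i, ‖H k i p‖ₑ ^ 2)
              ∂(LameExt.wMeasure n (1 - 2 * s))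
            ≤ C * ∫⁻ p in LameExt.halfCyl n 1, ‖U p‖ₑ ^ 2
                ∂(LameExt.wMeasure n (1 - 2 * s)) := by
  -- For negative `K` no `V` satisfies the bound, and any constant works.
  by_cases hK : 0 ≤ K
  · obtain ⟨C, hC, h⟩ := LameExt.exists_regularity_bound n (a := 1 - 2 * s) (by linarith)
      (by linarith) hδ₀ Λ hK
    lift C to NNReal using hC
    exact ⟨C, h⟩
  · exact ⟨0, fun μ lam _ _ _ _ V hV => absurd ((abs_nonneg _).trans (hV.abs_le 0)) hK⟩
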